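/- Let $X$ be a (Hausdorff, second countable) complex manifold of dimension $n\ge 1$, not necessarily compact, and $D\subset X$ a smooth hypersurface: a closed subset such that every point of $D$ has an open neighbourhood $U$ with a local equation, i.e. a holomorphic function $f$ on $U$ with $D\cap U=\{f=0\}$ and $df\neq 0$ on $D\cap U$. Regard $D$ as a complex manifold of dimension $n-1$. **Notation.** Complex manifolds carry their canonical orientation. Let $\Gamma_c(X,\mathcal A_X^{p,0}(mD))$ be the space of smooth $(p,0)$-forms $\alpha$ on $X\smallsetminus D$ such that $f^m\alpha$ extends smoothly over $D$ for local equations $f$, and whose support has compact closure in $X$; $\Gamma_c(X,\mathcal A_X^{p,0}(*D))$ is defined in the same way with poles of any locally bounded order. Let $\Gamma(X,\Omega^n_X(D))$ be the space of meromorphic $n$-forms on $X$, holomorphic on $X\smallsetminus D$, with at most a simple pole on $D$. If an $(n,0)$-form with a simple pole is written locally as $\frac{df}{f}\wedge\sigma+\tau$ with $\sigma,\tau$ smooth of types $(n-1,0)$ and $(n,0)$, its Poincaré residue is $\mathrm{Res}=\sigma|_D$. For $\alpha\in\Gamma_c(X,\mathcal A_X^{n,0}(*D))$, the class $$\mathrm{Res}_\partial\,\alpha\in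 \Gamma_c(D,\mathcal A_D^{n-1,0})/\partial\,\Gamma_c(D,\mathcal A_D^{n-2,0})$$ is the class of $\mathrm{Res}\,\omega$ for any $\omega\in\Gamma_c(X,\mathcal A_X^{n,0}(D))$ with $\alpha=\omega+\partial\gamma$ on $X\smallsetminus D$ for some $\gamma\in\Gamma_c(X,\mathcal A_X^{n-1,0}(*D))$ (for $n=1$ the quotient is $\Gamma_c(D,\mathcal A_D^{0,0})$ itself). A cut-off function is a function $\lambda\colon X\to[0,\infty)$ which is smooth and positive on $X\smallsetminus D$ and such that for every local equation $f\colon U\to\mathbb C$ of $D$ one has $\lambda=h\,|f|$ on $U$ with $h$ smooth and positive on $U$. For $\varepsilon>0$ put $$\langle\alpha,\beta\rangle_{\lambda,\varepsilon}=\frac{(-1)^{n-1}}{2\pi i}\int_{\lambda\ge\varepsilon}\alpha\wedge\bar\beta .$$ **Theorem.** Let $m\in\{0,1,2,\dots\}$, $\alpha\in\Gamma_c(X,\mathcal A_X^{n,0}(mD))$ and $\beta\in\Gamma(X,\Omega_X^n(D))$. Then the class $\mathrm{Res}_\partial\,\alpha$ exists (it has a representative), and there is a complex-valued function $I_1$ of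 the cut-off function such that: (i) for every cut-off function $\lambda$, as $\varepsilon\to0^+$, $$\langle\alpha,\beta\rangle_{\lambda,\varepsilon}=2\log\varepsilon\int_D\mathrm{Res}_\partial\,\alpha\wedge\overline{\mathrm{Res}\,\beta}+I_1(\lambda)+O(\varepsilon);$$ (ii) for every cut-off function $\lambda$ and every $\varphi\in C^\infty(X,\mathbb R)$, $$I_1(e^{\varphi}\lambda)=I_1(\lambda)-2\int_D\mathrm{Res}_\partial(\varphi\alpha)\wedge\overline{\mathrm{Res}\,\beta}.$$ The integrals over $D$ are taken over any representatives of the classes $\mathrm{Res}_\partial\,\alpha$ and $\mathrm{Res}_\partial(\varphi\alpha)$; the formulas hold for every choice of representative. -/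

import Mathlib

open scoped Manifold ContDiff Topology

noncomputable section

/-- Coordinate space `ℂⁿ` (used as a topological vector space and for its Lebesgue measure). -/
abbrev Cn (n : ℕ) : Type := Fin n → ℂ

/-- A (not necessarily continuous) differential form of type `(p,0)` on an `n`-dimensional complex
manifold `X`: at every point `x` a `ℂ`-multilinear alternating map on the holomorphic tangent space
`TangentSpace 𝓘(ℂ, Cn n) x`, which by definition in Mathlib is the type `Cn n`.
Forms on `X ∖ D` are written as forms on `X` whose values on `D` are irrelevant. -/
abbrev PForm (n p : ℕ) (X : Type*) : Type _ := X → (Cn n) [⋀^Fin p]→L[ℂ] ℂ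

section Forms

variable {n p : ℕ} {X : Type*} [TopologicalSpace X] [ChartedSpace (Cn n) X]

/-- The pull-back `(e⁻¹)^* α` of a form to the coordinate domain of the chart `e` around `x₀`. -/
def PForm.inChart (α : PForm n p X) (x₀ : X) (y : Cn n) : (Cn n) [⋀^Fin p]→L[ℂ] ℂ :=
  (α ((chartAt (Cn n) x₀).symm y)).compContinuousLinearMap
    (mfderiv 𝓘(ℂ, Cn n) 𝓘(ℂ, Cn n) (chartAt (Cn n) x₀).symm y : Cn n →L[ℂ] Cn n)

/-- `α` is `C^∞` (in the real sense) on the open set `U`. -/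
def PForm.SmoothOn (α : PForm n p X) (U : Set X) : Prop :=
  ∀ x₀ : X, ContDiffOn ℝ ∞ (α.inChart x₀)
    ((chartAt (Cn n) x₀).target ∩ (chartAt (Cn n) x₀).symm ⁻¹' U)

/-- `α` is holomorphic (complex analytic) on the open set `U`. -/
def PForm.HolomorphicOn (α : PForm n p X) (U : Set X) : Prop :=
  ∀ x₀ : X, ContDiffOn ℂ ω (α.inChart x₀)
    ((chartAt (Cn n) x₀).target ∩ (chartAt (Cn n) x₀).symm ⁻¹' U)

/-- The `ℂ`-linear part `v ↦ (L v - i L (i v)) / 2` of a real-linear map. -/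
def complexLinearPart {E F : Type*} [NormedAddCommGroup E] [NormedSpace ℂ E]
    [NormedAddCommGroup F] [NormedSpace ℂ F] (L : E →L[ℝ] F) : E →L[ℂ] F where
  toFun v := (2⁻¹ : ℂ) • (L v - Complex.I • L (Complex.I • v))
  map_add' v w := by
    simp only [smul_add, map_add, smul_sub]; abel
  map_smul' c v := by
    have hL : ∀ w : E, L (c • w) = (c.re : ℂ) • L w + (c.im : ℂ) • L (Complex.I • w) := by
      intro w
      have h : c • w = c.re • w + c.im • (Complex.I • w) := by
        conv_lhs => rw [← Complex.re_add_im c]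
        rw [add_smul, mul_smul, Complex.coe_smul, Complex.coe_smul]
      rw [h, map_add, map_smul, map_smul, Complex.coe_smul, Complex.coe_smul]
    have hI : L (Complex.I • Complex.I • v) = - L v := by
      rw [smul_smul, Complex.I_mul_I, neg_smul, one_smul, map_neg]
    rw [smul_comm Complex.I c v, hL, hL, hI, RingHom.id_apply]
    generalize L v = a
    generalize L (Complex.I • v) = b
    nth_rewrite 5 [← Complex.re_add_im c]
    match_scalars
    · ring
    · linear_combination (2⁻¹ * (c.im : ℂ)) * Complex.I_mul_I
  cont := by fun_prop

/-- The operator `∂ : 𝒜^{p,0} → 𝒜^{p+1,0}` on a coordinate domain: the antisymmetrization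
`∑ᵢ (-1)^i (D^{1,0}_{vᵢ} η)(v₀, …, v̂ᵢ, …, v_p)` of the `ℂ`-linear part of the real derivative. -/
def delCoord (η : Cn n → (Cn n) [⋀^Fin p]→L[ℂ] ℂ) (y : Cn n) : (Cn n) [⋀^Fin (p + 1)]→L[ℂ] ℂ :=
  ContinuousAlternatingMap.alternatizeUncurryFin (complexLinearPart (fderiv ℝ η y))

/-- The operator `∂ : 𝒜^{p,0} → 𝒜^{p+1,0}` on a complex manifold, computed at `x` in the chart
around `x`. -/
def PForm.del (α : PForm n p X) : PForm n (p + 1) X := fun x =>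
  (delCoord (α.inChart x) (chartAt (Cn n) x x)).compContinuousLinearMap
    (mfderiv 𝓘(ℂ, Cn n) 𝓘(ℂ, Cn n) (chartAt (Cn n) x) x : Cn n →L[ℂ] Cn n)

/-- The form `df ∧ σ` for a complex function `f` holomorphic at the points considered. -/
def dWedge (f : X → ℂ) (σ : PForm n p X) : PForm n (p + 1) X := fun x =>
  let df : Cn n →L[ℂ] ℂ := mfderiv 𝓘(ℂ, Cn n) 𝓘(ℂ, ℂ) f x
  ContinuousAlternatingMap.alternatizeUncurryFin (df.smulRight (σ x))

/-- The pull-back `ι^* σ` of a form along a holomorphic map. -/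
def PForm.pullback {k : ℕ} {Y : Type*} [TopologicalSpace Y] [ChartedSpace (Cn k) Y]
    (ι : Y → X) (σ : PForm n p X) : PForm k p Y := fun y =>
  (σ (ι y)).compContinuousLinearMap
    (mfderiv 𝓘(ℂ, Cn k) 𝓘(ℂ, Cn n) ι y : Cn k →L[ℂ] Cn n)

end Forms

section Integral

variable {n : ℕ} {X : Type*} [TopologicalSpace X] [ChartedSpace (Cn n) X]

/-- For `a = a₀ dz₁ ∧ ⋯ ∧ dzₙ` and `b = b₀ dz₁ ∧ ⋯ ∧ dzₙ` the density of the real `2n`-form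
`a ∧ b̄` with respect to `dx₁ dy₁ ⋯ dxₙ dyₙ`, the canonical orientation of `ℂⁿ`. It is
`a₀ · b̄₀ · (-1)^{n(n-1)/2} (-2i)^n`, because
`dz₁ ∧ ⋯ ∧ dzₙ ∧ dz̄₁ ∧ ⋯ ∧ dz̄ₙ = (-1)^{n(n-1)/2} (dz₁ ∧ dz̄₁) ∧ ⋯ ∧ (dzₙ ∧ dz̄ₙ)`
and `dz ∧ dz̄ = -2i dx ∧ dy`. -/
def wedgeConjDensity (a b : (Cn n) [⋀^Fin n]→L[ℂ] ℂ) : ℂ :=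
  a (fun i => Pi.single i 1) * (starRingEnd ℂ) (b (fun i => Pi.single i 1)) *
    ((-1) ^ (n * (n - 1) / 2) * (-2 * Complex.I) ^ n)

/-- A complex manifold is a real smooth manifold. -/
theorem isManifold_real [IsManifold 𝓘(ℂ, Cn n) ω X] : IsManifold 𝓘(ℝ, Cn n) ∞ X := by
  apply isManifold_of_contDiffOn
  intro e e' he he'
  have h := (contDiffGroupoid ω 𝓘(ℂ, Cn n)).compatible he he'
  rw [contDiffGroupoid, mem_groupoid_of_pregroupoid] at h
  have h1 : ContDiffOn ℂ ω (e.symm ≫ₕ e') (e.symm ≫ₕ e').source := by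
    simpa [contDiffPregroupoid] using h.1
  simpa using (h1.restrict_scalars ℝ).of_le le_top

variable (n X) in
/-- A smooth partition of unity on `X` subordinate to the cover by the charts around the points. -/
def chartPartition [T2Space X] [SigmaCompactSpace X] [IsManifold 𝓘(ℂ, Cn n) ω X] :
    SmoothPartitionOfUnity X 𝓘(ℝ, Cn n) X Set.univ :=
  haveI : IsManifold 𝓘(ℝ, Cn n) ∞ X := isManifold_real
  Classical.choose
    (SmoothPartitionOfUnity.exists_isSubordinate_chartAt_source 𝓘(ℝ, Cn n) X)

/-- The integral `∫_A α ∧ β̄` over a subset `A` of the (canonically oriented) complex manifold `X`,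
for forms `α, β` of type `(n,0)`: a partition of unity subordinate to the charts reduces it to
Lebesgue integrals over coordinate domains. -/
def integralWedgeConj [T2Space X] [SigmaCompactSpace X] [IsManifold 𝓘(ℂ, Cn n) ω X]
    (A : Set X) (α β : PForm n n X) : ℂ :=
  ∑ᶠ i : X, ∫ y in (chartAt (Cn n) i).target ∩ (chartAt (Cn n) i).symm ⁻¹' A,
    ((chartPartition n X i ((chartAt (Cn n) i).symm y) : ℝ) : ℂ) *
      wedgeConjDensity (α.inChart i y) (β.inChart i y)

end Integral

section Hypersurface

variable {n p : ℕ} {X : Type*} [TopologicalSpace X] [ChartedSpace (Cn n) X]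

/-- `f` is a local equation on the open set `U` of the smooth hypersurface `D`: a holomorphic
function on `U` vanishing exactly on `D ∩ U`, with nonzero differential there (so that it generates
the ideal sheaf of `D` on `U`). -/
structure IsLocalEquation (D U : Set X) (f : X → ℂ) : Prop where
  isOpen : IsOpen U
  holomorphic : ContMDiffOn 𝓘(ℂ, Cn n) 𝓘(ℂ, ℂ) ω f U
  mem_iff : ∀ x ∈ U, x ∈ D ↔ f x = 0
  differential_ne_zero : ∀ x ∈ U, x ∈ D → mfderiv 𝓘(ℂ, Cn n) 𝓘(ℂ, ℂ) f x ≠ 0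

/-- `D ⊂ X` is a smooth hypersurface. -/
structure IsSmoothHypersurface (D : Set X) : Prop where
  isClosed : IsClosed D
  exists_equation : ∀ x ∈ D, ∃ (U : Set X) (f : X → ℂ), x ∈ U ∧ IsLocalEquation (n := n) D U f

/-- The complex manifold `Y`, with the map `ι : Y → X`, is `D` with its structure of a complex
submanifold of `X`: `ι` is a holomorphic immersion and a homeomorphism onto `D`. -/
structure IsSubmanifoldStructure {k : ℕ} {Y : Type*} [TopologicalSpace Y] [ChartedSpace (Cn k) Y]
    (D : Set X) (ι : Y → X) : Prop where
  holomorphic : ContMDiff 𝓘(ℂ, Cn k) 𝓘(ℂ, Cn n) ω ι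
  immersion : ∀ y : Y, Function.Injective (mfderiv 𝓘(ℂ, Cn k) 𝓘(ℂ, Cn n) ι y)
  isEmbedding : Topology.IsEmbedding ι
  range_eq : Set.range ι = D

/-- `α ∈ Γ(X, 𝒜^{p,0}(mD))`: a smooth form on `X ∖ D` such that around every point of `D` the form
`f^m α` extends smoothly over `D` for a local equation `f`. -/
def PForm.HasPoleOrderLE (D : Set X) (m : ℕ) (α : PForm n p X) : Prop :=
  α.SmoothOn Dᶜ ∧
    ∀ x ∈ D, ∃ (U : Set X) (f : X → ℂ) (η : PForm n p X),
      x ∈ U ∧ IsLocalEquation (n := n) D U f ∧ η.SmoothOn U ∧ ∀ y ∈ U \ D, f y ^ m • α y = η y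

/-- `α ∈ Γ(X, 𝒜^{p,0}(*D))`: as before, with poles of locally bounded order. -/
def PForm.HasPoles (D : Set X) (α : PForm n p X) : Prop :=
  α.SmoothOn Dᶜ ∧
    ∀ x ∈ D, ∃ (m : ℕ) (U : Set X) (f : X → ℂ) (η : PForm n p X),
      x ∈ U ∧ IsLocalEquation (n := n) D U f ∧ η.SmoothOn U ∧ ∀ y ∈ U \ D, f y ^ m • α y = η y

/-- `β ∈ Γ(X, Ω^p(mD))`: a meromorphic form, holomorphic on `X ∖ D`, with poles of order at most `m`
on `D`. -/
def PForm.IsMeromorphic (D : Set X) (m : ℕ) (β : PForm n p X) : Prop :=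
  β.HolomorphicOn Dᶜ ∧
    ∀ x ∈ D, ∃ (U : Set X) (f : X → ℂ) (η : PForm n p X),
      x ∈ U ∧ IsLocalEquation (n := n) D U f ∧ η.HolomorphicOn U ∧
        ∀ y ∈ U \ D, f y ^ m • β y = η y

/-- The form `α` on `X ∖ D` has compact support in `X`: its support has compact closure in `X`. -/
def PForm.CompactSupportOff (D : Set X) (α : PForm n p X) : Prop :=
  IsCompact (closure {x | x ∉ D ∧ α x ≠ 0})

/-- A cut-off function for `D`: positive and smooth on `X ∖ D`, and for any local equation
`f` of `D` on `U`, `λ / |f|` extends to a smooth positive function `h` on `U`. -/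
structure IsCutoff (n : ℕ) {X : Type*} [TopologicalSpace X] [ChartedSpace (Cn n) X]
    (D : Set X) (lam : X → ℝ) : Prop where
  pos : ∀ x ∉ D, 0 < lam x
  smooth : ContMDiffOn 𝓘(ℝ, Cn n) 𝓘(ℝ, ℝ) ∞ lam Dᶜ
  local_form : ∀ (U : Set X) (f : X → ℂ), IsLocalEquation (n := n) D U f →
    ∃ h : X → ℝ, ContMDiffOn 𝓘(ℝ, Cn n) 𝓘(ℝ, ℝ) ∞ h U ∧ (∀ x ∈ U, 0 < h x) ∧
      ∀ x ∈ U, lam x = h x * ‖f x‖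

end Hypersurface

section Residue

/-- `ρ` is the Poincaré residue on `Y ≅ D` of the form `α` with simple pole on `D`: around every
point of `D` one has `α = (df / f) ∧ σ + τ` with `σ, τ` smooth, and `ρ = σ|_D`. -/
def IsPoincareResidue {n k p : ℕ} {X Y : Type*} [TopologicalSpace X] [ChartedSpace (Cn n) X]
    [TopologicalSpace Y] [ChartedSpace (Cn k) Y] (D : Set X) (ι : Y → X)
    (α : PForm n (p + 1) X) (ρ : PForm k p Y) : Prop :=
  ∀ x ∈ D, ∃ (U : Set X) (f : X → ℂ) (σ : PForm n p X) (τ : PForm n (p + 1) X),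
    x ∈ U ∧ IsLocalEquation (n := n) D U f ∧ σ.SmoothOn U ∧ τ.SmoothOn U ∧
      (∀ z ∈ U \ D, α z = (f z)⁻¹ • dWedge f σ z + τ z) ∧
      ∀ y : Y, ι y ∈ U → ρ y = PForm.pullback ι σ y

/-- The Poincaré residue `Res α` of a form with simple pole on `D`. -/
def poincareResidue {n k p : ℕ} {X Y : Type*} [TopologicalSpace X] [ChartedSpace (Cn n) X]
    [TopologicalSpace Y] [ChartedSpace (Cn k) Y] (D : Set X) (ι : Y → X)
    (α : PForm n (p + 1) X) : PForm k p Y :=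
  Classical.epsilon (IsPoincareResidue D ι α)

/-- `r` lies in the image of `∂ : Γ_c(Y, 𝒜^{q-1,0}) → Γ_c(Y, 𝒜^{q,0})` (which is zero if `q = 0`). -/
def IsDelExact {k : ℕ} {Y : Type*} [TopologicalSpace Y] [ChartedSpace (Cn k) Y] :
    {q : ℕ} → PForm k q Y → Prop
  | 0, r => r = 0
  | q + 1, r => ∃ δ : PForm k q Y,
      δ.SmoothOn Set.univ ∧ IsCompact (closure {y | δ y ≠ 0}) ∧ r = δ.del

/-- The class `Res_∂ α ∈ Γ_c(D, 𝒜^{d,0}) / ∂ Γ_c(D, 𝒜^{d-1,0})` for a form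
`α ∈ Γ_c(X, 𝒜^{d+1,0}(*D))` of top degree, as the set of its representatives. The compactly
supported logarithmic top forms are those with pole of order at most one (`df ∧ ω = 0` for reasons
of degree); if `ω` is one with `α = ω + ∂γ`, `γ ∈ Γ_c(X, 𝒜^{d,0}(*D))`, then `Res_∂ α` is
the class of the Poincaré residue of `ω`. -/
def dolbeaultResidue {d : ℕ} {X Y : Type*} [TopologicalSpace X] [ChartedSpace (Cn (d + 1)) X]
    [TopologicalSpace Y] [ChartedSpace (Cn d) Y] (D : Set X) (ι : Y → X)
    (α : PForm (d + 1) (d + 1) X) : Set (PForm d d Y) :=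
  {r | ∃ (ω' : PForm (d + 1) (d + 1) X) (γ : PForm (d + 1) d X),
    ω'.HasPoleOrderLE D 1 ∧ ω'.CompactSupportOff D ∧ γ.HasPoles D ∧ γ.CompactSupportOff D ∧
      (∀ x ∉ D, α x = ω' x + γ.del x) ∧
      IsDelExact (fun y => r y - poincareResidue (k := d) D ι ω' y)}

/-- The regularized pairing
`⟨α, β⟩_{λ,ε} = ((-1)^{n-1} / 2πi) ∫_{λ ≥ ε} α ∧ β̄`, where `n = d + 1 = dim X`. -/
def regularizedPairing {d : ℕ} {X : Type*} [TopologicalSpace X] [ChartedSpace (Cn (d + 1)) X]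
    [T2Space X] [SigmaCompactSpace X] [IsManifold 𝓘(ℂ, Cn (d + 1)) ω X]
    (lam : X → ℝ) (ε : ℝ) (α β : PForm (d + 1) (d + 1) X) : ℂ :=
  (-1) ^ d / (2 * Real.pi * Complex.I) * integralWedgeConj {x | ε ≤ lam x} α β

end Residue

end

/-! Everything comes down to one truncated integral. In a holomorphic chart in which `D` is `z₀ = 0`
the cut-off function is `h|z₀|` with `h` smooth and positive. A partition of unity localizes `α`,
and since `β` has at most a simple pole the pairing becomes a constant times `∫_{h|z₀| ≥ ε} G
z₀^{-m} z̄₀^{-1}` with `G` smooth of compact support (`IsLocalized.regularizedPairing_eq`).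

Existence of the expansion. No boundary integrals occur: the sharp truncation is a limit of smooth
weights `Φ(h|z₀|)`, and integration by parts against a weight (`integral_weight_mul_wirt`) only
produces `s Φ'(s)` times the logarithmic derivative of `h|z₀|`. For a vector field tangent to the
level sets of `h|z₀|` these terms cancel, and its divergence theorem lowers the pole
(`exists_lower_pole`) until only `|z₀|^{-2}` and a singularity of size `1/|z₀|` remain. The latter
is integrable with truncation error `O(ε)`; the former is treated with a weight approximating
`log(s/ε)` (`hasLogExp_simple`). So an expansion `A log ε + I + O(ε)` exists (`exists_hasLogExp`).

Dependence on the cut-off function. The central lemma is `HasLogExp.of_wirt`: a derivative `∂P/∂z_j`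
has no logarithmic term, and its finite part is the logarithmic coefficient of `P ∂
log(h|z₀|)/∂z_j`. It follows by averaging the expansions over the levels `ε e^t` and integrating by
parts. Since `z₀^{-m-2}` is up to a factor the derivative of `z₀^{-m-1}`, the coefficient `A`
satisfies a recursion in which `h` does not occur (`logCoef`, `hasLogExp_logCoef`). By the same
recursion the finite part changes under `h ↦ e^φ h` by minus the logarithmic coefficient of `φG`
(`finitePart_exp_mul`). Globally, the shift of the constant term is the logarithmic coefficient of
`φα`, so (ii) is reduced to knowing logarithmic coefficients.

Identification of the coefficient. For a simple pole it is `-2π ∫_{z₀=0} G` (`logCoef_one`), which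
after matching the orientation constants is twice the pairing of the residues
(`hasLogCoef_residue`). For `∂γ` it vanishes (`hasLogCoef_del`): as `β` is holomorphic off `D`, the
density of `∂γ ∧ β̄` is a sum of derivatives `∂/∂z_i`. Hence `α = ω + ∂γ` gives the formula with
`Res ω`. Adding a `∂`-exact form on `D` changes nothing, by Stokes' theorem and the holomorphy of
`Res β` (`hasLogCoef_of_mem_dolbeaultResidue`). A decomposition `α = ω + ∂γ` exists because
integration by parts in `z₀` lowers poles one order at a time (`dolbeaultResidue_nonempty`).
Uniqueness of expansions (`HasLogExp.unique`) ties the pieces together and defines the constant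
term. -/

noncomputable section

/-! ### Wirtinger derivatives on `ℂⁿ` and integration by parts. -/

section Wirtinger

open MeasureTheory Filter

variable {n : ℕ}

/-- The first order operator `f ↦ (D f e_j + c D f (i e_j)) / 2` on `ℂⁿ`: it is `∂/∂z_j` for
`c = -i` and `∂/∂z̄_j` for `c = i`. -/
def wirt (c : ℂ) (j : Fin n) (f : Cn n → ℂ) (y : Cn n) : ℂ :=
  2⁻¹ * (fderiv ℝ f y (Pi.single j 1) + c * fderiv ℝ f y (Complex.I • Pi.single j 1))

variable {c : ℂ} {j : Fin n} {f g : Cn n → ℂ} {y : Cn n}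

theorem wirt_congr (h : f =ᶠ[𝓝 y] g) : wirt c j f y = wirt c j g y := by
  simp [wirt, h.fderiv_eq]

theorem wirt_add (hf : DifferentiableAt ℝ f y) (hg : DifferentiableAt ℝ g y) :
    wirt c j (fun y => f y + g y) y = wirt c j f y + wirt c j g y := by
  simp only [wirt, fderiv_fun_add hf hg, add_apply]; ring

theorem wirt_mul (hf : DifferentiableAt ℝ f y) (hg : DifferentiableAt ℝ g y) :
    wirt c j (fun y => f y * g y) y = wirt c j f y * g y + f y * wirt c j g y := by
  simp only [wirt, fderiv_fun_mul hf hg, add_apply,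
    smul_apply, smul_eq_mul]; ring

theorem wirt_const (a : ℂ) : wirt c j (fun _ => a) y = 0 := by
  simp [wirt]

theorem wirt_const_mul (a : ℂ) (hf : DifferentiableAt ℝ f y) :
    wirt c j (fun y => a * f y) y = a * wirt c j f y := by
  rw [wirt_mul (differentiableAt_const a) hf, wirt_const]; ring

theorem fderiv_real_eq (hf : DifferentiableAt ℂ f y) (v : Cn n) :
    fderiv ℝ f y v = fderiv ℂ f y v := by
  rw [(hf.hasFDerivAt.restrictScalars ℝ).fderiv]; rfl

/-- The numerical factor is `1` for `c = -i` and `0` for `c = i`, so one formula serves `∂/∂z_j` and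
the Cauchy-Riemann equations. -/
theorem wirt_of_holomorphic (hf : DifferentiableAt ℂ f y) :
    wirt c j f y = 2⁻¹ * (1 + c * Complex.I) * fderiv ℂ f y (Pi.single j 1) := by
  simp only [wirt, fderiv_real_eq hf, map_smul, smul_eq_mul]; ring

theorem dzbar_of_holomorphic (hf : DifferentiableAt ℂ f y) :
    wirt Complex.I j f y = 0 := by
  rw [wirt_of_holomorphic hf]; simp

/-- Conjugation exchanges `∂/∂z_j` and `∂/∂z̄_j`. This is how conjugates of holomorphic coefficients
become constants for `∂/∂z_j`. -/
theorem wirt_conj (hf : DifferentiableAt ℝ f y) :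
    wirt c j (fun y => (starRingEnd ℂ) (f y)) y
      = (starRingEnd ℂ) (wirt ((starRingEnd ℂ) c) j f y) := by
  have h : HasFDerivAt (fun y => (starRingEnd ℂ) (f y))
      ((Complex.conjCLE : ℂ →L[ℝ] ℂ).comp (fderiv ℝ f y)) y :=
    (Complex.conjCLE : ℂ →L[ℝ] ℂ).hasFDerivAt.comp y hf.hasFDerivAt
  simp only [wirt, h.fderiv, ContinuousLinearMap.comp_apply, map_mul, map_add,
    Complex.conj_conj, map_inv₀, map_ofNat]
  simp

theorem wirt_comp_real {u : Cn n → ℝ} {Φ : ℝ → ℝ} {Φ' : ℝ} (hu : DifferentiableAt ℝ u y)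
    (hΦ : HasDerivAt Φ Φ' (u y)) :
    wirt c j (fun y => (Φ (u y) : ℂ)) y = Φ' * wirt c j (fun y => (u y : ℂ)) y := by
  have h1 : HasFDerivAt (fun y => (u y : ℂ)) (Complex.ofRealCLM.comp (fderiv ℝ u y)) y :=
    Complex.ofRealCLM.hasFDerivAt.comp y hu.hasFDerivAt
  have h2 : HasFDerivAt (fun y => (Φ (u y) : ℂ)) (Complex.ofRealCLM.comp (Φ' • fderiv ℝ u y)) y :=
    Complex.ofRealCLM.hasFDerivAt.comp y (hΦ.comp_hasFDerivAt y hu.hasFDerivAt)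
  simp only [wirt, h1.fderiv, h2.fderiv, ContinuousLinearMap.comp_apply,
    smul_apply, smul_eq_mul, Complex.ofRealCLM_apply, Complex.ofReal_mul]
  ring

theorem ContDiff.wirt (hf : ContDiff ℝ ∞ f) : ContDiff ℝ ∞ (wirt c j f) := by
  have h := hf.fderiv_right (m := ∞) le_rfl
  unfold _root_.wirt
  fun_prop

theorem ContDiffAt.wirt (hf : ContDiffAt ℝ ∞ f y) : ContDiffAt ℝ ∞ (wirt c j f) y := by
  have h := hf.fderiv_right (m := ∞) le_rfl
  unfold _root_.wirt
  fun_prop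

theorem support_wirt_subset : Function.support (wirt c j f) ⊆ tsupport f := by
  intro y hy
  by_contra hn
  apply hy
  have : f =ᶠ[𝓝 y] fun _ => 0 := notMem_tsupport_iff_eventuallyEq.mp hn
  rw [wirt_congr this, wirt_const]

theorem HasCompactSupport.wirt (hf : HasCompactSupport f) : HasCompactSupport (wirt c j f) :=
  hf.mono' support_wirt_subset

/-- Integration by parts for line derivatives with the constant function `1` as the other factor;
only the products have to be integrable. -/
theorem integral_fderiv_apply_eq_zero (hf : ContDiff ℝ 1 f) (hc : HasCompactSupport f)
    (v : Cn n) : ∫ y, fderiv ℝ f y v = 0 := by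
  have hcont : Continuous fun y => fderiv ℝ f y v :=
    (hf.continuous_fderiv one_ne_zero).clm_apply continuous_const
  have hc' : HasCompactSupport fun y => fderiv ℝ f y v := by
    refine hc.mono' fun y hy => ?_
    by_contra hn
    apply hy
    have : f =ᶠ[𝓝 y] fun _ => 0 := notMem_tsupport_iff_eventuallyEq.mp hn
    simp [this.fderiv_eq]
  have := integral_bilinear_hasLineDerivAt_right_eq_neg_left_of_integrable
    (μ := (volume : Measure (Cn n))) (f := fun _ => (1 : ℂ)) (f' := fun _ => 0) (g := f)
    (g' := fun y => fderiv ℝ f y v) (v := v) (B := ContinuousLinearMap.mul ℝ ℂ)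
    (by simp) (by simpa using hcont.integrable_of_hasCompactSupport hc')
    (by simpa using hf.continuous.integrable_of_hasCompactSupport hc)
    (fun y _ => by simpa using (hasFDerivAt_const (1 : ℂ) y).hasLineDerivAt v)
    (fun y _ => ((hf.differentiable one_ne_zero) y).hasFDerivAt.hasLineDerivAt v)
  simpa using this

theorem integral_wirt_eq_zero (hf : ContDiff ℝ 1 f) (hc : HasCompactSupport f) :
    ∫ y, wirt c j f y = 0 := by
  have hi : ∀ v : Cn n, Integrable fun y => fderiv ℝ f y v := fun v => by
    refine ((hf.continuous_fderiv one_ne_zero).clm_apply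
      continuous_const).integrable_of_hasCompactSupport (hc.mono' fun y hy => ?_)
    by_contra hn
    apply hy
    have : f =ᶠ[𝓝 y] fun _ => 0 := notMem_tsupport_iff_eventuallyEq.mp hn
    simp [this.fderiv_eq]
  simp only [wirt]
  rw [integral_const_mul, integral_add (hi _) ((hi _).const_mul _), integral_const_mul,
    integral_fderiv_apply_eq_zero hf hc, integral_fderiv_apply_eq_zero hf hc]
  simp

end Wirtinger

end

noncomputable section

/-! ### Weights `Φ(h|z₀|)`, the monomials `z₀^a z̄₀^b`, and their derivatives. -/

section Truncation

open MeasureTheory Filter Set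

variable {d : ℕ}

/-- A smooth positive function on `ℂ^{d+1}`. -/
structure SmoothPos (h : Cn (d + 1) → ℝ) : Prop where
  smooth : ContDiff ℝ ∞ h
  pos : ∀ y, 0 < h y

/-- A smooth function with compact support on `ℂ^{d+1}`. -/
structure IsTest (G : Cn (d + 1) → ℂ) : Prop where
  smooth : ContDiff ℝ ∞ G
  compact : HasCompactSupport G

/-- A compactly supported function, continuous off the hyperplane `z₀ = 0`. -/
structure ContOff (X : Cn (d + 1) → ℂ) : Prop where
  cont : ContinuousOn X {y | y 0 ≠ 0}
  compact : HasCompactSupport X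

/-- A `C¹` function on the line that vanishes on a neighbourhood of `(-∞, 0]`. -/
structure IsWeight (Φ : ℝ → ℝ) : Prop where
  smooth : ContDiff ℝ 1 Φ
  vanish : ∃ δ > 0, ∀ s ≤ δ, Φ s = 0

/-- The function `h |z₀|`. -/
def dist0 (h : Cn (d + 1) → ℝ) (y : Cn (d + 1)) : ℝ := h y * ‖y 0‖

/-- The truncated integral `∫_{h|z₀| ≥ ε} X`. -/
def truncInt (h : Cn (d + 1) → ℝ) (X : Cn (d + 1) → ℂ) (ε : ℝ) : ℂ :=
  ∫ y in {y | ε ≤ dist0 h y}, X y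

theorem isOpen_off : IsOpen {y : Cn (d + 1) | y 0 ≠ 0} :=
  isOpen_ne_fun (continuous_apply 0) continuous_const

theorem SmoothPos.continuous {h : Cn (d + 1) → ℝ} (hh : SmoothPos h) : Continuous h :=
  hh.smooth.continuous

theorem SmoothPos.continuous_dist0 {h : Cn (d + 1) → ℝ} (hh : SmoothPos h) :
    Continuous (dist0 h) := by
  have := hh.continuous
  unfold dist0; fun_prop

theorem ne_zero_of_dist0_pos {h : Cn (d + 1) → ℝ} {y : Cn (d + 1)}
    (hy : 0 < dist0 h y) : y 0 ≠ 0 := by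
  rintro h0
  simp [dist0, h0] at hy

theorem SmoothPos.dist0_pos {h : Cn (d + 1) → ℝ} (hh : SmoothPos h) {y : Cn (d + 1)}
    (hy : y 0 ≠ 0) : 0 < dist0 h y :=
  mul_pos (hh.pos y) (norm_pos_iff.mpr hy)

theorem SmoothPos.measurableSet {h : Cn (d + 1) → ℝ} (hh : SmoothPos h) (ε : ℝ) :
    MeasurableSet {y | ε ≤ dist0 h y} :=
  (isClosed_le continuous_const hh.continuous_dist0).measurableSet

theorem contDiffAt_dist0 {h : Cn (d + 1) → ℝ} (hh : SmoothPos h) {y : Cn (d + 1)}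
    (hy : y 0 ≠ 0) : ContDiffAt ℝ ∞ (dist0 h) y := by
  have h1 : ContDiffAt ℝ ∞ (fun y : Cn (d + 1) => ‖y 0‖) y :=
    ContDiffAt.norm ℝ (by fun_prop) hy
  exact hh.smooth.contDiffAt.mul h1

/-- The hyperplane is a proper real subspace, hence null; identities that hold off it may therefore
be integrated. -/
theorem ae_off : ∀ᵐ y : Cn (d + 1), y 0 ≠ 0 := by
  let p : Submodule ℝ (Cn (d + 1)) :=
    LinearMap.ker (LinearMap.proj (R := ℝ) (φ := fun _ : Fin (d + 1) => ℂ) 0)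
  have hp : p ≠ ⊤ := by
    intro hp
    have : (Pi.single 0 1 : Cn (d + 1)) ∈ p := hp ▸ Submodule.mem_top
    simp [p] at this
  rw [ae_iff]
  simpa [p] using! Measure.addHaar_submodule volume p hp

namespace ContOff

variable {X X' : Cn (d + 1) → ℂ}

theorem add (hX : ContOff X) (hX' : ContOff X') : ContOff fun y => X y + X' y :=
  ⟨hX.cont.add hX'.cont, hX.compact.add hX'.compact⟩

theorem mul_left {u : Cn (d + 1) → ℂ} (hu : ContinuousOn u {y | y 0 ≠ 0}) (hX : ContOff X) :
    ContOff fun y => u y * X y :=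
  ⟨hu.mul hX.cont, hX.compact.mul_left⟩

theorem const_mul (hX : ContOff X) (c : ℂ) : ContOff fun y => c * X y :=
  hX.mul_left continuousOn_const

/-- The part of the support with `ε ≤ h|z₀|` is compact and misses the hyperplane, so no growth
condition on `X` is needed. -/
theorem integrableOn (hX : ContOff X) {h : Cn (d + 1) → ℝ} (hh : SmoothPos h) {ε : ℝ}
    (hε : 0 < ε) : IntegrableOn X {y | ε ≤ dist0 h y} := by
  have hK : IsCompact (tsupport X ∩ {y | ε ≤ dist0 h y}) :=
    hX.compact.isCompact.inter_right (isClosed_le continuous_const hh.continuous_dist0)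
  have h1 : IntegrableOn X (tsupport X ∩ {y | ε ≤ dist0 h y}) :=
    (hX.cont.mono fun y hy => ne_zero_of_dist0_pos (hε.trans_le hy.2)).integrableOn_compact hK
  refine h1.of_forall_sdiff_eq_zero (hh.measurableSet ε) fun y hy => ?_
  exact image_eq_zero_of_notMem_tsupport fun h => hy.2 ⟨h, hy.1⟩

theorem aestronglyMeasurable (hX : ContOff X) : AEStronglyMeasurable X volume := by
  have h1 : AEStronglyMeasurable X (volume.restrict {y : Cn (d + 1) | y 0 ≠ 0}) :=
    hX.cont.aestronglyMeasurable isOpen_off.measurableSet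
  have h2 : volume.restrict {y : Cn (d + 1) | y 0 ≠ 0} = volume :=
    Measure.restrict_eq_self_of_ae_mem ae_off
  rwa [h2] at h1

/-- Near a point of the hyperplane `h|z₀|` is below the threshold `δ`, so the weight removes any
singularity there. -/
theorem continuous_weight_mul (hX : ContOff X) {h : Cn (d + 1) → ℝ} (hh : SmoothPos h)
    {Φ : ℝ → ℝ} (hΦ : Continuous Φ) (hv : ∃ δ > 0, ∀ s ≤ δ, Φ s = 0) :
    Continuous fun y => (Φ (dist0 h y) : ℂ) * X y := by
  obtain ⟨δ, hδ, hv⟩ := hv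
  rw [continuous_iff_continuousAt]
  intro y
  by_cases hy : y 0 = 0
  · have : (fun y => (Φ (dist0 h y) : ℂ) * X y) =ᶠ[𝓝 y] fun _ => 0 := by
      have h0 : dist0 h y < δ := by simpa [dist0, hy] using hδ
      filter_upwards [hh.continuous_dist0.continuousAt.eventually_lt continuousAt_const h0]
        with z hz
      rw [hv _ hz.le]; simp
    exact continuousAt_const.congr this.symm
  · exact (Complex.continuous_ofReal.continuousAt.comp
      (hΦ.continuousAt.comp hh.continuous_dist0.continuousAt)).mul
      (hX.cont.continuousAt (isOpen_off.mem_nhds hy))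

theorem integrable_weight_mul (hX : ContOff X) {h : Cn (d + 1) → ℝ} (hh : SmoothPos h)
    {Φ : ℝ → ℝ} (hΦ : Continuous Φ) (hv : ∃ δ > 0, ∀ s ≤ δ, Φ s = 0) :
    Integrable fun y => (Φ (dist0 h y) : ℂ) * X y :=
  (hX.continuous_weight_mul hh hΦ hv).integrable_of_hasCompactSupport hX.compact.mul_left

end ContOff

theorem contDiff_weight_mul {X : Cn (d + 1) → ℂ} (hX : ∀ y, y 0 ≠ 0 → ContDiffAt ℝ 1 X y)
    {h : Cn (d + 1) → ℝ} (hh : SmoothPos h) {Φ : ℝ → ℝ} (hΦ : IsWeight Φ) :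
    ContDiff ℝ 1 fun y => (Φ (dist0 h y) : ℂ) * X y := by
  obtain ⟨δ, hδ, hv⟩ := hΦ.vanish
  rw [contDiff_iff_contDiffAt]
  intro y
  by_cases hy : y 0 = 0
  · have : (fun y => (Φ (dist0 h y) : ℂ) * X y) =ᶠ[𝓝 y] fun _ => 0 := by
      have h0 : dist0 h y < δ := by simpa [dist0, hy] using hδ
      filter_upwards [hh.continuous_dist0.continuousAt.eventually_lt continuousAt_const h0]
        with z hz
      rw [hv _ hz.le]; simp
    exact contDiffAt_const.congr_of_eventuallyEq this
  · have h1 := (contDiffAt_dist0 hh hy).of_le (show (1 : WithTop ℕ∞) ≤ ∞ by simp)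
    have h2 : ContDiffAt ℝ 1 (fun y => (Φ (dist0 h y) : ℂ)) y :=
      Complex.ofRealCLM.contDiff.contDiffAt.comp y (hΦ.smooth.contDiffAt.comp y h1)
    exact h2.mul (hX y hy)

/-- The logarithmic derivative of a positive function. -/
def dlog (c : ℂ) (j : Fin (d + 1)) (h : Cn (d + 1) → ℝ) (y : Cn (d + 1)) : ℂ :=
  wirt c j (fun y => (h y : ℂ)) y / h y

theorem SmoothPos.contDiff_ofReal {h : Cn (d + 1) → ℝ} (hh : SmoothPos h) :
    ContDiff ℝ ∞ fun y => (h y : ℂ) :=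
  Complex.ofRealCLM.contDiff.comp hh.smooth

theorem SmoothPos.contDiff_dlog {h : Cn (d + 1) → ℝ} (hh : SmoothPos h) {c : ℂ}
    {j : Fin (d + 1)} : ContDiff ℝ ∞ (dlog c j h) :=
  hh.contDiff_ofReal.wirt.mul (hh.contDiff_ofReal.inv fun y => by simpa using (hh.pos y).ne')

variable {y : Cn (d + 1)}

theorem hasFDerivAt_coord (j : Fin (d + 1)) (y : Cn (d + 1)) :
    HasFDerivAt (fun y : Cn (d + 1) => y j)
      (ContinuousLinearMap.proj (R := ℂ) (φ := fun _ : Fin (d + 1) => ℂ) j) y :=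
  (ContinuousLinearMap.proj (R := ℂ) (φ := fun _ : Fin (d + 1) => ℂ) j).hasFDerivAt

theorem wirt_coord_zpow {c : ℂ} {j : Fin (d + 1)} (a : ℤ) (hy : y 0 ≠ 0) :
    wirt c j (fun y => (y 0) ^ a) y
      = 2⁻¹ * (1 + c * Complex.I) * (if j = 0 then a * (y 0) ^ (a - 1) else 0) := by
  have h := (hasDerivAt_zpow a (y 0) (Or.inl hy)).comp_hasFDerivAt y (hasFDerivAt_coord 0 y)
  have h' : HasFDerivAt (fun y : Cn (d + 1) => (y 0) ^ a) _ y := h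
  rw [wirt_of_holomorphic h'.differentiableAt, h'.fderiv]
  split_ifs with hj
  · simp [hj]
  · simp [Ne.symm hj]

theorem contDiffAt_coord_zpow (a : ℤ) (hy : y 0 ≠ 0) :
    ContDiffAt ℝ ∞ (fun y : Cn (d + 1) => (y 0) ^ a) y := by
  have h0 : ContDiffAt ℝ ∞ (fun y : Cn (d + 1) => y 0) y := by fun_prop
  rcases a with a | a
  · simpa using h0.pow a
  · simp only [zpow_negSucc]
    exact (h0.pow (a + 1)).inv (pow_ne_zero _ hy)

theorem contDiffAt_conj {f : Cn (d + 1) → ℂ} (hf : ContDiffAt ℝ ∞ f y) :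
    ContDiffAt ℝ ∞ (fun y => (starRingEnd ℂ) (f y)) y :=
  (Complex.conjCLE : ℂ →L[ℝ] ℂ).contDiff.contDiffAt.comp y hf

/-- The function `z₀^a z̄₀^b`. -/
def mono (a b : ℤ) (y : Cn (d + 1)) : ℂ := (y 0) ^ a * (starRingEnd ℂ) (y 0) ^ b

theorem contDiffAt_mono (a b : ℤ) (hy : y 0 ≠ 0) :
    ContDiffAt ℝ ∞ (mono (d := d) a b) y := by
  have := contDiffAt_conj (contDiffAt_coord_zpow b hy)
  simp only [map_zpow₀] at this
  exact (contDiffAt_coord_zpow a hy).mul this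

theorem mono_add_one_left (a b : ℤ) (hy : y 0 ≠ 0) : mono (a + 1) b y = y 0 * mono a b y := by
  simp only [mono, zpow_add_one₀ hy]; ring

theorem mono_add_one_right (a b : ℤ) (hy : y 0 ≠ 0) :
    mono a (b + 1) y = (starRingEnd ℂ) (y 0) * mono a b y := by
  simp only [mono, zpow_add_one₀ ((map_ne_zero _).mpr hy)]; ring

theorem norm_mono (a b : ℤ) (hy : y 0 ≠ 0) : ‖mono a b y‖ = ‖y 0‖ ^ (a + b) := by
  simp [mono, zpow_add₀ (norm_ne_zero_iff.mpr hy)]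

theorem dz_mono {j : Fin (d + 1)} (a b : ℤ) (hy : y 0 ≠ 0) :
    wirt (-Complex.I) j (mono a b) y = if j = 0 then a * mono (a - 1) b y else 0 := by
  have h1 := (contDiffAt_coord_zpow a hy).differentiableAt (by simp)
  have h2 := (contDiffAt_coord_zpow b hy).differentiableAt (by simp)
  have h3 := (contDiffAt_conj (contDiffAt_coord_zpow b hy)).differentiableAt (by simp)
  have : mono (d := d) a b = fun y => (y 0) ^ a * (starRingEnd ℂ) ((y 0) ^ b) := by
    ext; simp [mono]
  rw [this, wirt_mul h1 h3, wirt_conj h2, wirt_coord_zpow a hy, wirt_coord_zpow b hy]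
  split_ifs
  · simp [mono]; norm_num; ring
  · simp

theorem dzbar_mono (a b : ℤ) (hy : y 0 ≠ 0) :
    wirt Complex.I 0 (mono a b) y = b * mono a (b - 1) y := by
  have h1 := (contDiffAt_coord_zpow a hy).differentiableAt (by simp)
  have h2 := (contDiffAt_coord_zpow b hy).differentiableAt (by simp)
  have h3 := (contDiffAt_conj (contDiffAt_coord_zpow b hy)).differentiableAt (by simp)
  have : mono (d := d) a b = fun y => (y 0) ^ a * (starRingEnd ℂ) ((y 0) ^ b) := by
    ext; simp [mono]
  rw [this, wirt_mul h1 h3, wirt_conj h2, wirt_coord_zpow a hy, wirt_coord_zpow b hy]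
  simp [mono, map_ofNat]; ring

theorem contDiffAt_norm_coord (hy : y 0 ≠ 0) :
    ContDiffAt ℝ ∞ (fun y : Cn (d + 1) => (‖y 0‖ : ℂ)) y :=
  have h1 : ContDiffAt ℝ ∞ (fun y : Cn (d + 1) => ‖y 0‖) y :=
    ContDiffAt.norm ℝ (by fun_prop) hy
  Complex.ofRealCLM.contDiff.contDiffAt.comp y h1

theorem wirt_norm_coord {c : ℂ} {j : Fin (d + 1)} (hy : y 0 ≠ 0) :
    wirt c j (fun y => (‖y 0‖ : ℂ)) y
      = ‖y 0‖ * (if j = 0 then (2⁻¹ * (1 + c * Complex.I)) / (2 * y 0)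
        + (2⁻¹ * (1 - c * Complex.I)) / (2 * (starRingEnd ℂ) (y 0)) else 0) := by
  have hN := contDiffAt_norm_coord hy
  have hd := hN.differentiableAt (by simp)
  have h0 : DifferentiableAt ℝ (fun y : Cn (d + 1) => y 0) y := by fun_prop
  have h0' : DifferentiableAt ℝ (fun y : Cn (d + 1) => (starRingEnd ℂ) (y 0)) y :=
    (contDiffAt_conj (by fun_prop)).differentiableAt (by simp)
  -- The formula results from differentiating `|z₀|² = z₀ z̄₀` and dividing by `2|z₀|`.
  have key : (fun y : Cn (d + 1) => (‖y 0‖ : ℂ) * ‖y 0‖)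
      = fun y => y 0 * (starRingEnd ℂ) (y 0) := by
    ext z
    rw [Complex.mul_conj, Complex.normSq_eq_norm_sq]; push_cast; ring
  have h1 := wirt_mul (c := c) (j := j) hd hd
  have e1 := wirt_coord_zpow (c := c) (j := j) 1 hy
  have e2 := wirt_coord_zpow (c := (starRingEnd ℂ) c) (j := j) 1 hy
  simp only [zpow_one, sub_self, zpow_zero, Int.cast_one, mul_one] at e1 e2
  rw [key, wirt_mul h0 h0', wirt_conj h0, e1, e2] at h1
  have hn : (‖y 0‖ : ℂ) ≠ 0 := by simpa using hy
  have hc : (starRingEnd ℂ) (y 0) ≠ 0 := (map_ne_zero _).mpr hy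
  have hk : (‖y 0‖ : ℂ) * ‖y 0‖ = y 0 * (starRingEnd ℂ) (y 0) := congrFun key y
  apply mul_left_cancel₀ (mul_ne_zero two_ne_zero hn)
  have h2 : (2 : ℂ) * ‖y 0‖ * wirt c j (fun y => (‖y 0‖ : ℂ)) y
      = wirt c j (fun y => (‖y 0‖ : ℂ)) y * ‖y 0‖ + ‖y 0‖ * wirt c j (fun y => (‖y 0‖ : ℂ)) y := by
    ring
  rw [h2, ← h1]
  split_ifs
  · simp only [map_mul, map_add, map_inv₀, map_ofNat, map_one, Complex.conj_conj, Complex.conj_I]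
    have : (2 : ℂ) * ‖y 0‖ * (‖y 0‖ * (2⁻¹ * (1 + c * Complex.I) / (2 * y 0) +
      2⁻¹ * (1 - c * Complex.I) / (2 * (starRingEnd ℂ) (y 0))))
      = 2 * (‖y 0‖ * ‖y 0‖) * ((2⁻¹ * (1 + c * Complex.I) / (2 * y 0) +
      2⁻¹ * (1 - c * Complex.I) / (2 * (starRingEnd ℂ) (y 0)))) := by ring
    rw [this, hk]
    field_simp
    ring
  · simp

/-- The factor `dist0 h y` is pulled out so that a weight will enter only through `s Φ'(s)`, its
derivative with respect to `log s`. -/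
theorem wirt_dist0 {h : Cn (d + 1) → ℝ} (hh : SmoothPos h) {c : ℂ} {j : Fin (d + 1)}
    (hy : y 0 ≠ 0) :
    wirt c j (fun y => (dist0 h y : ℂ)) y
      = dist0 h y * (dlog c j h y + (if j = 0 then (2⁻¹ * (1 + c * Complex.I)) / (2 * y 0)
        + (2⁻¹ * (1 - c * Complex.I)) / (2 * (starRingEnd ℂ) (y 0)) else 0)) := by
  have hN := contDiffAt_norm_coord hy
  have h1 := wirt_mul (c := c) (j := j)
    (hh.contDiff_ofReal.contDiffAt.differentiableAt (by simp) : DifferentiableAt ℝ _ y)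
    (hN.differentiableAt (by simp))
  have h2 : (fun y => (dist0 h y : ℂ)) = fun y => (h y : ℂ) * ‖y 0‖ := by
    ext; simp [dist0]
  have hp : (h y : ℂ) ≠ 0 := by simpa using (hh.pos y).ne'
  rw [h2, h1, wirt_norm_coord hy, dlog, dist0]
  push_cast
  field_simp

/-- The derivative of the weight `Φ(h|z₀|)`. -/
theorem wirt_weight_mul {h : Cn (d + 1) → ℝ} (hh : SmoothPos h) {c : ℂ} {j : Fin (d + 1)}
    {Φ : ℝ → ℝ} (hΦ : Differentiable ℝ Φ) {X : Cn (d + 1) → ℂ} (hX : DifferentiableAt ℝ X y)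
    (hy : y 0 ≠ 0) :
    wirt c j (fun y => (Φ (dist0 h y) : ℂ) * X y) y
      = (deriv Φ (dist0 h y) * dist0 h y : ℝ) *
        ((dlog c j h y + (if j = 0 then (2⁻¹ * (1 + c * Complex.I)) / (2 * y 0)
        + (2⁻¹ * (1 - c * Complex.I)) / (2 * (starRingEnd ℂ) (y 0)) else 0)) * X y)
        + Φ (dist0 h y) * wirt c j X y := by
  have h1 := (contDiffAt_dist0 hh hy).differentiableAt (by simp)
  have h2 : DifferentiableAt ℝ (fun y => (Φ (dist0 h y) : ℂ)) y :=
    Complex.ofRealCLM.differentiableAt.comp y (hΦ.differentiableAt.comp y h1)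
  rw [wirt_mul h2 hX, wirt_comp_real h1 (hΦ _).hasDerivAt, wirt_dist0 hh hy]
  push_cast
  ring

end Truncation

end

noncomputable section

/-! ### Lowering the order of a pole by integration by parts. -/

section Reduction

open MeasureTheory Filter Set

variable {d : ℕ}

/-- A compactly supported function, smooth off the hyperplane `z₀ = 0`. -/
structure SmoothOff (X : Cn (d + 1) → ℂ) : Prop where
  smooth : ∀ y, y 0 ≠ 0 → ContDiffAt ℝ ∞ X y
  compact : HasCompactSupport X

namespace SmoothOff

variable {X : Cn (d + 1) → ℂ}

theorem contOff (hX : SmoothOff X) : ContOff X :=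
  ⟨fun y hy => (hX.smooth y hy).continuousAt.continuousWithinAt, hX.compact⟩

theorem wirt (hX : SmoothOff X) {c : ℂ} {j : Fin (d + 1)} : SmoothOff (wirt c j X) :=
  ⟨fun y hy => (hX.smooth y hy).wirt, hX.compact.wirt⟩

theorem mul_left (hX : SmoothOff X) {u : Cn (d + 1) → ℂ}
    (hu : ∀ y, y 0 ≠ 0 → ContDiffAt ℝ ∞ u y) : SmoothOff fun y => u y * X y :=
  ⟨fun y hy => (hu y hy).mul (hX.smooth y hy), hX.compact.mul_left⟩

end SmoothOff

namespace IsTest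

variable {G G' : Cn (d + 1) → ℂ}

theorem mul_left (hG : IsTest G) {u : Cn (d + 1) → ℂ} (hu : ContDiff ℝ ∞ u) :
    IsTest fun y => u y * G y :=
  ⟨hu.mul hG.smooth, hG.compact.mul_left⟩

theorem const_mul (hG : IsTest G) (c : ℂ) : IsTest fun y => c * G y :=
  hG.mul_left contDiff_const

theorem add (hG : IsTest G) (hG' : IsTest G') : IsTest fun y => G y + G' y :=
  ⟨hG.smooth.add hG'.smooth, hG.compact.add hG'.compact⟩

theorem sub (hG : IsTest G) (hG' : IsTest G') : IsTest fun y => G y - G' y := by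
  simpa [sub_eq_add_neg] using hG.add (hG'.const_mul (-1))

theorem zero : IsTest fun _ : Cn (d + 1) => (0 : ℂ) :=
  ⟨contDiff_const, HasCompactSupport.zero⟩

theorem wirt (hG : IsTest G) {c : ℂ} {j : Fin (d + 1)} : IsTest (wirt c j G) :=
  ⟨hG.smooth.wirt, hG.compact.wirt⟩

theorem diff (hG : IsTest G) (y : Cn (d + 1)) : DifferentiableAt ℝ G y :=
  hG.smooth.contDiffAt.differentiableAt (by simp)

theorem smoothOff (hG : IsTest G) (a b : ℤ) : SmoothOff fun y => G y * mono a b y :=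
  ⟨fun _ hy => hG.smooth.contDiffAt.mul (contDiffAt_mono a b hy), hG.compact.mul_right⟩

end IsTest

/-- The logarithmic derivative of `h |z₀|`. -/
def slope0 (c : ℂ) (j : Fin (d + 1)) (h : Cn (d + 1) → ℝ) (y : Cn (d + 1)) : ℂ :=
  dlog c j h y + if j = 0 then (2⁻¹ * (1 + c * Complex.I)) / (2 * y 0)
        + (2⁻¹ * (1 - c * Complex.I)) / (2 * (starRingEnd ℂ) (y 0)) else 0

theorem slope0_dz (h : Cn (d + 1) → ℝ) (y : Cn (d + 1)) :
    slope0 (-Complex.I) 0 h y = dlog (-Complex.I) 0 h y + 2⁻¹ * (y 0)⁻¹ := by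
  simp [slope0]; norm_num; ring

theorem slope0_dzbar (h : Cn (d + 1) → ℝ) (y : Cn (d + 1)) :
    slope0 Complex.I 0 h y = dlog Complex.I 0 h y + 2⁻¹ * ((starRingEnd ℂ) (y 0))⁻¹ := by
  simp [slope0]; norm_num; ring

theorem contDiffAt_slope0 {h : Cn (d + 1) → ℝ} (hh : SmoothPos h) {c : ℂ} {j : Fin (d + 1)}
    {y : Cn (d + 1)} (hy : y 0 ≠ 0) : ContDiffAt ℝ ∞ (slope0 c j h) y := by
  have h1 : ContDiffAt ℝ ∞ (fun y : Cn (d + 1) => (2 * y 0)⁻¹) y :=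
    ContDiffAt.inv (by fun_prop) (by simpa using hy)
  have h2 : ContDiffAt ℝ ∞ (fun y : Cn (d + 1) => (2 * (starRingEnd ℂ) (y 0))⁻¹) y :=
    ContDiffAt.inv (contDiffAt_const.mul (contDiffAt_conj (by fun_prop))) (by simpa using hy)
  unfold slope0
  split_ifs
  · simp only [div_eq_mul_inv]
    exact hh.contDiff_dlog.contDiffAt.add ((contDiffAt_const.mul h1).add (contDiffAt_const.mul h2))
  · exact hh.contDiff_dlog.contDiffAt.add contDiffAt_const

theorem IsWeight.logDeriv {Φ : ℝ → ℝ} (hΦ : IsWeight Φ) :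
    Continuous (fun s => deriv Φ s * s) ∧ ∃ δ > 0, ∀ s ≤ δ, deriv Φ s * s = 0 := by
  refine ⟨(hΦ.smooth.continuous_deriv le_rfl).mul continuous_id, ?_⟩
  obtain ⟨δ, hδ, hv⟩ := hΦ.vanish
  -- The derivative is seen to vanish where `Φ` is locally zero, that is for `s < δ`; halving `δ`
  -- gives a closed condition.
  refine ⟨δ / 2, by positivity, fun s hs => ?_⟩
  have : Φ =ᶠ[𝓝 s] fun _ => 0 := by
    filter_upwards [Iio_mem_nhds (show s < δ by linarith)] with t ht using hv t ht.le
  simp [this.deriv_eq]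

variable {h : Cn (d + 1) → ℝ}

/-- Integration by parts against a weight `Φ(h|z₀|)`. -/
theorem integral_weight_mul_wirt (hh : SmoothPos h) {c : ℂ} {j : Fin (d + 1)}
    {Φ : ℝ → ℝ} (hΦ : IsWeight Φ) {P : Cn (d + 1) → ℂ} (hP : SmoothOff P) :
    ∫ y, (Φ (dist0 h y) : ℂ) * wirt c j P y
      = -∫ y, (deriv Φ (dist0 h y) * dist0 h y : ℝ) * (slope0 c j h y * P y) := by
  have h1 := contDiff_weight_mul (fun y hy => (hP.smooth y hy).of_le (by simp)) hh hΦ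
  have h2 := integral_wirt_eq_zero (c := c) (j := j) h1 hP.compact.mul_left
  have h3 : ∀ y, wirt c j (fun y => (Φ (dist0 h y) : ℂ) * P y) y
      = (deriv Φ (dist0 h y) * dist0 h y : ℝ) * (slope0 c j h y * P y)
        + Φ (dist0 h y) * wirt c j P y := by
    intro y
    by_cases hy : y 0 = 0
    · obtain ⟨δ, hδ, hv⟩ := hΦ.vanish
      have h0 : dist0 h y = 0 := by simp [dist0, hy]
      have : (fun y => (Φ (dist0 h y) : ℂ) * P y) =ᶠ[𝓝 y] fun _ => 0 := by
        filter_upwards [hh.continuous_dist0.continuousAt.eventually_lt continuousAt_const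
          (h0.trans_lt hδ)] with z hz
        rw [hv _ hz.le]; simp
      rw [wirt_congr this, wirt_const, h0, hv 0 hδ.le]; simp
    · exact wirt_weight_mul hh (hΦ.smooth.differentiable one_ne_zero)
        ((hP.smooth y hy).differentiableAt (by simp)) hy
  obtain ⟨hc, hv⟩ := hΦ.logDeriv
  simp only [h3] at h2
  rw [integral_add] at h2
  · linear_combination h2
  · exact (hP.mul_left fun y hy => contDiffAt_slope0 hh hy).contOff.integrable_weight_mul hh hc hv
  · exact hP.wirt.contOff.integrable_weight_mul hh hΦ.smooth.continuous hΦ.vanish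

/-- Two functions with the same integrals against all weights. -/
def WeightEq (h : Cn (d + 1) → ℝ) (X X' : Cn (d + 1) → ℂ) : Prop :=
  ∀ Φ, IsWeight Φ → ∫ y, (Φ (dist0 h y) : ℂ) * X y = ∫ y, (Φ (dist0 h y) : ℂ) * X' y

/-- Weights vanish at `0`, so junk values of the integrands on the hyperplane are invisible. -/
theorem IsWeight.congr_integral {Φ : ℝ → ℝ} (hΦ : IsWeight Φ) {X X' : Cn (d + 1) → ℂ}
    (hX : ∀ y, y 0 ≠ 0 → X y = X' y) :
    ∫ y, (Φ (dist0 h y) : ℂ) * X y = ∫ y, (Φ (dist0 h y) : ℂ) * X' y := by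
  congr 1
  ext y
  by_cases hy : y 0 = 0
  · obtain ⟨δ, hδ, hv⟩ := hΦ.vanish
    simp [dist0, hy, hv 0 hδ.le]
  · rw [hX y hy]

theorem dz_test_mul_mono {G : Cn (d + 1) → ℂ} (hG : IsTest G) (a b : ℤ) {j : Fin (d + 1)}
    {y : Cn (d + 1)} (hy : y 0 ≠ 0) :
    wirt (-Complex.I) j (fun y => G y * mono a b y) y
      = wirt (-Complex.I) j G y * mono a b y
        + if j = 0 then a * G y * mono (a - 1) b y else 0 := by
  rw [wirt_mul (hG.diff y) ((contDiffAt_mono a b hy).differentiableAt (by simp)), dz_mono a b hy]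
  split_ifs <;> ring

theorem dzbar_test_mul_mono {G : Cn (d + 1) → ℂ} (hG : IsTest G) (a b : ℤ)
    {y : Cn (d + 1)} (hy : y 0 ≠ 0) :
    wirt Complex.I 0 (fun y => G y * mono a b y) y
      = wirt Complex.I 0 G y * mono a b y + b * G y * mono a (b - 1) y := by
  rw [wirt_mul (hG.diff y) ((contDiffAt_mono a b hy).differentiableAt (by simp)),
    dzbar_mono a b hy]
  ring

/-- The vector field `(1/2 + z̄₀ q̄) z₀ ∂/∂z₀ - (1/2 + z₀ q) z̄₀ ∂/∂z̄₀`, with `q = ∂ log h/∂z₀`, is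
tangent to the level sets of `h|z₀|`; its divergence theorem lowers the order of a pole. -/
theorem exists_lower_pole (hh : SmoothPos h) {a b : ℤ} (hab : a ≠ b) {G : Cn (d + 1) → ℂ}
    (hG : IsTest G) : ∃ G₁ G₂, IsTest G₁ ∧ IsTest G₂ ∧
      WeightEq h (fun y => G y * mono a b y)
        (fun y => G₁ y * mono (a + 1) b y + G₂ y * mono a (b + 1) y) := by
  set q : Cn (d + 1) → ℂ := dlog (-Complex.I) 0 h with hq
  set q' : Cn (d + 1) → ℂ := dlog Complex.I 0 h with hq'
  have hqG : IsTest fun y => q y * G y := hG.mul_left hh.contDiff_dlog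
  have hqG' : IsTest fun y => q' y * G y := hG.mul_left hh.contDiff_dlog
  have hconj : ContDiff ℝ ∞ fun y : Cn (d + 1) => (starRingEnd ℂ) (y 0) :=
    contDiff_iff_contDiffAt.mpr fun y => contDiffAt_conj (by fun_prop)
  set k : ℂ := -2 / (a - b) with hk
  have hab' : (a : ℂ) - b ≠ 0 := sub_ne_zero.mpr (by exact_mod_cast hab)
  set G₁ : Cn (d + 1) → ℂ := fun y => k * (2⁻¹ * wirt (-Complex.I) 0 G y +
      (starRingEnd ℂ) (y 0) * (wirt (-Complex.I) 0 (fun y => q' y * G y) y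
        - wirt Complex.I 0 (fun y => q y * G y) y) - (b + 1) * (q y * G y)) with hG₁
  set G₂ : Cn (d + 1) → ℂ := fun y => k * ((a + 1) * (q' y * G y) - 2⁻¹ * wirt Complex.I 0 G y)
    with hG₂
  have t₁ : IsTest G₁ := (((hG.wirt.const_mul _).add ((hqG'.wirt.sub hqG.wirt).mul_left hconj)).sub
    (hqG.const_mul _)).const_mul _
  have t₂ : IsTest G₂ := ((hqG'.const_mul _).sub (hG.wirt.const_mul _)).const_mul _
  refine ⟨G₁, G₂, t₁, t₂, fun Φ hΦ => ?_⟩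
  -- `Z` and `W` are the coefficients `z₀(1/2 + z̄₀ q')` and `z̄₀(1/2 + z₀ q)` of the field,
  -- multiplied by `G z₀^a z̄₀^b`.
  set Z : Cn (d + 1) → ℂ := fun y => (2⁻¹ * G y) * mono (a + 1) b y +
    (q' y * G y) * mono (a + 1) (b + 1) y with hZ
  set W : Cn (d + 1) → ℂ := fun y => (2⁻¹ * G y) * mono a (b + 1) y +
    (q y * G y) * mono (a + 1) (b + 1) y with hW
  have sZ1 := (hG.const_mul 2⁻¹).smoothOff (a + 1) b
  have sZ2 := hqG'.smoothOff (a + 1) (b + 1)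
  have sW1 := (hG.const_mul 2⁻¹).smoothOff a (b + 1)
  have sW2 := hqG.smoothOff (a + 1) (b + 1)
  have sZ : SmoothOff Z :=
    ⟨fun y hy => (sZ1.smooth y hy).add (sZ2.smooth y hy), sZ1.compact.add sZ2.compact⟩
  have sW : SmoothOff W :=
    ⟨fun y hy => (sW1.smooth y hy).add (sW2.smooth y hy), sW1.compact.add sW2.compact⟩
  have e1 := integral_weight_mul_wirt hh (c := -Complex.I) (j := 0) hΦ sZ
  have e2 := integral_weight_mul_wirt hh (c := Complex.I) (j := 0) hΦ sW
  -- Tangency to the level sets: both sides contain the symmetric product `(1/2 + z₀ q)(1/2 + z̄₀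
  -- q')`, so the terms in which the weight is differentiated cancel.
  have e3 : ∀ y, (deriv Φ (dist0 h y) * dist0 h y : ℝ) * (slope0 (-Complex.I) 0 h y * Z y)
      = (deriv Φ (dist0 h y) * dist0 h y : ℝ) * (slope0 Complex.I 0 h y * W y) := by
    intro y
    by_cases hy : y 0 = 0
    · simp [dist0, hy]
    · have hy' : (starRingEnd ℂ) (y 0) ≠ 0 := (map_ne_zero _).mpr hy
      congr 1
      simp only [slope0_dz, slope0_dzbar, hZ, hW, mono_add_one_left _ _ hy,
        mono_add_one_right _ _ hy, ← hq, ← hq']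
      field_simp
      ring
  have e4 : ∫ y, (Φ (dist0 h y) : ℂ) * wirt (-Complex.I) 0 Z y
      = ∫ y, (Φ (dist0 h y) : ℂ) * wirt Complex.I 0 W y := by
    rw [e1, e2, integral_congr_ae (Eventually.of_forall e3)]
  have i1 := (hG.smoothOff a b).contOff.integrable_weight_mul hh hΦ.smooth.continuous hΦ.vanish
  have i2 := sZ.wirt (c := -Complex.I) (j := 0) |>.contOff.integrable_weight_mul hh
    hΦ.smooth.continuous hΦ.vanish
  have i3 := sW.wirt (c := Complex.I) (j := 0) |>.contOff.integrable_weight_mul hh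
    hΦ.smooth.continuous hΦ.vanish
  have e5 : ∫ y, (Φ (dist0 h y) : ℂ) * (G₁ y * mono (a + 1) b y + G₂ y * mono a (b + 1) y)
      = ∫ y, ((Φ (dist0 h y) : ℂ) * (G y * mono a b y) +
        k * ((Φ (dist0 h y) : ℂ) * wirt (-Complex.I) 0 Z y
          - (Φ (dist0 h y) : ℂ) * wirt Complex.I 0 W y)) := by
    have : ∀ y : Cn (d + 1), y 0 ≠ 0 → G₁ y * mono (a + 1) b y + G₂ y * mono a (b + 1) y
        = G y * mono a b y + k * (wirt (-Complex.I) 0 Z y - wirt Complex.I 0 W y) := by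
      intro y hy
      rw [hZ, hW, wirt_add ((sZ1.smooth y hy).differentiableAt (by simp))
        ((sZ2.smooth y hy).differentiableAt (by simp)),
        wirt_add ((sW1.smooth y hy).differentiableAt (by simp))
        ((sW2.smooth y hy).differentiableAt (by simp)),
        dz_test_mul_mono (hG.const_mul _) _ _ hy, dz_test_mul_mono hqG' _ _ hy,
        dzbar_test_mul_mono (hG.const_mul _) _ _ hy, dzbar_test_mul_mono hqG _ _ hy,
        wirt_const_mul _ (hG.diff y), wirt_const_mul _ (hG.diff y)]
      simp only [if_true, add_sub_cancel_right, hG₁, hG₂]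
      simp only [mono_add_one_left _ _ hy, mono_add_one_right _ _ hy]
      have : k * (2⁻¹ * (a - b)) = -1 := by rw [hk]; field_simp
      push_cast
      linear_combination (-(G y * mono a b y)) * this
    rw [hΦ.congr_integral this]
    congr 1; ext y; ring
  have i4 : Integrable fun y => k * ((Φ (dist0 h y) : ℂ) * wirt (-Complex.I) 0 Z y
      - (Φ (dist0 h y) : ℂ) * wirt Complex.I 0 W y) := (i2.sub i3).const_mul k
  rw [e5, integral_add i1 i4, integral_const_mul, integral_sub i2 i3, e4]
  simp

/-- An integrable singularity of order one along `z₀ = 0`. -/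
structure IsMild (T : Cn (d + 1) → ℂ) : Prop where
  contOff : ContOff T
  bound : ∃ C : ℝ, 0 ≤ C ∧ ∀ y, y 0 ≠ 0 → ‖T y‖ ≤ C / ‖y 0‖

theorem IsMild.add {T T' : Cn (d + 1) → ℂ} (hT : IsMild T) (hT' : IsMild T') :
    IsMild fun y => T y + T' y := by
  obtain ⟨C, hC, hb⟩ := hT.bound
  obtain ⟨C', hC', hb'⟩ := hT'.bound
  refine ⟨hT.contOff.add hT'.contOff, C + C', by positivity, fun y hy => ?_⟩
  rw [add_div]
  exact (norm_add_le _ _).trans (add_le_add (hb y hy) (hb' y hy))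

/-- The surplus `|z₀|^{a+b+1}` is absorbed into `G`: their product is continuous with compact
support, hence bounded. -/
theorem IsTest.isMild {G : Cn (d + 1) → ℂ} (hG : IsTest G) {a b : ℤ} (hab : -1 ≤ a + b) :
    IsMild fun y => G y * mono a b y := by
  refine ⟨(hG.smoothOff a b).contOff, ?_⟩
  obtain ⟨n, hn⟩ : ∃ n : ℕ, a + b = (n : ℤ) - 1 := ⟨(a + b + 1).toNat, by omega⟩
  have hc : HasCompactSupport fun y : Cn (d + 1) => ‖G y‖ * ‖y 0‖ ^ n :=
    hG.compact.norm.mul_right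
  have hct : Continuous fun y : Cn (d + 1) => ‖G y‖ * ‖y 0‖ ^ n := by
    have := hG.smooth.continuous; fun_prop
  obtain ⟨C, hC⟩ := hc.exists_bound_of_continuous hct
  refine ⟨C, (norm_nonneg _).trans (hC 0), fun y hy => ?_⟩
  have hy' : ‖y 0‖ ≠ 0 := norm_ne_zero_iff.mpr hy
  rw [norm_mul, norm_mono a b hy, hn, zpow_sub_one₀ hy', zpow_natCast, ← mul_assoc,
    ← div_eq_mul_inv]
  gcongr
  simpa using hC y

/-- Every pole `z₀^a z̄₀^b` with `b ≥ -1` reduces to `|z₀|^{-2}` and an integrable singularity. -/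
theorem exists_weightEq_mild (hh : SmoothPos h) (N : ℕ) : ∀ (a b : ℤ), -1 ≤ b → -1 - N ≤ a + b →
    ∀ G : Cn (d + 1) → ℂ, IsTest G → ∃ G₀ T, IsTest G₀ ∧ IsMild T ∧
      WeightEq h (fun y => G y * mono a b y) (fun y => G₀ y * mono (-1) (-1) y + T y) := by
  have base : ∀ (a b : ℤ), -1 ≤ a + b → ∀ G : Cn (d + 1) → ℂ, IsTest G → ∃ G₀ T, IsTest G₀ ∧
      IsMild T ∧ WeightEq h (fun y => G y * mono a b y)
        (fun y => G₀ y * mono (-1) (-1) y + T y) := fun a b hab G hG =>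
    ⟨_, _, IsTest.zero, hG.isMild hab, fun Φ _ => by simp⟩
  induction N with
  | zero => exact fun a b _ hab G hG => base a b (by simpa using hab) G hG
  | succ N ih =>
    intro a b hb hab G hG
    by_cases h1 : -1 ≤ a + b
    · exact base a b h1 G hG
    -- With `-1 ≤ b` and `a + b ≤ -2`, equality forces `a = b = -1`, the only pole at which the
    -- reduction gets stuck. Otherwise each step raises `a + b` by one.
    by_cases hne : a = b
    · obtain ⟨rfl, rfl⟩ : a = -1 ∧ b = -1 := by omega
      exact ⟨G, _, hG, (IsTest.zero (d := d)).isMild (a := 0) (b := 0) (by norm_num),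
        fun Φ _ => by simp⟩
    obtain ⟨G₁, G₂, t₁, t₂, h12⟩ := exists_lower_pole hh hne hG
    push_cast at hab
    obtain ⟨A₁, T₁, tA₁, m₁, e₁⟩ := ih (a + 1) b hb (by omega) G₁ t₁
    obtain ⟨A₂, T₂, tA₂, m₂, e₂⟩ := ih a (b + 1) (by omega) (by omega) G₂ t₂
    refine ⟨_, _, tA₁.add tA₂, m₁.add m₂, fun Φ hΦ => ?_⟩
    have hi : ∀ {X : Cn (d + 1) → ℂ}, ContOff X →
        Integrable fun y => (Φ (dist0 h y) : ℂ) * X y := fun hX =>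
      hX.integrable_weight_mul hh hΦ.smooth.continuous hΦ.vanish
    rw [h12 Φ hΦ]
    simp only [mul_add]
    rw [integral_add (hi (t₁.smoothOff _ _).contOff) (hi (t₂.smoothOff _ _).contOff),
      e₁ Φ hΦ, e₂ Φ hΦ,
      ← integral_add (hi ((tA₁.smoothOff _ _).contOff.add m₁.contOff))
        (hi ((tA₂.smoothOff _ _).contOff.add m₂.contOff))]
    congr 1; ext y; ring

end Reduction

end

noncomputable section

/-! ### Singularities of size `1/|z₀|`: the tube `h|z₀| < ε` contributes `O(ε)`. -/

section Estimates

open MeasureTheory Filter Set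

variable {d : ℕ}

/-- The exponent is the order one of a mild singularity plus one half reserved for absorbing a
logarithm. In polar coordinates the integrand becomes `r^{-1/2}`, with primitive `2 r^{1/2}`. -/
theorem radial_singularity : ∃ M : ℝ, 0 ≤ M ∧ ∀ δ > 0,
    Integrable (fun w : ℂ => if ‖w‖ < δ then ‖w‖ ^ (-(3 / 2) : ℝ) else 0) ∧
    ∫ w : ℂ, (if ‖w‖ < δ then ‖w‖ ^ (-(3 / 2) : ℝ) else 0) = M * δ ^ (1 / 2 : ℝ) := by
  refine ⟨2 * ((volume : Measure ℂ).real (Metric.ball 0 1) * 2), by positivity, fun δ hδ => ?_⟩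
  set f : ℝ → ℝ := fun r => if r < δ then r ^ (-(3 / 2) : ℝ) else 0 with hf
  have hr : Module.finrank ℝ ℂ - 1 = 1 := by simp
  have e : ∀ y ∈ Ioi (0 : ℝ), y ^ 1 • f y = (Ioo 0 δ).indicator (fun y => y ^ (-(1 / 2) : ℝ)) y := by
    intro y hy
    have hy' : (0 : ℝ) < y := hy
    simp only [hf, indicator, mem_Ioo, hy', true_and]
    split_ifs
    · rw [smul_eq_mul, ← Real.rpow_natCast, ← Real.rpow_add hy']; norm_num
    · simp
  have hi : IntegrableOn (fun y : ℝ => y ^ (-(1 / 2) : ℝ)) (Ioc 0 δ) :=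
    (intervalIntegrable_iff_integrableOn_Ioc_of_le hδ.le).mp
      (intervalIntegral.intervalIntegrable_rpow' (by norm_num))
  constructor
  · refine (integrable_fun_norm_addHaar (volume : Measure ℂ) (f := f)).mpr ?_
    rw [hr, integrableOn_congr_fun e measurableSet_Ioi]
    exact ((integrable_indicator_iff measurableSet_Ioo).mpr
      (hi.mono_set Ioo_subset_Ioc_self)).integrableOn
  · have h1 : ∫ w : ℂ, (if ‖w‖ < δ then ‖w‖ ^ (-(3 / 2) : ℝ) else 0) = _ :=
      integral_fun_norm_addHaar (volume : Measure ℂ) f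
    rw [h1, hr, setIntegral_congr_fun measurableSet_Ioi e,
      setIntegral_indicator measurableSet_Ioo, inter_eq_right.mpr Ioo_subset_Ioi_self,
      ← integral_Ioc_eq_integral_Ioo, ← intervalIntegral.integral_of_le hδ.le,
      integral_rpow (Or.inl (by norm_num)), Complex.finrank_real_complex]
    norm_num
    ring

/-- The splitting `ℂ^{d+1} = ℂ × ℂ^d`. -/
theorem measurePreserving_split : MeasurePreserving
    (fun y : Cn (d + 1) => ((y 0, fun i => y (Fin.succ i)) : ℂ × Cn d)) := by
  simpa [MeasurableEquiv.piFinSuccAbove, Fin.insertNthEquiv, Fin.removeNth] using!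
    volume_preserving_piFinSuccAbove (fun _ : Fin (d + 1) => ℂ) 0

theorem measurableEmbedding_split : MeasurableEmbedding
    (fun y : Cn (d + 1) => ((y 0, fun i => y (Fin.succ i)) : ℂ × Cn d)) := by
  simpa [MeasurableEquiv.piFinSuccAbove, Fin.insertNthEquiv, Fin.removeNth] using!
    (MeasurableEquiv.piFinSuccAbove (fun _ : Fin (d + 1) => ℂ) 0).measurableEmbedding

theorem integral_split {F : Type*} [NormedAddCommGroup F] [NormedSpace ℝ F] (f : ℂ × Cn d → F) :
    ∫ y : Cn (d + 1), f (y 0, fun i => y (Fin.succ i)) = ∫ p, f p :=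
  measurePreserving_split.integral_comp measurableEmbedding_split f

theorem integrable_split {F : Type*} [NormedAddCommGroup F] {f : ℂ × Cn d → F} :
    Integrable (fun y : Cn (d + 1) => f (y 0, fun i => y (Fin.succ i))) ↔ Integrable f :=
  measurePreserving_split.integrable_comp_emb measurableEmbedding_split

/-- `B` is the radial function of `z₀` times the indicator of a ball in the remaining variables;
Fubini reduces the integral to `radial_singularity`. -/
theorem singularity_estimate (R : ℝ) : ∃ M : ℝ, 0 ≤ M ∧ ∀ δ > 0, ∃ B : Cn (d + 1) → ℝ,
    Integrable B ∧ (∀ y, 0 ≤ B y) ∧ (∫ y, B y) ≤ M * δ ^ (1 / 2 : ℝ) ∧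
    ∀ y, ‖y‖ ≤ R → ‖y 0‖ < δ → B y = ‖y 0‖ ^ (-(3 / 2) : ℝ) := by
  obtain ⟨M, hM, h⟩ := radial_singularity
  set g : Cn d → ℝ := (Metric.closedBall 0 R).indicator fun _ => 1 with hg
  have gi : Integrable g :=
    (integrable_indicator_iff measurableSet_closedBall).mpr
      (integrableOn_const (measure_closedBall_lt_top.ne))
  have g0 : ∀ z, 0 ≤ g z := fun z => indicator_nonneg (fun _ _ => zero_le_one) z
  refine ⟨M * ∫ z, g z, mul_nonneg hM (integral_nonneg g0), fun δ hδ => ?_⟩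
  obtain ⟨h1, h2⟩ := h δ hδ
  refine ⟨fun y => (if ‖y 0‖ < δ then ‖y 0‖ ^ (-(3 / 2) : ℝ) else 0) *
    g (fun i => y (Fin.succ i)), ?_, ?_, ?_, ?_⟩
  · exact integrable_split.mpr (h1.mul_prod gi)
  · intro y
    refine mul_nonneg ?_ (g0 _)
    split_ifs <;> positivity
  · rw [integral_split (fun p : ℂ × Cn d =>
      (if ‖p.1‖ < δ then ‖p.1‖ ^ (-(3 / 2) : ℝ) else 0) * g p.2)]
    rw [show (volume : Measure (ℂ × Cn d)) = (volume : Measure ℂ).prod volume from rfl,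
      integral_prod_mul (fun w : ℂ => if ‖w‖ < δ then ‖w‖ ^ (-(3 / 2) : ℝ) else 0) g, h2]
    apply le_of_eq; ring
  · intro y hy hy'
    have : g (fun i => y (Fin.succ i)) = 1 := by
      rw [hg, indicator_of_mem]
      rw [mem_closedBall_zero_iff]
      have hR : 0 ≤ R := (norm_nonneg y).trans hy
      exact (pi_norm_le_iff_of_nonneg hR).mpr fun i => (norm_le_pi_norm y _).trans hy
    simp [this, hy']

variable {h : Cn (d + 1) → ℝ} {T : Cn (d + 1) → ℂ}

/-- Let `h ≥ c > 0` on a ball containing the support. The dominated function is at most `C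
(ε/c)^{1/2} |z₀|^{-3/2}`, and the tube lies in `|z₀| < ε/c`, where the integral of `|z₀|^{-3/2}` is
`O((ε/c)^{1/2})`: the two half powers combine to `ε`. -/
theorem IsMild.tail (hT : IsMild T) (hh : SmoothPos h) : ∃ M : ℝ, 0 ≤ M ∧ ∀ ε > 0,
    ∃ B : Cn (d + 1) → ℝ, Integrable B ∧ (∀ y, 0 ≤ B y) ∧ (∫ y, B y) ≤ M * ε ∧
    ∀ y, y 0 ≠ 0 → dist0 h y < ε → ‖T y‖ * (ε / dist0 h y) ^ (1 / 2 : ℝ) ≤ B y := by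
  obtain ⟨C, hC, hb⟩ := hT.bound
  obtain ⟨R, hR⟩ := hT.contOff.compact.isCompact.isBounded.subset_closedBall 0
  obtain ⟨c, hc, hcb⟩ : ∃ c > 0, ∀ y ∈ Metric.closedBall (0 : Cn (d + 1)) R, c ≤ h y := by
    rcases (Metric.closedBall (0 : Cn (d + 1)) R).eq_empty_or_nonempty with he | hne
    · exact ⟨1, one_pos, by simp [he]⟩
    obtain ⟨y, _, hy⟩ := (isCompact_closedBall (0 : Cn (d + 1)) R).exists_isMinOn hne
      hh.continuous.continuousOn
    exact ⟨h y, hh.pos y, fun z hz => hy hz⟩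
  obtain ⟨M, hM, h1⟩ := singularity_estimate (d := d) R
  refine ⟨C * M / c, by positivity, fun ε hε => ?_⟩
  obtain ⟨B, Bi, B0, Bm, Be⟩ := h1 (ε / c) (by positivity)
  refine ⟨fun y => C * (ε / c) ^ (1 / 2 : ℝ) * B y, Bi.const_mul _,
    fun y => mul_nonneg (by positivity) (B0 y), ?_, ?_⟩
  · rw [integral_const_mul]
    calc C * (ε / c) ^ (1 / 2 : ℝ) * ∫ y, B y
        ≤ C * (ε / c) ^ (1 / 2 : ℝ) * (M * (ε / c) ^ (1 / 2 : ℝ)) := by gcongr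
      _ = C * M * ((ε / c) ^ (1 / 2 : ℝ) * (ε / c) ^ (1 / 2 : ℝ)) := by ring
      _ = C * M / c * ε := by
        rw [← Real.rpow_add (by positivity)]; norm_num; ring
  · intro y hy hlt
    by_cases hyR : y ∈ tsupport T
    · have hyb := hR hyR
      have hn : 0 < ‖y 0‖ := norm_pos_iff.mpr hy
      have h2 : c * ‖y 0‖ ≤ dist0 h y := mul_le_mul_of_nonneg_right (hcb y hyb) hn.le
      beta_reduce
      rw [Be y (mem_closedBall_zero_iff.mp hyb) (by rw [lt_div_iff₀ hc]; linarith)]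
      calc ‖T y‖ * (ε / dist0 h y) ^ (1 / 2 : ℝ)
          ≤ (C / ‖y 0‖) * (ε / (c * ‖y 0‖)) ^ (1 / 2 : ℝ) := by
            have := hb y hy
            have hp := hh.dist0_pos hy
            gcongr
        _ = C * (ε / c) ^ (1 / 2 : ℝ) * ‖y 0‖ ^ (-(3 / 2) : ℝ) := by
            rw [← div_div, Real.div_rpow (by positivity) hn.le,
              show (-(3 / 2) : ℝ) = -1 - 1 / 2 by norm_num, Real.rpow_sub hn, Real.rpow_neg_one]
            ring
    · rw [image_eq_zero_of_notMem_tsupport hyR]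
      simpa using mul_nonneg (by positivity) (B0 y)

/-- Applied to `s = h|z₀|/ε`, this bounds the logarithmic factor by the half power allowed in
`IsMild.tail`. -/
theorem abs_log_le {s : ℝ} (hs : 0 < s) (hs1 : s ≤ 1) :
    |Real.log s| ≤ 2 * (1 / s) ^ (1 / 2 : ℝ) := by
  rw [abs_of_nonpos (Real.log_nonpos hs.le hs1), ← Real.log_inv]
  have := Real.log_le_rpow_div (x := s⁻¹) (ε := 1 / 2) (by positivity) (by norm_num)
  rw [one_div s]
  linarith

/-- Integrals over the tube `h|z₀| < ε` of a function dominated by `|T| (ε/h|z₀|)^{1/2}`. -/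
theorem IsMild.tube (hT : IsMild T) (hh : SmoothPos h) {u : ℝ → Cn (d + 1) → ℂ}
    (hu : ∀ ε > 0, AEStronglyMeasurable (u ε)) {K : ℝ}
    (hK : ∀ ε > 0, ∀ y, y 0 ≠ 0 → dist0 h y < ε →
      ‖u ε y‖ ≤ K * (‖T y‖ * (ε / dist0 h y) ^ (1 / 2 : ℝ))) :
    (∀ ε > 0, IntegrableOn (u ε) {y | dist0 h y < ε}) ∧
      ∃ M, ∀ ε > 0, ‖∫ y in {y | dist0 h y < ε}, u ε y‖ ≤ M * ε := by
  obtain ⟨M, hM, hB⟩ := hT.tail hh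
  have hm : ∀ ε, MeasurableSet {y | dist0 h y < ε} := fun ε =>
    (isOpen_lt hh.continuous_dist0 continuous_const).measurableSet
  have key : ∀ ε > 0, ∃ B : Cn (d + 1) → ℝ, Integrable B ∧ (∀ y, 0 ≤ B y) ∧ (∫ y, B y) ≤ M * ε ∧
      ∀ᵐ y ∂(volume.restrict {y | dist0 h y < ε}), ‖u ε y‖ ≤ |K| * B y := by
    intro ε hε
    obtain ⟨B, Bi, B0, Bm, Bb⟩ := hB ε hε
    refine ⟨B, Bi, B0, Bm, ?_⟩
    filter_upwards [ae_restrict_of_ae ae_off, ae_restrict_mem (hm ε)] with y hy hlt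
    refine (hK ε hε y hy hlt).trans ?_
    calc K * (‖T y‖ * (ε / dist0 h y) ^ (1 / 2 : ℝ))
        ≤ |K| * (‖T y‖ * (ε / dist0 h y) ^ (1 / 2 : ℝ)) := by
          refine mul_le_mul_of_nonneg_right (le_abs_self K) ?_
          have := hh.dist0_pos hy
          positivity
      _ ≤ |K| * B y := mul_le_mul_of_nonneg_left (Bb y hy hlt) (abs_nonneg K)
  refine ⟨fun ε hε => ?_, |K| * M, fun ε hε => ?_⟩
  · obtain ⟨B, Bi, B0, Bm, Bb⟩ := key ε hε
    exact (Bi.const_mul |K|).integrableOn.mono' (hu ε hε).restrict Bb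
  · obtain ⟨B, Bi, B0, Bm, Bb⟩ := key ε hε
    calc ‖∫ y in {y | dist0 h y < ε}, u ε y‖
        ≤ ∫ y in {y | dist0 h y < ε}, |K| * B y :=
          norm_integral_le_of_norm_le (Bi.const_mul |K|).integrableOn Bb
      _ ≤ ∫ y, |K| * B y :=
          setIntegral_le_integral (Bi.const_mul |K|)
            (Eventually.of_forall fun y => mul_nonneg (abs_nonneg K) (B0 y))
      _ ≤ |K| * M * ε := by
          rw [integral_const_mul, mul_assoc]
          exact mul_le_mul_of_nonneg_left Bm (abs_nonneg K)

theorem one_le_ratio {ε s : ℝ} (hs : 0 < s) (h : s < ε) : 1 ≤ (ε / s) ^ (1 / 2 : ℝ) :=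
  Real.one_le_rpow ((one_le_div hs).mpr h.le) (by norm_num)

theorem integrable_of_tube (hh : SmoothPos h) {u : Cn (d + 1) → ℂ} (hu : ContOff u)
    {ε : ℝ} (hε : 0 < ε) (h1 : IntegrableOn u {y | dist0 h y < ε}) : Integrable u := by
  have h2 := h1.union (hu.integrableOn hh hε)
  rwa [show {y | dist0 h y < ε} ∪ {y | ε ≤ dist0 h y} = univ from by
    ext y; simp [lt_or_ge], integrableOn_univ] at h2

theorem truncInt_eq_sub (hh : SmoothPos h) {u : Cn (d + 1) → ℂ} (hu : Integrable u) (ε : ℝ) :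
    truncInt h u ε = (∫ y, u y) - ∫ y in {y | dist0 h y < ε}, u y := by
  have hm : MeasurableSet {y | dist0 h y < ε} :=
    (isOpen_lt hh.continuous_dist0 continuous_const).measurableSet
  rw [← integral_add_compl hm hu, truncInt,
    show {y | ε ≤ dist0 h y} = {y | dist0 h y < ε}ᶜ from by ext y; simp]
  ring

theorem IsMild.integrable (hT : IsMild T) (hh : SmoothPos h) : Integrable T := by
  refine integrable_of_tube hh hT.contOff one_pos ((hT.tube hh (u := fun _ => T) (K := 1)
    (fun _ _ => hT.contOff.aestronglyMeasurable) fun ε hε y hy hlt => ?_).1 1 one_pos)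
  rw [one_mul]
  exact le_mul_of_one_le_right (norm_nonneg _) (one_le_ratio (hh.dist0_pos hy) hlt)

theorem IsMild.truncInt (hT : IsMild T) (hh : SmoothPos h) :
    (fun ε => truncInt h T ε - ∫ y, T y) =O[𝓝[>] 0] fun ε : ℝ => ε := by
  obtain ⟨M, hM⟩ := (hT.tube hh (u := fun _ => T) (K := 1)
    (fun _ _ => hT.contOff.aestronglyMeasurable) fun ε hε y hy hlt => by
      rw [one_mul]
      exact le_mul_of_one_le_right (norm_nonneg _) (one_le_ratio (hh.dist0_pos hy) hlt)).2
  refine Asymptotics.IsBigO.of_bound M ?_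
  filter_upwards [self_mem_nhdsWithin] with ε hε
  have hε' : 0 < ε := hε
  rw [truncInt_eq_sub hh (hT.integrable hh), sub_sub_cancel_left, norm_neg, Real.norm_eq_abs,
    abs_of_pos hε']
  exact hM ε hε'

theorem continuousOn_log_dist0 (hh : SmoothPos h) (a : ℝ) :
    ContinuousOn (fun y => ((Real.log (dist0 h y) - a : ℝ) : ℂ)) {y | y 0 ≠ 0} :=
  Complex.continuous_ofReal.comp_continuousOn
    ((hh.continuous_dist0.continuousOn.log fun _ hy => (hh.dist0_pos hy).ne').sub
      continuousOn_const)

theorem IsMild.log_tube (hT : IsMild T) (hh : SmoothPos h) :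
    (∀ ε > 0, IntegrableOn (fun y => ((Real.log (dist0 h y) - Real.log ε : ℝ) : ℂ) * T y)
      {y | dist0 h y < ε}) ∧
    ∃ M, ∀ ε > 0, ‖∫ y in {y | dist0 h y < ε},
      ((Real.log (dist0 h y) - Real.log ε : ℝ) : ℂ) * T y‖ ≤ M * ε :=
  hT.tube hh (u := fun ε y => ((Real.log (dist0 h y) - Real.log ε : ℝ) : ℂ) * T y) (K := 2)
    (fun ε _ => (hT.contOff.mul_left (continuousOn_log_dist0 hh _)).aestronglyMeasurable)
    fun ε hε y hy hlt => by
      have hp := hh.dist0_pos hy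
      have := abs_log_le (s := dist0 h y / ε) (by positivity) ((div_le_one hε).mpr hlt.le)
      rw [Real.log_div hp.ne' hε.ne', one_div_div] at this
      rw [norm_mul, Complex.norm_real, Real.norm_eq_abs]
      nlinarith [norm_nonneg (T y)]

theorem IsMild.integrable_log (hT : IsMild T) (hh : SmoothPos h) :
    Integrable fun y => (Real.log (dist0 h y) : ℂ) * T y := by
  have h1 := (hT.log_tube hh).1 1 one_pos
  have h2 := hT.contOff.mul_left (continuousOn_log_dist0 hh 0)
  simp only [Real.log_one, sub_zero] at h1 h2
  exact integrable_of_tube hh h2 one_pos h1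

/-- Removing the truncation costs only `O(ε)` even with the factor `log(h|z₀|/ε)`, and the full
integral depends on `ε` through `-log ε ∫ T`. This is where the logarithm in the expansion
originates. -/
theorem IsMild.truncInt_log (hT : IsMild T) (hh : SmoothPos h) :
    (fun ε => _root_.truncInt h (fun y => ((Real.log (dist0 h y) - Real.log ε : ℝ) : ℂ) * T y) ε
      - ((∫ y, (Real.log (dist0 h y) : ℂ) * T y) - Real.log ε * ∫ y, T y))
      =O[𝓝[>] 0] fun ε : ℝ => ε := by
  obtain ⟨M, hM⟩ := (hT.log_tube hh).2
  refine Asymptotics.IsBigO.of_bound M ?_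
  filter_upwards [self_mem_nhdsWithin] with ε hε
  have hε' : 0 < ε := hε
  have i1 := hT.integrable_log hh
  have i2 : Integrable fun y => (Real.log ε : ℂ) * T y := (hT.integrable hh).const_mul _
  have i3 : Integrable fun y => ((Real.log (dist0 h y) - Real.log ε : ℝ) : ℂ) * T y := by
    refine (i1.sub i2).congr (Eventually.of_forall fun y => ?_)
    simp only [Pi.sub_apply]
    push_cast; ring
  have e : ∫ y, ((Real.log (dist0 h y) - Real.log ε : ℝ) : ℂ) * T y
      = (∫ y, (Real.log (dist0 h y) : ℂ) * T y) - Real.log ε * ∫ y, T y := by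
    rw [← integral_const_mul, ← integral_sub i1 i2]
    congr 1; ext y; push_cast; ring
  rw [truncInt_eq_sub hh i3, e, sub_sub_cancel_left, norm_neg, Real.norm_eq_abs,
    abs_of_pos hε']
  exact hM ε hε'

end Estimates

end

noncomputable section

/-! ### Sharp truncations as limits of weights, and logarithmic expansions. -/

section Expansion

open MeasureTheory Filter Set

variable {d : ℕ}

/-- The function `f (k log (s/ε))` for `s > 0`, extended by zero. -/
def logWeight (f : ℝ → ℝ) (k ε s : ℝ) : ℝ := if 0 < s then f (k * Real.log (s / ε)) else 0

theorem logWeight_of_small {f : ℝ → ℝ} (hv : ∀ t ≤ -1, f t = 0) {k ε : ℝ} (hk : 0 < k)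
    (hε : 0 < ε) {s : ℝ} (hs : s ≤ ε * Real.exp (-(1 / k))) : logWeight f k ε s = 0 := by
  unfold logWeight
  split_ifs with h0
  · apply hv
    have h1 : Real.log (s / ε) ≤ -(1 / k) := by
      rw [Real.log_le_iff_le_exp (by positivity), div_le_iff₀ hε]; linarith
    calc k * Real.log (s / ε) ≤ k * (-(1 / k)) := by gcongr
      _ = -1 := by field_simp
  · rfl

theorem hasDerivAt_logWeight {f : ℝ → ℝ} (hf : Differentiable ℝ f) {k ε : ℝ}
    (hε : 0 < ε) {s : ℝ} (hs : 0 < s) :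
    HasDerivAt (logWeight f k ε) (k * deriv f (k * Real.log (s / ε)) / s) s := by
  have h1 : HasDerivAt (fun s => k * Real.log (s / ε)) (k * (1 / ε / (s / ε))) s :=
    (((hasDerivAt_id s).div_const ε).log (by simp; constructor <;> positivity)).const_mul k
  have h2 := (hf (k * Real.log (s / ε))).hasDerivAt.comp s h1
  have h3 : logWeight f k ε =ᶠ[𝓝 s] f ∘ fun s => k * Real.log (s / ε) := by
    filter_upwards [Ioi_mem_nhds hs] with t ht
    simp only [logWeight, Function.comp]
    rw [if_pos (show 0 < t from ht)]
  refine (h2.congr_of_eventuallyEq h3).congr_deriv ?_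
  field_simp

theorem isWeight_logWeight {f : ℝ → ℝ} (hf : ContDiff ℝ 1 f) (hv : ∀ t ≤ -1, f t = 0)
    {k ε : ℝ} (hk : 0 < k) (hε : 0 < ε) : IsWeight (logWeight f k ε) := by
  refine ⟨contDiff_iff_contDiffAt.mpr fun s => ?_, ε * Real.exp (-(1 / k)), by positivity,
    fun s hs => logWeight_of_small hv hk hε hs⟩
  rcases le_or_gt s 0 with h0 | h0
  · have : logWeight f k ε =ᶠ[𝓝 s] fun _ => 0 := by
      filter_upwards [Iio_mem_nhds (show s < ε * Real.exp (-(1 / k)) by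
        have : 0 < ε * Real.exp (-(1 / k)) := by positivity
        linarith)] with t ht using logWeight_of_small hv hk hε (le_of_lt ht)
    exact contDiffAt_const.congr_of_eventuallyEq this
  · have h3 : logWeight f k ε =ᶠ[𝓝 s] f ∘ fun s => k * Real.log (s / ε) := by
      filter_upwards [Ioi_mem_nhds h0] with t ht
      simp only [logWeight, Function.comp]
      rw [if_pos (show 0 < t from ht)]
    refine ContDiffAt.congr_of_eventuallyEq ?_ h3
    refine hf.contDiffAt.comp s (contDiffAt_const.mul ?_)
    exact (contDiffAt_id.div_const ε).log (by simp; constructor <;> positivity)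

/-- The reason for using the variable `log(s/ε)`: there `s d/ds`, the only derivative produced by
integration by parts, becomes `f ↦ k f'`. -/
theorem deriv_logWeight_mul {f : ℝ → ℝ} (hf : Differentiable ℝ f) {k ε : ℝ}
    (hε : 0 < ε) {s : ℝ} (hs : 0 ≤ s) :
    deriv (logWeight f k ε) s * s = k * logWeight (deriv f) k ε s := by
  rcases hs.eq_or_lt with rfl | hs
  · simp [logWeight]
  · rw [(hasDerivAt_logWeight hf hε hs).deriv, logWeight, if_pos hs]
    field_simp

/-- A smooth function equal to `0` for `t ≤ -1` and to `t` for `t ≥ 0`. -/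
def rampFun (t : ℝ) : ℝ := t * Real.smoothTransition (t + 1)

theorem contDiff_rampFun : ContDiff ℝ ∞ rampFun :=
  contDiff_id.mul (Real.smoothTransition.contDiff.comp (contDiff_id.add contDiff_const))

theorem rampFun_of_le {t : ℝ} (ht : t ≤ -1) : rampFun t = 0 := by
  rw [rampFun, Real.smoothTransition.zero_of_nonpos (by linarith), mul_zero]

theorem rampFun_of_nonneg {t : ℝ} (ht : 0 ≤ t) : rampFun t = t := by
  rw [rampFun, Real.smoothTransition.one_of_one_le (by linarith), mul_one]

theorem abs_rampFun_le (t : ℝ) : |rampFun t| ≤ |t| := by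
  rw [rampFun, abs_mul, abs_of_nonneg (Real.smoothTransition.nonneg _)]
  exact mul_le_of_le_one_right (abs_nonneg t) (Real.smoothTransition.le_one _)

theorem contDiff_deriv_rampFun : ContDiff ℝ ∞ (deriv rampFun) :=
  contDiff_rampFun.deriv'

theorem deriv_rampFun_of_le {t : ℝ} (ht : t ≤ -1) : deriv rampFun t = 0 := by
  have h1 : ∀ t < (-1 : ℝ), deriv rampFun t = 0 := fun t ht => by
    have : rampFun =ᶠ[𝓝 t] fun _ => 0 := by
      filter_upwards [Iio_mem_nhds ht] with s hs using rampFun_of_le (le_of_lt hs)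
    simp [this.deriv_eq]
  rcases ht.eq_or_lt with rfl | ht
  -- At the endpoint the function is not locally zero; the value of the derivative follows by
  -- continuity from the left.
  · have h2 : Tendsto (deriv rampFun) (𝓝[<] (-1)) (𝓝 (deriv rampFun (-1))) :=
      contDiff_deriv_rampFun.continuous.continuousAt.tendsto.mono_left nhdsWithin_le_nhds
    refine tendsto_nhds_unique h2 (tendsto_const_nhds.congr' ?_)
    filter_upwards [self_mem_nhdsWithin] with s hs using (h1 s hs).symm
  · exact h1 t ht

theorem deriv_rampFun_of_nonneg {t : ℝ} (ht : 0 ≤ t) : deriv rampFun t = 1 := by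
  have h1 : ∀ t > (0 : ℝ), deriv rampFun t = 1 := fun t ht => by
    have : rampFun =ᶠ[𝓝 t] id := by
      filter_upwards [Ioi_mem_nhds ht] with s hs using rampFun_of_nonneg (le_of_lt hs)
    simp [this.deriv_eq]
  rcases ht.eq_or_lt with rfl | ht
  · have h2 : Tendsto (deriv rampFun) (𝓝[>] 0) (𝓝 (deriv rampFun 0)) :=
      contDiff_deriv_rampFun.continuous.continuousAt.tendsto.mono_left nhdsWithin_le_nhds
    refine tendsto_nhds_unique h2 (tendsto_const_nhds.congr' ?_)
    filter_upwards [self_mem_nhdsWithin] with s hs using (h1 s hs).symm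
  · exact h1 t ht

theorem exists_bound_deriv_rampFun : ∃ C, ∀ t, |deriv rampFun t| ≤ C := by
  obtain ⟨C, hC⟩ := (isCompact_Icc (a := (-1 : ℝ)) (b := 0)).exists_bound_of_continuousOn
    contDiff_deriv_rampFun.continuous.continuousOn
  refine ⟨max C 1, fun t => ?_⟩
  rcases le_total t (-1) with h | h
  · simp [deriv_rampFun_of_le h]
  rcases le_total 0 t with h' | h'
  · simp [deriv_rampFun_of_nonneg h']
  · exact (hC t ⟨h, h'⟩).trans (le_max_left _ _)

variable {h : Cn (d + 1) → ℝ}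

theorem truncInt_eq_integral (hh : SmoothPos h) (X : Cn (d + 1) → ℂ) (ε : ℝ) :
    truncInt h X ε = ∫ y, ((if ε ≤ dist0 h y then 1 else 0 : ℝ) : ℂ) * X y := by
  rw [truncInt, ← integral_indicator (hh.measurableSet ε)]
  congr 1; ext y
  by_cases hy : ε ≤ dist0 h y <;> simp [indicator, hy]

/-- Dominated convergence for weights vanishing near `0`. -/
theorem tendsto_integral_weight (hh : SmoothPos h) {X : Cn (d + 1) → ℂ} (hX : ContOff X)
    {w : ℕ → ℝ → ℝ} {w' W : ℝ → ℝ} (hw : ∀ k, Measurable (w k))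
    {δ : ℝ} (hδ : 0 < δ) (hv : ∀ k, ∀ s < δ, w k s = 0)
    (hW : ContinuousOn W (Ioi 0)) (hb : ∀ k, ∀ s, δ ≤ s → |w k s| ≤ W s)
    (hlim : ∀ s ≥ 0, Tendsto (fun k => w k s) atTop (𝓝 (w' s))) :
    Tendsto (fun k => ∫ y, (w k (dist0 h y) : ℂ) * X y) atTop
      (𝓝 (∫ y, (w' (dist0 h y) : ℂ) * X y)) := by
  have hWX : ContOff fun y => (W (dist0 h y) : ℂ) * X y :=
    hX.mul_left (Complex.continuous_ofReal.comp_continuousOn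
      (hW.comp hh.continuous_dist0.continuousOn fun y hy => hh.dist0_pos hy))
  refine tendsto_integral_of_dominated_convergence
    ({y | δ ≤ dist0 h y}.indicator fun y => ‖(W (dist0 h y) : ℂ) * X y‖) ?_ ?_ ?_ ?_
  · intro k
    exact (Complex.measurable_ofReal.comp
      ((hw k).comp hh.continuous_dist0.measurable)).aestronglyMeasurable.mul
      hX.aestronglyMeasurable
  · exact (integrable_indicator_iff (hh.measurableSet δ)).mpr (hWX.integrableOn hh hδ).norm
  · intro k
    refine Eventually.of_forall fun y => ?_
    by_cases hy : δ ≤ dist0 h y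
    · rw [indicator_of_mem (by exact hy), norm_mul, norm_mul, Complex.norm_real,
        Complex.norm_real, Real.norm_eq_abs, Real.norm_eq_abs]
      exact mul_le_mul_of_nonneg_right ((hb k _ hy).trans (le_abs_self _)) (norm_nonneg _)
    · rw [indicator_of_notMem (by exact hy), hv k _ (not_le.mp hy)]; simp
  · refine Eventually.of_forall fun y => ?_
    have h0 : 0 ≤ dist0 h y := mul_nonneg (hh.pos y).le (norm_nonneg _)
    exact ((Complex.continuous_ofReal.tendsto _).comp (hlim _ h0)).mul_const _

theorem measurable_logWeight {f : ℝ → ℝ} (hf : Continuous f) (k ε : ℝ) :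
    Measurable (logWeight f k ε) := by
  unfold logWeight
  have := hf.measurable
  exact Measurable.ite measurableSet_Ioi (by fun_prop) measurable_const

theorem logWeight_eq_zero_of_lt {f : ℝ → ℝ} (hv : ∀ t ≤ -1, f t = 0) {k ε : ℝ} (hk : 1 ≤ k)
    (hε : 0 < ε) {s : ℝ} (hs : s < ε * Real.exp (-1)) : logWeight f k ε s = 0 := by
  refine logWeight_of_small hv (by linarith) hε (hs.le.trans ?_)
  gcongr
  rw [div_le_one (by linarith)]
  exact hk

theorem tendsto_logWeight_of_lt {f : ℝ → ℝ} (hv : ∀ t ≤ -1, f t = 0) {ε : ℝ}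
    (hε : 0 < ε) {s : ℝ} (hs : s < ε) :
    ∀ᶠ k : ℕ in atTop, logWeight f (k + 1) ε s = 0 := by
  rcases le_or_gt s 0 with h0 | h0
  · exact Eventually.of_forall fun k => by simp [logWeight, not_lt.mpr h0]
  have h1 : Real.log (s / ε) < 0 := Real.log_neg (by positivity) ((div_lt_one hε).mpr hs)
  have h2 : Tendsto (fun k : ℕ => ((k : ℝ) + 1) * Real.log (s / ε)) atTop atBot :=
    (tendsto_natCast_atTop_atTop.atTop_add tendsto_const_nhds).atTop_mul_const_of_neg h1
  filter_upwards [h2.eventually_le_atBot (-1)] with k hk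
  rw [logWeight, if_pos h0, hv _ hk]

/-- The weights `rampFun'(k log(s/ε))` are `1` for `s ≥ ε` and `0` for `s ≤ ε e^{-1/k}`, hence
converge to the sharp indicator. They are uniformly bounded and vanish for `s < ε/e`, which gives
domination. -/
theorem tendsto_truncInt (hh : SmoothPos h) {X : Cn (d + 1) → ℂ} (hX : ContOff X)
    {ε : ℝ} (hε : 0 < ε) :
    Tendsto (fun k : ℕ => ∫ y, (logWeight (deriv rampFun) (k + 1) ε (dist0 h y) : ℂ) * X y) atTop
      (𝓝 (truncInt h X ε)) := by
  obtain ⟨C, hC⟩ := exists_bound_deriv_rampFun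
  have hC0 : 0 ≤ C := (abs_nonneg _).trans (hC 0)
  rw [truncInt_eq_integral hh]
  refine tendsto_integral_weight hh hX (w := fun k => logWeight (deriv rampFun) (k + 1) ε)
    (w' := fun s => if ε ≤ s then 1 else 0) (W := fun _ => C)
    (fun k => measurable_logWeight contDiff_deriv_rampFun.continuous _ _)
    (δ := ε * Real.exp (-1)) (by positivity)
    (fun k s hs => logWeight_eq_zero_of_lt (fun t ht => deriv_rampFun_of_le ht) (by simp) hε hs)
    continuousOn_const (fun k s _ => ?_) (fun s hs => ?_)
  · unfold logWeight
    split_ifs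
    · exact hC _
    · simpa using hC0
  · by_cases hs' : ε ≤ s
    · simp only [hs', if_true]
      refine tendsto_const_nhds.congr fun k => ?_
      rw [logWeight, if_pos (hε.trans_le hs'), deriv_rampFun_of_nonneg]
      exact mul_nonneg (by positivity) (Real.log_nonneg ((one_le_div hε).mpr hs'))
    · simp only [hs', if_false]
      refine tendsto_const_nhds.congr' ?_
      filter_upwards [tendsto_logWeight_of_lt (fun t ht => deriv_rampFun_of_le ht) hε
        (not_le.mp hs')] with k hk using hk.symm

/-- The primitives, with respect to `log s`, of the weights in `tendsto_truncInt` equal `log(s/ε)`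
exactly for `s ≥ ε`. The bound `|rampFun t| ≤ |t|` dominates them by `|log(s/ε)|`. -/
theorem tendsto_truncInt_log (hh : SmoothPos h) {X : Cn (d + 1) → ℂ} (hX : ContOff X)
    {ε : ℝ} (hε : 0 < ε) :
    Tendsto (fun k : ℕ => ∫ y, (((k : ℝ) + 1)⁻¹ * logWeight rampFun (k + 1) ε (dist0 h y) : ℝ)
        * X y) atTop
      (𝓝 (truncInt h (fun y => ((Real.log (dist0 h y) - Real.log ε : ℝ) : ℂ) * X y) ε)) := by
  rw [truncInt_eq_integral hh]
  have e : ∀ y, ((if ε ≤ dist0 h y then 1 else 0 : ℝ) : ℂ) *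
      (((Real.log (dist0 h y) - Real.log ε : ℝ) : ℂ) * X y)
      = ((if ε ≤ dist0 h y then Real.log (dist0 h y) - Real.log ε else 0 : ℝ) : ℂ) * X y := by
    intro y; split_ifs <;> simp
  simp only [e]
  refine tendsto_integral_weight hh hX
    (w := fun k s => ((k : ℝ) + 1)⁻¹ * logWeight rampFun (k + 1) ε s)
    (w' := fun s => if ε ≤ s then Real.log s - Real.log ε else 0)
    (W := fun s => |Real.log (s / ε)|)
    (fun k => (measurable_logWeight contDiff_rampFun.continuous _ _).const_mul _)
    (δ := ε * Real.exp (-1)) (by positivity)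
    (fun k s hs => by
      rw [logWeight_eq_zero_of_lt (fun t ht => rampFun_of_le ht) (by simp) hε hs, mul_zero])
    ?_ (fun k s hs => ?_) (fun s hs => ?_)
  · refine ((continuousOn_id.div_const ε).log fun s hs => ?_).abs
    have : 0 < s := hs
    simp; constructor <;> positivity
  · have hs' : 0 < s := lt_of_lt_of_le (by positivity) hs
    have hk : (0 : ℝ) < k + 1 := by positivity
    rw [logWeight, if_pos hs', abs_mul, abs_inv, abs_of_pos hk, inv_mul_le_iff₀ hk]
    refine (abs_rampFun_le _).trans_eq ?_
    rw [abs_mul, abs_of_pos hk]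
  · by_cases hs' : ε ≤ s
    · simp only [hs', if_true]
      refine tendsto_const_nhds.congr fun k => ?_
      have hk : (0 : ℝ) < k + 1 := by positivity
      have h0 := hε.trans_le hs'
      rw [logWeight, if_pos h0, rampFun_of_nonneg, Real.log_div h0.ne' hε.ne']
      · field_simp
      · exact mul_nonneg (by positivity) (Real.log_nonneg ((one_le_div hε).mpr hs'))
    · simp only [hs', if_false]
      refine tendsto_const_nhds.congr' ?_
      filter_upwards [tendsto_logWeight_of_lt (fun t ht => rampFun_of_le ht) hε
        (not_le.mp hs')] with k hk
      rw [hk, mul_zero]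

theorem isWeight_step {ε : ℝ} (hε : 0 < ε) (k : ℕ) :
    IsWeight (logWeight (deriv rampFun) (k + 1) ε) :=
  isWeight_logWeight (contDiff_deriv_rampFun.of_le (by simp)) (fun t ht => deriv_rampFun_of_le ht)
    (by positivity) hε

theorem WeightEq.truncInt_eq (hh : SmoothPos h) {X X' : Cn (d + 1) → ℂ} (hX : ContOff X)
    (hX' : ContOff X') (he : WeightEq h X X') {ε : ℝ} (hε : 0 < ε) :
    truncInt h X ε = truncInt h X' ε :=
  tendsto_nhds_unique (tendsto_truncInt hh hX hε)
    ((tendsto_truncInt hh hX' hε).congr fun k => (he _ (isWeight_step hε k)).symm)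

theorem truncInt_add (hh : SmoothPos h) {X X' : Cn (d + 1) → ℂ} (hX : ContOff X)
    (hX' : ContOff X') {ε : ℝ} (hε : 0 < ε) :
    truncInt h (fun y => X y + X' y) ε = truncInt h X ε + truncInt h X' ε :=
  integral_add (hX.integrableOn hh hε) (hX'.integrableOn hh hε)

theorem truncInt_const_mul (X : Cn (d + 1) → ℂ) (c : ℂ) (ε : ℝ) :
    truncInt h (fun y => c * X y) ε = c * truncInt h X ε :=
  integral_const_mul _ _

theorem truncInt_congr (hh : SmoothPos h) {X X' : Cn (d + 1) → ℂ}
    (he : ∀ y, y 0 ≠ 0 → X y = X' y) {ε : ℝ} (hε : 0 < ε) : truncInt h X ε = truncInt h X' ε :=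
  setIntegral_congr_fun (hh.measurableSet ε) fun y hy =>
    he y (ne_zero_of_dist0_pos (hε.trans_le hy))

/-- `F(ε) = A log ε + I + O(ε)` as `ε → 0⁺`. -/
def HasLogExp (F : ℝ → ℂ) (A I : ℂ) : Prop :=
  (fun ε : ℝ => F ε - (A * (Real.log ε : ℂ) + I)) =O[𝓝[>] 0] fun ε : ℝ => ε

namespace HasLogExp

variable {F F' : ℝ → ℂ} {A I A' I' : ℂ}

theorem add (hF : HasLogExp F A I) (hF' : HasLogExp F' A' I') :
    HasLogExp (fun ε => F ε + F' ε) (A + A') (I + I') := by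
  refine (Asymptotics.IsBigO.add hF hF').congr_left fun ε => ?_
  ring

theorem const_mul (hF : HasLogExp F A I) (c : ℂ) :
    HasLogExp (fun ε => c * F ε) (c * A) (c * I) := by
  refine (Asymptotics.IsBigO.const_mul_left hF c).congr_left fun ε => ?_
  ring

theorem congr (hF : HasLogExp F A I) (he : ∀ ε > 0, F ε = F' ε) : HasLogExp F' A I := by
  refine Asymptotics.IsBigO.congr' hF ?_ EventuallyEq.rfl
  filter_upwards [self_mem_nhdsWithin] with ε hε
  rw [he ε hε]

theorem zero : HasLogExp (fun _ => 0) 0 0 := by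
  simpa [HasLogExp] using Asymptotics.isBigO_zero _ _

theorem sum {ι : Type*} (s : Finset ι) {F : ι → ℝ → ℂ} {A I : ι → ℂ}
    (hF : ∀ i ∈ s, HasLogExp (F i) (A i) (I i)) :
    HasLogExp (fun ε => ∑ i ∈ s, F i ε) (∑ i ∈ s, A i) (∑ i ∈ s, I i) := by
  classical
  induction s using Finset.induction_on with
  | empty => simpa using zero
  | insert i s hi ih =>
    simp only [Finset.sum_insert hi]
    exact (hF i (by simp)).add (ih fun j hj => hF j (by simp [hj]))

theorem tendsto (hF : HasLogExp F A I) :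
    Tendsto (fun ε => F ε - (A * (Real.log ε : ℂ) + I)) (𝓝[>] 0) (𝓝 0) :=
  Asymptotics.IsBigO.trans_tendsto hF (tendsto_id.mono_left nhdsWithin_le_nhds)

/-- `log ε` is unbounded while everything else converges. All later identifications of coefficients
compare two expansions of the same function by this lemma. -/
theorem unique (hF : HasLogExp F A I) (hF' : HasLogExp F A' I') : A = A' ∧ I = I' := by
  have h1 : Tendsto (fun ε : ℝ => (A - A') * (Real.log ε : ℂ) + (I - I')) (𝓝[>] 0) (𝓝 0) := by
    have := hF'.tendsto.sub hF.tendsto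
    rw [sub_zero] at this
    refine this.congr fun ε => ?_
    ring
  have hA : A = A' := by
    by_contra hne
    have h2 : Tendsto (fun ε : ℝ => (A - A') * (Real.log ε : ℂ)) (𝓝[>] 0) (𝓝 (-(I - I'))) := by
      have := h1.sub_const (I - I')
      simpa using this
    have h3 : Tendsto (fun ε : ℝ => (Real.log ε : ℂ)) (𝓝[>] 0)
        (𝓝 ((A - A')⁻¹ * -(I - I'))) := by
      refine (h2.const_mul (A - A')⁻¹).congr fun ε => ?_
      rw [← mul_assoc, inv_mul_cancel₀ (sub_ne_zero.mpr hne), one_mul]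
    have h4 : Tendsto (fun ε : ℝ => Real.log ε) (𝓝[>] 0) (𝓝 ((A - A')⁻¹ * -(I - I')).re) :=
      ((Complex.continuous_re.tendsto _).comp h3).congr fun ε => by simp
    exact not_tendsto_nhds_of_tendsto_atBot Real.tendsto_log_nhdsGT_zero _ h4
  subst hA
  refine ⟨rfl, ?_⟩
  have : Tendsto (fun _ : ℝ => I - I') (𝓝[>] 0) (𝓝 0) := by simpa using h1
  exact sub_eq_zero.mp (tendsto_nhds_unique tendsto_const_nhds this)

end HasLogExp

theorem IsMild.hasLogExp (hh : SmoothPos h) {T : Cn (d + 1) → ℂ} (hT : IsMild T) :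
    HasLogExp (_root_.truncInt h T) 0 (∫ y, T y) := by
  simpa [HasLogExp] using hT.truncInt hh

/-- The expansion for the singularity `|z₀|^{-2}`. -/
theorem hasLogExp_simple (hh : SmoothPos h) {G : Cn (d + 1) → ℂ} (hG : IsTest G) :
    HasLogExp (truncInt h fun y => G y * mono (-1) (-1) y)
      (2 * ∫ y, wirt (-Complex.I) 0 G y * mono 0 (-1) y)
      (-2 * (∫ y, (Real.log (dist0 h y) : ℂ) * (wirt (-Complex.I) 0 G y * mono 0 (-1) y))
        - 2 * ∫ y, (dlog (-Complex.I) 0 h y * G y) * mono 0 (-1) y) := by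
  have hqG : IsTest fun y => dlog (-Complex.I) 0 h y * G y := hG.mul_left hh.contDiff_dlog
  have m1 : IsMild fun y => wirt (-Complex.I) 0 G y * mono 0 (-1) y :=
    (hG.wirt).isMild (by norm_num)
  have m2 : IsMild fun y => (dlog (-Complex.I) 0 h y * G y) * mono 0 (-1) y :=
    hqG.isMild (by norm_num)
  -- Integrate by parts the function `G z̄₀^{-1}` against the weight approximating `log(s/ε)`.
  -- Differentiating the weight gives the approximate indicator times `∂ log h/∂z₀ + z₀^{-1}/2`; the
  -- one half explains the factors `2`. The identity is exact for each `k` and then passes to the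
  -- limit.
  have key : ∀ ε > 0, truncInt h (fun y => G y * mono (-1) (-1) y) ε
      = -2 * truncInt h (fun y => ((Real.log (dist0 h y) - Real.log ε : ℝ) : ℂ) *
          (wirt (-Complex.I) 0 G y * mono 0 (-1) y)) ε
        - 2 * truncInt h (fun y => (dlog (-Complex.I) 0 h y * G y) * mono 0 (-1) y) ε := by
    intro ε hε
    have t1 := tendsto_truncInt hh (hG.smoothOff (-1) (-1)).contOff hε
    have t2 := tendsto_truncInt_log hh m1.contOff hε
    have t3 := tendsto_truncInt hh m2.contOff hε
    refine tendsto_nhds_unique t1 (((t2.const_mul (-2)).sub (t3.const_mul 2)).congr fun k => ?_)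
    have hk : (0 : ℝ) < k + 1 := by positivity
    have hw : IsWeight (logWeight rampFun (k + 1) ε) :=
      isWeight_logWeight (contDiff_rampFun.of_le (by simp)) (fun t ht => rampFun_of_le ht) hk hε
    have hs := isWeight_step hε k
    have e := integral_weight_mul_wirt hh (c := -Complex.I) (j := 0) hw (hG.smoothOff 0 (-1))
    have e1 : ∫ y, (((k : ℝ) + 1)⁻¹ * logWeight rampFun (k + 1) ε (dist0 h y) : ℝ)
          * (wirt (-Complex.I) 0 G y * mono 0 (-1) y)
        = ((k : ℂ) + 1)⁻¹ * ∫ y, (logWeight rampFun (k + 1) ε (dist0 h y) : ℂ)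
          * wirt (-Complex.I) 0 (fun y => G y * mono 0 (-1) y) y := by
      have e2 := hw.congr_integral (h := h) (X := fun y => wirt (-Complex.I) 0 G y * mono 0 (-1) y)
        (X' := wirt (-Complex.I) 0 (fun y => G y * mono 0 (-1) y)) fun y hy => by
          rw [dz_test_mul_mono hG 0 (-1) hy]; simp
      rw [← e2, ← integral_const_mul]
      congr 1; ext y; push_cast; ring
    have i1 := (hG.smoothOff (-1) (-1)).contOff.integrable_weight_mul hh hs.smooth.continuous
      hs.vanish
    have i2 := m2.contOff.integrable_weight_mul hh hs.smooth.continuous hs.vanish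
    have e3 : ∫ y, (deriv (logWeight rampFun (k + 1) ε) (dist0 h y) * dist0 h y : ℝ)
          * (slope0 (-Complex.I) 0 h y * (G y * mono 0 (-1) y))
        = ((k : ℂ) + 1) * ((∫ y, (logWeight (deriv rampFun) (k + 1) ε (dist0 h y) : ℂ)
            * ((dlog (-Complex.I) 0 h y * G y) * mono 0 (-1) y)) +
          2⁻¹ * ∫ y, (logWeight (deriv rampFun) (k + 1) ε (dist0 h y) : ℂ)
            * (G y * mono (-1) (-1) y)) := by
      rw [← integral_const_mul, ← integral_add i2 (i1.const_mul _), ← integral_const_mul]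
      congr 1; ext y
      rw [deriv_logWeight_mul (contDiff_rampFun.differentiable (by simp)) hε
        (show 0 ≤ dist0 h y from mul_nonneg (hh.pos y).le (norm_nonneg _)), slope0_dz]
      simp only [mono, zpow_neg_one, zpow_zero, one_mul]
      push_cast
      ring
    have hk' : ((k : ℂ) + 1) ≠ 0 := by exact_mod_cast hk.ne'
    rw [e1, e, e3]
    field_simp
    ring
  have f1 : HasLogExp (truncInt h fun y => (dlog (-Complex.I) 0 h y * G y) * mono 0 (-1) y) 0 _ :=
    m2.hasLogExp hh
  have f2 : HasLogExp (fun ε => truncInt h (fun y => ((Real.log (dist0 h y) - Real.log ε : ℝ) : ℂ)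
      * (wirt (-Complex.I) 0 G y * mono 0 (-1) y)) ε)
      (-∫ y, wirt (-Complex.I) 0 G y * mono 0 (-1) y)
      (∫ y, (Real.log (dist0 h y) : ℂ) * (wirt (-Complex.I) 0 G y * mono 0 (-1) y)) := by
    refine (m1.truncInt_log hh).congr_left fun ε => ?_
    ring
  have f3 := ((f2.const_mul (-2)).add (f1.const_mul (-2))).congr
    (F' := truncInt h fun y => G y * mono (-1) (-1) y) fun ε hε => by
      rw [key ε hε]; ring
  convert! f3 using 1 <;> ring

/-- Every pole `z₀^a z̄₀^b`, `b ≥ -1`, has a logarithmic expansion. -/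
theorem exists_hasLogExp (hh : SmoothPos h) {a b : ℤ} (hb : -1 ≤ b) {G : Cn (d + 1) → ℂ}
    (hG : IsTest G) : ∃ A I, HasLogExp (truncInt h fun y => G y * mono a b y) A I := by
  obtain ⟨G₀, T, tG, mT, he⟩ := exists_weightEq_mild hh (a + b + 1).natAbs a b hb (by omega) G hG
  refine ⟨_, _, ((hasLogExp_simple hh tG).add (mT.hasLogExp hh)).congr fun ε hε => ?_⟩
  have h1 := (tG.smoothOff (-1) (-1)).contOff
  rw [he.truncInt_eq hh (hG.smoothOff a b).contOff (h1.add mT.contOff) hε,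
    truncInt_add hh h1 mT.contOff hε]

end Expansion

end

noncomputable section

/-! ### The logarithmic coefficient, and the dependence of the finite part on `h`. -/

section LogCoefficient

open MeasureTheory Filter Set

variable {d : ℕ} {h : Cn (d + 1) → ℝ}

/-- The layer-cake identity `κ(τ) = ∫₀¹ κ'(t) 1_{t ≤ τ} dt`. -/
theorem integral_deriv_indicator {κ : ℝ → ℝ} (hκ : ContDiff ℝ 1 κ) (h0 : ∀ t ≤ 0, κ t = 0)
    (h1 : ∀ t ≥ 1, κ t = κ 1) (τ : ℝ) :
    ∫ t in Ioc (0 : ℝ) 1, (if t ≤ τ then deriv κ t else 0) = κ τ := by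
  have e : ∀ t, (if t ≤ τ then deriv κ t else 0) = (Iic τ).indicator (deriv κ) t := by
    intro t; simp [indicator]
  simp only [e]
  rw [setIntegral_indicator measurableSet_Iic, Ioc_inter_Iic]
  have ftc : ∀ a b : ℝ, a ≤ b → ∫ t in Ioc a b, deriv κ t = κ b - κ a := by
    intro a b hab
    rw [← intervalIntegral.integral_of_le hab, intervalIntegral.integral_deriv_eq_sub
      (fun t _ => hκ.differentiable one_ne_zero t)
      ((hκ.continuous_deriv le_rfl).intervalIntegrable _ _)]
  rcases le_total τ 0 with hτ | hτ
  · rw [Ioc_eq_empty (by simp [hτ]), h0 τ hτ]; simp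
  · rw [ftc 0 _ (le_min zero_le_one hτ), h0 0 le_rfl, sub_zero]
    rcases le_total 1 τ with h2 | h2
    · rw [min_eq_left h2, h1 τ h2]
    · rw [min_eq_right h2]

/-- As `t > 0`, every layer lies inside `{ε ≤ h|z₀|}`, where `X` is integrable; this is the
hypothesis for Fubini in the layer-cake formula. -/
theorem integrable_layers (hh : SmoothPos h) {X : Cn (d + 1) → ℂ} (hX : ContOff X)
    {k : ℝ → ℝ} (hk : Continuous k) {ε : ℝ} (hε : 0 < ε) :
    Integrable (fun p : Cn (d + 1) × ℝ =>
      ((if ε * Real.exp p.2 ≤ dist0 h p.1 then k p.2 else 0 : ℝ) : ℂ) * X p.1)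
      (volume.prod (volume.restrict (Ioc 0 1))) := by
  obtain ⟨C, hC⟩ := (isCompact_Icc (a := (0 : ℝ)) (b := 1)).exists_bound_of_continuousOn
    hk.continuousOn
  have i1 : Integrable ({y | ε ≤ dist0 h y}.indicator X) :=
    (integrable_indicator_iff (hh.measurableSet ε)).mpr (hX.integrableOn hh hε)
  have i2 : Integrable (fun _ : ℝ => C) (volume.restrict (Ioc (0 : ℝ) 1)) := integrable_const _
  have hm : MeasurableSet {p : Cn (d + 1) × ℝ | ε * Real.exp p.2 ≤ dist0 h p.1} := by
    have := hh.continuous_dist0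
    exact (isClosed_le (by fun_prop) (by fun_prop)).measurableSet
  refine (i1.norm.mul_prod i2).mono' ?_ ?_
  · refine AEStronglyMeasurable.mul ?_ hX.aestronglyMeasurable.comp_fst
    have := hk.measurable
    exact (Complex.measurable_ofReal.comp
      (Measurable.ite hm (by fun_prop) measurable_const)).aestronglyMeasurable
  · have h2 : ∀ᵐ p ∂((volume : Measure (Cn (d + 1))).prod (volume.restrict (Ioc (0 : ℝ) 1))),
        p.2 ∈ Ioc (0 : ℝ) 1 :=
      Measure.quasiMeasurePreserving_snd.ae (ae_restrict_mem measurableSet_Ioc)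
    filter_upwards [h2] with p hp
    split_ifs with hle
    · have : ε ≤ dist0 h p.1 := by
        refine le_trans ?_ hle
        exact le_mul_of_one_le_right hε.le (Real.one_le_exp hp.1.le)
      rw [indicator_of_mem (by exact this), norm_mul, Complex.norm_real, mul_comm]
      exact mul_le_mul_of_nonneg_left (hC _ (Ioc_subset_Icc_self hp)) (norm_nonneg _)
    · simp only [Complex.ofReal_zero, zero_mul, norm_zero]
      exact mul_nonneg (norm_nonneg _) ((norm_nonneg _).trans (hC 0 (by simp)))

/-- The layer-cake identity at `τ = log(h|z₀|/ε)`: a smooth truncation is an average of the sharp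
truncations at the levels `ε e^t`, so expansions can be averaged too. -/
theorem integral_logWeight_eq (hh : SmoothPos h) {X : Cn (d + 1) → ℂ} (hX : ContOff X)
    {κ : ℝ → ℝ} (hκ : ContDiff ℝ 1 κ) (h0 : ∀ t ≤ 0, κ t = 0) (h1 : ∀ t ≥ 1, κ t = κ 1)
    {ε : ℝ} (hε : 0 < ε) :
    IntegrableOn (fun t => ((deriv κ t : ℝ) : ℂ) * truncInt h X (ε * Real.exp t)) (Ioc 0 1) ∧
    ∫ y, (logWeight κ 1 ε (dist0 h y) : ℂ) * X y
      = ∫ t in Ioc (0 : ℝ) 1, ((deriv κ t : ℝ) : ℂ) * truncInt h X (ε * Real.exp t) := by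
  have hi := integrable_layers hh hX (hκ.continuous_deriv le_rfl) hε
  have e1 : ∀ t, ∫ y, ((if ε * Real.exp t ≤ dist0 h y then deriv κ t else 0 : ℝ) : ℂ) * X y
      = ((deriv κ t : ℝ) : ℂ) * truncInt h X (ε * Real.exp t) := by
    intro t
    rw [truncInt_eq_integral hh, ← integral_const_mul]
    congr 1; ext y
    split_ifs <;> simp
  have e2 : ∀ y, y 0 ≠ 0 → ∫ t in Ioc (0 : ℝ) 1,
      ((if ε * Real.exp t ≤ dist0 h y then deriv κ t else 0 : ℝ) : ℂ) * X y
      = (logWeight κ 1 ε (dist0 h y) : ℂ) * X y := by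
    intro y hy
    have hp := hh.dist0_pos hy
    rw [integral_mul_const, integral_complex_ofReal, logWeight, if_pos hp,
      ← integral_deriv_indicator hκ h0 h1, one_mul]
    congr 3; ext t
    have : ε * Real.exp t ≤ dist0 h y ↔ t ≤ Real.log (dist0 h y / ε) := by
      rw [Real.le_log_iff_exp_le (by positivity), le_div_iff₀ hε, mul_comm]
    simp [this]
  constructor
  · have := hi.integral_prod_right
    simp only [e1] at this
    exact this
  · have := integral_integral_swap (f := fun y t =>
      ((if ε * Real.exp t ≤ dist0 h y then deriv κ t else 0 : ℝ) : ℂ) * X y) hi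
    simp only [e1] at this
    rw [← this]
    refine integral_congr_ae ?_
    filter_upwards [ae_off] with y hy using (e2 y hy).symm

/-- The expansion of a smoothed truncation. -/
theorem HasLogExp.smoothed (hh : SmoothPos h) {X : Cn (d + 1) → ℂ} (hX : ContOff X)
    {κ : ℝ → ℝ} (hκ : ContDiff ℝ 1 κ) (h0 : ∀ t ≤ 0, κ t = 0) (h1 : ∀ t ≥ 1, κ t = κ 1)
    {A I : ℂ} (hF : HasLogExp (truncInt h X) A I) :
    HasLogExp (fun ε => ∫ y, (logWeight κ 1 ε (dist0 h y) : ℂ) * X y) (A * κ 1)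
      (I * κ 1 + A * ((∫ t in Ioc (0 : ℝ) 1, deriv κ t * t : ℝ) : ℂ)) := by
  obtain ⟨C, hC⟩ := (isCompact_Icc (a := (0 : ℝ)) (b := 1)).exists_bound_of_continuousOn
    (hκ.continuous_deriv le_rfl).continuousOn
  have hC0 : 0 ≤ C := (norm_nonneg _).trans (hC 0 (by simp))
  obtain ⟨M, hM⟩ := hF.bound
  rw [eventually_nhdsWithin_iff, Metric.eventually_nhds_iff] at hM
  obtain ⟨r, hr, hM⟩ := hM
  have hdc : Continuous fun t => ((deriv κ t : ℝ) : ℂ) :=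
    Complex.continuous_ofReal.comp (hκ.continuous_deriv le_rfl)
  refine Asymptotics.IsBigO.of_bound (C * (|M| * Real.exp 1)) ?_
  -- All levels `ε e^t` with `t ≤ 1` must stay below the radius `r` on which the error bound is
  -- known.
  have hr' : 0 < r / Real.exp 1 := by positivity
  filter_upwards [self_mem_nhdsWithin, nhdsWithin_le_nhds (Iio_mem_nhds hr')] with ε hε hεr
  have hε' : 0 < ε := hε
  obtain ⟨i1, e1⟩ := integral_logWeight_eq hh hX hκ h0 h1 hε'
  have i2 : IntegrableOn (fun t : ℝ => ((deriv κ t : ℝ) : ℂ) *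
      (A * (Real.log (ε * Real.exp t) : ℂ) + I)) (Ioc 0 1) := by
    have : ∀ t, Real.log (ε * Real.exp t) = Real.log ε + t := fun t => by
      rw [Real.log_mul hε'.ne' (Real.exp_pos t).ne', Real.log_exp]
    simp only [this]
    have hc : Continuous fun t : ℝ => ((deriv κ t : ℝ) : ℂ) *
      (A * ((Real.log ε + t : ℝ) : ℂ) + I) := by fun_prop
    exact (hc.integrableOn_Icc).mono_set Ioc_subset_Icc_self
  -- Averaging `A (log ε + t) + I` against `κ'(t) dt` leaves the extra constant `A ∫ t κ'(t) dt`.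
  have e2 : ∫ t in Ioc (0 : ℝ) 1, ((deriv κ t : ℝ) : ℂ) * (A * (Real.log (ε * Real.exp t) : ℂ) + I)
      = (A * κ 1) * Real.log ε
        + (I * κ 1 + A * ((∫ t in Ioc (0 : ℝ) 1, deriv κ t * t : ℝ) : ℂ)) := by
    have j1 : IntegrableOn (fun t : ℝ => ((deriv κ t : ℝ) : ℂ)) (Ioc 0 1) :=
      (hdc.integrableOn_Icc).mono_set Ioc_subset_Icc_self
    have j2 : IntegrableOn (fun t : ℝ => ((deriv κ t * t : ℝ) : ℂ)) (Ioc 0 1) := by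
      have hc : Continuous fun t : ℝ => ((deriv κ t * t : ℝ) : ℂ) := by
        push_cast; fun_prop
      exact (hc.integrableOn_Icc).mono_set Ioc_subset_Icc_self
    have e3 : ∫ t in Ioc (0 : ℝ) 1, ((deriv κ t : ℝ) : ℂ) = κ 1 := by
      rw [integral_complex_ofReal, ← integral_deriv_indicator hκ h0 h1 1]
      congr 1
      refine setIntegral_congr_fun measurableSet_Ioc fun t ht => ?_
      simp [ht.2]
    rw [← integral_complex_ofReal]
    have e4 : ∀ t : ℝ, ((deriv κ t : ℝ) : ℂ) * (A * (Real.log (ε * Real.exp t) : ℂ) + I)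
        = (A * Real.log ε + I) * deriv κ t + A * ((deriv κ t * t : ℝ) : ℂ) := fun t => by
      rw [Real.log_mul hε'.ne' (Real.exp_pos t).ne', Real.log_exp]
      push_cast; ring
    simp only [e4]
    rw [integral_add (j1.const_mul _) (j2.const_mul _), integral_const_mul, integral_const_mul, e3]
    ring
  rw [e1, ← e2, ← integral_sub i1 i2, Real.norm_eq_abs, abs_of_pos hε']
  calc ‖∫ t in Ioc (0 : ℝ) 1, (((deriv κ t : ℝ) : ℂ) * truncInt h X (ε * Real.exp t) -
        ((deriv κ t : ℝ) : ℂ) * (A * (Real.log (ε * Real.exp t) : ℂ) + I))‖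
      ≤ C * (|M| * Real.exp 1 * ε) * (volume : Measure ℝ).real (Ioc 0 1) := by
        refine norm_setIntegral_le_of_norm_le_const (by simp) fun t ht => ?_
        rw [← mul_sub, norm_mul]
        have ht1 : Real.exp t ≤ Real.exp 1 := Real.exp_le_exp.mpr ht.2
        have hpos : 0 < ε * Real.exp t := by positivity
        have hlt : ε * Real.exp t < r := by
          calc ε * Real.exp t ≤ ε * Real.exp 1 := by gcongr
            _ < r := by rwa [← lt_div_iff₀ (Real.exp_pos 1)]
        have hb := hM (y := ε * Real.exp t) (by simpa [abs_of_pos hpos, abs_of_pos hε'] using hlt) hpos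
        rw [Real.norm_eq_abs, abs_of_pos hpos] at hb
        have hb2 : ‖truncInt h X (ε * Real.exp t) - (A * (Real.log (ε * Real.exp t) : ℂ) + I)‖
            ≤ |M| * Real.exp 1 * ε := by
          refine hb.trans ?_
          calc M * (ε * Real.exp t) ≤ |M| * (ε * Real.exp 1) := by
                gcongr
                exact le_abs_self M
            _ = |M| * Real.exp 1 * ε := by ring
        refine mul_le_mul ?_ hb2 (norm_nonneg _) hC0
        simpa using hC t (Ioc_subset_Icc_self ht)
    _ = C * (|M| * Real.exp 1) * ε := by simp; ring

theorem deriv_smoothTransition_of_le {t : ℝ} (ht : t ≤ 0) : deriv Real.smoothTransition t = 0 := by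
  have h1 : ∀ t < (0 : ℝ), deriv Real.smoothTransition t = 0 := fun t ht => by
    have : Real.smoothTransition =ᶠ[𝓝 t] fun _ => 0 := by
      filter_upwards [Iio_mem_nhds ht] with s hs
        using Real.smoothTransition.zero_of_nonpos (le_of_lt hs)
    simp [this.deriv_eq]
  rcases ht.eq_or_lt with rfl | ht
  · have hc : ContDiff ℝ ∞ (deriv Real.smoothTransition) :=
      (show ContDiff ℝ ∞ _ from Real.smoothTransition.contDiff (n := ⊤)).deriv'
    have h2 : Tendsto (deriv Real.smoothTransition) (𝓝[<] 0) (𝓝 (deriv Real.smoothTransition 0)) :=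
      hc.continuous.continuousAt.tendsto.mono_left nhdsWithin_le_nhds
    refine tendsto_nhds_unique h2 (tendsto_const_nhds.congr' ?_)
    filter_upwards [self_mem_nhdsWithin] with s hs using (h1 s hs).symm
  · exact h1 t ht

theorem deriv_smoothTransition_of_ge {t : ℝ} (ht : 1 ≤ t) : deriv Real.smoothTransition t = 0 := by
  have h1 : ∀ t > (1 : ℝ), deriv Real.smoothTransition t = 0 := fun t ht => by
    have : Real.smoothTransition =ᶠ[𝓝 t] fun _ => 1 := by
      filter_upwards [Ioi_mem_nhds ht] with s hs
        using Real.smoothTransition.one_of_one_le (le_of_lt hs)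
    simp [this.deriv_eq]
  rcases ht.eq_or_lt with rfl | ht
  · have hc : ContDiff ℝ ∞ (deriv Real.smoothTransition) :=
      (show ContDiff ℝ ∞ _ from Real.smoothTransition.contDiff (n := ⊤)).deriv'
    have h2 : Tendsto (deriv Real.smoothTransition) (𝓝[>] 1) (𝓝 (deriv Real.smoothTransition 1)) :=
      hc.continuous.continuousAt.tendsto.mono_left nhdsWithin_le_nhds
    refine tendsto_nhds_unique h2 (tendsto_const_nhds.congr' ?_)
    filter_upwards [self_mem_nhdsWithin] with s hs using (h1 s hs).symm
  · exact h1 t ht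

/-- A derivative `∂P/∂z_j` has no logarithmic term; its finite part is the logarithmic coefficient
of `P ∂ log (h|z₀|)/∂z_j`. -/
theorem HasLogExp.of_wirt (hh : SmoothPos h) {c : ℂ} {j : Fin (d + 1)} {P : Cn (d + 1) → ℂ}
    (hP : SmoothOff P) {A I B J : ℂ} (h1 : HasLogExp (truncInt h (wirt c j P)) A I)
    (h2 : HasLogExp (truncInt h fun y => slope0 c j h y * P y) B J) :
    HasLogExp (truncInt h (wirt c j P)) 0 B := by
  have hs : ContDiff ℝ ∞ Real.smoothTransition := Real.smoothTransition.contDiff (n := ⊤)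
  have hs' : ContDiff ℝ ∞ (deriv Real.smoothTransition) := hs.deriv'
  have hs'' : ContDiff ℝ ∞ (deriv (deriv Real.smoothTransition)) := hs'.deriv'
  -- Write `κ` for the smooth transition. Integration by parts says that smoothing `∂P` by `κ` is
  -- minus smoothing `P ∂ log(h|z₀|)` by `κ'`. The former has logarithmic coefficient `A`, the
  -- latter none because `κ'(1) = 0`; so `A = 0`. Then `∫₀¹ t κ''(t) dt = -1` gives `I = B`.
  have e1 := h1.smoothed hh hP.wirt.contOff (hs.of_le (by simp))
    (fun t ht => Real.smoothTransition.zero_of_nonpos ht)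
    (fun t ht => by rw [Real.smoothTransition.one_of_one_le ht, Real.smoothTransition.one])
  have e2 := h2.smoothed hh (hP.mul_left fun y hy => contDiffAt_slope0 hh hy).contOff
    (hs'.of_le (by simp))
    (fun t ht => deriv_smoothTransition_of_le ht)
    (fun t ht => by rw [deriv_smoothTransition_of_ge ht, deriv_smoothTransition_of_ge le_rfl])
  have e3 : ∫ t in Ioc (0 : ℝ) 1, deriv (deriv Real.smoothTransition) t * t = -1 := by
    rw [← intervalIntegral.integral_of_le zero_le_one]
    have := intervalIntegral.integral_deriv_mul_eq_sub (a := (0 : ℝ)) (b := 1)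
      (u := deriv Real.smoothTransition) (u' := deriv (deriv Real.smoothTransition))
      (v := fun t => t) (v' := fun _ => 1)
      (fun t _ => (hs'.differentiable (by simp) t).hasDerivAt) (fun t _ => hasDerivAt_id t)
      (hs''.continuous.intervalIntegrable _ _) (by simp)
    have hi : ∀ f : ℝ → ℝ, Continuous f → IntervalIntegrable f volume 0 1 :=
      fun f hf => hf.intervalIntegrable _ _
    have hc1 := hs'.continuous
    have hc2 := hs''.continuous
    rw [intervalIntegral.integral_add (hi _ (by fun_prop)) (hi _ (by fun_prop))] at this
    simp only [mul_one, deriv_smoothTransition_of_ge le_rfl, mul_zero, sub_zero] at this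
    rw [intervalIntegral.integral_deriv_eq_sub (fun t _ => hs.differentiable (by simp) t)
      (hi _ hc1), Real.smoothTransition.one, Real.smoothTransition.zero] at this
    linarith
  rw [e3, deriv_smoothTransition_of_ge le_rfl] at e2
  rw [Real.smoothTransition.one] at e1
  have e4 := (e2.const_mul (-1)).congr
    (F' := fun ε => ∫ y, (logWeight Real.smoothTransition 1 ε (dist0 h y) : ℂ) * wirt c j P y)
    fun ε hε => by
      rw [integral_weight_mul_wirt hh (isWeight_logWeight (hs.of_le (by simp))
        (fun t ht => Real.smoothTransition.zero_of_nonpos (by linarith)) one_pos hε) hP,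
        neg_one_mul]
      congr 2; ext y
      rw [deriv_logWeight_mul (hs.differentiable (by simp)) hε
        (show 0 ≤ dist0 h y from mul_nonneg (hh.pos y).le (norm_nonneg _)), one_mul]
  obtain ⟨u1, u2⟩ := e1.unique e4
  simp only [Complex.ofReal_one, mul_one, Complex.ofReal_zero, mul_zero, zero_add,
    Complex.ofReal_neg, mul_neg, neg_mul, one_mul, neg_neg] at u1 u2
  have hA : A = 0 := u1
  have hI : I = B := by rw [hA] at u2; simpa using u2
  rw [← hA, ← hI]
  exact h1

/-- The coefficient of the logarithm for the singularity `G z₀^{-m} z̄₀^{-1}`. -/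
def logCoef : ℕ → (Cn (d + 1) → ℂ) → ℂ
  | 0, _ => 0
  | 1, G => 2 * ∫ y, wirt (-Complex.I) 0 G y * mono 0 (-1) y
  | m + 2, G => logCoef (m + 1) fun y => ((m : ℂ) + 1)⁻¹ * wirt (-Complex.I) 0 G y

theorem mono_neg_succ (k : ℕ) {y : Cn (d + 1)} (hy : y 0 ≠ 0) :
    y 0 * mono (-((k + 1 : ℕ) : ℤ)) (-1) y = mono (-(k : ℤ)) (-1) y := by
  rw [← mono_add_one_left _ _ hy]
  congr 1; push_cast; ring

theorem isTest_coord_mul {G : Cn (d + 1) → ℂ} (hG : IsTest G) : IsTest fun y => y 0 * G y :=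
  hG.mul_left (by fun_prop)

/-- The numerator of `∂ log(h|z₀|)/∂z_j · Q z₀^{-k} z̄₀^{-1}` over `z₀^{k+1} z̄₀`. -/
def slopeNum (h : Cn (d + 1) → ℝ) (j : Fin (d + 1)) (Q : Cn (d + 1) → ℂ) (y : Cn (d + 1)) : ℂ :=
  y 0 * (dlog (-Complex.I) j h y * Q y) + (if j = 0 then 2⁻¹ else 0) * Q y

theorem isTest_slopeNum (hh : SmoothPos h) (j : Fin (d + 1)) {Q : Cn (d + 1) → ℂ}
    (hQ : IsTest Q) : IsTest (slopeNum h j Q) :=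
  (isTest_coord_mul (hQ.mul_left hh.contDiff_dlog)).add (hQ.const_mul _)

theorem slope0_mul_eq (h : Cn (d + 1) → ℝ) (j : Fin (d + 1)) (Q : Cn (d + 1) → ℂ) (k : ℕ)
    {y : Cn (d + 1)} (hy : y 0 ≠ 0) :
    slope0 (-Complex.I) j h y * (Q y * mono (-(k : ℤ)) (-1) y)
      = slopeNum h j Q y * mono (-((k + 1 : ℕ) : ℤ)) (-1) y := by
  rw [← mono_neg_succ k hy]
  by_cases hj : j = 0
  · subst hj
    rw [slope0_dz, slopeNum, if_pos rfl]
    field_simp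
  · simp only [slope0, slopeNum, if_neg hj]
    ring

/-- For `P = Q z₀^{-k} z̄₀^{-1}` both `∂P/∂z_j` and `P ∂ log(h|z₀|)/∂z_j` can be written over
`z₀^{k+1} z̄₀` with smooth numerators, so both have expansions and `HasLogExp.of_wirt` applies. -/
theorem exists_hasLogExp_dz (hh : SmoothPos h) (k : ℕ) (j : Fin (d + 1)) {Q : Cn (d + 1) → ℂ}
    (hQ : IsTest Q) :
    ∃ B J, HasLogExp (truncInt h (wirt (-Complex.I) j fun y => Q y * mono (-(k : ℤ)) (-1) y)) 0 B ∧
      HasLogExp (truncInt h fun y => slopeNum h j Q y * mono (-((k + 1 : ℕ) : ℤ)) (-1) y) B J := by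
  have hS : IsTest fun y => y 0 * wirt (-Complex.I) j Q y +
      (if j = 0 then -(k : ℂ) else 0) * Q y :=
    (isTest_coord_mul hQ.wirt).add (hQ.const_mul _)
  obtain ⟨A, I, hA⟩ := exists_hasLogExp hh (a := -((k + 1 : ℕ) : ℤ)) le_rfl hS
  obtain ⟨B, J, hB⟩ := exists_hasLogExp hh (a := -((k + 1 : ℕ) : ℤ)) le_rfl
    (isTest_slopeNum hh j hQ)
  refine ⟨B, J, ?_, hB⟩
  refine HasLogExp.of_wirt (A := A) (I := I) (J := J) hh (hQ.smoothOff _ _) (hA.congr fun ε hε => ?_)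
    (hB.congr fun ε hε => ?_)
  · refine truncInt_congr hh (fun y hy => ?_) hε
    rw [dz_test_mul_mono hQ _ _ hy, ← mono_neg_succ k hy]
    by_cases hj : j = 0
    · simp only [if_pos hj]
      rw [show -(k : ℤ) - 1 = -((k + 1 : ℕ) : ℤ) by push_cast; ring]
      push_cast; ring
    · simp only [if_neg hj]; ring
  · exact truncInt_congr hh (fun y hy => (slope0_mul_eq h j Q k hy).symm) hε

/-- The product rule for `∂/∂z₀` on `G z₀^{-(m+1)} z̄₀^{-1}`, solved for the highest pole; off the
hyperplane `z̄₀^{-1}` is a constant for `∂/∂z₀`. -/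
theorem truncInt_pole_succ (hh : SmoothPos h) (m : ℕ) {G : Cn (d + 1) → ℂ} (hG : IsTest G)
    {ε : ℝ} (hε : 0 < ε) :
    truncInt h (fun y => (((m : ℂ) + 1)⁻¹ * wirt (-Complex.I) 0 G y)
        * mono (-((m + 1 : ℕ) : ℤ)) (-1) y) ε
      + -((m : ℂ) + 1)⁻¹ * truncInt h (wirt (-Complex.I) 0
        fun y => G y * mono (-((m + 1 : ℕ) : ℤ)) (-1) y) ε
      = truncInt h (fun y => G y * mono (-((m + 2 : ℕ) : ℤ)) (-1) y) ε := by
  have c1 := ((hG.wirt (c := -Complex.I) (j := 0)).const_mul ((m : ℂ) + 1)⁻¹).smoothOff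
    (-((m + 1 : ℕ) : ℤ)) (-1) |>.contOff
  have c2 := (hG.smoothOff (-((m + 1 : ℕ) : ℤ)) (-1)).wirt (c := -Complex.I) (j := 0) |>.contOff
  rw [← truncInt_const_mul, ← truncInt_add hh c1 (c2.const_mul _) hε]
  refine truncInt_congr hh (fun y hy => ?_) hε
  rw [dz_test_mul_mono hG _ _ hy, if_pos rfl,
    show -((m + 1 : ℕ) : ℤ) - 1 = -((m + 2 : ℕ) : ℤ) by push_cast; ring]
  have : (m : ℂ) + 1 ≠ 0 := by exact_mod_cast m.succ_ne_zero
  push_cast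
  field_simp
  ring

/-- The logarithmic coefficient does not depend on `h`. -/
theorem hasLogExp_logCoef (m : ℕ) : ∀ {h : Cn (d + 1) → ℝ}, SmoothPos h →
    ∀ {G : Cn (d + 1) → ℂ}, IsTest G →
    ∃ I, HasLogExp (truncInt h fun y => G y * mono (-(m : ℤ)) (-1) y) (logCoef m G) I := by
  induction m using Nat.strong_induction_on with
  | _ m ih =>
    intro h hh G hG
    match m, ih with
    | 0, _ => exact ⟨_, (hG.isMild (by norm_num)).hasLogExp hh⟩
    | 1, _ => exact ⟨_, hasLogExp_simple hh hG⟩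
    | m + 2, ih =>
      obtain ⟨I, hI⟩ := ih (m + 1) (by omega) hh ((hG.wirt (c := -Complex.I) (j := 0)).const_mul
        ((m : ℂ) + 1)⁻¹)
      obtain ⟨B, J, hB, -⟩ := exists_hasLogExp_dz hh (m + 1) 0 hG
      refine ⟨I + -((m : ℂ) + 1)⁻¹ * B, ?_⟩
      have := (hI.add (hB.const_mul (-((m : ℂ) + 1)⁻¹))).congr fun ε hε =>
        truncInt_pole_succ hh m hG hε
      rw [mul_zero, add_zero] at this
      exact this

theorem smoothPos_one : SmoothPos fun _ : Cn (d + 1) => (1 : ℝ) :=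
  ⟨contDiff_const, fun _ => one_pos⟩

/-- `logCoef m G` is the coefficient in an actual expansion, here taken for `h = 1`. It thus depends
only on the function `G z₀^{-m} z̄₀^{-1}` and linearly so, even when the pole orders of the terms
differ. -/
theorem logCoef_linear {m m₁ m₂ : ℕ} {G G₁ G₂ : Cn (d + 1) → ℂ} (hG : IsTest G) (h₁ : IsTest G₁)
    (h₂ : IsTest G₂) (c₁ c₂ : ℂ)
    (he : ∀ y, y 0 ≠ 0 → G y * mono (-(m : ℤ)) (-1) y
      = c₁ * (G₁ y * mono (-(m₁ : ℤ)) (-1) y) + c₂ * (G₂ y * mono (-(m₂ : ℤ)) (-1) y)) :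
    logCoef m G = c₁ * logCoef m₁ G₁ + c₂ * logCoef m₂ G₂ := by
  have hh := smoothPos_one (d := d)
  obtain ⟨I, hI⟩ := hasLogExp_logCoef m hh hG
  obtain ⟨I₁, hI₁⟩ := hasLogExp_logCoef m₁ hh h₁
  obtain ⟨I₂, hI₂⟩ := hasLogExp_logCoef m₂ hh h₂
  refine (hI.unique (((hI₁.const_mul c₁).add (hI₂.const_mul c₂)).congr fun ε hε => ?_)).1
  rw [← truncInt_const_mul, ← truncInt_const_mul,
    ← truncInt_add hh ((h₁.smoothOff _ _).contOff.const_mul _)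
      ((h₂.smoothOff _ _).contOff.const_mul _) hε]
  exact truncInt_congr hh (fun y hy => (he y hy).symm) hε

/-- Here the finite part depends on `h` only through `∂ log h` inside `slopeNum`, which makes its
change under `h ↦ e^φ h` computable. -/
theorem hasLogExp_dz (hh : SmoothPos h) (k : ℕ) (j : Fin (d + 1)) {Q : Cn (d + 1) → ℂ}
    (hQ : IsTest Q) :
    HasLogExp (truncInt h (wirt (-Complex.I) j fun y => Q y * mono (-(k : ℤ)) (-1) y)) 0
      (logCoef (k + 1) (slopeNum h j Q)) := by
  obtain ⟨B, J, hB, hJ⟩ := exists_hasLogExp_dz hh k j hQ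
  obtain ⟨I, hI⟩ := hasLogExp_logCoef (k + 1) hh (isTest_slopeNum hh j hQ)
  rwa [(hI.unique hJ).1]

variable {φ : Cn (d + 1) → ℝ}

theorem SmoothPos.exp_mul (hh : SmoothPos h) (hφ : ContDiff ℝ ∞ φ) :
    SmoothPos fun y => Real.exp (φ y) * h y :=
  ⟨hφ.exp.mul hh.smooth, fun y => mul_pos (Real.exp_pos _) (hh.pos y)⟩

theorem dlog_exp_mul (hh : SmoothPos h) (hφ : ContDiff ℝ ∞ φ) {c : ℂ} {j : Fin (d + 1)}
    (y : Cn (d + 1)) :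
    dlog c j (fun y => Real.exp (φ y) * h y) y
      = wirt c j (fun y => (φ y : ℂ)) y + dlog c j h y := by
  have h1 : DifferentiableAt ℝ φ y := hφ.contDiffAt.differentiableAt (by simp)
  have h2 : DifferentiableAt ℝ (fun y => (h y : ℂ)) y :=
    hh.contDiff_ofReal.contDiffAt.differentiableAt (by simp)
  have h3 : DifferentiableAt ℝ (fun y => (Real.exp (φ y) : ℂ)) y :=
    Complex.ofRealCLM.differentiableAt.comp y h1.exp
  have hp : (h y : ℂ) ≠ 0 := by exact_mod_cast (hh.pos y).ne'
  have he : (Real.exp (φ y) : ℂ) ≠ 0 := by exact_mod_cast (Real.exp_pos _).ne'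
  simp only [dlog, Complex.ofReal_mul]
  rw [wirt_mul h3 h2, wirt_comp_real h1 (Real.hasDerivAt_exp _)]
  field_simp

theorem dist0_exp_mul (h φ : Cn (d + 1) → ℝ) (y : Cn (d + 1)) :
    dist0 (fun y => Real.exp (φ y) * h y) y = Real.exp (φ y) * dist0 h y := by
  simp only [dist0]; ring

/-- The finite part changes under `h ↦ e^φ h` by the logarithmic coefficient of `φ G`. -/
theorem finitePart_exp_mul (hφ : ContDiff ℝ ∞ φ) (m : ℕ) : ∀ {h : Cn (d + 1) → ℝ}, SmoothPos h →
    ∀ {G : Cn (d + 1) → ℂ}, IsTest G → ∀ {A I A' I' : ℂ},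
    HasLogExp (truncInt h fun y => G y * mono (-(m : ℤ)) (-1) y) A I →
    HasLogExp (truncInt (fun y => Real.exp (φ y) * h y) fun y => G y * mono (-(m : ℤ)) (-1) y)
      A' I' → I' = I - logCoef m fun y => (φ y : ℂ) * G y := by
  have hφc : ContDiff ℝ ∞ fun y => (φ y : ℂ) := Complex.ofRealCLM.contDiff.comp hφ
  induction m using Nat.strong_induction_on with
  | _ m ih =>
    intro h hh G hG A I A' I' hI hI'
    have hh' := hh.exp_mul hφ
    have dG : IsTest (wirt (-Complex.I) 0 G) := hG.wirt
    have dφ : ContDiff ℝ ∞ (wirt (-Complex.I) 0 fun y => (φ y : ℂ)) := hφc.wirt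
    match m, ih with
    | 0, _ =>
      have hm : IsMild fun y => G y * mono (-((0 : ℕ) : ℤ)) (-1) y := hG.isMild (by norm_num)
      rw [(hI.unique (hm.hasLogExp hh)).2, (hI'.unique (hm.hasLogExp hh')).2, logCoef, sub_zero]
    -- In the explicit formula `log(h|z₀|)` gains `φ` and `∂ log h` gains `∂φ`; the two changes
    -- combine to the derivative of `φG`.
    | 1, _ =>
      rw [(hI.unique (hasLogExp_simple hh hG)).2, (hI'.unique (hasLogExp_simple hh' hG)).2]
      have m1 : IsMild fun y => wirt (-Complex.I) 0 G y * mono 0 (-1) y := dG.isMild (by norm_num)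
      have m2 : IsMild fun y => (dlog (-Complex.I) 0 h y * G y) * mono 0 (-1) y :=
        (hG.mul_left hh.contDiff_dlog).isMild (by norm_num)
      have m3 : IsMild fun y => ((φ y : ℂ) * wirt (-Complex.I) 0 G y) * mono 0 (-1) y :=
        (dG.mul_left hφc).isMild (by norm_num)
      have m4 : IsMild fun y => (wirt (-Complex.I) 0 (fun y => (φ y : ℂ)) y * G y) * mono 0 (-1) y :=
        (hG.mul_left dφ).isMild (by norm_num)
      have e1 : ∫ y, (Real.log (dist0 (fun y => Real.exp (φ y) * h y) y) : ℂ) *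
            (wirt (-Complex.I) 0 G y * mono 0 (-1) y)
          = (∫ y, (Real.log (dist0 h y) : ℂ) * (wirt (-Complex.I) 0 G y * mono 0 (-1) y))
            + ∫ y, ((φ y : ℂ) * wirt (-Complex.I) 0 G y) * mono 0 (-1) y := by
        rw [← integral_add (m1.integrable_log hh) (m3.integrable hh)]
        refine integral_congr_ae ?_
        filter_upwards [ae_off] with y hy
        rw [dist0_exp_mul, Real.log_mul (Real.exp_pos _).ne' (hh.dist0_pos hy).ne', Real.log_exp]
        push_cast; ring
      have e2 : ∫ y, (dlog (-Complex.I) 0 (fun y => Real.exp (φ y) * h y) y * G y) * mono 0 (-1) y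
          = (∫ y, (wirt (-Complex.I) 0 (fun y => (φ y : ℂ)) y * G y) * mono 0 (-1) y)
            + ∫ y, (dlog (-Complex.I) 0 h y * G y) * mono 0 (-1) y := by
        rw [← integral_add (m4.integrable hh) (m2.integrable hh)]
        congr 1; ext y
        rw [dlog_exp_mul hh hφ]; ring
      have e3 : ∫ y, wirt (-Complex.I) 0 (fun y => (φ y : ℂ) * G y) y * mono 0 (-1) y
          = (∫ y, (wirt (-Complex.I) 0 (fun y => (φ y : ℂ)) y * G y) * mono 0 (-1) y)
            + ∫ y, ((φ y : ℂ) * wirt (-Complex.I) 0 G y) * mono 0 (-1) y := by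
        rw [← integral_add (m4.integrable hh) (m3.integrable hh)]
        congr 1; ext y
        rw [wirt_mul (hφc.contDiffAt.differentiableAt (by simp)) (hG.diff y)]; ring
      rw [e1, e2, logCoef, e3]
      ring
    | m + 2, ih =>
      have hdG := dG.const_mul ((m : ℂ) + 1)⁻¹
      obtain ⟨L, hL⟩ := hasLogExp_logCoef (m + 1) hh hdG
      obtain ⟨L', hL'⟩ := hasLogExp_logCoef (m + 1) hh' hdG
      have e := ih (m + 1) (by omega) hh hdG hL hL'
      -- The finite part at order `m + 2` is the one at order `m + 1`, known by induction, plus a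
      -- logarithmic coefficient. Under `h ↦ e^φ h` the latter changes by that of `∂φ · G` (`e4`),
      -- which is what the product rule requires in the recursion for `φG` (`e5`).
      have f : ∀ {h : Cn (d + 1) → ℝ} {A I L : ℂ} (hh : SmoothPos h)
          (_ : HasLogExp (truncInt h fun y => G y * mono (-((m + 2 : ℕ) : ℤ)) (-1) y) A I)
          (_ : HasLogExp (truncInt h fun y => (((m : ℂ) + 1)⁻¹ * wirt (-Complex.I) 0 G y)
            * mono (-((m + 1 : ℕ) : ℤ)) (-1) y)
            (logCoef (m + 1) fun y => ((m : ℂ) + 1)⁻¹ * wirt (-Complex.I) 0 G y) L),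
          I = L + -((m : ℂ) + 1)⁻¹ * logCoef (m + 2) (slopeNum h 0 G) := by
        intro h A I L hh hI hL
        refine (hI.unique ((hL.add ((hasLogExp_dz hh (m + 1) 0 hG).const_mul
          (-((m : ℂ) + 1)⁻¹))).congr fun ε hε => truncInt_pole_succ hh m hG hε)).2
      have t1 : IsTest fun y => wirt (-Complex.I) 0 (fun y => (φ y : ℂ)) y * G y := hG.mul_left dφ
      have t2 : IsTest fun y => (φ y : ℂ) * wirt (-Complex.I) 0 G y := dG.mul_left hφc
      have e4 : logCoef (m + 2) (slopeNum (fun y => Real.exp (φ y) * h y) 0 G)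
          = 1 * logCoef (m + 2) (slopeNum h 0 G) + 1 * logCoef (m + 1)
            (fun y => wirt (-Complex.I) 0 (fun y => (φ y : ℂ)) y * G y) := by
        refine logCoef_linear (isTest_slopeNum hh' 0 hG) (isTest_slopeNum hh 0 hG) t1 1 1 ?_
        intro y hy
        rw [← mono_neg_succ (m + 1) hy]
        simp only [slopeNum, dlog_exp_mul hh hφ]
        ring
      have e5 : logCoef (m + 2) (fun y => (φ y : ℂ) * G y)
          = ((m : ℂ) + 1)⁻¹ * logCoef (m + 1)
              (fun y => wirt (-Complex.I) 0 (fun y => (φ y : ℂ)) y * G y)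
            + 1 * logCoef (m + 1)
              (fun y => (φ y : ℂ) * (((m : ℂ) + 1)⁻¹ * wirt (-Complex.I) 0 G y)) := by
        rw [logCoef]
        refine logCoef_linear ((hG.mul_left hφc).wirt.const_mul _) t1 (hdG.mul_left hφc) _ _ ?_
        intro y hy
        rw [wirt_mul (hφc.contDiffAt.differentiableAt (by simp)) (hG.diff y)]
        ring
      rw [f hh hI hL, f hh' hI' hL', e, e4, e5]
      ring

end LogCoefficient

end

noncomputable section

/-! ### The logarithmic coefficient of a simple pole as an integral over the hyperplane. -/

section SimplePole

open MeasureTheory Filter Set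

variable {d : ℕ}

/-- A test function vanishing on `z₀ = 0` has no logarithmic coefficient for a simple pole. -/
theorem logCoef_one_of_vanish {G : Cn (d + 1) → ℂ} (hG : IsTest G) (h0 : ∀ y, y 0 = 0 → G y = 0) :
    logCoef 1 G = 0 := by
  have hh := smoothPos_one (d := d)
  -- Comparing `y` with its projection to the hyperplane, where `G` vanishes, gives `|G| ≤ C|z₀|`,
  -- so the singularity is mild.
  obtain ⟨C, hC⟩ := ContDiff.lipschitzWith_of_hasCompactSupport hG.compact
    (hG.smooth.of_le (m := 1) (by simp)) one_ne_zero
  have hm : IsMild fun y => G y * mono (-((1 : ℕ) : ℤ)) (-1) y := by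
    refine ⟨(hG.smoothOff _ _).contOff, C, C.2, fun y hy => ?_⟩
    have h1 : G (Function.update y 0 0) = 0 := h0 _ (by simp)
    have h2 : ‖G y‖ ≤ C * ‖y 0‖ := by
      have := hC.dist_le_mul y (Function.update y 0 0)
      rw [h1, dist_zero_right] at this
      refine this.trans ?_
      gcongr
      refine (dist_pi_le_iff (norm_nonneg _)).mpr fun i => ?_
      by_cases hi : i = 0
      · subst hi; simp
      · simp [hi]
    have hn : 0 < ‖y 0‖ := norm_pos_iff.mpr hy
    rw [norm_mul, norm_mono _ _ hy, le_div_iff₀ hn]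
    calc ‖G y‖ * ‖y 0‖ ^ (-((1 : ℕ) : ℤ) + -1) * ‖y 0‖
        ≤ (C * ‖y 0‖) * ‖y 0‖ ^ (-((1 : ℕ) : ℤ) + -1) * ‖y 0‖ := by gcongr
      _ = C := by
        have : (-((1 : ℕ) : ℤ) + -1) = -2 := by norm_num
        rw [this, zpow_neg]
        field_simp
  obtain ⟨I, hI⟩ := hasLogExp_logCoef 1 hh hG
  exact (hI.unique (hm.hasLogExp hh)).1

/-- With `κ` the smooth transition, polar coordinates give `2π ∫ r κ'(r²) dr`, and `r κ'(r²)` is the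
derivative of `κ(r²)/2`. -/
theorem integral_radial_bump : Integrable
      (fun w : ℂ => ((deriv Real.smoothTransition (‖w‖ ^ 2) : ℝ) : ℂ)) ∧
    ∫ w : ℂ, ((deriv Real.smoothTransition (‖w‖ ^ 2) : ℝ) : ℂ) = Real.pi := by
  have hs : ContDiff ℝ ∞ Real.smoothTransition := Real.smoothTransition.contDiff (n := ⊤)
  have hs' : ContDiff ℝ ∞ (deriv Real.smoothTransition) := hs.deriv'
  have hc : Continuous fun w : ℂ => deriv Real.smoothTransition (‖w‖ ^ 2) :=
    hs'.continuous.comp (by fun_prop)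
  have hcs : HasCompactSupport fun w : ℂ => deriv Real.smoothTransition (‖w‖ ^ 2) := by
    refine HasCompactSupport.of_support_subset_isCompact (isCompact_closedBall (0 : ℂ) 1)
      fun w hw => ?_
    by_contra hn
    rw [mem_closedBall_zero_iff, not_le] at hn
    exact hw (deriv_smoothTransition_of_ge (one_le_pow₀ hn.le))
  have hi := hc.integrable_of_hasCompactSupport (μ := volume) hcs
  refine ⟨hi.ofReal, ?_⟩
  rw [integral_complex_ofReal]
  have h1 := integral_fun_norm_addHaar (volume : Measure ℂ)
    (fun r => deriv Real.smoothTransition (r ^ 2))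
  have hd : ∀ r : ℝ, HasDerivAt (fun r => 2⁻¹ * Real.smoothTransition (r ^ 2))
      (r ^ 1 • deriv Real.smoothTransition (r ^ 2)) r := by
    intro r
    have := ((hs.differentiable (by simp) (r ^ 2)).hasDerivAt.comp r (hasDerivAt_pow 2 r)).const_mul
      (2⁻¹ : ℝ)
    refine this.congr_deriv ?_
    simp; ring
  have h2 : ∫ r in Ioi (0 : ℝ), r ^ 1 • deriv Real.smoothTransition (r ^ 2) = 2⁻¹ := by
    have h3 : ∫ r in Ioi (0 : ℝ), r ^ 1 • deriv Real.smoothTransition (r ^ 2)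
        = ∫ r in Ioc (0 : ℝ) 1, r ^ 1 • deriv Real.smoothTransition (r ^ 2) := by
      refine (setIntegral_eq_of_subset_of_forall_sdiff_eq_zero measurableSet_Ioi
        Ioc_subset_Ioi_self fun r hr => ?_)
      have h0 : (0 : ℝ) < r := hr.1
      have : 1 < r := by
        by_contra hn
        exact hr.2 ⟨h0, not_lt.mp hn⟩
      rw [deriv_smoothTransition_of_ge (one_le_pow₀ this.le), smul_zero]
    rw [h3, ← intervalIntegral.integral_of_le zero_le_one,
      intervalIntegral.integral_eq_sub_of_hasDerivAt (fun r _ => hd r)]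
    · simp
    · have := hs'.continuous
      exact (show Continuous fun r : ℝ => r ^ 1 • deriv Real.smoothTransition (r ^ 2) by
        fun_prop).intervalIntegrable _ _
  rw [h1, Complex.finrank_real_complex, h2, measureReal_def, Complex.volume_ball]
  simp
  ring

/-- The logarithmic coefficient of a simple pole is the integral over the hyperplane. -/
theorem logCoef_one {G : Cn (d + 1) → ℂ} (hG : IsTest G) :
    logCoef 1 G = -2 * Real.pi * ∫ z : Cn d, G (Fin.cons 0 z) := by
  have hs : ContDiff ℝ ∞ Real.smoothTransition := Real.smoothTransition.contDiff (n := ⊤)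
  have hcons : ContDiff ℝ ∞ fun y : Cn (d + 1) =>
      (Fin.cons 0 (fun i => y (Fin.succ i)) : Cn (d + 1)) := by
    rw [contDiff_pi]
    intro i
    refine Fin.cases ?_ (fun i => ?_) i
    · simpa using contDiff_const
    · simpa using contDiff_apply ℝ ℂ i.succ
  set ρ : Cn (d + 1) → ℝ := fun y => 1 - Real.smoothTransition (‖y 0‖ ^ 2) with hρ
  have hsq : ContDiff ℝ ∞ fun y : Cn (d + 1) => ‖y 0‖ ^ 2 :=
    ContDiff.norm_sq ℝ (contDiff_apply ℝ ℂ 0)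
  have hρs : ContDiff ℝ ∞ ρ := contDiff_const.sub (hs.comp hsq)
  have hρc : ContDiff ℝ ∞ fun y => (ρ y : ℂ) := Complex.ofRealCLM.contDiff.comp hρs
  set g : Cn (d + 1) → ℂ := fun y => G (Fin.cons 0 fun i => y (Fin.succ i)) with hg
  have hgs : ContDiff ℝ ∞ g := hG.smooth.comp hcons
  -- Only the values on the hyperplane matter, so `G` may be replaced by a product of a radial bump
  -- in `z₀` and the restriction of `G`; Fubini then separates the variables.
  set G₀ : Cn (d + 1) → ℂ := fun y => (ρ y : ℂ) * g y with hG₀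
  have hG₀t : IsTest G₀ := by
    refine ⟨hρc.mul hgs, ?_⟩
    obtain ⟨R, hR⟩ := hG.compact.isCompact.isBounded.subset_closedBall 0
    refine HasCompactSupport.of_support_subset_isCompact
      (isCompact_closedBall (0 : Cn (d + 1)) (max 1 R)) fun y hy => ?_
    have h1 : g y ≠ 0 := right_ne_zero_of_mul hy
    have h2 : (ρ y : ℂ) ≠ 0 := left_ne_zero_of_mul hy
    have h3 : (Fin.cons 0 fun i => y (Fin.succ i) : Cn (d + 1)) ∈ Metric.closedBall 0 R :=
      hR (subset_tsupport _ h1)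
    rw [mem_closedBall_zero_iff] at h3 ⊢
    refine (pi_norm_le_iff_of_nonneg (by positivity)).mpr fun i => ?_
    refine Fin.cases ?_ (fun i => ?_) i
    · by_contra hn
      rw [not_le] at hn
      have h4 : 1 ≤ ‖y 0‖ ^ 2 := one_le_pow₀ ((le_max_left 1 R).trans hn.le)
      exact h2 (by simp [hρ, Real.smoothTransition.one_of_one_le h4])
    · refine le_trans ?_ (le_max_right 1 R)
      simpa using (norm_le_pi_norm (Fin.cons 0 fun i => y (Fin.succ i) : Cn (d + 1)) i.succ).trans h3
  have hdiff : logCoef 1 (fun y => G y - G₀ y) = 0 := by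
    refine logCoef_one_of_vanish (hG.sub hG₀t) fun y hy => ?_
    have : (Fin.cons 0 (fun i => y (Fin.succ i)) : Cn (d + 1)) = y := by
      ext i
      refine Fin.cases ?_ (fun i => ?_) i <;> simp [hy]
    simp [hG₀, hρ, hg, hy, this, Real.smoothTransition.zero]
  have hlin : logCoef 1 G = 1 * logCoef 1 (fun y => G y - G₀ y) + 1 * logCoef 1 G₀ :=
    logCoef_linear hG (hG.sub hG₀t) hG₀t 1 1 fun y _ => by ring
  rw [hlin, hdiff, logCoef]
  -- Differentiating the function `κ(|z₀|²)` of `z₀` produces a factor `z̄₀`, which cancels the pole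
  -- `z̄₀^{-1}`.
  have hpt : ∀ y : Cn (d + 1), y 0 ≠ 0 → wirt (-Complex.I) 0 G₀ y * mono 0 (-1) y
      = -(((deriv Real.smoothTransition (‖y 0‖ ^ 2) : ℝ) : ℂ) *
        G (Fin.cons 0 fun i => y (Fin.succ i))) := by
    intro y hy
    have e1 : wirt (-Complex.I) 0 g y = 0 := by
      have hd : ∀ v : ℂ, fderiv ℝ g y (Pi.single 0 v) = 0 := by
        intro v
        have h1 : HasDerivAt (fun t : ℝ => g (y + t • (Pi.single 0 v : Cn (d + 1))))
            (fderiv ℝ g y (Pi.single 0 v)) 0 := by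
          have := (hgs.contDiffAt.differentiableAt (by simp) :
            DifferentiableAt ℝ g y).hasFDerivAt.hasLineDerivAt (Pi.single 0 v)
          exact this
        have h2 : (fun t : ℝ => g (y + t • (Pi.single 0 v : Cn (d + 1)))) = fun _ => g y := by
          ext t
          simp [hg]
        rw [h2] at h1
        exact h1.unique (hasDerivAt_const _ _)
      have hI : (Complex.I • Pi.single 0 1 : Cn (d + 1)) = Pi.single 0 Complex.I := by
        rw [← Pi.single_smul]; simp
      simp [wirt, hd, hI]
    have e2 : wirt (-Complex.I) 0 (fun y => (ρ y : ℂ)) y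
        = -((deriv Real.smoothTransition (‖y 0‖ ^ 2) : ℝ) : ℂ) * (starRingEnd ℂ) (y 0) := by
      have hd1 : HasDerivAt (fun s : ℝ => 1 - Real.smoothTransition s)
          (-deriv Real.smoothTransition (‖y 0‖ ^ 2)) (‖y 0‖ ^ 2) :=
        (hs.differentiable (by simp) _).hasDerivAt.const_sub 1
      have h0 : DifferentiableAt ℝ (fun y : Cn (d + 1) => y 0) y := by fun_prop
      have h0' : DifferentiableAt ℝ (fun y : Cn (d + 1) => (starRingEnd ℂ) (y 0)) y :=
        (contDiffAt_conj (by fun_prop)).differentiableAt (by simp)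
      have hsq' : (fun y : Cn (d + 1) => ((‖y 0‖ ^ 2 : ℝ) : ℂ))
          = fun y => y 0 * (starRingEnd ℂ) (y 0) := by
        ext z
        rw [Complex.mul_conj, Complex.normSq_eq_norm_sq]
      rw [wirt_comp_real (hsq.contDiffAt.differentiableAt (by simp)) hd1, hsq',
        wirt_mul h0 h0', wirt_conj h0]
      have e3 := wirt_coord_zpow (c := -Complex.I) (j := 0) 1 hy
      have e4 := wirt_coord_zpow (c := (starRingEnd ℂ) (-Complex.I)) (j := 0) 1 hy
      simp only [zpow_one, sub_self, zpow_zero, Int.cast_one, mul_one] at e3 e4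
      rw [e3, e4]
      simp; norm_num
    rw [wirt_mul (hρc.contDiffAt.differentiableAt (by simp))
      (hgs.contDiffAt.differentiableAt (by simp)), e1, e2]
    have hy' : (starRingEnd ℂ) (y 0) ≠ 0 := (map_ne_zero _).mpr hy
    simp only [mono, zpow_zero, zpow_neg_one, one_mul, hg]
    field_simp
    ring
  have hint : ∫ y, wirt (-Complex.I) 0 G₀ y * mono 0 (-1) y
      = ∫ y : Cn (d + 1), -(((deriv Real.smoothTransition (‖y 0‖ ^ 2) : ℝ) : ℂ) *
        G (Fin.cons 0 fun i => y (Fin.succ i))) := by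
    refine integral_congr_ae ?_
    filter_upwards [ae_off] with y hy using hpt y hy
  rw [hint, integral_neg, integral_split (fun p : ℂ × Cn d =>
    ((deriv Real.smoothTransition (‖p.1‖ ^ 2) : ℝ) : ℂ) * G (Fin.cons 0 p.2)),
    show (volume : Measure (ℂ × Cn d)) = (volume : Measure ℂ).prod volume from rfl,
    integral_prod_mul (fun w : ℂ => ((deriv Real.smoothTransition (‖w‖ ^ 2) : ℝ) : ℂ))
      (fun z : Cn d => G (Fin.cons 0 z)), integral_radial_bump.2]
  ring

end SimplePole

end

noncomputable section

/-! ### Smoothness of form-valued maps, read off from coefficients. -/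

section AlternatingRegularity

open Filter

variable {n p : ℕ}

theorem alternating_ext_single {f g : (Cn n) [⋀^Fin p]→L[ℂ] ℂ}
    (h : ∀ r : Fin p → Fin n, f (fun i => Pi.single (r i) 1) = g (fun i => Pi.single (r i) 1)) :
    f = g := by
  apply ContinuousAlternatingMap.toAlternatingMap_injective
  apply AlternatingMap.coe_multilinearMap_injective
  refine Module.Basis.ext_multilinear (fun _ => Pi.basisFun ℂ (Fin n)) fun r => ?_
  simpa using h r

/-- Evaluation of alternating forms on the tuples of standard basis vectors. -/
def evalSingle (n p : ℕ) : ((Cn n) [⋀^Fin p]→L[ℂ] ℂ) →ₗ[ℂ] ((Fin p → Fin n) → ℂ) where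
  toFun f r := f (fun i => Pi.single (r i) 1)
  map_add' _ _ := rfl
  map_smul' _ _ := rfl

/-- A linear left inverse lets regularity of a form-valued map be checked on its finitely many
coefficients. -/
theorem exists_leftInverse_evalSingle (n p : ℕ) :
    ∃ g : ((Fin p → Fin n) → ℂ) →L[ℂ] ((Cn n) [⋀^Fin p]→L[ℂ] ℂ), ∀ f, g (evalSingle n p f) = f := by
  obtain ⟨g, hg⟩ := LinearMap.exists_leftInverse_of_injective (evalSingle n p) (by
    rw [LinearMap.ker_eq_bot]
    intro f g h
    exact alternating_ext_single fun r => congrFun h r)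
  exact ⟨LinearMap.toContinuousLinearMap g, fun f => LinearMap.congr_fun hg f⟩

variable {𝕜 : Type*} [NontriviallyNormedField 𝕜] [NormedAlgebra 𝕜 ℂ]
  {E : Type*} [NormedAddCommGroup E] [NormedSpace 𝕜 E] {k : WithTop ℕ∞}

theorem ContDiffAt.alternating_apply {f : E → (Cn n) [⋀^Fin p]→L[ℂ] ℂ} {y : E}
    (hf : ContDiffAt 𝕜 k f y) (v : Fin p → Cn n) : ContDiffAt 𝕜 k (fun y => f y v) y :=
  ((ContinuousAlternatingMap.apply ℂ (Cn n) ℂ v).restrictScalars 𝕜).contDiff.contDiffAt.comp y hf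

theorem contDiffAt_alternating {f : E → (Cn n) [⋀^Fin p]→L[ℂ] ℂ} {y : E}
    (h : ∀ r : Fin p → Fin n, ContDiffAt 𝕜 k (fun y => f y (fun i => Pi.single (r i) 1)) y) :
    ContDiffAt 𝕜 k f y := by
  obtain ⟨g, hg⟩ := exists_leftInverse_evalSingle n p
  have h1 : ContDiffAt 𝕜 k (fun y => evalSingle n p (f y)) y := contDiffAt_pi.2 h
  have := (g.restrictScalars 𝕜).contDiff.contDiffAt.comp y h1
  convert! this using 1
  funext z
  exact (hg (f z)).symm

theorem ContDiffAt.compContinuousLinearMap {q : ℕ} {f : E → (Cn n) [⋀^Fin p]→L[ℂ] ℂ}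
    {L : E → Cn q →L[ℂ] Cn n} {y : E}
    (hf : ContDiffAt 𝕜 k f y) (hL : ContDiffAt 𝕜 k L y) :
    ContDiffAt 𝕜 k (fun y => (f y).compContinuousLinearMap (L y)) y := by
  refine contDiffAt_alternating fun r => ?_
  -- The coefficients of a pull-back are polynomial in the entries of `L` and linear in the
  -- coefficients of `f`.
  have key : ∀ z, (f z).compContinuousLinearMap (L z) (fun i => Pi.single (r i) 1)
      = ∑ s : Fin p → Fin n, (∏ i, L z (Pi.single (r i) 1) (s i)) *
        f z (fun i => Pi.single (s i) 1) := by
    intro z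
    have h1 : ∀ i, L z (Pi.single (r i) 1) =
        ∑ j : Fin n, L z (Pi.single (r i) 1) j • (Pi.single j 1 : Cn n) := by
      intro i
      exact pi_eq_sum_univ' _
    have h2 : (f z).compContinuousLinearMap (L z) (fun i => Pi.single (r i) 1)
      = (f z).toMultilinearMap
          (fun i => ∑ j : Fin n, L z (Pi.single (r i) 1) j • (Pi.single j 1 : Cn n)) := by
      simp_rw [← h1]; rfl
    rw [h2, MultilinearMap.map_sum]
    refine Finset.sum_congr rfl fun s _ => ?_
    rw [MultilinearMap.map_smul_univ]; rfl
  simp_rw [key]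
  refine ContDiffAt.sum fun s _ => ?_
  refine ContDiffAt.mul ?_ (hf.alternating_apply _)
  refine contDiffAt_prod fun i _ => ?_
  exact (((ContinuousLinearMap.proj (R := ℂ) (φ := fun _ : Fin n => ℂ) (s i)).comp
    (ContinuousLinearMap.apply ℂ (Cn n) (Pi.single (r i) (1:ℂ) : Cn q))).restrictScalars
    𝕜).contDiff.contDiffAt.comp y hL

end AlternatingRegularity

/-! ### Compatibility of `∂` with holomorphic pull-back. -/

section Naturality

open ContinuousAlternatingMap

variable {n p q : ℕ}

theorem complexLinearPart_restrict {E F : Type*} [NormedAddCommGroup E] [NormedSpace ℂ E]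
    [NormedAddCommGroup F] [NormedSpace ℂ F] (L : E →L[ℂ] F) :
    complexLinearPart (L.restrictScalars ℝ) = L := by
  ext v
  simp only [complexLinearPart, ContinuousLinearMap.coe_mk', LinearMap.coe_mk, AddHom.coe_mk,
    ContinuousLinearMap.coe_restrictScalars', map_smul, smul_smul, Complex.I_mul_I]
  module

theorem complexLinearPart_add {E F : Type*} [NormedAddCommGroup E] [NormedSpace ℂ E]
    [NormedAddCommGroup F] [NormedSpace ℂ F] (L M : E →L[ℝ] F) :
    complexLinearPart (L + M) = complexLinearPart L + complexLinearPart M := by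
  ext v
  simp only [complexLinearPart, ContinuousLinearMap.coe_mk', LinearMap.coe_mk, AddHom.coe_mk,
    _root_.add_apply]
  module

theorem complexLinearPart_comp {E E' F F' : Type*} [NormedAddCommGroup E] [NormedSpace ℂ E]
    [NormedAddCommGroup F] [NormedSpace ℂ F] [NormedAddCommGroup E'] [NormedSpace ℂ E']
    [NormedAddCommGroup F'] [NormedSpace ℂ F'] (L : E →L[ℝ] F) (A : F →L[ℂ] F') (B : E' →L[ℂ] E) :
    complexLinearPart ((A.restrictScalars ℝ) ∘L L ∘L (B.restrictScalars ℝ)) =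
      A ∘L complexLinearPart L ∘L B := by
  ext v
  simp only [complexLinearPart, ContinuousLinearMap.coe_mk', LinearMap.coe_mk, AddHom.coe_mk,
    ContinuousLinearMap.coe_restrictScalars', ContinuousLinearMap.comp_apply, map_smul, map_sub]

/-- The derivative of the pull-back has two terms. Taking complex-linear parts commutes with
composition by the complex-linear `dΨ` in the first; the second contains `d²Ψ`, whose symmetry makes
it vanish after antisymmetrization. -/
theorem delCoord_pullback {η : Cn n → (Cn n) [⋀^Fin p]→L[ℂ] ℂ} {Ψ : Cn q → Cn n} {y : Cn q}
    (hη : DifferentiableAt ℝ η (Ψ y)) (hΨ : ContDiffAt ℂ ω Ψ y) :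
    delCoord (fun z => (η (Ψ z)).compContinuousLinearMap (fderiv ℂ Ψ z)) y =
      (delCoord η (Ψ y)).compContinuousLinearMap (fderiv ℂ Ψ y) := by
  have hd : DifferentiableAt ℂ Ψ y := hΨ.differentiableAt (by simp)
  have hd2 : DifferentiableAt ℂ (fderiv ℂ Ψ) y :=
    (hΨ.fderiv_right (m := 1) (by simp)).differentiableAt one_ne_zero
  have hf1 : HasFDerivAt (fun z => η (Ψ z))
      ((fderiv ℝ η (Ψ y)) ∘L (fderiv ℂ Ψ y).restrictScalars ℝ) y :=
    hη.hasFDerivAt.comp y (hd.hasFDerivAt.restrictScalars ℝ)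
  have hJ := ((hasStrictFDerivAt_compContinuousLinearMap
    (η (Ψ y), fderiv ℂ Ψ y)).hasFDerivAt.restrictScalars ℝ).comp y
      (hf1.prodMk (hd2.hasFDerivAt.restrictScalars ℝ))
  have hJ' := hJ.fderiv
  have e1 : fderiv ℝ (fun z => (η (Ψ z)).compContinuousLinearMap (fderiv ℂ Ψ z)) y =
      ((compContinuousLinearMapCLM (fderiv ℂ Ψ y)).restrictScalars ℝ) ∘L (fderiv ℝ η (Ψ y)) ∘L
        (fderiv ℂ Ψ y).restrictScalars ℝ +
      (((η (Ψ y)).fderivCompContinuousLinearMap (fderiv ℂ Ψ y)) ∘L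
        (fderiv ℂ (fderiv ℂ Ψ) y)).restrictScalars ℝ := by
    refine Eq.trans hJ' ?_
    ext v
    rfl
  rw [delCoord, e1, complexLinearPart_add, complexLinearPart_comp, complexLinearPart_restrict,
    alternatizeUncurryFin_add, alternatizeUncurryFin_fderivCompContinuousLinearMap_eq_zero, add_zero]
  · ext v
    simp +unfoldPartialApp [alternatizeUncurryFin_apply, Fin.removeNth, Function.comp_def, delCoord]
  · exact hΨ.isSymmSndFDerivAt (by simp)

end Naturality

end

noncomputable section

/-! ### Forms in arbitrary holomorphic charts. -/

section Coordinates

open Filter Set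

variable {n p : ℕ} {X : Type*} [TopologicalSpace X] [ChartedSpace (Cn n) X]

section TangentMaps

variable {k l : ℕ} {Y : Type*} [TopologicalSpace Y] [ChartedSpace (Cn k) Y]
  {Z : Type*} [TopologicalSpace Z] [ChartedSpace (Cn l) Z]

/-- The tangent map of a map between complex manifolds, as a linear map of coordinate spaces. -/
def tangentCLM (k n : ℕ) {Y : Type*} [TopologicalSpace Y] [ChartedSpace (Cn k) Y] {X : Type*}
    [TopologicalSpace X] [ChartedSpace (Cn n) X] (f : Y → X) (y : Y) : Cn k →L[ℂ] Cn n :=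
  mfderiv 𝓘(ℂ, Cn k) 𝓘(ℂ, Cn n) f y

theorem tangentCLM_comp {g : X → Z} {f : Y → X} {y : Y}
    (hg : MDifferentiableAt 𝓘(ℂ, Cn n) 𝓘(ℂ, Cn l) g (f y))
    (hf : MDifferentiableAt 𝓘(ℂ, Cn k) 𝓘(ℂ, Cn n) f y) :
    tangentCLM k l (g ∘ f) y = tangentCLM n l g (f y) ∘L tangentCLM k n f y :=
  mfderiv_comp y hg hf

theorem tangentCLM_congr {f g : Y → X} {y : Y} (h : f =ᶠ[𝓝 y] g) :
    tangentCLM k n f y = tangentCLM k n g y := h.mfderiv_eq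

theorem tangentCLM_id (y : Y) : tangentCLM k k (id : Y → Y) y = ContinuousLinearMap.id ℂ (Cn k) :=
  mfderiv_id

theorem tangentCLM_eq_fderiv (f : Cn k → Cn n) (y : Cn k) : tangentCLM k n f y = fderiv ℂ f y :=
  mfderiv_eq_fderiv

end TangentMaps

/-- The pull-back `(e⁻¹)^* α` of a form to the target of a chart `e`. -/
def PForm.inCoord (α : PForm n p X) (e : OpenPartialHomeomorph X (Cn n)) (y : Cn n) :
    (Cn n) [⋀^Fin p]→L[ℂ] ℂ :=
  (α (e.symm y)).compContinuousLinearMap (tangentCLM n n e.symm y)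

variable (n X) in
/-- The holomorphic charts of `X`. -/
abbrev holoAtlas : Set (OpenPartialHomeomorph X (Cn n)) :=
  IsManifold.maximalAtlas 𝓘(ℂ, Cn n) ω X

theorem PForm.inChart_eq_inCoord (α : PForm n p X) (x : X) :
    α.inChart x = α.inCoord (chartAt (Cn n) x) := rfl

variable {e e' : OpenPartialHomeomorph X (Cn n)} {α β : PForm n p X} {x : X} {y : Cn n}

theorem compContinuousLinearMap_comp {n₁ n₂ n₃ : ℕ} (f : (Cn n₃) [⋀^Fin p]→L[ℂ] ℂ)
    (A : Cn n₂ →L[ℂ] Cn n₃) (B : Cn n₁ →L[ℂ] Cn n₂) :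
    (f.compContinuousLinearMap A).compContinuousLinearMap B =
      f.compContinuousLinearMap (A ∘L B) := rfl

theorem compContinuousLinearMap_id' (f : (Cn n) [⋀^Fin p]→L[ℂ] ℂ) :
    f.compContinuousLinearMap (ContinuousLinearMap.id ℂ (Cn n)) = f := rfl

theorem mdifferentiableAt_of_mem_holoAtlas (he : e ∈ holoAtlas n X) (hx : x ∈ e.source) :
    MDifferentiableAt 𝓘(ℂ, Cn n) 𝓘(ℂ, Cn n) e x :=
  (contMDiffAt_of_mem_maximalAtlas he hx).mdifferentiableAt (by simp)

theorem mdifferentiableAt_symm_of_mem_holoAtlas (he : e ∈ holoAtlas n X) (hy : y ∈ e.target) :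
    MDifferentiableAt 𝓘(ℂ, Cn n) 𝓘(ℂ, Cn n) e.symm y :=
  (contMDiffAt_symm_of_mem_maximalAtlas he hy).mdifferentiableAt (by simp)

theorem tangentCLM_comp_symm (he : e ∈ holoAtlas n X) (hx : x ∈ e.source) :
    tangentCLM n n e x ∘L tangentCLM n n e.symm (e x) = ContinuousLinearMap.id ℂ (Cn n) := by
  have hy := e.map_source hx
  have h1 := mdifferentiableAt_symm_of_mem_holoAtlas he hy
  have h2 := mdifferentiableAt_of_mem_holoAtlas he (e.map_target hy)
  have h := tangentCLM_comp h2 h1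
  rw [e.left_inv hx] at h
  have : (e ∘ e.symm) =ᶠ[𝓝 (e x)] id := by
    filter_upwards [e.open_target.mem_nhds hy] with z hz using e.right_inv hz
  rw [← h, tangentCLM_congr this, tangentCLM_id]

theorem tangentCLM_symm_comp (he : e ∈ holoAtlas n X) (hx : x ∈ e.source) :
    tangentCLM n n e.symm (e x) ∘L tangentCLM n n e x = ContinuousLinearMap.id ℂ (Cn n) := by
  have hy := e.map_source hx
  have h := tangentCLM_comp (mdifferentiableAt_symm_of_mem_holoAtlas he hy)
    (mdifferentiableAt_of_mem_holoAtlas he hx)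
  have : (e.symm ∘ e) =ᶠ[𝓝 x] id := by
    filter_upwards [e.open_source.mem_nhds hx] with z hz using e.left_inv hz
  rw [← h, tangentCLM_congr this, tangentCLM_id]

theorem PForm.inCoord_apply_comp (he : e ∈ holoAtlas n X) (hx : x ∈ e.source) :
    (α.inCoord e (e x)).compContinuousLinearMap (tangentCLM n n e x) = α x := by
  rw [PForm.inCoord, compContinuousLinearMap_comp, tangentCLM_symm_comp he hx, e.left_inv hx,
    compContinuousLinearMap_id']

theorem PForm.inCoord_eq_zero_iff (he : e ∈ holoAtlas n X) (hx : x ∈ e.source) :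
    α.inCoord e (e x) = 0 ↔ α x = 0 := by
  constructor
  · intro h
    rw [← PForm.inCoord_apply_comp (α := α) he hx, h]; rfl
  · intro h
    rw [PForm.inCoord, e.left_inv hx, h]; rfl

theorem contDiffAt_transition (he : e ∈ holoAtlas n X) (he' : e' ∈ holoAtlas n X)
    (hy : y ∈ e'.target) (hye : e'.symm y ∈ e.source) : ContDiffAt ℂ ω (e ∘ e'.symm) y := by
  rw [← contMDiffAt_iff_contDiffAt]
  exact (contMDiffAt_of_mem_maximalAtlas he hye).comp y (contMDiffAt_symm_of_mem_maximalAtlas he' hy)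

theorem eventually_transition {M H : Type*} [TopologicalSpace M] [TopologicalSpace H]
    {e e' : OpenPartialHomeomorph M H} {y : H} (hy : y ∈ e'.target) (hye : e'.symm y ∈ e.source) :
    ∀ᶠ z in 𝓝 y, z ∈ e'.target ∧ e'.symm z ∈ e.source :=
  Filter.Eventually.and (e'.open_target.mem_nhds hy)
    ((e'.symm.continuousAt hy).eventually (e.open_source.mem_nhds hye))

theorem PForm.inCoord_transition (he : e ∈ holoAtlas n X) (he' : e' ∈ holoAtlas n X)
    (hy : y ∈ e'.target) (hye : e'.symm y ∈ e.source) :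
    α.inCoord e' y = (α.inCoord e ((e ∘ e'.symm) y)).compContinuousLinearMap
      (fderiv ℂ (e ∘ e'.symm) y) := by
  rw [PForm.inCoord, PForm.inCoord, compContinuousLinearMap_comp, Function.comp_apply,
    e.left_inv hye]
  congr 1
  have h1 := (contDiffAt_transition he he' hy hye).differentiableAt (by simp)
  have h2 : MDifferentiableAt 𝓘(ℂ, Cn n) 𝓘(ℂ, Cn n) e.symm ((e ∘ e'.symm) y) :=
    mdifferentiableAt_symm_of_mem_holoAtlas he (e.map_source hye)
  have h := tangentCLM_comp h2 h1.mdifferentiableAt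
  rw [tangentCLM_eq_fderiv] at h
  refine Eq.trans (tangentCLM_congr ?_) h
  filter_upwards [eventually_transition hy hye] with z hz
  exact (e.left_inv hz.2).symm

theorem PForm.inCoord_eventually_transition (he : e ∈ holoAtlas n X) (he' : e' ∈ holoAtlas n X)
    (hy : y ∈ e'.target) (hye : e'.symm y ∈ e.source) :
    α.inCoord e' =ᶠ[𝓝 y] fun z => (α.inCoord e ((e ∘ e'.symm) z)).compContinuousLinearMap
      (fderiv ℂ (e ∘ e'.symm) z) := by
  filter_upwards [eventually_transition hy hye] with z hz
  exact PForm.inCoord_transition he he' hz.1 hz.2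

variable {𝕜 : Type*} [NontriviallyNormedField 𝕜] [NormedAlgebra 𝕜 ℂ] {k : WithTop ℕ∞}

/-- Holomorphic transition maps preserve both regularity classes in use; the general field `𝕜`
covers the smooth and the holomorphic case at once. -/
theorem PForm.contDiffAt_inCoord_change (he : e ∈ holoAtlas n X) (he' : e' ∈ holoAtlas n X)
    (hx : x ∈ e.source) (hx' : x ∈ e'.source) (h : ContDiffAt 𝕜 k (α.inCoord e) (e x)) :
    ContDiffAt 𝕜 k (α.inCoord e') (e' x) := by
  have hy := e'.map_source hx'
  have hye : e'.symm (e' x) ∈ e.source := by rwa [e'.left_inv hx']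
  have hΨ := contDiffAt_transition he he' hy hye
  refine ContDiffAt.congr_of_eventuallyEq ?_ (PForm.inCoord_eventually_transition he he' hy hye)
  have h1 : ContDiffAt 𝕜 k (fun z => α.inCoord e ((e ∘ e'.symm) z)) (e' x) := by
    have hΨ' : ContDiffAt 𝕜 k (e ∘ e'.symm) (e' x) := (hΨ.restrict_scalars 𝕜).of_le le_top
    have h' : ContDiffAt 𝕜 k (α.inCoord e) ((e ∘ e'.symm) (e' x)) := by
      rwa [Function.comp_apply, e'.left_inv hx']
    exact h'.comp (e' x) hΨ'
  have h2 : ContDiffAt ℂ ω (fderiv ℂ (e ∘ e'.symm)) (e' x) := hΨ.fderiv_right (m := ω) le_rfl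
  exact h1.compContinuousLinearMap ((h2.restrict_scalars 𝕜).of_le le_top)

theorem PForm.HolomorphicOn.smoothOn {U : Set X} (h : α.HolomorphicOn U) : α.SmoothOn U :=
  fun x₀ => ((h x₀).restrict_scalars ℝ).of_le le_top

theorem PForm.inCoord_add (e : OpenPartialHomeomorph X (Cn n)) (y : Cn n) :
    PForm.inCoord (fun x => α x + β x) e y = α.inCoord e y + β.inCoord e y := rfl

theorem PForm.inCoord_smul (c : X → ℂ) (e : OpenPartialHomeomorph X (Cn n)) (y : Cn n) :
    PForm.inCoord (fun x => c x • α x) e y = c (e.symm y) • α.inCoord e y := rfl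

section Manifold

variable [IsManifold 𝓘(ℂ, Cn n) ω X] {U : Set X}

theorem chart_mem_holoAtlas (x : X) : chartAt (Cn n) x ∈ holoAtlas n X :=
  IsManifold.chart_mem_maximalAtlas x

theorem PForm.contDiffAt_inCoord_of_forall
    (h : ∀ x₀ : X, ContDiffOn 𝕜 k (α.inChart x₀)
      ((chartAt (Cn n) x₀).target ∩ (chartAt (Cn n) x₀).symm ⁻¹' U))
    (hU : U ∈ 𝓝 x) (he : e ∈ holoAtlas n X) (hx : x ∈ e.source) :
    ContDiffAt 𝕜 k (α.inCoord e) (e x) := by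
  refine PForm.contDiffAt_inCoord_change (chart_mem_holoAtlas x) he (mem_chart_source _ x) hx ?_
  refine (h x).contDiffAt ?_
  have hy := (chartAt (Cn n) x).map_source (mem_chart_source _ x)
  refine inter_mem ((chartAt (Cn n) x).open_target.mem_nhds hy) ?_
  refine ((chartAt (Cn n) x).symm.continuousAt hy).preimage_mem_nhds ?_
  rwa [(chartAt (Cn n) x).left_inv (mem_chart_source _ x)]

theorem PForm.contDiffOn_inChart_of_forall
    (h : ∀ x ∈ U, ∃ e ∈ holoAtlas n X, x ∈ e.source ∧ ContDiffAt 𝕜 k (α.inCoord e) (e x))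
    (x₀ : X) : ContDiffOn 𝕜 k (α.inChart x₀)
      ((chartAt (Cn n) x₀).target ∩ (chartAt (Cn n) x₀).symm ⁻¹' U) := by
  rintro y ⟨hy, hyU⟩
  obtain ⟨e, he, hxe, hc⟩ := h _ hyU
  have := PForm.contDiffAt_inCoord_change he (chart_mem_holoAtlas x₀) hxe
    ((chartAt (Cn n) x₀).map_target hy) hc
  rw [(chartAt (Cn n) x₀).right_inv hy] at this
  exact this.contDiffWithinAt

theorem PForm.SmoothOn.contDiffAt (h : α.SmoothOn U) (hU : U ∈ 𝓝 x) (he : e ∈ holoAtlas n X)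
    (hx : x ∈ e.source) : ContDiffAt ℝ ∞ (α.inCoord e) (e x) :=
  PForm.contDiffAt_inCoord_of_forall h hU he hx

theorem PForm.smoothOn_of_forall
    (h : ∀ x ∈ U, ∃ e ∈ holoAtlas n X, x ∈ e.source ∧ ContDiffAt ℝ ∞ (α.inCoord e) (e x)) :
    α.SmoothOn U :=
  PForm.contDiffOn_inChart_of_forall h

theorem PForm.HolomorphicOn.contDiffAt (h : α.HolomorphicOn U) (hU : U ∈ 𝓝 x)
    (he : e ∈ holoAtlas n X) (hx : x ∈ e.source) : ContDiffAt ℂ ω (α.inCoord e) (e x) :=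
  PForm.contDiffAt_inCoord_of_forall h hU he hx

/-- `∂` is defined pointwise in the preferred chart at each point; naturality makes it computable in
any holomorphic chart. -/
theorem PForm.inCoord_del (he : e ∈ holoAtlas n X) (hx : x ∈ e.source)
    (h : ContDiffAt ℝ ∞ (α.inCoord e) (e x)) :
    α.del.inCoord e (e x) = delCoord (α.inCoord e) (e x) := by
  set c := chartAt (Cn n) x with hc
  have hcm : c ∈ holoAtlas n X := chart_mem_holoAtlas x
  have hxc : x ∈ c.source := mem_chart_source _ x
  have hy := e.map_source hx
  have hyc : e.symm (e x) ∈ c.source := by rwa [e.left_inv hx]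
  have hΨ := contDiffAt_transition hcm he hy hyc
  have h' := (PForm.contDiffAt_inCoord_change he hcm hx hxc h).differentiableAt (by simp)
  have hdel : α.del.inCoord c (c x) = delCoord (α.inCoord c) (c x) := by
    have h3 : α.del x = (delCoord (α.inCoord c) (c x)).compContinuousLinearMap
      (tangentCLM n n c x) := rfl
    rw [PForm.inCoord, c.left_inv hxc, h3, compContinuousLinearMap_comp,
      tangentCLM_comp_symm hcm hxc, compContinuousLinearMap_id']
  rw [PForm.inCoord_transition hcm he hy hyc]
  have hcx : (c ∘ e.symm) (e x) = c x := by rw [Function.comp_apply, e.left_inv hx]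
  have h2 := delCoord_pullback (η := α.inCoord c) (Ψ := c ∘ e.symm) (y := e x)
    (by rwa [hcx]) hΨ
  rw [hcx] at h2 ⊢
  rw [hdel, ← h2]
  unfold delCoord
  rw [(PForm.inCoord_eventually_transition hcm he hy hyc).fderiv_eq]

end Manifold

/-- The form on `e.source` with coordinate expression `η`, extended by zero. -/
def PForm.ofCoord (e : OpenPartialHomeomorph X (Cn n)) (η : Cn n → (Cn n) [⋀^Fin p]→L[ℂ] ℂ) :
    PForm n p X := by
  classical
  exact fun x => if x ∈ e.source then (η (e x)).compContinuousLinearMap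
    (tangentCLM n n e x) else 0

theorem PForm.ofCoord_of_notMem {η : Cn n → (Cn n) [⋀^Fin p]→L[ℂ] ℂ} (hx : x ∉ e.source) :
    PForm.ofCoord e η x = 0 := by simp [PForm.ofCoord, hx]

theorem PForm.inCoord_ofCoord {η : Cn n → (Cn n) [⋀^Fin p]→L[ℂ] ℂ} (he : e ∈ holoAtlas n X)
    (hy : y ∈ e.target) : (PForm.ofCoord e η).inCoord e y = η y := by
  have hx := e.map_target hy
  rw [PForm.inCoord, PForm.ofCoord, if_pos hx, compContinuousLinearMap_comp, e.right_inv hy]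
  have := tangentCLM_comp_symm he hx
  rw [e.right_inv hy] at this
  rw [this, compContinuousLinearMap_id']

end Coordinates

end

noncomputable section

/-! ### Top forms, Jacobians and orientation. -/

section TopForms

variable {n : ℕ}

/-- The coefficient of a top form with respect to `dz₁ ∧ ⋯ ∧ dzₙ`. -/
def topCoef (f : (Cn n) [⋀^Fin n]→L[ℂ] ℂ) : ℂ := f (fun i => Pi.single i 1)

/-- The constant relating `dz₁ ∧ ⋯ ∧ dzₙ ∧ dz̄₁ ∧ ⋯ ∧ dz̄ₙ` to Lebesgue measure. -/
def orientConst (n : ℕ) : ℂ := (-1) ^ (n * (n - 1) / 2) * (-2 * Complex.I) ^ n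

/-- The form `dz₁ ∧ ⋯ ∧ dzₙ`. -/
def detForm (n : ℕ) : (Cn n) [⋀^Fin n]→L[ℂ] ℂ :=
  { toMultilinearMap := (Pi.basisFun ℂ (Fin n)).det.toMultilinearMap
    map_eq_zero_of_eq' := (Pi.basisFun ℂ (Fin n)).det.map_eq_zero_of_eq'
    cont := by
      change Continuous fun v : Fin n → Cn n => (Pi.basisFun ℂ (Fin n)).det v
      simp_rw [Module.Basis.det_apply]
      refine Continuous.matrix_det (continuous_pi fun i => continuous_pi fun j => ?_)
      simp only [Module.Basis.toMatrix_apply, Pi.basisFun_repr]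
      fun_prop }

theorem wedgeConjDensity_eq (a b : (Cn n) [⋀^Fin n]→L[ℂ] ℂ) :
    wedgeConjDensity a b = topCoef a * (starRingEnd ℂ) (topCoef b) * orientConst n := rfl

theorem detForm_apply (v : Fin n → Cn n) : detForm n v = (Pi.basisFun ℂ (Fin n)).det v := rfl

theorem topCoef_detForm : topCoef (detForm n) = 1 := by
  rw [topCoef, detForm_apply]
  convert (Pi.basisFun ℂ (Fin n)).det_self using 2
  funext i
  simp

theorem eq_topCoef_smul_detForm (f : (Cn n) [⋀^Fin n]→L[ℂ] ℂ) : f = topCoef f • detForm n := by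
  ext v
  have := congrArg (fun g => g v) (AlternatingMap.eq_smul_basis_det (Pi.basisFun ℂ (Fin n))
    f.toAlternatingMap)
  have h2 : (fun i => (Pi.basisFun ℂ (Fin n)) i) = fun i => (Pi.single i 1 : Cn n) := by
    funext i; simp
  simp only [AlternatingMap.smul_apply] at this
  rw [ContinuousAlternatingMap.smul_apply, detForm_apply, topCoef, ← h2]
  exact this

theorem topCoef_compContinuousLinearMap (f : (Cn n) [⋀^Fin n]→L[ℂ] ℂ) (L : Cn n →L[ℂ] Cn n) :
    topCoef (f.compContinuousLinearMap L) = LinearMap.det (L : Cn n →ₗ[ℂ] Cn n) * topCoef f := by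
  rw [eq_topCoef_smul_detForm f]
  have h := (Pi.basisFun ℂ (Fin n)).det_comp (L : Cn n →ₗ[ℂ] Cn n) (fun i => Pi.single i 1)
  have h1 : (detForm n) (fun i => L (Pi.single i 1)) =
      LinearMap.det (L : Cn n →ₗ[ℂ] Cn n) * topCoef (detForm n) := h
  change topCoef f * (detForm n) (fun i => L (Pi.single i 1)) = _ * (topCoef f * topCoef (detForm n))
  rw [h1]; ring

theorem det_restrictScalars_eq (L : Cn n →L[ℂ] Cn n) :
    (L.restrictScalars ℝ).det = ‖LinearMap.det (L : Cn n →ₗ[ℂ] Cn n)‖ ^ 2 := by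
  have h := LinearMap.det_restrictScalars (R := ℝ) (S := ℂ) (f := (L : Cn n →ₗ[ℂ] Cn n))
  rw [Algebra.norm_complex_apply] at h
  rw [← Complex.normSq_eq_norm_sq, ← h]
  rfl

/-- The factor is `det L` times its conjugate, and `|det L|²` is the determinant of `L` as a real
map. It is nonnegative, so densities transform as Lebesgue measure requires, without sign. -/
theorem wedgeConjDensity_comp (a b : (Cn n) [⋀^Fin n]→L[ℂ] ℂ) (L : Cn n →L[ℂ] Cn n) :
    wedgeConjDensity (a.compContinuousLinearMap L) (b.compContinuousLinearMap L) =
      |(L.restrictScalars ℝ).det| • wedgeConjDensity a b := by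
  rw [wedgeConjDensity_eq, wedgeConjDensity_eq, topCoef_compContinuousLinearMap,
    topCoef_compContinuousLinearMap, det_restrictScalars_eq, abs_of_nonneg (by positivity), map_mul,
    Complex.real_smul]
  push_cast
  rw [← Complex.mul_conj']
  ring

theorem ContDiffAt.topCoef {𝕜 : Type*} [NontriviallyNormedField 𝕜] [NormedAlgebra 𝕜 ℂ]
    {E : Type*} [NormedAddCommGroup E] [NormedSpace 𝕜 E] {k : WithTop ℕ∞}
    {f : E → (Cn n) [⋀^Fin n]→L[ℂ] ℂ} {y : E} (hf : ContDiffAt 𝕜 k f y) :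
    ContDiffAt 𝕜 k (fun y => topCoef (f y)) y :=
  hf.alternating_apply _

theorem ContDiffAt.wedgeConjDensity {E : Type*} [NormedAddCommGroup E] [NormedSpace ℝ E]
    {k : WithTop ℕ∞} {f g : E → (Cn n) [⋀^Fin n]→L[ℂ] ℂ} {y : E}
    (hf : ContDiffAt ℝ k f y) (hg : ContDiffAt ℝ k g y) :
    ContDiffAt ℝ k (fun y => wedgeConjDensity (f y) (g y)) y := by
  simp_rw [wedgeConjDensity_eq]
  exact (hf.topCoef.mul (Complex.conjCLE.contDiff.contDiffAt.comp y hg.topCoef)).mul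
    contDiffAt_const

theorem wedgeConjDensity_zero_left (b : (Cn n) [⋀^Fin n]→L[ℂ] ℂ) : wedgeConjDensity 0 b = 0 := by
  simp [wedgeConjDensity]

end TopForms

/-! ### Independence of the integral of charts and of the partition of unity. -/

section IntegralCoord

open Filter Set MeasureTheory

variable {n : ℕ} {X : Type*} [TopologicalSpace X]

theorem measurableSet_coord (e : OpenPartialHomeomorph X (Cn n)) {A : Set X} (hA : IsClosed A) :
    MeasurableSet (e.target ∩ e.symm ⁻¹' A) := by
  have h : e.target ∩ e.symm ⁻¹' A = e.target \ (e.target ∩ e.symm ⁻¹' Aᶜ) := by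
    ext y; simp only [mem_inter_iff, mem_preimage, Set.mem_sdiff, mem_compl_iff]; tauto
  rw [h]
  exact e.open_target.measurableSet.diff
    (e.symm.isOpen_inter_preimage hA.isOpen_compl).measurableSet

theorem integrableOn_coord [T2Space X] (e : OpenPartialHomeomorph X (Cn n)) {A L : Set X}
    (hA : IsClosed A) (hL : IsCompact L) (hLe : L ⊆ e.source) {F : Cn n → ℂ}
    (hF : ContinuousOn F (e.target ∩ e.symm ⁻¹' A))
    (h0 : ∀ y ∈ e.target ∩ e.symm ⁻¹' A, e.symm y ∉ L → F y = 0) :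
    IntegrableOn F (e.target ∩ e.symm ⁻¹' A) := by
  have hc : IsCompact (e '' (A ∩ L)) :=
    (hL.inter_left hA).image_of_continuousOn (e.continuousOn.mono fun x hx => hLe hx.2)
  have hsub : e '' (A ∩ L) ⊆ e.target ∩ e.symm ⁻¹' A := by
    rintro _ ⟨x, hx, rfl⟩
    refine ⟨e.map_source (hLe hx.2), ?_⟩
    rw [mem_preimage, e.left_inv (hLe hx.2)]
    exact hx.1
  refine IntegrableOn.of_forall_sdiff_eq_zero ((hF.mono hsub).integrableOn_compact hc)
    (measurableSet_coord e hA) ?_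
  rintro y ⟨hy, hy'⟩
  refine h0 y hy fun hl => hy' ⟨e.symm y, ⟨hy.2, hl⟩, e.right_inv hy.1⟩

variable [ChartedSpace (Cn n) X]

theorem continuousOn_wedgeConjDensity [IsManifold 𝓘(ℂ, Cn n) ω X] {U A : Set X} (hU : IsOpen U) (hAU : A ⊆ U)
    {a b : PForm n n X} (ha : a.SmoothOn U) (hb : b.SmoothOn U) {e : OpenPartialHomeomorph X (Cn n)}
    (he : e ∈ holoAtlas n X) :
    ContinuousOn (fun y => wedgeConjDensity (a.inCoord e y) (b.inCoord e y))
      (e.target ∩ e.symm ⁻¹' A) := by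
  intro y hy
  have hx := e.map_target hy.1
  have hUx : U ∈ 𝓝 (e.symm y) := hU.mem_nhds (hAU hy.2)
  have h1 := ha.contDiffAt hUx he hx
  have h2 := hb.contDiffAt hUx he hx
  rw [e.right_inv hy.1] at h1 h2
  exact (h1.wedgeConjDensity h2).continuousAt.continuousWithinAt

/-- Change of charts for one term of the integral. -/
theorem integral_coord_change {e c : OpenPartialHomeomorph X (Cn n)} (he : e ∈ holoAtlas n X)
    (hc : c ∈ holoAtlas n X) {A : Set X} (hA : IsClosed A) (u : X → ℂ) (a b : PForm n n X) :
    ∫ y in c.target ∩ c.symm ⁻¹' (A ∩ e.source),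
      u (c.symm y) * wedgeConjDensity (a.inCoord c y) (b.inCoord c y) =
    ∫ y in e.target ∩ e.symm ⁻¹' (A ∩ c.source),
      u (e.symm y) * wedgeConjDensity (a.inCoord e y) (b.inCoord e y) := by
  set T := e.target ∩ e.symm ⁻¹' (A ∩ c.source) with hT
  have hTm : MeasurableSet T := by
    have : T = (e.target ∩ e.symm ⁻¹' A) ∩ (e.target ∩ e.symm ⁻¹' c.source) := by
      rw [hT]; ext y; simp only [mem_inter_iff, mem_preimage]; tauto
    rw [this]
    exact (measurableSet_coord e hA).inter
      (e.symm.isOpen_inter_preimage c.open_source).measurableSet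
  have himg : c.target ∩ c.symm ⁻¹' (A ∩ e.source) = (c ∘ e.symm) '' T := by
    ext y
    constructor
    · rintro ⟨hy, hyA, hye⟩
      refine ⟨e (c.symm y), ⟨e.map_source hye, ?_⟩, ?_⟩
      · rw [mem_preimage, e.left_inv hye]
        exact ⟨hyA, c.map_target hy⟩
      · rw [Function.comp_apply, e.left_inv hye, c.right_inv hy]
    · rintro ⟨z, ⟨hz, hzA, hzc⟩, rfl⟩
      refine ⟨c.map_source hzc, ?_⟩
      rw [mem_preimage, Function.comp_apply, c.left_inv hzc]
      exact ⟨hzA, e.map_target hz⟩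
  have hinj : InjOn (c ∘ e.symm) T := by
    intro z hz z' hz' h
    have := c.injOn hz.2.2 hz'.2.2 h
    exact e.symm.injOn hz.1 hz'.1 this
  have hder : ∀ z ∈ T, HasFDerivWithinAt (c ∘ e.symm)
      ((fderiv ℂ (c ∘ e.symm) z).restrictScalars ℝ) T z := fun z hz =>
    (((contDiffAt_transition hc he hz.1 hz.2.2).differentiableAt
      (by simp)).hasFDerivAt.restrictScalars ℝ).hasFDerivWithinAt
  rw [himg, integral_image_eq_integral_abs_det_fderiv_smul volume hTm hder hinj]
  refine setIntegral_congr_fun hTm fun z hz => ?_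
  have h1 := PForm.inCoord_transition (α := a) hc he hz.1 hz.2.2
  have h2 := PForm.inCoord_transition (α := b) hc he hz.1 hz.2.2
  simp only [h1, h2, wedgeConjDensity_comp, Function.comp_apply, c.left_inv hz.2.2]
  rw [mul_smul_comm]

variable [T2Space X] [SigmaCompactSpace X] [IsManifold 𝓘(ℂ, Cn n) ω X]

theorem chartPartition_subordinate (i : X) :
    tsupport (chartPartition n X i) ⊆ (chartAt (Cn n) i).source :=
  haveI : IsManifold 𝓘(ℝ, Cn n) ∞ X := isManifold_real
  Classical.choose_spec
    (SmoothPartitionOfUnity.exists_isSubordinate_chartAt_source 𝓘(ℝ, Cn n) X) i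

theorem chartPartition_finite {K : Set X} (hK : IsCompact K) :
    {i : X | (Function.support (chartPartition n X i) ∩ K).Nonempty}.Finite :=
  (chartPartition n X).locallyFinite.finite_nonempty_inter_compact hK

theorem continuousOn_chartPartition (i : X) (e : OpenPartialHomeomorph X (Cn n)) (A : Set X) :
    ContinuousOn (fun y => ((chartPartition n X i (e.symm y) : ℝ) : ℂ))
      (e.target ∩ e.symm ⁻¹' A) :=
  Complex.continuous_ofReal.comp_continuousOn
    ((chartPartition n X i).2.continuous.comp_continuousOn
      (e.symm.continuousOn.mono inter_subset_left))

theorem integralWedgeConj_term_eq_zero {A K : Set X} {a b : PForm n n X}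
    (h0 : ∀ x ∈ A, x ∉ K → a x = 0) {i : X}
    (hi : ¬ (Function.support (chartPartition n X i) ∩ K).Nonempty) :
    ∫ y in (chartAt (Cn n) i).target ∩ (chartAt (Cn n) i).symm ⁻¹' A,
      ((chartPartition n X i ((chartAt (Cn n) i).symm y) : ℝ) : ℂ) *
      wedgeConjDensity (a.inChart i y) (b.inChart i y) = 0 := by
  refine setIntegral_eq_zero_of_forall_eq_zero fun y hy => ?_
  by_cases hK : (chartAt (Cn n) i).symm y ∈ K
  · have : chartPartition n X i ((chartAt (Cn n) i).symm y) = 0 := by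
      by_contra h
      exact hi ⟨_, h, hK⟩
    simp [this]
  · have : a.inChart i y = 0 := by
      rw [PForm.inChart_eq_inCoord, PForm.inCoord, h0 _ hy.2 hK]; rfl
    rw [this, wedgeConjDensity_zero_left, mul_zero]

theorem integralWedgeConj_eq_sum {A K : Set X} (hK : IsCompact K) {a b : PForm n n X}
    (h0 : ∀ x ∈ A, x ∉ K → a x = 0) :
    integralWedgeConj A a b = ∑ i ∈ (chartPartition_finite (n := n) hK).toFinset,
      ∫ y in (chartAt (Cn n) i).target ∩ (chartAt (Cn n) i).symm ⁻¹' A,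
        ((chartPartition n X i ((chartAt (Cn n) i).symm y) : ℝ) : ℂ) *
        wedgeConjDensity (a.inChart i y) (b.inChart i y) := by
  refine finsum_eq_sum_of_support_subset _ fun i hi => ?_
  simp only [Finite.coe_toFinset, mem_ofPred_eq]
  by_contra h
  exact hi (integralWedgeConj_term_eq_zero h0 h)

/-- Smoothness is asked only on an open `U ⊇ A`: the forms are singular along `D`, and `A` is `{ε ≤
λ}` with `U = Dᶜ`. On `D` itself both sets are everything. Compactness of `K` provides integrability
and a common finite range of summation. -/
theorem integralWedgeConj_sum {U A K : Set X} (hA : IsClosed A) (hU : IsOpen U) (hAU : A ⊆ U)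
    (hK : IsCompact K) {J : Type*} (s : Finset J) {a : J → PForm n n X} {b : PForm n n X}
    (ha : ∀ j ∈ s, (a j).SmoothOn U) (hb : b.SmoothOn U)
    (h0 : ∀ j ∈ s, ∀ x ∈ A, x ∉ K → a j x = 0) :
    integralWedgeConj A (fun x => ∑ j ∈ s, a j x) b = ∑ j ∈ s, integralWedgeConj A (a j) b := by
  have h1 : ∀ x ∈ A, x ∉ K → ∑ j ∈ s, a j x = 0 := fun x hx hxK =>
    Finset.sum_eq_zero fun j hj => h0 j hj x hx hxK
  rw [integralWedgeConj_eq_sum hK h1, Finset.sum_congr rfl fun j hj =>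
    integralWedgeConj_eq_sum (b := b) hK (h0 j hj), Finset.sum_comm]
  refine Finset.sum_congr rfl fun i _ => ?_
  rw [← integral_finsetSum]
  · congr 1
    funext y
    rw [← Finset.mul_sum]
    congr 1
    simp_rw [wedgeConjDensity_eq, ← Finset.sum_mul]
    congr 2
    simp only [topCoef, PForm.inChart]
    change (∑ j ∈ s, a j ((chartAt (Cn n) i).symm y)) _ = _
    rw [ContinuousAlternatingMap.sum_apply]
    rfl
  · intro j hj
    have hL : IsCompact (tsupport (chartPartition n X i) ∩ K) := hK.inter_left (isClosed_tsupport _)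
    refine integrableOn_coord (chartAt (Cn n) i) hA hL
      (inter_subset_left.trans (chartPartition_subordinate i)) ?_ ?_
    · exact (continuousOn_chartPartition i _ A).mul
        (continuousOn_wedgeConjDensity hU hAU (ha j hj) hb (chart_mem_holoAtlas i))
    · intro y hy hyL
      by_cases hyK : (chartAt (Cn n) i).symm y ∈ K
      · have : chartPartition n X i ((chartAt (Cn n) i).symm y) = 0 := by
          by_contra h
          exact hyL ⟨subset_tsupport _ h, hyK⟩
        simp [this]
      · have : (a j).inChart i y = 0 := by
          rw [PForm.inChart_eq_inCoord, PForm.inCoord, h0 j hj _ hy.2 hyK]; rfl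
        rw [this, wedgeConjDensity_zero_left, mul_zero]

theorem integralWedgeConj_congr {A : Set X} {a a' b b' : PForm n n X} (ha : ∀ x ∈ A, a x = a' x)
    (hb : ∀ x ∈ A, b x = b' x) (hA : IsClosed A) :
    integralWedgeConj A a b = integralWedgeConj A a' b' := by
  unfold integralWedgeConj
  refine finsum_congr fun i => setIntegral_congr_fun (measurableSet_coord _ hA) fun y hy => ?_
  simp only [PForm.inChart, ha _ hy.2, hb _ hy.2]

/-- The integral of a form supported in one holomorphic chart. -/
theorem integralWedgeConj_eq_integral_coord {e : OpenPartialHomeomorph X (Cn n)}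
    (he : e ∈ holoAtlas n X) {U A K : Set X} (hA : IsClosed A) (hU : IsOpen U) (hAU : A ⊆ U)
    (hK : IsCompact K) (hKe : K ⊆ e.source) {a b : PForm n n X} (ha : a.SmoothOn U)
    (hb : b.SmoothOn U) (h0 : ∀ x ∈ A, x ∉ K → a x = 0) :
    integralWedgeConj A a b = ∫ y in e.target ∩ e.symm ⁻¹' A,
      wedgeConjDensity (a.inCoord e y) (b.inCoord e y) := by
  have hz : ∀ (c : OpenPartialHomeomorph X (Cn n)) y, c.symm y ∈ A → c.symm y ∉ K →
      a.inCoord c y = 0 := by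
    intro c y hy hyK
    rw [PForm.inCoord, h0 _ hy hyK]; rfl
  -- Each term is moved from its own chart to `e`. Outside the overlap it vanishes on one side by
  -- the support of the form, on the other by the support of the partition function.
  have hterm : ∀ i : X, ∫ y in (chartAt (Cn n) i).target ∩ (chartAt (Cn n) i).symm ⁻¹' A,
      ((chartPartition n X i ((chartAt (Cn n) i).symm y) : ℝ) : ℂ) *
        wedgeConjDensity (a.inChart i y) (b.inChart i y) =
      ∫ y in e.target ∩ e.symm ⁻¹' A, ((chartPartition n X i (e.symm y) : ℝ) : ℂ) *
        wedgeConjDensity (a.inCoord e y) (b.inCoord e y) := by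
    intro i
    set c := chartAt (Cn n) i with hc
    have h1 := integral_coord_change he (chart_mem_holoAtlas i) hA
      (fun x => ((chartPartition n X i x : ℝ) : ℂ)) a b
    rw [setIntegral_eq_of_subset_of_forall_sdiff_eq_zero (s := c.target ∩ c.symm ⁻¹' (A ∩ e.source))
      (measurableSet_coord c hA), setIntegral_eq_of_subset_of_forall_sdiff_eq_zero
      (s := e.target ∩ e.symm ⁻¹' (A ∩ c.source)) (measurableSet_coord e hA)]
    · exact h1
    · exact fun y hy => ⟨hy.1, hy.2.1⟩
    · rintro y ⟨hy, hy'⟩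
      have : chartPartition n X i (e.symm y) = 0 := by
        by_contra h
        exact hy' ⟨hy.1, hy.2, chartPartition_subordinate i (subset_tsupport _ h)⟩
      simp [this]
    · exact fun y hy => ⟨hy.1, hy.2.1⟩
    · rintro y ⟨hy, hy'⟩
      have : c.symm y ∉ K := fun h => hy' ⟨hy.1, hy.2, hKe h⟩
      rw [PForm.inChart_eq_inCoord, ← hc, hz c y hy.2 this, wedgeConjDensity_zero_left, mul_zero]
  rw [integralWedgeConj_eq_sum hK h0, Finset.sum_congr rfl fun i _ => hterm i,
    ← integral_finsetSum]
  · refine setIntegral_congr_fun (measurableSet_coord e hA) fun y hy => ?_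
    rw [← Finset.sum_mul]
    by_cases hyK : e.symm y ∈ K
    · have h1 := (chartPartition n X).sum_eq_one (mem_univ (e.symm y))
      rw [finsum_eq_sum_of_support_subset (s := (chartPartition_finite (n := n) hK).toFinset)] at h1
      · rw [← Complex.ofReal_sum, h1, Complex.ofReal_one, one_mul]
      · intro i hi
        simp only [Finite.coe_toFinset, mem_ofPred_eq]
        exact ⟨_, hi, hyK⟩
    · rw [hz e y hy.2 hyK, wedgeConjDensity_zero_left, mul_zero]
  · intro i _
    refine integrableOn_coord e hA hK hKe ((continuousOn_chartPartition i e A).mul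
      (continuousOn_wedgeConjDensity hU hAU ha hb he)) fun y hy hyK => ?_
    rw [hz e y hy.2 hyK, wedgeConjDensity_zero_left, mul_zero]

end IntegralCoord

end

noncomputable section

/-! ### Division of a function by a coordinate. -/

section Division

open Filter Set MeasureTheory

variable {d : ℕ}

theorem norm_update_sub_le {y p : Cn (d + 1)} (hp : p 0 = 0) {r : ℝ} (hy : ‖y - p‖ < r) {w : ℂ}
    (hw : ‖w‖ < r) : ‖Function.update y 0 w - p‖ < r := by
  have hr : 0 < r := (norm_nonneg _).trans_lt hy
  rw [pi_norm_lt_iff hr] at hy ⊢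
  intro i
  rcases eq_or_ne i 0 with rfl | hi
  · simpa [hp] using hw
  · simpa [hi] using hy i

/-- A holomorphic function vanishing on `z₀ = 0` is divisible by `z₀` among smooth functions. -/
theorem exists_eq_coord_mul {F : Cn (d + 1) → ℂ} {p : Cn (d + 1)} (hF : ContDiffAt ℂ ω F p)
    (hp : p 0 = 0) (h0 : ∀ᶠ y in 𝓝 p, y 0 = 0 → F y = 0) (hd : fderiv ℂ F p ≠ 0) :
    ∃ (u : Cn (d + 1) → ℂ) (V : Set (Cn (d + 1))), IsOpen V ∧ p ∈ V ∧ ContDiffOn ℝ ∞ u V ∧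
      ∀ y ∈ V, u y ≠ 0 ∧ F y = y 0 * u y := by
  obtain ⟨r, hr, hball⟩ := Metric.eventually_nhds_iff.1 ((hF.eventually (by simp)).and h0)
  have hball' : ∀ y, ‖y - p‖ < r → ContDiffAt ℂ ω F y ∧ (y 0 = 0 → F y = 0) := fun y hy =>
    hball (by rwa [dist_eq_norm])
  -- The quotient is `u(y) = ∫₀¹ (∂F/∂z₀)(t z₀, z') dt`. To get its smoothness in `y`, it is written
  -- as the convolution at `0` of the indicator of `[0, 1]` with a compactly supported smooth
  -- family; `χ` supplies the support and is `1` where the indicator lives.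
  let χ : ContDiffBump (0 : ℝ) := ⟨1, 2, one_pos, one_lt_two⟩
  let g : Cn (d + 1) → ℝ → ℂ := fun y s =>
    χ s • fderiv ℂ F (Function.update y 0 (-s • y 0)) (Pi.single 0 1)
  let f : ℝ → ℝ := (Icc (0 : ℝ) 1).indicator 1
  let u : Cn (d + 1) → ℂ := fun y => ∫ t in (0 : ℝ)..1,
    fderiv ℂ F (Function.update y 0 (t • y 0)) (Pi.single 0 1)
  -- The support of `χ` is `|t| ≤ 2`; allowing `|t| < 3` leaves an open margin, and the radius `r /
  -- 3` keeps `t z₀` within `r`.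
  have hnear : ∀ y, ‖y - p‖ < r / 3 → ∀ t : ℝ, |t| < 3 →
      ‖Function.update y 0 (t • y 0) - p‖ < r := by
    intro y hy t ht
    refine norm_update_sub_le hp (by linarith) ?_
    rw [norm_smul, Real.norm_eq_abs]
    have h1 : ‖y 0‖ ≤ ‖y - p‖ := by simpa [hp] using norm_le_pi_norm (y - p) 0
    have := abs_nonneg t
    have := norm_nonneg (y 0)
    nlinarith
  have hconv : ∀ y, (MeasureTheory.convolution f (g y) (ContinuousLinearMap.lsmul ℝ ℝ) volume) 0
      = u y := by
    intro y
    rw [MeasureTheory.convolution]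
    have : ∀ t : ℝ, (ContinuousLinearMap.lsmul ℝ ℝ) (f t) (g y (0 - t)) =
        (Icc (0 : ℝ) 1).indicator (fun t => fderiv ℂ F (Function.update y 0 (t • y 0))
          (Pi.single 0 1)) t := by
      intro t
      by_cases ht : t ∈ Icc (0 : ℝ) 1
      · have h1 : χ (-t) = 1 := χ.one_of_mem_closedBall (by
          rw [Metric.mem_closedBall, Real.dist_eq, sub_zero, abs_neg, abs_of_nonneg ht.1]
          exact ht.2)
        simp only [f, g, indicator_of_mem ht, h1, ContinuousLinearMap.lsmul_apply, Pi.one_apply,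
          one_smul, zero_sub, neg_neg]
      · simp only [f, indicator_of_notMem ht, ContinuousLinearMap.lsmul_apply, zero_smul]
    simp_rw [this]
    rw [integral_indicator measurableSet_Icc, integral_Icc_eq_integral_Ioc,
      ← intervalIntegral.integral_of_le zero_le_one]
  have hsm : ContDiffOn ℝ ((⊤ : ℕ∞) : WithTop ℕ∞) u (Metric.ball p (r / 3)) := by
    have hg : ContDiffOn ℝ ((⊤ : ℕ∞) : WithTop ℕ∞) ↿g (Metric.ball p (r / 3) ×ˢ univ) := by
      rintro ⟨y, t⟩ ⟨hy, -⟩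
      rw [Metric.mem_ball, dist_eq_norm] at hy
      refine ContDiffAt.contDiffWithinAt ?_
      by_cases ht : |t| < 3
      · have h1 : ContDiffAt ℂ ω F (Function.update y 0 (-t • y 0)) :=
          (hball' _ (hnear y hy (-t) (by rwa [abs_neg]))).1
        have h2 : ContDiffAt ℂ ω (fun z => fderiv ℂ F z (Pi.single 0 1))
            (Function.update y 0 (-t • y 0)) :=
          (h1.fderiv_right (m := ω) le_rfl).clm_apply contDiffAt_const
        have h3 : ContDiffAt ℝ ∞ (fun q : Cn (d + 1) × ℝ =>
            (Function.update q.1 0 (-q.2 • q.1 0) : Cn (d + 1))) (y, t) := by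
          rw [contDiffAt_pi]
          intro i
          rcases eq_or_ne i 0 with rfl | hi
          · simp only [Function.update_self]; fun_prop
          · simp only [Function.update_of_ne hi]; fun_prop
        have h4 := ((h2.restrict_scalars ℝ).of_le (m := ∞) le_top).comp (y, t) h3
        have h5 : ContDiffAt ℝ ∞ (fun q : Cn (d + 1) × ℝ => χ q.2) (y, t) :=
          χ.contDiff.contDiffAt.comp (y, t) contDiffAt_snd
        exact h5.smul h4
      · have h1 : ∀ᶠ q : Cn (d + 1) × ℝ in 𝓝 (y, t), ↿g q = 0 := by
          have : ∀ᶠ q : Cn (d + 1) × ℝ in 𝓝 (y, t), 2 < |q.2| :=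
            (continuous_abs.comp continuous_snd).continuousAt.eventually
              (lt_mem_nhds (by simp only [Function.comp_apply]; linarith))
          filter_upwards [this] with q hq
          have : χ q.2 = 0 := χ.zero_of_le_dist (by rw [Real.dist_eq, sub_zero]; exact hq.le)
          simp [Function.HasUncurry.uncurry, g, this]
        exact (contDiffAt_const (c := (0 : ℂ))).congr_of_eventuallyEq h1
    have hf : LocallyIntegrable f volume :=
      ((integrable_indicator_iff measurableSet_Icc).2
        (continuous_one.integrableOn_Icc)).locallyIntegrable
    have := contDiffOn_convolution_right_with_param_comp (ContinuousLinearMap.lsmul ℝ ℝ)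
      (v := fun _ : Cn (d + 1) => (0 : ℝ)) contDiffOn_const (f := f) (g := g) (μ := volume)
      (n := ⊤) (k := Metric.closedBall (0 : ℝ) 2) (s := Metric.ball p (r / 3)) Metric.isOpen_ball
      (isCompact_closedBall _ _) (fun y s _ hs => by
        have : χ s = 0 := χ.zero_of_le_dist (by
          rw [Metric.mem_closedBall, not_le] at hs; exact hs.le)
        simp [g, this]) hf hg
    exact this.congr fun y _ => (hconv y).symm
  have hu : ContDiffAt ℝ ∞ u p := hsm.contDiffAt (Metric.ball_mem_nhds p (by linarith))
  have hFu : ∀ᶠ y in 𝓝 p, F y = y 0 * u y := by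
    filter_upwards [Metric.ball_mem_nhds p (show 0 < r / 3 by linarith)] with y hy
    rw [Metric.mem_ball, dist_eq_norm] at hy
    have hder : ∀ t ∈ uIcc (0 : ℝ) 1, HasDerivAt (fun t : ℝ => F (Function.update y 0 (t • y 0)))
        (y 0 * fderiv ℂ F (Function.update y 0 (t • y 0)) (Pi.single 0 1)) t := by
      intro t ht
      rw [uIcc_of_le zero_le_one] at ht
      have h1 := ((hball' _ (hnear y hy t (by rw [abs_of_nonneg ht.1]; linarith [ht.2]))).1
        |>.differentiableAt (by simp)).hasFDerivAt.restrictScalars ℝ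
      have h2 : HasDerivAt (fun t : ℝ => (Function.update y 0 (t • y 0) : Cn (d + 1)))
          (Pi.single 0 (y 0)) t := by
        rw [hasDerivAt_pi]
        intro i
        rcases eq_or_ne i 0 with rfl | hi
        · simp only [Function.update_self, Pi.single_eq_same]
          simpa using (hasDerivAt_id t).smul_const (y 0)
        · simp only [Function.update_of_ne hi, Pi.single_eq_of_ne hi]
          exact hasDerivAt_const _ _
      have h3 := h1.comp_hasDerivAt t h2
      have h4 : (Pi.single 0 (y 0) : Cn (d + 1)) = y 0 • Pi.single 0 1 := by
        rw [← Pi.single_smul, smul_eq_mul, mul_one]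
      have h5 : fderiv ℂ F (Function.update y 0 (t • y 0)) (Pi.single 0 (y 0)) =
          y 0 * fderiv ℂ F (Function.update y 0 (t • y 0)) (Pi.single 0 1) := by
        rw [h4, map_smul, smul_eq_mul]
      rw [← h5]
      exact h3
    have hcont : ContinuousOn (fun t : ℝ => y 0 * fderiv ℂ F (Function.update y 0 (t • y 0))
        (Pi.single 0 1)) (uIcc 0 1) := by
      intro t ht
      rw [uIcc_of_le zero_le_one] at ht
      have h1 := (hball' _ (hnear y hy t (by rw [abs_of_nonneg ht.1]; linarith [ht.2]))).1
      have h2 := ((h1.fderiv_right (m := ω) le_rfl).clm_apply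
        (contDiffAt_const (c := (Pi.single 0 1 : Cn (d + 1))))).continuousAt
      have h3 : ContinuousAt (fun t : ℝ => (Function.update y 0 (t • y 0) : Cn (d + 1))) t := by
        fun_prop
      exact (continuousAt_const.mul
        (ContinuousAt.comp (g := fun z => fderiv ℂ F z (Pi.single 0 1))
          (f := fun t : ℝ => (Function.update y 0 (t • y 0) : Cn (d + 1))) h2 h3)).continuousWithinAt
    have h := intervalIntegral.integral_eq_sub_of_hasDerivAt hder hcont.intervalIntegrable
    rw [intervalIntegral.integral_const_mul] at h
    have hz : F (Function.update y 0 ((0 : ℝ) • y 0)) = 0 :=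
      (hball' _ (hnear y hy 0 (by norm_num))).2 (by simp)
    rw [hz, sub_zero, one_smul, Function.update_eq_self] at h
    exact h.symm
  suffices hup : u p ≠ 0 by
    have h1 := (hFu.and (hu.continuousAt.eventually_ne hup)).and
      (Metric.ball_mem_nhds p (show 0 < r / 3 by linarith))
    obtain ⟨V, hVs, hV, hpV⟩ := eventually_nhds_iff.1 h1
    exact ⟨u, V, hV, hpV, hsm.mono fun y hy => (hVs y hy).2,
      fun y hy => ⟨(hVs y hy).1.2, (hVs y hy).1.1⟩⟩
  -- At `p` both factors of `z₀ u` would vanish, hence so would the differential of `F`.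
  refine fun hup => hd ?_
  have h1 : HasFDerivAt (𝕜 := ℝ) (fun y : Cn (d + 1) => y 0)
      (ContinuousLinearMap.proj (R := ℝ) (φ := fun _ : Fin (d + 1) => ℂ) 0) p :=
    (ContinuousLinearMap.proj (R := ℝ) (φ := fun _ : Fin (d + 1) => ℂ) 0).hasFDerivAt
  have h2 := (h1.mul (hu.differentiableAt (by simp)).hasFDerivAt).congr_of_eventuallyEq hFu
  have h3 := (hF.differentiableAt (by simp)).hasFDerivAt.restrictScalars ℝ
  have h4 := h3.unique h2
  ext v
  have h5 := DFunLike.congr_fun h4 v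
  simpa [hp, hup] using! h5

end Division

end

noncomputable section

/-! ### Criteria for being a holomorphic chart. -/

section Charts

open Filter Set

variable {n : ℕ} {X : Type*} [TopologicalSpace X] {e : OpenPartialHomeomorph X (Cn n)}

theorem exists_continuousLinearEquiv_of_injective (A : Cn n →L[ℂ] Cn n)
    (hA : Function.Injective A) : ∃ L : Cn n ≃L[ℂ] Cn n, (L : Cn n →L[ℂ] Cn n) = A :=
  ⟨(LinearEquiv.ofInjectiveEndo A.toLinearMap hA).toContinuousLinearEquiv, by ext; rfl⟩

variable [ChartedSpace (Cn n) X]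

variable [IsManifold 𝓘(ℂ, Cn n) ω X]

theorem restrOpen_mem_holoAtlas (he : e ∈ holoAtlas n X) {W : Set X} (hW : IsOpen W) :
    e.restrOpen W hW ∈ holoAtlas n X := by
  refine OpenPartialHomeomorph.mem_maximalAtlas_of_contMDiffOn _ ?_ ?_
  · exact (contMDiffOn_of_mem_maximalAtlas he).mono inter_subset_left
  · exact (contMDiffOn_symm_of_mem_maximalAtlas he).mono inter_subset_left

theorem exists_restrOpen_mem_holoAtlas {x : X} (hx : x ∈ e.source)
    (h : ContMDiffAt 𝓘(ℂ, Cn n) 𝓘(ℂ, Cn n) ω e x)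
    (h' : ContMDiffAt 𝓘(ℂ, Cn n) 𝓘(ℂ, Cn n) ω e.symm (e x)) :
    ∃ (W : Set X) (hW : IsOpen W), x ∈ W ∧ e.restrOpen W hW ∈ holoAtlas n X := by
  have h2 := (contMDiffAt_iff_contMDiffAt_nhds (by simp)).1 h'
  have h3 := ((e.continuousAt hx).eventually h2).and
    ((contMDiffAt_iff_contMDiffAt_nhds (by simp)).1 h)
  obtain ⟨W, hWs, hW, hxW⟩ := eventually_nhds_iff.1 h3
  refine ⟨W, hW, hxW, OpenPartialHomeomorph.mem_maximalAtlas_of_contMDiffOn _ ?_ ?_⟩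
  · rintro z ⟨-, hz⟩
    exact (hWs z hz).2.contMDiffWithinAt
  · rintro y ⟨hy, hyW⟩
    have := (hWs _ hyW).1
    rw [e.right_inv hy] at this
    exact this.contMDiffWithinAt

/-- A local homeomorphism to coordinate space which is holomorphic with injective differential is
a holomorphic chart. -/
theorem mem_holoAtlas_of_injective (h : ContMDiffOn 𝓘(ℂ, Cn n) 𝓘(ℂ, Cn n) ω e e.source)
    (hinj : ∀ x ∈ e.source, Function.Injective (tangentCLM n n e x)) : e ∈ holoAtlas n X := by
  refine OpenPartialHomeomorph.mem_maximalAtlas_of_contMDiffOn _ h fun y hy => ?_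
  refine ContMDiffAt.contMDiffWithinAt ?_
  set x := e.symm y with hx
  have hxe : x ∈ e.source := e.map_target hy
  set c := chartAt (Cn n) x with hc
  have hcm : c ∈ holoAtlas n X := chart_mem_holoAtlas x
  have hxc : x ∈ c.source := mem_chart_source _ x
  -- Passing to a chart `c` turns the claim into the holomorphic inverse function theorem on
  -- coordinate space.
  set Φ := c.symm.trans e with hΦ
  have hyt : y ∈ Φ.target := by
    rw [hΦ, OpenPartialHomeomorph.trans_target]
    exact ⟨hy, hxc⟩
  have hΦs : Φ.symm y = c x := rfl
  have hcx : c.symm (c x) = x := c.left_inv hxc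
  have hecm : ContMDiffAt 𝓘(ℂ, Cn n) 𝓘(ℂ, Cn n) ω e (c.symm (c x)) := by
    rw [hcx]; exact h.contMDiffAt (e.open_source.mem_nhds hxe)
  have hΦd : ContDiffAt ℂ ω Φ (Φ.symm y) := by
    rw [← contMDiffAt_iff_contDiffAt, hΦs]
    exact hecm.comp (c x) (contMDiffAt_symm_of_mem_maximalAtlas hcm (c.map_source hxc))
  have hder : fderiv ℂ Φ (Φ.symm y) =
      tangentCLM n n e x ∘L tangentCLM n n c.symm (c x) := by
    have := tangentCLM_comp (hecm.mdifferentiableAt (by simp))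
      (mdifferentiableAt_symm_of_mem_holoAtlas hcm (c.map_source hxc))
    rw [hcx] at this
    rw [← this, tangentCLM_eq_fderiv]; rfl
  have hinj' : Function.Injective (fderiv ℂ Φ (Φ.symm y)) := by
    rw [hder]
    refine (hinj x hxe).comp (Function.LeftInverse.injective (g := tangentCLM n n c x) fun v => ?_)
    exact DFunLike.congr_fun (tangentCLM_comp_symm hcm hxc) v
  obtain ⟨L, hLe⟩ := exists_continuousLinearEquiv_of_injective _ hinj'
  have hL : HasFDerivAt Φ (L : Cn n →L[ℂ] Cn n) (Φ.symm y) := by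
    rw [hLe]; exact (hΦd.differentiableAt (by simp)).hasFDerivAt
  have hs : ContDiffAt ℂ ω Φ.symm y := Φ.contDiffAt_symm hyt hL hΦd
  have hcomp : ContMDiffAt 𝓘(ℂ, Cn n) 𝓘(ℂ, Cn n) ω (c.symm ∘ Φ.symm) y :=
    ContMDiffAt.comp y (by
      rw [hΦs]; exact contMDiffAt_symm_of_mem_maximalAtlas hcm (c.map_source hxc)) hs.contMDiffAt
  refine hcomp.congr_of_eventuallyEq ?_
  filter_upwards [Φ.open_target.mem_nhds hyt] with z hz
  rw [hΦ, OpenPartialHomeomorph.trans_target] at hz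
  exact (c.left_inv hz.2).symm

end Charts

/-! ### Charts that straighten the hypersurface. -/

section Adapted

open Filter Set

variable {d : ℕ} {X : Type*} [TopologicalSpace X] [ChartedSpace (Cn (d + 1)) X]

/-- A holomorphic chart in which the hypersurface `D` is given by `z₀ = 0`. -/
structure IsAdapted (D : Set X) (e : OpenPartialHomeomorph X (Cn (d + 1))) : Prop where
  mem : e ∈ holoAtlas (d + 1) X
  mem_iff : ∀ x ∈ e.source, x ∈ D ↔ e x 0 = 0

variable {D : Set X} {e : OpenPartialHomeomorph X (Cn (d + 1))}

theorem IsAdapted.restrOpen [IsManifold 𝓘(ℂ, Cn (d + 1)) ω X] (he : IsAdapted D e) {W : Set X}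
    (hW : IsOpen W) : IsAdapted D (e.restrOpen W hW) :=
  ⟨restrOpen_mem_holoAtlas he.mem hW, fun x hx => he.mem_iff x hx.1⟩

theorem IsAdapted.symm_mem_iff (he : IsAdapted D e) {y : Cn (d + 1)} (hy : y ∈ e.target) :
    e.symm y ∈ D ↔ y 0 = 0 := by
  rw [he.mem_iff _ (e.map_target hy), e.right_inv hy]

theorem IsAdapted.isLocalEquation (he : IsAdapted D e) :
    IsLocalEquation (n := d + 1) D e.source (fun x => e x 0) := by
  have hpr : ContDiff ℂ ω (fun y : Cn (d + 1) => y 0) := contDiff_apply ℂ ℂ 0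
  refine ⟨e.open_source, ?_, he.mem_iff, ?_⟩
  · exact hpr.contMDiff.comp_contMDiffOn (contMDiffOn_of_mem_maximalAtlas he.mem)
  · intro x hx _ h
    have h1 := mfderiv_comp x (I := 𝓘(ℂ, Cn (d + 1))) (I' := 𝓘(ℂ, Cn (d + 1))) (I'' := 𝓘(ℂ, ℂ))
      (g := fun y : Cn (d + 1) => y 0) (f := e)
      (hpr.differentiable (by simp)).differentiableAt.mdifferentiableAt
      (mdifferentiableAt_of_mem_holoAtlas he.mem hx)
    have h2 : (fderiv ℂ (fun y : Cn (d + 1) => y 0) (e x)) =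
        ContinuousLinearMap.proj (R := ℂ) (φ := fun _ : Fin (d + 1) => ℂ) 0 :=
      (ContinuousLinearMap.proj (R := ℂ) (φ := fun _ : Fin (d + 1) => ℂ) 0).hasFDerivAt.fderiv
    rw [mfderiv_eq_fderiv, h2] at h1
    have h3 : ∀ v : Cn (d + 1), (tangentCLM (d + 1) (d + 1) e x v) 0 = 0 := by
      intro v
      have := DFunLike.congr_fun (h1.symm.trans h) v
      exact this
    have h4 := DFunLike.congr_fun (tangentCLM_comp_symm he.mem hx) (Pi.single 0 1)
    have h5 := h3 (tangentCLM (d + 1) (d + 1) e.symm (e x) (Pi.single 0 1))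
    have h6 : (Pi.single 0 1 : Cn (d + 1)) 0 = 0 := by
      rw [← h5]; exact (congrFun h4 0).symm
    simp at h6

variable [IsManifold 𝓘(ℂ, Cn (d + 1)) ω X]

/-- The coordinate change replacing the `j`-th coordinate by the function `g`, which is put first. -/
def straighten (j : Fin (d + 1)) (g : Cn (d + 1) → ℂ) (y : Cn (d + 1)) : Cn (d + 1) :=
  Fin.cons (g y) fun i => y (j.succAbove i)

/-- With `∂g/∂z_j(p) ≠ 0`, replacing the `j`-th coordinate by `g` has injective differential at `p`,
and the inverse function theorem applies. -/
theorem exists_straighten {g : Cn (d + 1) → ℂ} {p : Cn (d + 1)} (hg : ContDiffAt ℂ ω g p)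
    (hd : fderiv ℂ g p ≠ 0) : ∃ Φ : OpenPartialHomeomorph (Cn (d + 1)) (Cn (d + 1)),
      p ∈ Φ.source ∧ ContDiffAt ℂ ω Φ p ∧ ContDiffAt ℂ ω Φ.symm (Φ p) ∧ ∀ y, Φ y 0 = g y := by
  obtain ⟨j, hj⟩ : ∃ j, fderiv ℂ g p (Pi.single j 1) ≠ 0 := by
    by_contra! h
    refine hd (ContinuousLinearMap.coe_injective ((Pi.basisFun ℂ (Fin (d + 1))).ext fun j => ?_))
    simpa using h j
  have hs : ContDiffAt ℂ ω (straighten j g) p := by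
    rw [contDiffAt_pi]
    intro i
    refine Fin.cases ?_ (fun i => ?_) i
    · simpa [straighten] using hg
    · simpa [straighten] using (contDiff_apply ℂ ℂ (j.succAbove i)).contDiffAt
  have hder := (hs.differentiableAt (by simp)).hasFDerivAt
  have h0 : ∀ v, fderiv ℂ (straighten j g) p v 0 = fderiv ℂ g p v := by
    intro v
    have h1 := (hasFDerivAt_pi'.1 hder 0)
    have h2 : (fun y => straighten j g y 0) = g := by funext y; simp [straighten]
    rw [h2] at h1
    exact (DFunLike.congr_fun h1.fderiv v).symm
  have hsucc : ∀ v (i : Fin d), fderiv ℂ (straighten j g) p v i.succ = v (j.succAbove i) := by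
    intro v i
    have h1 := (hasFDerivAt_pi'.1 hder i.succ)
    have h2 : (fun y : Cn (d + 1) => straighten j g y i.succ) = fun y => y (j.succAbove i) := by
      funext y; simp [straighten]
    rw [h2] at h1
    have h3 := h1.unique (ContinuousLinearMap.proj (R := ℂ) (φ := fun _ : Fin (d + 1) => ℂ)
      (j.succAbove i)).hasFDerivAt
    exact DFunLike.congr_fun h3 v
  have hinj : Function.Injective (fderiv ℂ (straighten j g) p).toLinearMap := by
    rw [← LinearMap.ker_eq_bot, LinearMap.ker_eq_bot']
    intro v hv
    have hv' : ∀ i, fderiv ℂ (straighten j g) p v i = 0 := fun i => congrFun hv i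
    have h1 : ∀ i, v (j.succAbove i) = 0 := fun i => (hsucc v i).symm.trans (hv' _)
    have h2 : v = v j • Pi.single j 1 := by
      funext i
      rcases eq_or_ne i j with rfl | hi
      · simp
      · obtain ⟨k, rfl⟩ := Fin.exists_succAbove_eq hi
        simp [h1 k]
    have h3 := hv' 0
    rw [h0, h2, map_smul, smul_eq_mul, mul_eq_zero] at h3
    rw [h2, h3.resolve_right hj, zero_smul]
  obtain ⟨L, hLe⟩ := exists_continuousLinearEquiv_of_injective _ hinj
  have hL : HasFDerivAt (straighten j g) (L : Cn (d + 1) →L[ℂ] Cn (d + 1)) p := by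
    rw [hLe]; exact hder
  refine ⟨hs.toOpenPartialHomeomorph _ hL (by simp), hs.mem_toOpenPartialHomeomorph_source hL
    (by simp), hs, hs.to_localInverse hL (by simp), fun y => ?_⟩
  change straighten j g y 0 = g y
  simp [straighten]

/-- The first coordinate is the given equation itself. This precision matters for
`poincareResidue_holomorphicOn`, where the numerator of `β` with respect to that very equation is
holomorphic. -/
theorem IsLocalEquation.exists_adapted {U : Set X} {f : X → ℂ}
    (hf : IsLocalEquation (n := d + 1) D U f) {x : X} (hx : x ∈ U) (hxD : x ∈ D) :
    ∃ e : OpenPartialHomeomorph X (Cn (d + 1)), IsAdapted D e ∧ x ∈ e.source ∧ e.source ⊆ U ∧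
      ∀ z, e z 0 = f ((chartAt (Cn (d + 1)) x).symm (chartAt (Cn (d + 1)) x z)) ∧
        (z ∈ e.source → e z 0 = f z) := by
  set c := chartAt (Cn (d + 1)) x with hc
  have hcm : c ∈ holoAtlas (d + 1) X := chart_mem_holoAtlas x
  have hxc : x ∈ c.source := mem_chart_source _ x
  have hcx : c.symm (c x) = x := c.left_inv hxc
  have hfx : ContMDiffAt 𝓘(ℂ, Cn (d + 1)) 𝓘(ℂ, ℂ) ω f x :=
    hf.holomorphic.contMDiffAt (hf.isOpen.mem_nhds hx)
  have hfx' : ContMDiffAt 𝓘(ℂ, Cn (d + 1)) 𝓘(ℂ, ℂ) ω f (c.symm (c x)) := by rwa [hcx]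
  have hsymm := contMDiffAt_symm_of_mem_maximalAtlas hcm (c.map_source hxc)
  have hg : ContDiffAt ℂ ω (f ∘ c.symm) (c x) := by
    rw [← contMDiffAt_iff_contDiffAt]
    exact hfx'.comp (c x) hsymm
  have hd : fderiv ℂ (f ∘ c.symm) (c x) ≠ 0 := by
    intro h0
    have h1 : MDifferentiableAt 𝓘(ℂ, Cn (d + 1)) 𝓘(ℂ, ℂ) (f ∘ c.symm) (c x) :=
      (hg.differentiableAt (by simp)).mdifferentiableAt
    have h2 := mfderiv_comp x h1 (mdifferentiableAt_of_mem_holoAtlas hcm hxc)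
    rw [mfderiv_eq_fderiv, h0] at h2
    have h3 : (f ∘ c.symm) ∘ c =ᶠ[𝓝 x] f := by
      filter_upwards [c.open_source.mem_nhds hxc] with z hz
      simp only [Function.comp_apply, c.left_inv hz]
    rw [h3.mfderiv_eq] at h2
    exact hf.differential_ne_zero x hx hxD (h2.trans (ContinuousLinearMap.zero_comp _))
  obtain ⟨Φ, hpΦ, hΦ, hΦs, hΦ0⟩ := exists_straighten hg hd
  set e₀ := c.trans Φ with he₀
  have hxe₀ : x ∈ e₀.source := by
    rw [he₀, OpenPartialHomeomorph.trans_source]; exact ⟨hxc, hpΦ⟩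
  obtain ⟨W, hW, hxW, hmem⟩ := exists_restrOpen_mem_holoAtlas (e := e₀) hxe₀
    (hΦ.contMDiffAt.comp x (contMDiffAt_of_mem_maximalAtlas hcm hxc))
    (ContMDiffAt.comp (g := c.symm) (f := Φ.symm) (I' := 𝓘(ℂ, Cn (d + 1))) (Φ (c x))
      (by rw [Φ.left_inv hpΦ]; exact hsymm) hΦs.contMDiffAt)
  have hval : ∀ z ∈ c.source, e₀ z 0 = f z := by
    intro z hz
    change Φ (c z) 0 = f z
    rw [hΦ0, Function.comp_apply, c.left_inv hz]
  refine ⟨(e₀.restrOpen W hW).restrOpen U hf.isOpen, ⟨restrOpen_mem_holoAtlas hmem _, ?_⟩,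
    ⟨⟨hxe₀, hxW⟩, hx⟩, fun z hz => hz.2, fun z => ⟨?_, fun hz => hval z hz.1.1.1⟩⟩
  · rintro z ⟨⟨hz, -⟩, hzU⟩
    rw [hf.mem_iff z hzU]
    exact (hval z hz.1) ▸ Iff.rfl
  · change Φ (c z) 0 = _
    rw [hΦ0]; rfl

theorem exists_adapted (hD : IsSmoothHypersurface (n := d + 1) D) (x : X) :
    ∃ e : OpenPartialHomeomorph X (Cn (d + 1)), IsAdapted D e ∧ x ∈ e.source := by
  by_cases hx : x ∈ D
  · obtain ⟨U, f, hxU, hf⟩ := hD.exists_equation x hx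
    obtain ⟨e, he, hxe, -⟩ := hf.exists_adapted hxU hx
    exact ⟨e, he, hxe⟩
  set c := chartAt (Cn (d + 1)) x with hc
  have hcm : c ∈ holoAtlas (d + 1) X := chart_mem_holoAtlas x
  have hxc : x ∈ c.source := mem_chart_source _ x
  -- Off `D` a chart is translated so that `z₀ = 1` at `x` and shrunk to `z₀ ≠ 0` away from `D`.
  -- Adapted charts thus cover `X`, and points on and off `D` need no separate treatment later.
  let v : Cn (d + 1) := Pi.single 0 1 - c x
  let e₀ := c.trans (Homeomorph.addRight v).toOpenPartialHomeomorph
  have hsrc : e₀.source = c.source := by simp [e₀]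
  have htr : ∀ w : Cn (d + 1), ContMDiff 𝓘(ℂ, Cn (d + 1)) 𝓘(ℂ, Cn (d + 1)) ω
      (fun y : Cn (d + 1) => y + w) := fun w => (contDiff_id.add contDiff_const).contMDiff
  have he₀ : e₀ ∈ holoAtlas (d + 1) X := by
    refine OpenPartialHomeomorph.mem_maximalAtlas_of_contMDiffOn _ ?_ ?_
    · rw [hsrc]
      exact (htr v).comp_contMDiffOn (contMDiffOn_of_mem_maximalAtlas hcm)
    · refine (contMDiffOn_symm_of_mem_maximalAtlas hcm).comp (htr (-v)).contMDiffOn ?_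
      intro y hy
      simpa [e₀] using! hy
  have hcont : ContinuousOn (fun z => e₀ z 0) e₀.source :=
    (continuous_apply (0 : Fin (d + 1))).comp_continuousOn e₀.continuousOn
  have hWo := (hcont.isOpen_inter_preimage e₀.open_source
    (isOpen_ne (x := (0 : ℂ)))).inter hD.isClosed.isOpen_compl
  refine ⟨e₀.restrOpen _ hWo, ⟨restrOpen_mem_holoAtlas he₀ hWo, ?_⟩, ?_⟩
  · rintro z ⟨-, ⟨-, hz⟩, hzD⟩
    exact ⟨fun h => absurd h hzD, fun h => absurd h hz⟩
  · have h0 : e₀ x = Pi.single 0 1 := by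
      change c x + v = _
      simp [v]
    refine ⟨hsrc ▸ hxc, ⟨hsrc ▸ hxc, ?_⟩, hx⟩
    change e₀ x 0 ≠ 0
    rw [h0]; simp

end Adapted

end

noncomputable section

/-! ### Real smooth functions in holomorphic charts. -/

section RealFunctions

open Filter Set

variable {n : ℕ} {X : Type*} [TopologicalSpace X] [ChartedSpace (Cn n) X]
  [IsManifold 𝓘(ℂ, Cn n) ω X] {e : OpenPartialHomeomorph X (Cn n)}

theorem contDiffAt_comp_symm {F : Type*} [NormedAddCommGroup F] [NormedSpace ℝ F] {φ : X → F}
    {y : Cn n} (he : e ∈ holoAtlas n X) (hy : y ∈ e.target)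
    (h : ContMDiffAt 𝓘(ℝ, Cn n) 𝓘(ℝ, F) ∞ φ (e.symm y)) :
    ContDiffAt ℝ ∞ (fun y => φ (e.symm y)) y := by
  set c := chartAt (Cn n) (e.symm y) with hc
  have hcm : c ∈ holoAtlas n X := chart_mem_holoAtlas _
  have hxc : e.symm y ∈ c.source := mem_chart_source _ _
  have h1 : ContDiffAt ℝ ∞ (φ ∘ c.symm) (c (e.symm y)) := by
    have := (contMDiffAt_iff.1 h).2
    simpa [hc] using! this
  have h2 : ContDiffAt ℝ ∞ (c ∘ e.symm) y :=
    ((contDiffAt_transition hcm he hy hxc).restrict_scalars ℝ).of_le le_top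
  refine (ContDiffAt.comp y (g := φ ∘ c.symm) (f := c ∘ e.symm) h1 h2).congr_of_eventuallyEq ?_
  filter_upwards [eventually_transition hy hxc] with z hz
  simp only [Function.comp_apply, c.left_inv hz.2]

end RealFunctions

/-! ### Pole orders in adapted charts. -/

section Poles

open Filter Set

variable {d p : ℕ} {X : Type*} [TopologicalSpace X] [ChartedSpace (Cn (d + 1)) X]

/-- In the coordinates of the chart `e` the form `α` is `z₀^{-m} N` with smooth `N`. -/
def PoleRep (e : OpenPartialHomeomorph X (Cn (d + 1))) (m : ℕ) (α : PForm (d + 1) p X)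
    (N : Cn (d + 1) → (Cn (d + 1)) [⋀^Fin p]→L[ℂ] ℂ) : Prop :=
  ContDiffOn ℝ ∞ N e.target ∧
    ∀ y ∈ e.target, y 0 ≠ 0 → α.inCoord e y = ((y 0) ^ m)⁻¹ • N y

/-- In the coordinates of the chart `e` the form `α` has a pole of order at most `m` on `z₀ = 0`. -/
def PoleOn (e : OpenPartialHomeomorph X (Cn (d + 1))) (m : ℕ) (α : PForm (d + 1) p X) : Prop :=
  ∃ N : Cn (d + 1) → (Cn (d + 1)) [⋀^Fin p]→L[ℂ] ℂ, PoleRep e m α N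

/-- Near `x` the form `α` is smooth with at most a pole of order `m` along `D`. -/
def PoleAt (D : Set X) (m : ℕ) (α : PForm (d + 1) p X) (x : X) : Prop :=
  ∃ e : OpenPartialHomeomorph X (Cn (d + 1)), IsAdapted D e ∧ x ∈ e.source ∧ PoleOn e m α

variable {D : Set X} {m : ℕ} {e : OpenPartialHomeomorph X (Cn (d + 1))} {α β : PForm (d + 1) p X}
  {x : X}

theorem PoleOn.restrOpen (h : PoleOn e m α) {W : Set X} (hW : IsOpen W) :
    PoleOn (e.restrOpen W hW) m α := by
  obtain ⟨N, hN, h⟩ := h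
  exact ⟨N, hN.mono inter_subset_left, fun y hy => h y hy.1⟩

variable [IsManifold 𝓘(ℂ, Cn (d + 1)) ω X]

theorem exists_poleOn_of_smoothOn (hD : IsClosed D) {U : Set X} (hU : IsOpen U)
    (hα : α.SmoothOn U) (hx : x ∈ U) (hxD : x ∉ D) (he : IsAdapted D e) (m : ℕ) :
    ∃ (W : Set X) (hW : IsOpen W), x ∈ W ∧ PoleOn (e.restrOpen W hW) m α := by
  refine ⟨U ∩ Dᶜ, hU.inter hD.isOpen_compl, ⟨hx, hxD⟩, fun y => (y 0) ^ m • α.inCoord e y, ?_, ?_⟩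
  · rintro y ⟨hy, hyW⟩
    have h1 := hα.contDiffAt (hU.mem_nhds hyW.1) he.mem (e.map_target hy)
    rw [e.right_inv hy] at h1
    exact (((contDiff_apply ℝ ℂ (0 : Fin (d + 1))).pow m).contDiffAt.smul h1).contDiffWithinAt
  · intro y _ h0
    rw [smul_smul, inv_mul_cancel₀ (pow_ne_zero _ h0), one_smul]; rfl

/-- By division, any local equation is `z₀ u` near the point with `u` smooth and nowhere zero;
multiplying the numerator by `u^{-m}` trades the equation for the coordinate. -/
theorem IsAdapted.exists_poleOn_of_equation (he : IsAdapted D e) (hxe : x ∈ e.source)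
    (hxD : x ∈ D) {U : Set X}
    {f : X → ℂ} {η : PForm (d + 1) p X} (hxU : x ∈ U) (hf : IsLocalEquation (n := d + 1) D U f)
    (hη : η.SmoothOn U) (h : ∀ y ∈ U \ D, f y ^ m • α y = η y) :
    ∃ (W : Set X) (hW : IsOpen W), x ∈ W ∧ PoleOn (e.restrOpen W hW) m α := by
  have hp := e.map_source hxe
  have hex : e.symm (e x) = x := e.left_inv hxe
  have hfx : ContMDiffAt 𝓘(ℂ, Cn (d + 1)) 𝓘(ℂ, ℂ) ω f x :=
    hf.holomorphic.contMDiffAt (hf.isOpen.mem_nhds hxU)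
  have hF : ContDiffAt ℂ ω (f ∘ e.symm) (e x) := by
    rw [← contMDiffAt_iff_contDiffAt]
    exact ContMDiffAt.comp (e x) (by rwa [hex]) (contMDiffAt_symm_of_mem_maximalAtlas he.mem hp)
  have hd : fderiv ℂ (f ∘ e.symm) (e x) ≠ 0 := by
    intro h0
    have h1 : MDifferentiableAt 𝓘(ℂ, Cn (d + 1)) 𝓘(ℂ, ℂ) (f ∘ e.symm) (e x) :=
      (hF.differentiableAt (by simp)).mdifferentiableAt
    have h2 := mfderiv_comp x h1 (mdifferentiableAt_of_mem_holoAtlas he.mem hxe)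
    rw [mfderiv_eq_fderiv, h0] at h2
    have h3 : (f ∘ e.symm) ∘ e =ᶠ[𝓝 x] f := by
      filter_upwards [e.open_source.mem_nhds hxe] with z hz
      simp only [Function.comp_apply, e.left_inv hz]
    rw [h3.mfderiv_eq] at h2
    exact hf.differential_ne_zero x hxU hxD (h2.trans (ContinuousLinearMap.zero_comp _))
  have hUe : ∀ᶠ y in 𝓝 (e x), e.symm y ∈ U :=
    (e.symm.continuousAt hp).eventually (by rw [hex]; exact hf.isOpen.mem_nhds hxU)
  have h0 : ∀ᶠ y in 𝓝 (e x), y 0 = 0 → (f ∘ e.symm) y = 0 := by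
    filter_upwards [hUe, e.open_target.mem_nhds hp] with y hyU hy hy0
    exact (hf.mem_iff _ hyU).1 ((he.symm_mem_iff hy).2 hy0)
  obtain ⟨u, V, hV, hpV, hu, huV⟩ := exists_eq_coord_mul hF ((he.mem_iff x hxe).1 hxD) h0 hd
  refine ⟨(e.source ∩ e ⁻¹' V) ∩ U, (e.isOpen_inter_preimage hV).inter hf.isOpen, ⟨⟨hxe, hpV⟩, hxU⟩,
    fun y => ((u y) ^ m)⁻¹ • η.inCoord e y, ?_, ?_⟩
  · rintro y ⟨hy, ⟨-, hyV⟩, hyU⟩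
    rw [mem_preimage, e.right_inv hy] at hyV
    have h1 := hη.contDiffAt (hf.isOpen.mem_nhds hyU) he.mem (e.map_target hy)
    rw [e.right_inv hy] at h1
    have h2 := ((hu.contDiffAt (hV.mem_nhds hyV)).pow m).inv (pow_ne_zero _ (huV y hyV).1)
    exact (h2.smul h1).contDiffWithinAt
  · rintro y ⟨hy, ⟨-, hyV⟩, hyU⟩ hy0
    rw [mem_preimage, e.right_inv hy] at hyV
    have hyD : e.symm y ∉ D := fun h => hy0 ((he.symm_mem_iff hy).1 h)
    have h1 : η.inCoord e y = (y 0 * u y) ^ m • α.inCoord e y := by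
      rw [← (huV y hyV).2, PForm.inCoord, ← h _ ⟨hyU, hyD⟩]; rfl
    have h2 := (huV y hyV).1
    change α.inCoord e y = ((y 0) ^ m)⁻¹ • ((u y) ^ m)⁻¹ • η.inCoord e y
    rw [h1, smul_smul, smul_smul]
    have : ((y 0) ^ m)⁻¹ * (u y ^ m)⁻¹ * (y 0 * u y) ^ m = 1 := by
      rw [mul_pow]; field_simp
    rw [this, one_smul]

theorem PoleOn.smoothOn (he : IsAdapted D e) (h : PoleOn e m α) :
    α.SmoothOn (e.source ∩ Dᶜ) := by
  obtain ⟨N, hN, h⟩ := h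
  refine PForm.smoothOn_of_forall fun x hx => ⟨e, he.mem, hx.1, ?_⟩
  have hy := e.map_source hx.1
  have h0 : e x 0 ≠ 0 := fun h0 => hx.2 ((he.mem_iff x hx.1).2 h0)
  have h1 : ContDiffAt ℝ ∞ (fun y => ((y 0) ^ m)⁻¹ • N y) (e x) :=
    (((contDiff_apply ℝ ℂ (0 : Fin (d + 1))).pow m).contDiffAt.inv (pow_ne_zero _ h0)).smul
      (hN.contDiffAt (e.open_target.mem_nhds hy))
  refine h1.congr_of_eventuallyEq ?_
  filter_upwards [e.open_target.mem_nhds hy,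
    (continuous_apply (0 : Fin (d + 1))).continuousAt.eventually_ne h0] with y hy hy0
  exact h y hy hy0

theorem PoleOn.equation (he : IsAdapted D e) (h : PoleOn e m α) :
    ∃ η : PForm (d + 1) p X, η.SmoothOn e.source ∧
      ∀ y ∈ e.source \ D, e y 0 ^ m • α y = η y := by
  obtain ⟨N, hN, h⟩ := h
  refine ⟨PForm.ofCoord e N, PForm.smoothOn_of_forall fun x hx => ⟨e, he.mem, hx, ?_⟩, ?_⟩
  · have hy := e.map_source hx
    refine (hN.contDiffAt (e.open_target.mem_nhds hy)).congr_of_eventuallyEq ?_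
    filter_upwards [e.open_target.mem_nhds hy] with y hy
    exact PForm.inCoord_ofCoord he.mem hy
  · rintro x ⟨hx, hxD⟩
    have h0 : e x 0 ≠ 0 := fun h0 => hxD ((he.mem_iff x hx).2 h0)
    have hy := e.map_source hx
    rw [← PForm.inCoord_apply_comp (α := α) he.mem hx,
      ← PForm.inCoord_apply_comp (α := PForm.ofCoord e N) he.mem hx,
      PForm.inCoord_ofCoord he.mem hy, h _ hy h0]
    ext v
    simp only [ContinuousAlternatingMap.smul_apply,
      ContinuousAlternatingMap.compContinuousLinearMap_apply, smul_eq_mul]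
    field_simp

/-- Independence of the adapted chart: it allows the poles of two forms to be read in one common
chart after shrinking. -/
theorem PoleAt.exists_poleOn (hD : IsClosed D) (h : PoleAt D m α x) (he : IsAdapted D e)
    (hxe : x ∈ e.source) :
    ∃ (W : Set X) (hW : IsOpen W), x ∈ W ∧ PoleOn (e.restrOpen W hW) m α := by
  obtain ⟨e', he', hxe', h'⟩ := h
  by_cases hxD : x ∈ D
  · obtain ⟨η, hη, h⟩ := h'.equation he'
    exact he.exists_poleOn_of_equation hxe hxD hxe' he'.isLocalEquation hη h
  · exact exists_poleOn_of_smoothOn hD (e'.open_source.inter hD.isOpen_compl)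
      (h'.smoothOn he') ⟨hxe', hxD⟩ hxD he m

theorem poleAt_of_data (hD : IsSmoothHypersurface (n := d + 1) D) (h1 : α.SmoothOn Dᶜ)
    (h2 : x ∈ D → ∃ (U : Set X) (f : X → ℂ) (η : PForm (d + 1) p X),
      x ∈ U ∧ IsLocalEquation (n := d + 1) D U f ∧ η.SmoothOn U ∧
      ∀ y ∈ U \ D, f y ^ m • α y = η y) : PoleAt D m α x := by
  obtain ⟨e, he, hxe⟩ := exists_adapted hD x
  by_cases hxD : x ∈ D
  · obtain ⟨U, f, η, hxU, hf, hη, h⟩ := h2 hxD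
    obtain ⟨W, hW, hxW, hp⟩ := he.exists_poleOn_of_equation hxe hxD hxU hf hη h
    exact ⟨_, he.restrOpen hW, ⟨hxe, hxW⟩, hp⟩
  · obtain ⟨W, hW, hxW, hp⟩ := exists_poleOn_of_smoothOn hD.isClosed hD.isClosed.isOpen_compl h1 hxD
      hxD he m
    exact ⟨_, he.restrOpen hW, ⟨hxe, hxW⟩, hp⟩

theorem PForm.HasPoleOrderLE.poleAt (hD : IsSmoothHypersurface (n := d + 1) D)
    (h : α.HasPoleOrderLE D m) (x : X) : PoleAt D m α x :=
  poleAt_of_data hD h.1 (h.2 x)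

theorem PForm.HasPoles.poleAt (hD : IsSmoothHypersurface (n := d + 1) D)
    (h : α.HasPoles D) (x : X) : ∃ m, PoleAt D m α x := by
  by_cases hx : x ∈ D
  · obtain ⟨m, h'⟩ := h.2 x hx
    exact ⟨m, poleAt_of_data hD h.1 fun _ => h'⟩
  · exact ⟨0, poleAt_of_data hD h.1 fun h' => absurd h' hx⟩

theorem PForm.IsMeromorphic.hasPoleOrderLE (h : α.IsMeromorphic D m) : α.HasPoleOrderLE D m := by
  refine ⟨h.1.smoothOn, fun x hx => ?_⟩
  obtain ⟨U, f, η, hxU, hf, hη, h⟩ := h.2 x hx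
  exact ⟨U, f, η, hxU, hf, hη.smoothOn, h⟩

theorem smoothOn_compl_of_poleAt (hD : IsClosed D) (h : ∀ x, x ∉ D → ∃ m, PoleAt D m α x) :
    α.SmoothOn Dᶜ := by
  refine PForm.smoothOn_of_forall fun x hx => ?_
  obtain ⟨m, e, he, hxe, hp⟩ := h x hx
  exact ⟨e, he.mem, hxe, (hp.smoothOn he).contDiffAt
    ((e.open_source.inter hD.isOpen_compl).mem_nhds ⟨hxe, hx⟩) he.mem hxe⟩

theorem hasPoleOrderLE_of_poleAt (hD : IsClosed D) (h : ∀ x, PoleAt D m α x) :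
    α.HasPoleOrderLE D m := by
  refine ⟨smoothOn_compl_of_poleAt hD fun x _ => ⟨m, h x⟩, fun x _ => ?_⟩
  obtain ⟨e, he, hxe, hp⟩ := h x
  obtain ⟨η, hη, h'⟩ := hp.equation he
  exact ⟨e.source, _, η, hxe, he.isLocalEquation, hη, h'⟩

theorem PForm.HasPoleOrderLE.hasPoles (h : α.HasPoleOrderLE D m) : α.HasPoles D :=
  ⟨h.1, fun x hx => ⟨m, h.2 x hx⟩⟩

theorem PoleOn.add (hα : PoleOn e m α) (hβ : PoleOn e m β) :
    PoleOn e m (fun x => α x + β x) := by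
  obtain ⟨N, hN, h⟩ := hα
  obtain ⟨M, hM, h'⟩ := hβ
  refine ⟨fun y => N y + M y, hN.add hM, fun y hy hy0 => ?_⟩
  rw [PForm.inCoord_add, h y hy hy0, h' y hy hy0, smul_add]

theorem PoleAt.add (hD : IsSmoothHypersurface (n := d + 1) D) (hα : PoleAt D m α x)
    (hβ : PoleAt D m β x) : PoleAt D m (fun x => α x + β x) x := by
  obtain ⟨e, he, hxe, h⟩ := hα
  obtain ⟨W, hW, hxW, h'⟩ := hβ.exists_poleOn hD.isClosed he hxe
  exact ⟨_, he.restrOpen hW, ⟨hxe, hxW⟩, (h.restrOpen hW).add h'⟩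

theorem poleAt_of_eventually_zero (hD : IsSmoothHypersurface (n := d + 1) D)
    (h : ∀ᶠ z in 𝓝 x, α z = 0) : PoleAt D m α x := by
  obtain ⟨e, he, hxe⟩ := exists_adapted hD x
  obtain ⟨W, hWs, hW, hxW⟩ := eventually_nhds_iff.1 h
  refine ⟨_, he.restrOpen hW, ⟨hxe, hxW⟩, fun _ => 0, contDiffOn_const, fun y hy _ => ?_⟩
  have : α (e.symm y) = 0 := hWs _ hy.2
  have h1 : α.inCoord (e.restrOpen W hW) y = 0 := by
    rw [PForm.inCoord, OpenPartialHomeomorph.coe_restrOpen_symm, this]; rfl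
  rw [h1]
  ext v
  simp

theorem PoleAt.sum (hD : IsSmoothHypersurface (n := d + 1) D) {J : Type*} (s : Finset J)
    {a : J → PForm (d + 1) p X} (h : ∀ j ∈ s, PoleAt D m (a j) x) :
    PoleAt D m (fun x => ∑ j ∈ s, a j x) x := by
  classical
  induction s using Finset.induction_on with
  | empty => exact poleAt_of_eventually_zero hD (by simp)
  | insert i s hi ih =>
    simp only [Finset.sum_insert hi]
    exact (h i (Finset.mem_insert_self i s)).add hD
      (ih fun j hj => h j (Finset.mem_insert_of_mem hj))

theorem PoleOn.smul (he : e ∈ holoAtlas (d + 1) X) (h : PoleOn e m α) {φ : X → ℝ}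
    (hφ : ContMDiff 𝓘(ℝ, Cn (d + 1)) 𝓘(ℝ, ℝ) ∞ φ) :
    PoleOn e m (fun x => (φ x : ℂ) • α x) := by
  obtain ⟨N, hN, h⟩ := h
  refine ⟨fun y => (φ (e.symm y) : ℂ) • N y, fun y hy => ?_, fun y hy hy0 => ?_⟩
  · have h1 := contDiffAt_comp_symm he hy hφ.contMDiffAt
    exact ((Complex.ofRealCLM.contDiff.contDiffAt.comp y h1).contDiffWithinAt).smul (hN y hy)
  · rw [PForm.inCoord_smul (fun x => (φ x : ℂ)), h y hy hy0, smul_comm]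

theorem PoleAt.smul (h : PoleAt D m α x) {φ : X → ℝ}
    (hφ : ContMDiff 𝓘(ℝ, Cn (d + 1)) 𝓘(ℝ, ℝ) ∞ φ) :
    PoleAt D m (fun x => (φ x : ℂ) • α x) x := by
  obtain ⟨e, he, hxe, h⟩ := h
  exact ⟨e, he, hxe, h.smul he.mem hφ⟩

end Poles

end

noncomputable section

/-! ### Bump functions, and extension of identities across the hyperplane by density. -/

section CutoffInCoordinates

open Filter Set

theorem exists_contDiff_one_on {n : ℕ} {L T : Set (Cn n)} (hL : IsCompact L) (hT : IsOpen T)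
    (hLT : L ⊆ T) : ∃ χ : Cn n → ℝ, ContDiff ℝ ∞ χ ∧ (∀ y ∈ L, χ y = 1) ∧ HasCompactSupport χ ∧
      tsupport χ ⊆ T ∧ ∀ y, χ y ∈ Icc (0 : ℝ) 1 := by
  obtain ⟨K, hK, hLK, hKT⟩ := exists_compact_between hL hT hLT
  obtain ⟨χ, h1, h2, h3, h4⟩ := exists_contMDiff_support_eq_eq_one_iff 𝓘(ℝ, Cn n) (n := ⊤)
    (isOpen_interior (s := K)) hL.isClosed hLK
  have hs : tsupport χ ⊆ K := by
    rw [tsupport, h3]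
    exact closure_minimal interior_subset hK.isClosed
  exact ⟨χ, h1.contDiff, fun y hy => (h4 y).1 hy, hK.of_isClosed_subset (isClosed_tsupport _) hs,
    hs.trans hKT, fun y => h2 (mem_range_self y)⟩

theorem contDiff_smul_of_tsupport {E F 𝕜 : Type*} [NormedAddCommGroup E] [NormedSpace ℝ E]
    [NormedAddCommGroup F] [NormedSpace ℝ F] [NormedField 𝕜] [NormedAlgebra ℝ 𝕜] [NormedSpace 𝕜 F]
    [IsScalarTower ℝ 𝕜 F] {χ : E → 𝕜} {f : E → F}
    {T : Set E} (hT : IsOpen T) (hχ : ContDiff ℝ ∞ χ) (hs : tsupport χ ⊆ T)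
    (hf : ContDiffOn ℝ ∞ f T) : ContDiff ℝ ∞ fun y => χ y • f y := by
  rw [contDiff_iff_contDiffAt]
  intro y
  by_cases hy : y ∈ T
  · exact hχ.contDiffAt.smul (hf.contDiffAt (hT.mem_nhds hy))
  · have h1 : (tsupport χ)ᶜ ∈ 𝓝 y :=
      (isClosed_tsupport χ).isOpen_compl.mem_nhds fun h => hy (hs h)
    refine (contDiffAt_const (c := (0 : F))).congr_of_eventuallyEq ?_
    filter_upwards [h1] with z hz
    rw [image_eq_zero_of_notMem_tsupport hz, zero_smul]

variable {d : ℕ}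

theorem dense_off : Dense {y : Cn (d + 1) | y 0 ≠ 0} :=
  (dense_compl_singleton (0 : ℂ)).preimage (isOpenMap_eval (0 : Fin (d + 1)))

/-- Two functions which agree where `z₀ ≠ 0` agree wherever they are continuous. -/
theorem eq_of_eq_off {F : Type*} [TopologicalSpace F] [T2Space F] {S : Set (Cn (d + 1))}
    (hS : IsOpen S) {f g : Cn (d + 1) → F} (hf : ContinuousOn f S) (hg : ContinuousOn g S)
    (h : ∀ y ∈ S, y 0 ≠ 0 → f y = g y) {y : Cn (d + 1)} (hy : y ∈ S) : f y = g y := by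
  have hcl : y ∈ closure (S ∩ {y | y 0 ≠ 0}) := dense_off.open_subset_closure_inter hS hy
  have := mem_closure_iff_nhdsWithin_neBot.1 hcl
  have h1 := (hf.continuousAt (hS.mem_nhds hy)).tendsto.mono_left
    (nhdsWithin_le_nhds (s := S ∩ {y | y 0 ≠ 0}))
  have h2 := (hg.continuousAt (hS.mem_nhds hy)).tendsto.mono_left
    (nhdsWithin_le_nhds (s := S ∩ {y | y 0 ≠ 0}))
  refine tendsto_nhds_unique h1 (h2.congr' ?_)
  filter_upwards [self_mem_nhdsWithin] with z hz using (h z hz.1 hz.2).symm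

end CutoffInCoordinates

/-! ### The pairing of a localized form as a truncated integral. -/

section LocalPairing

open Filter Set MeasureTheory

variable {d p : ℕ} {X : Type*} [TopologicalSpace X] [ChartedSpace (Cn (d + 1)) X]

/-- The form `a`, smooth off `D`, is supported in the compact subset `K` of the domain of the
adapted chart `e`. -/
structure IsLocalized (D : Set X) (e : OpenPartialHomeomorph X (Cn (d + 1))) (K : Set X)
    (a : PForm (d + 1) p X) : Prop where
  adapted : IsAdapted D e
  compact : IsCompact K
  subset : K ⊆ e.source
  smooth : a.SmoothOn Dᶜ
  zero : ∀ x ∉ D, x ∉ K → a x = 0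

variable {D K : Set X} {e : OpenPartialHomeomorph X (Cn (d + 1))} {m : ℕ}

theorem IsLocalized.isCompact_image {a : PForm (d + 1) p X} (h : IsLocalized D e K a) :
    IsCompact (e '' K) :=
  h.compact.image_of_continuousOn (e.continuousOn.mono h.subset)

theorem IsLocalized.image_subset {a : PForm (d + 1) p X} (h : IsLocalized D e K a) :
    e '' K ⊆ e.target := by
  rintro _ ⟨x, hx, rfl⟩
  exact e.map_source (h.subset hx)

/-- Off the hyperplane this is the support condition on `a`; on it the numerator vanishes by
continuity, the complement being dense. -/
theorem IsLocalized.rep_eq_zero {a : PForm (d + 1) p X} (h : IsLocalized D e K a)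
    {N : Cn (d + 1) → (Cn (d + 1)) [⋀^Fin p]→L[ℂ] ℂ} (hN : PoleRep e m a N) {y : Cn (d + 1)}
    (hy : y ∈ e.target) (hyK : y ∉ e '' K) : N y = 0 := by
  refine eq_of_eq_off (S := e.target \ e '' K) (g := fun _ => 0)
    (e.open_target.sdiff h.isCompact_image.isClosed) (hN.1.continuousOn.mono sdiff_subset)
    continuousOn_const ?_ ⟨hy, hyK⟩
  rintro z ⟨hz, hzK⟩ hz0
  have hzD : e.symm z ∉ D := fun hD => hz0 ((h.adapted.symm_mem_iff hz).1 hD)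
  have h1 : a.inCoord e z = 0 := by
    rw [PForm.inCoord, h.zero _ hzD fun hK => hzK ⟨_, hK, e.right_inv hz⟩]; rfl
  have h2 := hN.2 z hz hz0
  rw [h1] at h2
  ext v
  have h3 := congrArg (fun f => f v) h2
  simpa [hz0] using h3.symm

theorem IsLocalized.exists_isTest {a : PForm (d + 1) p X} (h : IsLocalized D e K a)
    {u v : Cn (d + 1) → ℂ} (hu : ContDiffOn ℝ ∞ u e.target) (hv : ContDiffOn ℝ ∞ v e.target)
    (h0 : ∀ y ∈ e.target, y ∉ e '' K → u y = 0) :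
    ∃ G : Cn (d + 1) → ℂ, IsTest G ∧
      (∀ y ∈ e.target, G y = u y * (starRingEnd ℂ) (v y)) ∧ ∀ y, y ∉ e '' K → G y = 0 := by
  obtain ⟨χ, hχ, h1, hc, hs, -⟩ := exists_contDiff_one_on h.isCompact_image e.open_target
    h.image_subset
  have hsm : ContDiffOn ℝ ∞ (fun y => u y * (starRingEnd ℂ) (v y)) e.target := by
    intro y hy
    have hy' := e.open_target.mem_nhds hy
    exact ((hu.contDiffAt hy').mul (contDiffAt_conj (hv.contDiffAt hy'))).contDiffWithinAt
  have hG := contDiff_smul_of_tsupport e.open_target hχ hs hsm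
  have hval : ∀ y ∈ e.target, χ y • (u y * (starRingEnd ℂ) (v y)) =
      u y * (starRingEnd ℂ) (v y) := by
    intro y hy
    by_cases hyK : y ∈ e '' K
    · rw [h1 y hyK, one_smul]
    · rw [h0 y hy hyK, zero_mul, smul_zero]
  refine ⟨_, ⟨hG, hc.smul_right⟩, hval, fun y hyK => ?_⟩
  by_cases hy : y ∈ e.target
  · rw [hval y hy, h0 y hy hyK, zero_mul]
  · rw [image_eq_zero_of_notMem_tsupport fun h => hy (hs h), zero_smul]

/-- The smooth numerator of the density of `a ∧ b̄` in coordinates. -/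
theorem IsLocalized.exists_isTest_top {a b : PForm (d + 1) (d + 1) X} (h : IsLocalized D e K a)
    {Na Nb : Cn (d + 1) → (Cn (d + 1)) [⋀^Fin (d + 1)]→L[ℂ] ℂ} (ha : PoleRep e m a Na)
    (hb : PoleRep e 1 b Nb) :
    ∃ G : Cn (d + 1) → ℂ, IsTest G ∧
      (∀ y ∈ e.target, G y = topCoef (Na y) * (starRingEnd ℂ) (topCoef (Nb y))) ∧
      (∀ y, y ∉ e '' K → G y = 0) ∧
      ∀ y ∈ e.target, y 0 ≠ 0 → topCoef (a.inCoord e y) *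
        (starRingEnd ℂ) (topCoef (b.inCoord e y)) = G y * mono (-(m : ℤ)) (-1) y := by
  obtain ⟨G, hG, h1, h2⟩ := h.exists_isTest (u := fun y => topCoef (Na y))
    (v := fun y => topCoef (Nb y))
    (fun y hy => (ha.1.contDiffAt (e.open_target.mem_nhds hy)).topCoef.contDiffWithinAt)
    (fun y hy => (hb.1.contDiffAt (e.open_target.mem_nhds hy)).topCoef.contDiffWithinAt)
    (fun y hy hyK => by rw [h.rep_eq_zero ha hy hyK]; rfl)
  refine ⟨G, hG, h1, h2, fun y hy hy0 => ?_⟩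
  rw [ha.2 y hy hy0, hb.2 y hy hy0, h1 y hy]
  simp only [topCoef, ContinuousAlternatingMap.smul_apply, smul_eq_mul, map_mul, map_inv₀,
    pow_one, mono, zpow_neg, zpow_natCast, zpow_one]
  ring

variable {lam : X → ℝ}

theorem IsCutoff.eq_zero (hl : IsCutoff (d + 1) D lam) (he : IsAdapted D e) {x : X}
    (hx : x ∈ e.source) (hxD : x ∈ D) : lam x = 0 := by
  obtain ⟨h, -, -, h3⟩ := hl.local_form e.source _ he.isLocalEquation
  rw [h3 x hx, (he.mem_iff x hx).1 hxD, norm_zero, mul_zero]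

variable [IsManifold 𝓘(ℂ, Cn (d + 1)) ω X]

theorem IsCutoff.continuous (hl : IsCutoff (d + 1) D lam)
    (hD : IsSmoothHypersurface (n := d + 1) D) : Continuous lam := by
  rw [continuous_iff_continuousAt]
  intro x
  obtain ⟨e, he, hx⟩ := exists_adapted hD x
  obtain ⟨h, h1, -, h3⟩ := hl.local_form e.source _ he.isLocalEquation
  have hc : ContinuousOn (fun x => h x * ‖e x 0‖) e.source :=
    h1.continuousOn.mul ((continuous_apply (0 : Fin (d + 1))).comp_continuousOn e.continuousOn).norm
  exact (hc.congr h3).continuousAt (e.open_source.mem_nhds hx)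

theorem IsCutoff.isClosed_le (hl : IsCutoff (d + 1) D lam)
    (hD : IsSmoothHypersurface (n := d + 1) D) (ε : ℝ) : IsClosed {x | ε ≤ lam x} :=
  _root_.isClosed_le continuous_const (hl.continuous hD)

theorem IsCutoff.subset_compl (hl : IsCutoff (d + 1) D lam)
    (hD : IsSmoothHypersurface (n := d + 1) D) {ε : ℝ} (hε : 0 < ε) : {x | ε ≤ lam x} ⊆ Dᶜ := by
  intro x hx hxD
  obtain ⟨e, he, hxe⟩ := exists_adapted hD x
  have : ε ≤ lam x := hx
  rw [hl.eq_zero he hxe hxD] at this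
  linarith

theorem exists_contDiff_eq_on (he : e ∈ holoAtlas (d + 1) X) (hK : IsCompact K)
    (hKe : K ⊆ e.source) {φ : X → ℝ} (hφ : ContMDiffOn 𝓘(ℝ, Cn (d + 1)) 𝓘(ℝ, ℝ) ∞ φ e.source) :
    ∃ ψ : Cn (d + 1) → ℝ, ContDiff ℝ ∞ ψ ∧ (∀ x ∈ K, ψ (e x) = φ x) ∧
      ((∀ x ∈ e.source, 0 < φ x) → ∃ ψ' : Cn (d + 1) → ℝ, SmoothPos ψ' ∧
        ∀ x ∈ K, ψ' (e x) = φ x) := by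
  have hL : IsCompact (e '' K) := hK.image_of_continuousOn (e.continuousOn.mono hKe)
  have hLT : e '' K ⊆ e.target := by
    rintro _ ⟨x, hx, rfl⟩
    exact e.map_source (hKe hx)
  obtain ⟨χ, hχ, h1, -, hs, h01⟩ := exists_contDiff_one_on hL e.open_target hLT
  have hsm : ContDiffOn ℝ ∞ (fun y => φ (e.symm y)) e.target := fun y hy =>
    (contDiffAt_comp_symm he hy (hφ.contMDiffAt
      (e.open_source.mem_nhds (e.map_target hy)))).contDiffWithinAt
  have hψ := contDiff_smul_of_tsupport e.open_target hχ hs hsm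
  have hval : ∀ x ∈ K, χ (e x) • φ (e.symm (e x)) = φ x := fun x hx => by
    rw [h1 _ (mem_image_of_mem e hx), one_smul, e.left_inv (hKe hx)]
  -- The convex combination with the constant `1` extends a positive function to all of coordinate
  -- space while keeping it positive.
  refine ⟨_, hψ, hval, fun hpos => ⟨fun y => χ y • φ (e.symm y) + (1 - χ y),
    ⟨hψ.add (contDiff_const.sub hχ), fun y => ?_⟩, fun x hx => ?_⟩⟩
  · rcases eq_or_ne (χ y) 0 with h0 | h0
    · simp [h0]
    · have hy : y ∈ e.target := hs (subset_tsupport _ h0)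
      have hp := hpos _ (e.map_target hy)
      have hc : 0 < χ y := lt_of_le_of_ne (h01 y).1 (Ne.symm h0)
      have h2 := (h01 y).2
      have := mul_pos hc hp
      rw [smul_eq_mul]; linarith
  · change χ (e x) • φ (e.symm (e x)) + (1 - χ (e x)) = φ x
    rw [hval x hx, h1 _ (mem_image_of_mem e hx), sub_self, add_zero]

theorem IsCutoff.exists_smoothPos (hl : IsCutoff (d + 1) D lam) (he : IsAdapted D e)
    (hK : IsCompact K) (hKe : K ⊆ e.source) :
    ∃ h : Cn (d + 1) → ℝ, SmoothPos h ∧ ∀ x ∈ K, lam x = dist0 h (e x) := by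
  obtain ⟨h, h1, h2, h3⟩ := hl.local_form e.source _ he.isLocalEquation
  obtain ⟨-, -, -, h4⟩ := exists_contDiff_eq_on he.mem hK hKe h1
  obtain ⟨ψ, hψ, h5⟩ := h4 h2
  exact ⟨ψ, hψ, fun x hx => by rw [dist0, h5 x hx, h3 x (hKe hx)]⟩

theorem IsCutoff.exp_mul (hl : IsCutoff (d + 1) D lam) {φ : X → ℝ}
    (hφ : ContMDiff 𝓘(ℝ, Cn (d + 1)) 𝓘(ℝ, ℝ) ∞ φ) :
    IsCutoff (d + 1) D fun x => Real.exp (φ x) * lam x := by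
  have he : ContMDiff 𝓘(ℝ, Cn (d + 1)) 𝓘(ℝ, ℝ) ∞ fun x => Real.exp (φ x) :=
    Real.contDiff_exp.contMDiff.comp hφ
  refine ⟨fun x hx => mul_pos (Real.exp_pos _) (hl.pos x hx), ?_, fun U f hf => ?_⟩
  · have : ContDiff ℝ ∞ fun q : ℝ × ℝ => q.1 * q.2 := contDiff_fst.mul contDiff_snd
    exact this.contMDiff.comp_contMDiffOn (he.contMDiffOn.prodMk_space hl.smooth)
  · obtain ⟨h, h1, h2, h3⟩ := hl.local_form U f hf
    have : ContDiff ℝ ∞ fun q : ℝ × ℝ => q.1 * q.2 := contDiff_fst.mul contDiff_snd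
    refine ⟨fun x => Real.exp (φ x) * h x,
      this.contMDiff.comp_contMDiffOn (he.contMDiffOn.prodMk_space h1),
      fun x hx => mul_pos (Real.exp_pos _) (h2 x hx), fun x hx => ?_⟩
    rw [h3 x hx, mul_assoc]

variable (d) in
/-- The constant in front of the coordinate integrals. -/
def pairingConst : ℂ := (-1) ^ d / (2 * Real.pi * Complex.I) * orientConst (d + 1)

variable [T2Space X] [SigmaCompactSpace X]

/-- The regularized pairing of a localized form as a truncated integral on coordinate space. -/
theorem IsLocalized.regularizedPairing_eq (hD : IsSmoothHypersurface (n := d + 1) D)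
    {a b : PForm (d + 1) (d + 1) X} (ha : IsLocalized D e K a) (hb : b.SmoothOn Dᶜ)
    (hl : IsCutoff (d + 1) D lam) {h : Cn (d + 1) → ℝ} (hh : SmoothPos h)
    (hlam : ∀ x ∈ K, lam x = dist0 h (e x)) {F : Cn (d + 1) → ℂ}
    (hF : ∀ y ∈ e.target, y 0 ≠ 0 →
      topCoef (a.inCoord e y) * (starRingEnd ℂ) (topCoef (b.inCoord e y)) = F y)
    (hF0 : ∀ y, y ∉ e '' K → y 0 ≠ 0 → F y = 0) {ε : ℝ} (hε : 0 < ε) :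
    regularizedPairing lam ε a b = pairingConst d * truncInt h F ε := by
  have hA := hl.isClosed_le hD ε
  rw [regularizedPairing, integralWedgeConj_eq_integral_coord ha.adapted.mem hA
    hD.isClosed.isOpen_compl (hl.subset_compl hD hε) ha.compact ha.subset ha.smooth hb
    (fun x hx hxK => ha.zero x (hl.subset_compl hD hε hx) hxK), pairingConst,
    mul_assoc ((-1) ^ d / (2 * Real.pi * Complex.I) : ℂ)]
  congr 1
  have hS : ∀ y ∈ e '' K, (y ∈ e.symm ⁻¹' {x | ε ≤ lam x} ↔ ε ≤ dist0 h y) := by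
    rintro _ ⟨x, hx, rfl⟩
    rw [mem_preimage, e.left_inv (ha.subset hx), mem_ofPred_eq, hlam x hx]
  -- Both integrals are cut down to `e(K) ∩ {ε ≤ h|z₀|}`; only there is `λ` known to agree with the
  -- globally defined `h|z₀|`.
  rw [setIntegral_eq_of_subset_of_forall_sdiff_eq_zero
    (s := e '' K ∩ {y | ε ≤ dist0 h y}) (measurableSet_coord e hA), truncInt,
    setIntegral_eq_of_subset_of_forall_sdiff_eq_zero
    (s := e '' K ∩ {y | ε ≤ dist0 h y}) (hh.measurableSet ε), ← integral_const_mul]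
  · refine setIntegral_congr_fun
      (ha.isCompact_image.measurableSet.inter (hh.measurableSet ε)) fun y hy => ?_
    have := hF y (ha.image_subset hy.1) (ne_zero_of_dist0_pos (hε.trans_le hy.2))
    simp only [wedgeConjDensity_eq, this]
    ring
  · exact inter_subset_right
  · rintro y ⟨hy, hy'⟩
    exact hF0 y (fun hK => hy' ⟨hK, hy⟩) (ne_zero_of_dist0_pos (hε.trans_le hy))
  · rintro y ⟨hyK, hy⟩
    exact ⟨ha.image_subset hyK, (hS y hyK).2 hy⟩
  · rintro y ⟨hy, hy'⟩
    have hyK : y ∉ e '' K := fun hK => hy' ⟨hK, (hS y hK).1 hy.2⟩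
    have : a.inCoord e y = 0 := by
      rw [PForm.inCoord, ha.zero _ (hl.subset_compl hD hε hy.2)
        fun hK => hyK ⟨_, hK, e.right_inv hy.1⟩]; rfl
    rw [this, wedgeConjDensity_zero_left]

end LocalPairing

end

noncomputable section

/-! ### Finite partitions of unity on compact sets. -/

section PartitionOfUnity

open Filter Set

theorem alternating_smul_zero {n p : ℕ} (c : ℂ) : c • (0 : (Cn n) [⋀^Fin p]→L[ℂ] ℂ) = 0 := by
  ext v; simp

theorem alternating_zero_smul {n p : ℕ} (f : (Cn n) [⋀^Fin p]→L[ℂ] ℂ) : (0 : ℂ) • f = 0 :=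
  zero_smul ℂ f

theorem alternating_sum_smul {n p : ℕ} {J : Type*} (s : Finset J) (c : J → ℂ)
    (f : (Cn n) [⋀^Fin p]→L[ℂ] ℂ) : ∑ j ∈ s, c j • f = (∑ j ∈ s, c j) • f :=
  (Finset.sum_smul).symm

theorem alternating_smul_sum {n p : ℕ} {J : Type*} (s : Finset J) (c : ℂ)
    (f : J → (Cn n) [⋀^Fin p]→L[ℂ] ℂ) : ∑ j ∈ s, c • f j = c • ∑ j ∈ s, f j :=
  (Finset.smul_sum).symm

variable {n p : ℕ} {X : Type*} [TopologicalSpace X] [ChartedSpace (Cn n) X]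
  [IsManifold 𝓘(ℂ, Cn n) ω X]

/-- A finite smooth partition of unity on a compact set, subordinate to a family of charts. -/
theorem exists_finite_partition [T2Space X] [SigmaCompactSpace X] {S : Set X} (hS : IsCompact S)
    {e : X → OpenPartialHomeomorph X (Cn n)} (he : ∀ x, x ∈ (e x).source) :
    ∃ (F : Finset X) (f : X → X → ℝ), (∀ i, ContMDiff 𝓘(ℝ, Cn n) 𝓘(ℝ, ℝ) ∞ (f i)) ∧
      (∀ i, tsupport (f i) ⊆ (e i).source) ∧ ∀ x ∈ S, ∑ i ∈ F, f i x = 1 := by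
  have : IsManifold 𝓘(ℝ, Cn n) ∞ X := isManifold_real
  obtain ⟨f, hf⟩ := SmoothPartitionOfUnity.exists_isSubordinate 𝓘(ℝ, Cn n) isClosed_univ
    (fun x => (e x).source) (fun x => (e x).open_source) fun x _ => mem_iUnion.2 ⟨x, he x⟩
  have hfin : {i : X | (Function.support (f i) ∩ S).Nonempty}.Finite :=
    f.locallyFinite.finite_nonempty_inter_compact hS
  refine ⟨hfin.toFinset, fun i => f i, fun i => (f i).2, hf, fun x hx => ?_⟩
  have h1 := f.sum_eq_one (mem_univ x)
  rwa [finsum_eq_sum_of_support_subset (s := hfin.toFinset)] at h1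
  intro i hi
  simp only [Finite.coe_toFinset, mem_ofPred_eq]
  exact ⟨x, hi, hx⟩

theorem PForm.SmoothOn.smul {a : PForm n p X} {U : Set X} (hU : IsOpen U) (ha : a.SmoothOn U)
    {φ : X → ℝ} (hφ : ContMDiff 𝓘(ℝ, Cn n) 𝓘(ℝ, ℝ) ∞ φ) :
    PForm.SmoothOn (fun x => (φ x : ℂ) • a x) U := by
  refine PForm.smoothOn_of_forall fun x hx => ⟨_, chart_mem_holoAtlas x, mem_chart_source _ x, ?_⟩
  have h1 := ha.contDiffAt (hU.mem_nhds hx) (chart_mem_holoAtlas x) (mem_chart_source _ x)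
  have h2 := contDiffAt_comp_symm (chart_mem_holoAtlas x)
    ((chartAt (Cn n) x).map_source (mem_chart_source _ x)) hφ.contMDiffAt
  exact (Complex.ofRealCLM.contDiff.contDiffAt.comp _ h2).smul h1

end PartitionOfUnity

/-! ### The global expansion of the pairing and the change of cut-off function. -/

section Expansion

open Filter Set MeasureTheory

variable {d p : ℕ} {X : Type*} [TopologicalSpace X] [ChartedSpace (Cn (d + 1)) X]
  {D K : Set X} {e : OpenPartialHomeomorph X (Cn (d + 1))} {m : ℕ}

/-- The support of a form off `D`. -/
def PForm.supportOff (D : Set X) (a : PForm (d + 1) p X) : Set X :=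
  closure {x | x ∉ D ∧ a x ≠ 0}

theorem PForm.eq_zero_of_notMem_supportOff {a : PForm (d + 1) p X} {x : X} (hx : x ∉ D)
    (h : x ∉ a.supportOff D) : a x = 0 := by
  by_contra h0
  exact h (subset_closure ⟨hx, h0⟩)

variable [IsManifold 𝓘(ℂ, Cn (d + 1)) ω X]

theorem IsLocalized.smul_of_tsupport (hD : IsClosed D) (he : IsAdapted D e) {a : PForm (d + 1) p X}
    (ha : a.SmoothOn Dᶜ) (hc : a.CompactSupportOff D) {f : X → ℝ}
    (hf : ContMDiff 𝓘(ℝ, Cn (d + 1)) 𝓘(ℝ, ℝ) ∞ f) (hfe : tsupport f ⊆ e.source) :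
    IsLocalized D e (tsupport f ∩ a.supportOff D) fun x => (f x : ℂ) • a x := by
  refine ⟨he, IsCompact.inter_left hc (isClosed_tsupport f), inter_subset_left.trans hfe,
    ha.smul hD.isOpen_compl hf, fun x hx hxK => ?_⟩
  by_cases h : x ∈ tsupport f
  · rw [PForm.eq_zero_of_notMem_supportOff hx fun h' => hxK ⟨h, h'⟩, alternating_smul_zero]
  · rw [image_eq_zero_of_notMem_tsupport h, Complex.ofReal_zero, alternating_zero_smul]

theorem IsLocalized.smul (hD : IsClosed D) {a : PForm (d + 1) p X} (ha : IsLocalized D e K a)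
    {φ : X → ℝ} (hφ : ContMDiff 𝓘(ℝ, Cn (d + 1)) 𝓘(ℝ, ℝ) ∞ φ) :
    IsLocalized D e K fun x => (φ x : ℂ) • a x :=
  ⟨ha.adapted, ha.compact, ha.subset, ha.smooth.smul hD.isOpen_compl hφ,
    fun x hx hxK => by rw [ha.zero x hx hxK, alternating_smul_zero]⟩

variable [T2Space X] [SigmaCompactSpace X]

/-- `⟨a, b⟩_{λ,ε} = A log ε + I + O(ε)` for every cut-off function, with `A` independent of it. -/
def HasLogCoef (D : Set X) (a b : PForm (d + 1) (d + 1) X) (A : ℂ) : Prop :=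
  ∀ lam : X → ℝ, IsCutoff (d + 1) D lam →
    ∃ I, HasLogExp (fun ε => regularizedPairing lam ε a b) A I

/-- Replacing the cut-off function `λ` by `e^φ λ` decreases the constant term by `A`. -/
def HasLogShift (D : Set X) (φ : X → ℝ) (a b : PForm (d + 1) (d + 1) X) (A : ℂ) : Prop :=
  ∀ lam : X → ℝ, IsCutoff (d + 1) D lam → ∀ B I B' I',
    HasLogExp (fun ε => regularizedPairing lam ε a b) B I →
    HasLogExp (fun ε => regularizedPairing (fun x => Real.exp (φ x) * lam x) ε a b) B' I' →
    I' = I - A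

variable {a b : PForm (d + 1) (d + 1) X}

theorem regularizedPairing_sum (hD : IsSmoothHypersurface (n := d + 1) D) {J : Type*}
    (s : Finset J) {a : PForm (d + 1) (d + 1) X} {c : J → PForm (d + 1) (d + 1) X}
    (hac : ∀ x ∉ D, a x = ∑ j ∈ s, c j x) (hK : IsCompact K)
    (hc : ∀ j ∈ s, (c j).SmoothOn Dᶜ) (h0 : ∀ j ∈ s, ∀ x ∉ D, x ∉ K → c j x = 0)
    (hb : b.SmoothOn Dᶜ) {lam : X → ℝ} (hl : IsCutoff (d + 1) D lam) {ε : ℝ} (hε : 0 < ε) :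
    regularizedPairing lam ε a b = ∑ j ∈ s, regularizedPairing lam ε (c j) b := by
  have hA := hl.isClosed_le hD ε
  have hAD := hl.subset_compl hD hε
  simp only [regularizedPairing]
  rw [integralWedgeConj_congr (a' := fun x => ∑ j ∈ s, c j x) (b' := b)
    (fun x hx => hac x (hAD hx)) (fun _ _ => rfl) hA,
    integralWedgeConj_sum hA hD.isClosed.isOpen_compl hAD hK s hc hb
      (fun j hj x hx => h0 j hj x (hAD hx)), Finset.mul_sum]

theorem HasLogCoef.sum {J : Type*} (s : Finset J) {c : J → PForm (d + 1) (d + 1) X} {A : J → ℂ}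
    (hs : ∀ lam, IsCutoff (d + 1) D lam → ∀ ε > 0,
      regularizedPairing lam ε a b = ∑ j ∈ s, regularizedPairing lam ε (c j) b)
    (h : ∀ j ∈ s, HasLogCoef D (c j) b (A j)) : HasLogCoef D a b (∑ j ∈ s, A j) := by
  intro lam hl
  choose! I hI using fun j (hj : j ∈ s) => h j hj lam hl
  exact ⟨_, (HasLogExp.sum s hI).congr fun ε hε => (hs lam hl ε hε).symm⟩

/-- The hypothesis `hB` provides expansions of every summand for both `λ` and `e^φ λ`; without them
the shifts could hold vacuously and could not be added. -/
theorem HasLogShift.sum {φ : X → ℝ} (hφ : ContMDiff 𝓘(ℝ, Cn (d + 1)) 𝓘(ℝ, ℝ) ∞ φ) {J : Type*}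
    (s : Finset J) {c : J → PForm (d + 1) (d + 1) X} {A B : J → ℂ}
    (hs : ∀ lam, IsCutoff (d + 1) D lam → ∀ ε > 0,
      regularizedPairing lam ε a b = ∑ j ∈ s, regularizedPairing lam ε (c j) b)
    (hB : ∀ j ∈ s, HasLogCoef D (c j) b (B j)) (h : ∀ j ∈ s, HasLogShift D φ (c j) b (A j)) :
    HasLogShift D φ a b (∑ j ∈ s, A j) := by
  intro lam hl B₀ I₀ B₁ I₁ h0 h1
  choose! I hI using fun j (hj : j ∈ s) => hB j hj lam hl
  choose! I' hI' using fun j (hj : j ∈ s) => hB j hj _ (hl.exp_mul hφ)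
  have e0 := h0.unique ((HasLogExp.sum s hI).congr fun ε hε => (hs lam hl ε hε).symm)
  have e1 := h1.unique ((HasLogExp.sum s hI').congr fun ε hε =>
    (hs _ (hl.exp_mul hφ) ε hε).symm)
  rw [e0.2, e1.2, ← Finset.sum_sub_distrib]
  exact Finset.sum_congr rfl fun j hj => h j hj lam hl _ _ _ _ (hI j hj) (hI' j hj)

/-- One number works for all cut-off functions because `logCoef` does not involve `h`. -/
theorem IsLocalized.hasLogCoef (hD : IsSmoothHypersurface (n := d + 1) D)
    (ha : IsLocalized D e K a) (hb : b.SmoothOn Dᶜ) {G : Cn (d + 1) → ℂ} (hG : IsTest G)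
    (h1 : ∀ y ∈ e.target, y 0 ≠ 0 → topCoef (a.inCoord e y) *
      (starRingEnd ℂ) (topCoef (b.inCoord e y)) = G y * mono (-(m : ℤ)) (-1) y)
    (h2 : ∀ y, y ∉ e '' K → G y = 0) :
    HasLogCoef D a b (pairingConst d * logCoef m G) := by
  intro lam hl
  obtain ⟨h, hh, hlam⟩ := hl.exists_smoothPos ha.adapted ha.compact ha.subset
  obtain ⟨I, hI⟩ := hasLogExp_logCoef m hh hG
  exact ⟨_, (hI.const_mul (pairingConst d)).congr fun ε hε =>
    (ha.regularizedPairing_eq hD hb hl hh hlam h1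
      (fun y hy _ => by rw [h2 y hy, zero_mul]) hε).symm⟩

/-- Both properties hold for the same number, a multiple of `logCoef m (ψ G)`, where `ψ` is a global
smooth function on coordinate space that agrees with `φ` on the image of `K`; the second is
`finitePart_exp_mul`. -/
theorem IsLocalized.hasLogShift (hD : IsSmoothHypersurface (n := d + 1) D)
    (ha : IsLocalized D e K a) (hb : b.SmoothOn Dᶜ) {G : Cn (d + 1) → ℂ} (hG : IsTest G)
    (h1 : ∀ y ∈ e.target, y 0 ≠ 0 → topCoef (a.inCoord e y) *
      (starRingEnd ℂ) (topCoef (b.inCoord e y)) = G y * mono (-(m : ℤ)) (-1) y)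
    (h2 : ∀ y, y ∉ e '' K → G y = 0) {φ : X → ℝ}
    (hφ : ContMDiff 𝓘(ℝ, Cn (d + 1)) 𝓘(ℝ, ℝ) ∞ φ) :
    ∃ A, HasLogCoef D (fun x => (φ x : ℂ) • a x) b A ∧ HasLogShift D φ a b A := by
  obtain ⟨ψ, hψ, hψK, -⟩ := exists_contDiff_eq_on ha.adapted.mem ha.compact ha.subset
    hφ.contMDiffOn
  have hψc : ContDiff ℝ ∞ fun y => (ψ y : ℂ) := Complex.ofRealCLM.contDiff.comp hψ
  refine ⟨_, (ha.smul hD.isClosed hφ).hasLogCoef hD hb (hG.mul_left hψc) (m := m) ?_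
    fun y hy => by rw [h2 y hy, mul_zero], ?_⟩
  · intro y hy hy0
    have h3 : topCoef (PForm.inCoord (fun x => (φ x : ℂ) • a x) e y) =
        φ (e.symm y) * topCoef (a.inCoord e y) := rfl
    rw [h3, mul_assoc, h1 y hy hy0]
    by_cases hyK : y ∈ e '' K
    · obtain ⟨x, hx, rfl⟩ := hyK
      rw [e.left_inv (ha.subset hx), hψK x hx, mul_assoc]
    · rw [h2 y hyK]; ring
  · intro lam hl B I B' I' hI hI'
    obtain ⟨h, hh, hlam⟩ := hl.exists_smoothPos ha.adapted ha.compact ha.subset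
    have hF0 : ∀ y, y ∉ e '' K → y 0 ≠ 0 → G y * mono (-(m : ℤ)) (-1) y = 0 :=
      fun y hy _ => by rw [h2 y hy, zero_mul]
    obtain ⟨J, hJ⟩ := hasLogExp_logCoef m hh hG
    obtain ⟨J', hJ'⟩ := hasLogExp_logCoef m (hh.exp_mul hψ) hG
    have e1 := hI.unique ((hJ.const_mul (pairingConst d)).congr fun ε hε =>
      (ha.regularizedPairing_eq hD hb hl hh hlam h1 hF0 hε).symm)
    have e2 := hI'.unique ((hJ'.const_mul (pairingConst d)).congr fun ε hε =>
      (ha.regularizedPairing_eq hD hb (hl.exp_mul hφ) (hh.exp_mul hψ)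
        (fun x hx => by
          simp only [dist0, hψK x hx, hlam x hx]; ring) h1 hF0 hε).symm)
    rw [e1.2, e2.2, finitePart_exp_mul hψ m hh hG hJ hJ']
    ring

/-- The expansion of the regularized pairing and the dependence of its constant term on the cut-off
function. -/
theorem exists_hasLogCoef (hD : IsSmoothHypersurface (n := d + 1) D)
    (ha : a.HasPoles D) (hac : a.CompactSupportOff D) (hb : b.HasPoleOrderLE D 1) :
    (∃ A, HasLogCoef D a b A) ∧
    ∀ φ : X → ℝ, ContMDiff 𝓘(ℝ, Cn (d + 1)) 𝓘(ℝ, ℝ) ∞ φ →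
      ∃ A, HasLogCoef D (fun x => (φ x : ℂ) • a x) b A ∧ HasLogShift D φ a b A := by
  have hch : ∀ x, ∃ (e : OpenPartialHomeomorph X (Cn (d + 1))) (m : ℕ), IsAdapted D e ∧
      x ∈ e.source ∧ PoleOn e m a ∧ PoleOn e 1 b := by
    intro x
    obtain ⟨m, e, he, hxe, hp⟩ := ha.poleAt hD x
    obtain ⟨W, hW, hxW, hp'⟩ := (hb.poleAt hD x).exists_poleOn hD.isClosed he hxe
    exact ⟨_, m, he.restrOpen hW, ⟨hxe, hxW⟩, hp.restrOpen hW, hp'⟩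
  choose e m he hxe hpa hpb using hch
  obtain ⟨F, f, hf, hfe, hsum⟩ := exists_finite_partition (S := a.supportOff D) hac hxe
  have hloc := fun i => IsLocalized.smul_of_tsupport hD.isClosed (he i) ha.1 hac (hf i) (hfe i)
  have hdec : ∀ x ∉ D, a x = ∑ i ∈ F, (f i x : ℂ) • a x := by
    intro x hx
    by_cases h : x ∈ a.supportOff D
    · rw [alternating_sum_smul, ← Complex.ofReal_sum, hsum x h, Complex.ofReal_one]
      exact (one_smul ℂ _).symm
    · rw [alternating_sum_smul, PForm.eq_zero_of_notMem_supportOff hx h, alternating_smul_zero]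
  have hzero : ∀ i, ∀ x ∉ D, x ∉ a.supportOff D → (f i x : ℂ) • a x = 0 := fun i x hx h => by
    rw [PForm.eq_zero_of_notMem_supportOff hx h, alternating_smul_zero]
  have hreg : ∀ lam, IsCutoff (d + 1) D lam → ∀ ε > 0, regularizedPairing lam ε a b =
      ∑ i ∈ F, regularizedPairing lam ε (fun x => (f i x : ℂ) • a x) b := fun lam hl ε hε =>
    regularizedPairing_sum hD F hdec hac (fun i _ => (hloc i).smooth) (fun i _ => hzero i) hb.1 hl hε
  have hG : ∀ i, ∃ G, IsTest G ∧ (∀ y ∈ (e i).target, y 0 ≠ 0 →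
      topCoef (PForm.inCoord (fun x => (f i x : ℂ) • a x) (e i) y) *
        (starRingEnd ℂ) (topCoef (b.inCoord (e i) y)) = G y * mono (-(m i : ℤ)) (-1) y) ∧
      ∀ y, y ∉ e i '' (tsupport (f i) ∩ a.supportOff D) → G y = 0 := by
    intro i
    obtain ⟨Na, hNa⟩ := (hpa i).smul (he i).mem (hf i)
    obtain ⟨Nb, hNb⟩ := hpb i
    obtain ⟨G, hG, -, h2, h3⟩ := (hloc i).exists_isTest_top hNa hNb
    exact ⟨G, hG, h3, h2⟩
  choose G hGt hG1 hG2 using hG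
  have hcoef := fun i => (hloc i).hasLogCoef hD hb.1 (hGt i) (hG1 i) (hG2 i)
  refine ⟨⟨_, HasLogCoef.sum F hreg fun i _ => hcoef i⟩, fun φ hφ => ?_⟩
  choose A hA hA' using fun i => (hloc i).hasLogShift hD hb.1 (hGt i) (hG1 i) (hG2 i) hφ
  refine ⟨∑ i ∈ F, A i, HasLogCoef.sum F (fun lam hl ε hε => ?_) fun i _ => hA i,
    HasLogShift.sum hφ F hreg (fun i _ => hcoef i) fun i _ => hA' i⟩
  refine regularizedPairing_sum hD F (fun x hx => ?_) hac
    (fun i _ => ((hloc i).smul hD.isClosed hφ).smooth) (fun i _ x hx h => by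
      rw [hzero i x hx h, alternating_smul_zero]) hb.1 hl hε
  rw [alternating_smul_sum, ← hdec x hx]

end Expansion

end

noncomputable section

/-! ### Calculus of `∂` on the manifold. -/

section Del

open Filter Set

variable {n p : ℕ}

theorem complexLinearPart_apply {E F : Type*} [NormedAddCommGroup E] [NormedSpace ℂ E]
    [NormedAddCommGroup F] [NormedSpace ℂ F] (L : E →L[ℝ] F) (v : E) :
    complexLinearPart L v = (2⁻¹ : ℂ) • (L v - Complex.I • L (Complex.I • v)) := rfl

theorem delCoord_apply (η : Cn n → (Cn n) [⋀^Fin p]→L[ℂ] ℂ) (y : Cn n) (v : Fin (p + 1) → Cn n) :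
    delCoord η y v = ∑ i : Fin (p + 1), (-1) ^ (i : ℕ) *
      (2⁻¹ * ((fderiv ℝ η y (v i)) (i.removeNth v) -
        Complex.I * (fderiv ℝ η y (Complex.I • v i)) (i.removeNth v))) := by
  rw [delCoord, ContinuousAlternatingMap.alternatizeUncurryFin_apply]
  refine Finset.sum_congr rfl fun i _ => ?_
  rw [complexLinearPart_apply]
  simp

theorem fderiv_alternating_apply {η : Cn n → (Cn n) [⋀^Fin p]→L[ℂ] ℂ} {y : Cn n}
    (h : DifferentiableAt ℝ η y) (w : Fin p → Cn n) (v : Cn n) :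
    fderiv ℝ (fun z => η z w) y v = (fderiv ℝ η y v) w := by
  have := ((ContinuousAlternatingMap.apply ℂ (Cn n) ℂ w).restrictScalars ℝ).hasFDerivAt.comp y
    h.hasFDerivAt
  exact DFunLike.congr_fun this.fderiv v

/-- The standard basis of `ℂᵖ⁺¹` without its `i`-th member. -/
def coordFace (i : Fin (p + 1)) : Fin p → Cn (p + 1) := fun j => Pi.single (i.succAbove j) 1

/-- In degree one below the top, `∂` is a signed divergence; this is the form in which integration
by parts meets it. -/
theorem topCoef_delCoord {η : Cn (p + 1) → (Cn (p + 1)) [⋀^Fin p]→L[ℂ] ℂ} {y : Cn (p + 1)}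
    (h : DifferentiableAt ℝ η y) :
    topCoef (delCoord η y) = ∑ i : Fin (p + 1), (-1) ^ (i : ℕ) *
      wirt (-Complex.I) i (fun z => η z (coordFace i)) y := by
  rw [topCoef, delCoord_apply]
  refine Finset.sum_congr rfl fun i _ => ?_
  rw [wirt, fderiv_alternating_apply h, fderiv_alternating_apply h]
  have : (i.removeNth fun j : Fin (p + 1) => (Pi.single j 1 : Cn (p + 1))) = coordFace i := rfl
  rw [this]
  ring_nf

theorem contDiffAt_delCoord {η : Cn n → (Cn n) [⋀^Fin p]→L[ℂ] ℂ} {y : Cn n}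
    (h : ContDiffAt ℝ ∞ η y) : ContDiffAt ℝ ∞ (delCoord η) y := by
  refine contDiffAt_alternating fun r => ?_
  simp_rw [delCoord_apply]
  have h1 : ∀ (v : Cn n) (w : Fin p → Cn n), ContDiffAt ℝ ∞ (fun z => (fderiv ℝ η z v) w) y :=
    fun v w => ((h.fderiv_right (m := ∞) le_rfl).clm_apply contDiffAt_const).alternating_apply w
  exact ContDiffAt.sum fun i _ => contDiffAt_const.mul
    (contDiffAt_const.mul ((h1 _ _).sub (contDiffAt_const.mul (h1 _ _))))

variable {X : Type*} [TopologicalSpace X] [ChartedSpace (Cn n) X] {α β : PForm n p X} {x : X}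

theorem PForm.del_congr (h : α =ᶠ[𝓝 x] β) : α.del x = β.del x := by
  have hc : ∀ᶠ y in 𝓝 (chartAt (Cn n) x x), α.inChart x y = β.inChart x y := by
    have h1 := (chartAt (Cn n) x).symm.continuousAt
      ((chartAt (Cn n) x).map_source (mem_chart_source _ x))
    rw [ContinuousAt, (chartAt (Cn n) x).left_inv (mem_chart_source _ x)] at h1
    filter_upwards [h1.eventually h] with y hy
    rw [PForm.inChart, PForm.inChart, hy]
  unfold PForm.del delCoord
  rw [Filter.EventuallyEq.fderiv_eq hc]

theorem PForm.del_zero (x : X) : PForm.del (fun _ => 0 : PForm n p X) x = 0 := by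
  have h : PForm.inChart (fun _ => 0 : PForm n p X) x = fun _ => 0 := by
    funext y; rfl
  unfold PForm.del delCoord
  have h0 : ContinuousAlternatingMap.alternatizeUncurryFin (complexLinearPart
      (0 : Cn n →L[ℝ] (Cn n) [⋀^Fin p]→L[ℂ] ℂ)) = 0 := by
    ext v
    rw [ContinuousAlternatingMap.alternatizeUncurryFin_apply]
    simp [complexLinearPart_apply]
  rw [h, fderiv_fun_const, Pi.zero_apply, h0]
  rfl

theorem PForm.del_add (hα : DifferentiableAt ℝ (α.inChart x) (chartAt (Cn n) x x))
    (hβ : DifferentiableAt ℝ (β.inChart x) (chartAt (Cn n) x x)) :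
    PForm.del (fun x => α x + β x) x = α.del x + β.del x := by
  have h : PForm.inChart (fun x => α x + β x) x = fun y => α.inChart x y + β.inChart x y := rfl
  unfold PForm.del delCoord
  rw [h, fderiv_fun_add hα hβ, complexLinearPart_add,
    ContinuousAlternatingMap.alternatizeUncurryFin_add]
  rfl

theorem PForm.del_sum {J : Type*} (s : Finset J) {a : J → PForm n p X}
    (h : ∀ j ∈ s, DifferentiableAt ℝ ((a j).inChart x) (chartAt (Cn n) x x)) :
    PForm.del (fun x => ∑ j ∈ s, a j x) x = ∑ j ∈ s, (a j).del x := by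
  classical
  induction s using Finset.induction_on with
  | empty => simpa using PForm.del_zero x
  | insert i s hi ih =>
    have hs : ∀ j ∈ s, DifferentiableAt ℝ ((a j).inChart x) (chartAt (Cn n) x x) :=
      fun j hj => h j (Finset.mem_insert_of_mem hj)
    have hd : DifferentiableAt ℝ (PForm.inChart (fun x => ∑ j ∈ s, a j x) x)
        (chartAt (Cn n) x x) := by
      have : PForm.inChart (fun x => ∑ j ∈ s, a j x) x = fun y => ∑ j ∈ s, (a j).inChart x y := by
        funext y
        ext v
        change (∑ j ∈ s, a j ((chartAt (Cn n) x).symm y)) _ = _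
        rw [ContinuousAlternatingMap.sum_apply, ContinuousAlternatingMap.sum_apply]
        rfl
      rw [this]
      exact DifferentiableAt.fun_sum fun j hj => hs j hj
    simp only [Finset.sum_insert hi]
    rw [PForm.del_add (h i (Finset.mem_insert_self i s)) hd, ih hs]

variable [IsManifold 𝓘(ℂ, Cn n) ω X]

theorem PForm.SmoothOn.del {U : Set X} (hU : IsOpen U) (h : α.SmoothOn U) : α.del.SmoothOn U := by
  refine PForm.smoothOn_of_forall fun x hx => ⟨_, chart_mem_holoAtlas x, mem_chart_source _ x, ?_⟩
  set c := chartAt (Cn n) x with hc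
  have hxc : x ∈ c.source := mem_chart_source _ x
  have hcm : c ∈ holoAtlas n X := chart_mem_holoAtlas x
  have h1 := contDiffAt_delCoord (h.contDiffAt (hU.mem_nhds hx) hcm hxc)
  refine h1.congr_of_eventuallyEq ?_
  have hcont := c.symm.continuousAt (c.map_source hxc)
  rw [ContinuousAt, c.left_inv hxc] at hcont
  filter_upwards [c.open_target.mem_nhds (c.map_source hxc),
    hcont.eventually (hU.mem_nhds hx)] with y hy hyU
  have h2 := PForm.inCoord_del hcm (c.map_target hy)
    (h.contDiffAt (hU.mem_nhds hyU) hcm (c.map_target hy))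
  rwa [c.right_inv hy] at h2

theorem PForm.SmoothOn.differentiableAt_inChart {U : Set X} (hU : IsOpen U) (h : α.SmoothOn U)
    (hx : x ∈ U) : DifferentiableAt ℝ (α.inChart x) (chartAt (Cn n) x x) :=
  (h.contDiffAt (hU.mem_nhds hx) (chart_mem_holoAtlas x) (mem_chart_source _ x)).differentiableAt
    (by simp)

end Del

/-! ### `∂`-exact forms have no logarithmic term. -/

section DelPairing

open Filter Set MeasureTheory

variable {d : ℕ} {X : Type*} [TopologicalSpace X] [ChartedSpace (Cn (d + 1)) X]
  [IsManifold 𝓘(ℂ, Cn (d + 1)) ω X] {D K : Set X} {e : OpenPartialHomeomorph X (Cn (d + 1))}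
  {k : ℕ}

theorem truncInt_sum {h : Cn (d + 1) → ℝ} (hh : SmoothPos h) {J : Type*} (s : Finset J)
    {F : J → Cn (d + 1) → ℂ} (hF : ∀ j ∈ s, ContOff (F j)) {ε : ℝ} (hε : 0 < ε) :
    truncInt h (fun y => ∑ j ∈ s, F j y) ε = ∑ j ∈ s, truncInt h (F j) ε :=
  integral_finsetSum s fun j hj => (hF j hj).integrableOn hh hε

theorem IsLocalized.del {γ : PForm (d + 1) d X} (hD : IsClosed D) (h : IsLocalized D e K γ)
    [T2Space X] : IsLocalized D e K γ.del := by
  refine ⟨h.adapted, h.compact, h.subset, h.smooth.del hD.isOpen_compl, fun x hx hxK => ?_⟩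
  have : γ =ᶠ[𝓝 x] fun _ => 0 := by
    filter_upwards [(hD.isOpen_compl.inter h.compact.isClosed.isOpen_compl).mem_nhds ⟨hx, hxK⟩]
      with z hz using h.zero z hz.1 hz.2
  rw [PForm.del_congr this, PForm.del_zero]

variable [T2Space X] [SigmaCompactSpace X]

/-- The pairing of a localized `∂`-exact form with a meromorphic form has no logarithmic term. -/
theorem IsLocalized.hasLogCoef_del (hD : IsSmoothHypersurface (n := d + 1) D)
    {γ : PForm (d + 1) d X} {b : PForm (d + 1) (d + 1) X} (hγ : IsLocalized D e K γ)
    (hp : PoleOn e k γ) (hb : b.HolomorphicOn Dᶜ) (hbp : PoleOn e 1 b) :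
    HasLogCoef D γ.del b 0 := by
  obtain ⟨N, hN⟩ := hp
  obtain ⟨M, hM⟩ := hbp
  have he := hγ.adapted
  have hoff : ∀ y ∈ e.target, y 0 ≠ 0 → Dᶜ ∈ 𝓝 (e.symm y) := fun y hy hy0 =>
    hD.isClosed.isOpen_compl.mem_nhds fun h => hy0 ((he.symm_mem_iff hy).1 h)
  let w : Fin (d + 1) → Fin d → Cn (d + 1) := coordFace
  have hQ : ∀ i : Fin (d + 1), ∃ Q, IsTest Q ∧
      (∀ y ∈ e.target, Q y = N y (w i) * (starRingEnd ℂ) (topCoef (M y))) ∧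
      ∀ y, y ∉ e '' K → Q y = 0 := fun i =>
    hγ.exists_isTest
      (fun y hy => ((hN.1.contDiffAt (e.open_target.mem_nhds hy)).alternating_apply
        (w i)).contDiffWithinAt)
      (fun y hy => (hM.1.contDiffAt (e.open_target.mem_nhds hy)).topCoef.contDiffWithinAt)
      (fun y hy hyK => by rw [hγ.rep_eq_zero hN hy hyK]; rfl)
  choose Q hQ hQ1 hQ0 using hQ
  have hprod : ∀ i, ∀ y ∈ e.target, y 0 ≠ 0 → Q i y * mono (-(k : ℤ)) (-1) y =
      γ.inCoord e y (w i) * (starRingEnd ℂ) (topCoef (b.inCoord e y)) := by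
    intro i y hy hy0
    rw [hQ1 i y hy, hN.2 y hy hy0, hM.2 y hy hy0]
    simp only [topCoef, ContinuousAlternatingMap.smul_apply, smul_eq_mul, map_mul, map_inv₀,
      pow_one, mono, zpow_neg, zpow_natCast, zpow_one]
    ring
  have hsm : ∀ i, SmoothOff (wirt (-Complex.I) i fun y => Q i y * mono (-(k : ℤ)) (-1) y) :=
    fun i => ((hQ i).smoothOff _ _).wirt
  intro lam hl
  obtain ⟨h, hh, hlam⟩ := hl.exists_smoothPos he hγ.compact hγ.subset
  have hsum := HasLogExp.sum Finset.univ fun (i : Fin (d + 1)) _ =>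
    (hasLogExp_dz hh k i (hQ i)).const_mul ((-1) ^ (i : ℕ))
  simp only [mul_zero, Finset.sum_const_zero] at hsum
  have hfin := hsum.const_mul (pairingConst d)
  rw [mul_zero] at hfin
  refine ⟨_, hfin.congr fun ε hε => ?_⟩
  have hF := (hγ.del hD.isClosed).regularizedPairing_eq (b := b) hD hb.smoothOn hl hh hlam
    (F := fun y => ∑ i : Fin (d + 1), (-1) ^ (i : ℕ) *
      wirt (-Complex.I) i (fun y => Q i y * mono (-(k : ℤ)) (-1) y) y) ?_ ?_ hε
  · rw [hF, truncInt_sum hh _ (fun i _ => (hsm i).contOff.const_mul _) hε]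
    simp only [truncInt_const_mul]
  · intro y hy hy0
    have hxe := e.map_target hy
    have hγs := hγ.smooth.contDiffAt (hoff y hy hy0) he.mem hxe
    have hbh := hb.contDiffAt (hoff y hy hy0) he.mem hxe
    have hdel := PForm.inCoord_del he.mem hxe hγs
    rw [e.right_inv hy] at hγs hbh hdel
    have hbt : ContDiffAt ℂ ω (fun y => topCoef (b.inCoord e y)) y := hbh.topCoef
    have hbd : DifferentiableAt ℂ (fun y => topCoef (b.inCoord e y)) y :=
      hbt.differentiableAt (by simp)
    have hbr : DifferentiableAt ℝ (fun y => topCoef (b.inCoord e y)) y := hbd.restrictScalars ℝ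
    -- Since `b` is holomorphic, its conjugate coefficient is annihilated by `∂/∂z_i` and can be
    -- moved inside the derivative; the density becomes a sum of derivatives to which `hasLogExp_dz`
    -- applies.
    rw [hdel, topCoef_delCoord (hγs.differentiableAt (by simp)), Finset.sum_mul]
    refine Finset.sum_congr rfl fun i _ => ?_
    have hev : (fun y => Q i y * mono (-(k : ℤ)) (-1) y) =ᶠ[𝓝 y] fun y =>
        γ.inCoord e y (w i) * (starRingEnd ℂ) (topCoef (b.inCoord e y)) := by
      filter_upwards [e.open_target.mem_nhds hy,
        (continuous_apply (0 : Fin (d + 1))).continuousAt.eventually_ne hy0] with z hz hz0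
      exact hprod i z hz hz0
    have hγi : DifferentiableAt ℝ (fun y => γ.inCoord e y (w i)) y :=
      (hγs.alternating_apply (w i)).differentiableAt (by simp)
    have hconj : DifferentiableAt ℝ (fun y => (starRingEnd ℂ) (topCoef (b.inCoord e y))) y :=
      (Complex.conjCLE.differentiableAt).comp y hbr
    rw [wirt_congr hev, wirt_mul hγi hconj, wirt_conj hbr]
    have : (starRingEnd ℂ) (-Complex.I) = Complex.I := by simp
    rw [this, dzbar_of_holomorphic hbd, map_zero, mul_zero, add_zero, mul_assoc]
  · intro y hyK _
    refine Finset.sum_eq_zero fun i _ => ?_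
    have hev : (fun y => Q i y * mono (-(k : ℤ)) (-1) y) =ᶠ[𝓝 y] fun _ => 0 := by
      filter_upwards [hγ.isCompact_image.isClosed.isOpen_compl.mem_nhds hyK] with z hz
      rw [hQ0 i z hz, zero_mul]
    rw [wirt_congr hev, wirt_const, mul_zero]

/-- The partition of unity is applied to `γ` before taking `∂`, so every piece `∂(f_i γ)` is again
exact and no derivatives of the `f_i` have to be handled. -/
theorem hasLogCoef_del (hD : IsSmoothHypersurface (n := d + 1) D)
    {γ : PForm (d + 1) d X} {b : PForm (d + 1) (d + 1) X} (hγ : γ.HasPoles D)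
    (hγc : γ.CompactSupportOff D) (hb : b.IsMeromorphic D 1) : HasLogCoef D γ.del b 0 := by
  have hch : ∀ x, ∃ (e : OpenPartialHomeomorph X (Cn (d + 1))) (m : ℕ), IsAdapted D e ∧
      x ∈ e.source ∧ PoleOn e m γ ∧ PoleOn e 1 b := by
    intro x
    obtain ⟨m, e, he, hxe, hp⟩ := hγ.poleAt hD x
    obtain ⟨W, hW, hxW, hp'⟩ :=
      (hb.hasPoleOrderLE.poleAt hD x).exists_poleOn hD.isClosed he hxe
    exact ⟨_, m, he.restrOpen hW, ⟨hxe, hxW⟩, hp.restrOpen hW, hp'⟩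
  choose e m he hxe hpa hpb using hch
  obtain ⟨F, f, hf, hfe, hsum⟩ := exists_finite_partition (S := γ.supportOff D) hγc hxe
  have hloc := fun i => IsLocalized.smul_of_tsupport hD.isClosed (he i) hγ.1 hγc (hf i) (hfe i)
  have hdec : ∀ x ∉ D, γ x = ∑ i ∈ F, (f i x : ℂ) • γ x := by
    intro x hx
    by_cases h : x ∈ γ.supportOff D
    · rw [alternating_sum_smul, ← Complex.ofReal_sum, hsum x h, Complex.ofReal_one]
      exact (one_smul ℂ _).symm
    · rw [alternating_sum_smul, PForm.eq_zero_of_notMem_supportOff hx h, alternating_smul_zero]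
  have hdel : ∀ x ∉ D, γ.del x = ∑ i ∈ F, PForm.del (fun x => (f i x : ℂ) • γ x) x := by
    intro x hx
    rw [← PForm.del_sum F fun i _ => (hloc i).smooth.differentiableAt_inChart
      hD.isClosed.isOpen_compl hx]
    refine PForm.del_congr ?_
    filter_upwards [hD.isClosed.isOpen_compl.mem_nhds hx] with z hz using hdec z hz
  have hK : IsCompact (⋃ i ∈ F, tsupport (f i) ∩ γ.supportOff D) :=
    F.isCompact_biUnion fun i _ => (hloc i).compact
  have hmain := HasLogCoef.sum (a := γ.del) (A := fun _ => 0) F (fun lam hl ε hε =>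
    regularizedPairing_sum hD F hdel hK (fun i _ => ((hloc i).del hD.isClosed).smooth)
      (fun i hi x hx hxK => ((hloc i).del hD.isClosed).zero x hx fun h =>
        hxK (mem_biUnion hi h)) hb.1.smoothOn hl hε)
    fun i _ => (hloc i).hasLogCoef_del hD ((hpa i).smul (he i).mem (hf i)) hb.1 (hpb i)
  simpa using hmain

end DelPairing

end

noncomputable section

/-! ### Charts of `D` induced by adapted charts. -/

section SliceChart

open Filter Set

variable (d : ℕ)

/-- The inclusion of the hyperplane `z₀ = 0`. -/
def consCLM : Cn d →L[ℂ] Cn (d + 1) :=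
  ContinuousLinearMap.pi (Fin.cons 0 fun j => ContinuousLinearMap.proj j)

/-- The projection onto the hyperplane `z₀ = 0`. -/
def tailCLM : Cn (d + 1) →L[ℂ] Cn d :=
  ContinuousLinearMap.pi fun j => ContinuousLinearMap.proj j.succ

variable {d}

theorem consCLM_apply (z : Cn d) : consCLM d z = Fin.cons 0 z := by
  ext i
  refine Fin.cases rfl (fun j => rfl) i

theorem consCLM_zero (z : Cn d) : consCLM d z 0 = 0 := rfl

theorem tailCLM_consCLM (z : Cn d) : tailCLM d (consCLM d z) = z := rfl

theorem consCLM_tailCLM {y : Cn (d + 1)} (hy : y 0 = 0) : consCLM d (tailCLM d y) = y := by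
  ext i
  refine Fin.cases hy.symm (fun j => rfl) i

theorem consCLM_single (j : Fin d) : consCLM d (Pi.single j 1) = Pi.single j.succ 1 := by
  ext i
  refine Fin.cases ?_ (fun k => ?_) i
  · rw [consCLM_zero, Pi.single_eq_of_ne (Fin.succ_ne_zero j).symm]
  · change (Pi.single j 1 : Cn d) k = _
    simp [Pi.single_apply]

variable {X : Type*} [TopologicalSpace X] [ChartedSpace (Cn (d + 1)) X]
  {Y : Type*} [TopologicalSpace Y] [ChartedSpace (Cn d) Y] {D : Set X} {ι : Y → X}
  {e : OpenPartialHomeomorph X (Cn (d + 1))}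

theorem IsSubmanifoldStructure.mem (hι : IsSubmanifoldStructure (n := d + 1) (k := d) D ι) (y : Y) :
    ι y ∈ D := hι.range_eq ▸ mem_range_self y

theorem IsSubmanifoldStructure.ι_invFun [Nonempty Y]
    (hι : IsSubmanifoldStructure (n := d + 1) (k := d) D ι) {x : X} (hx : x ∈ D) :
    ι (Function.invFun ι x) = x :=
  Function.invFun_eq (by rwa [← hι.range_eq] at hx)

theorem IsSubmanifoldStructure.coord_ι (hι : IsSubmanifoldStructure (n := d + 1) (k := d) D ι)
    (he : IsAdapted D e) {y : Y} (hy : ι y ∈ e.source) : consCLM d (tailCLM d (e (ι y))) = e (ι y) :=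
  consCLM_tailCLM ((he.mem_iff _ hy).1 (hι.mem y))

theorem IsSubmanifoldStructure.ι_invFun_symm [Nonempty Y]
    (hι : IsSubmanifoldStructure (n := d + 1) (k := d) D ι) (he : IsAdapted D e) {z : Cn d}
    (hz : consCLM d z ∈ e.target) :
    ι (Function.invFun ι (e.symm (consCLM d z))) = e.symm (consCLM d z) :=
  hι.ι_invFun ((he.symm_mem_iff hz).2 (consCLM_zero z))

/-- The chart of the hypersurface obtained from an adapted chart by forgetting `z₀`. -/
def sliceChart [Nonempty Y] (hι : IsSubmanifoldStructure (n := d + 1) (k := d) D ι)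
    (he : IsAdapted D e) : OpenPartialHomeomorph Y (Cn d) where
  toFun y := tailCLM d (e (ι y))
  invFun z := Function.invFun ι (e.symm (consCLM d z))
  source := ι ⁻¹' e.source
  target := consCLM d ⁻¹' e.target
  map_source' y hy := by
    rw [mem_preimage, hι.coord_ι he hy]
    exact e.map_source hy
  map_target' z hz := by
    rw [mem_preimage, hι.ι_invFun_symm he hz]
    exact e.map_target hz
  left_inv' y hy := by
    rw [hι.coord_ι he hy, e.left_inv hy]
    exact Function.leftInverse_invFun hι.isEmbedding.injective y
  right_inv' z hz := by
    rw [hι.ι_invFun_symm he hz, e.right_inv hz, tailCLM_consCLM]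
  open_source := e.open_source.preimage hι.isEmbedding.continuous
  open_target := e.open_target.preimage (consCLM d).continuous
  continuousOn_toFun := (tailCLM d).continuous.comp_continuousOn
    (e.continuousOn.comp hι.isEmbedding.continuous.continuousOn fun _ h => h)
  continuousOn_invFun := by
    rw [hι.isEmbedding.isInducing.continuousOn_iff]
    refine (e.symm.continuousOn.comp (consCLM d).continuous.continuousOn fun _ h => h).congr ?_
    intro z hz
    exact hι.ι_invFun_symm he hz

variable [Nonempty Y] (hι : IsSubmanifoldStructure (n := d + 1) (k := d) D ι) (he : IsAdapted D e)

theorem ι_sliceChart_symm {z : Cn d} (hz : consCLM d z ∈ e.target) :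
    ι ((sliceChart hι he).symm z) = e.symm (consCLM d z) := hι.ι_invFun_symm he hz

theorem consCLM_sliceChart {y : Y} (hy : ι y ∈ e.source) :
    consCLM d (sliceChart hι he y) = e (ι y) := hι.coord_ι he hy

variable [IsManifold 𝓘(ℂ, Cn (d + 1)) ω X] [IsManifold 𝓘(ℂ, Cn d) ω Y]

/-- Because `e ∘ ι` is the hyperplane inclusion after the slice chart, and `ι` is an immersion, the
differential of the slice chart is injective; `mem_holoAtlas_of_injective` then gives compatibility
with the structure of `Y`. -/
theorem sliceChart_mem_holoAtlas : sliceChart hι he ∈ holoAtlas d Y := by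
  have hι1 : ∀ y, MDifferentiableAt 𝓘(ℂ, Cn d) 𝓘(ℂ, Cn (d + 1)) ι y := fun y =>
    (hι.holomorphic y).mdifferentiableAt (by simp)
  refine mem_holoAtlas_of_injective ?_ ?_
  · have h1 : ContMDiffOn 𝓘(ℂ, Cn (d + 1)) 𝓘(ℂ, Cn (d + 1)) ω e e.source :=
      contMDiffOn_of_mem_maximalAtlas he.mem
    exact (tailCLM d).contMDiff.comp_contMDiffOn
      (h1.comp hι.holomorphic.contMDiffOn fun _ h => h)
  · intro y hy
    have hy' : ι y ∈ e.source := hy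
    have he1 := mdifferentiableAt_of_mem_holoAtlas he.mem hy'
    have hc := tangentCLM_comp he1 (hι1 y)
    have ht : tangentCLM d d (sliceChart hι he) y =
        tailCLM d ∘L tangentCLM d (d + 1) (e ∘ ι) y := by
      have h2 : MDifferentiableAt 𝓘(ℂ, Cn (d + 1)) 𝓘(ℂ, Cn d) (tailCLM d) ((e ∘ ι) y) :=
        (tailCLM d).mdifferentiableAt
      have := tangentCLM_comp (k := d) (n := d + 1) (l := d) h2 (he1.comp y (hι1 y))
      rw [tangentCLM_eq_fderiv, ContinuousLinearMap.fderiv] at this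
      exact this
    have h0 : tangentCLM d (d + 1) (e ∘ ι) y =
        consCLM d ∘L tangentCLM d d (sliceChart hι he) y := by
      rw [ht]
      have h3 : MDifferentiableAt 𝓘(ℂ, Cn (d + 1)) 𝓘(ℂ, Cn (d + 1))
          (consCLM d ∘L tailCLM d) ((e ∘ ι) y) := (consCLM d ∘L tailCLM d).mdifferentiableAt
      have h4 := tangentCLM_comp (k := d) (n := d + 1) (l := d + 1) h3 (he1.comp y (hι1 y))
      rw [tangentCLM_eq_fderiv, ContinuousLinearMap.fderiv] at h4
      rw [← ContinuousLinearMap.comp_assoc, ← h4]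
      refine tangentCLM_congr ?_
      filter_upwards [(e.open_source.preimage hι.isEmbedding.continuous).mem_nhds hy'] with z hz
        using (hι.coord_ι he hz).symm
    intro u v huv
    refine hι.immersion y ?_
    have h5 : tangentCLM d (d + 1) (e ∘ ι) y u = tangentCLM d (d + 1) (e ∘ ι) y v := by
      rw [h0, ContinuousLinearMap.comp_apply, ContinuousLinearMap.comp_apply, huv]
    rw [hc] at h5
    have h6 := congrArg (tangentCLM (d + 1) (d + 1) e.symm (e (ι y))) h5
    have h7 := fun w => DFunLike.congr_fun (tangentCLM_symm_comp he.mem hy') w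
    simp only [ContinuousLinearMap.comp_apply, ContinuousLinearMap.id_apply] at h6 h7
    rw [h7, h7] at h6
    exact h6

/-- In the slice chart and `e` the map `ι` is the linear map `consCLM d`. -/
theorem inCoord_pullback {p : ℕ} (σ : PForm (d + 1) p X) {z : Cn d} (hz : consCLM d z ∈ e.target) :
    (PForm.pullback ι σ : PForm d p Y).inCoord (sliceChart hι he) z =
      (σ.inCoord e (consCLM d z)).compContinuousLinearMap (consCLM d) := by
  have hψ := sliceChart_mem_holoAtlas hι he
  have hz' : z ∈ (sliceChart hι he).target := hz
  have h1 : MDifferentiableAt 𝓘(ℂ, Cn d) 𝓘(ℂ, Cn (d + 1)) ι ((sliceChart hι he).symm z) :=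
    (hι.holomorphic _).mdifferentiableAt (by simp)
  have h2 := tangentCLM_comp h1 (mdifferentiableAt_symm_of_mem_holoAtlas hψ hz')
  have h3 : MDifferentiableAt 𝓘(ℂ, Cn d) 𝓘(ℂ, Cn (d + 1)) (consCLM d) z :=
    (consCLM d).mdifferentiableAt
  have h4 := tangentCLM_comp (k := d) (n := d + 1) (l := d + 1)
    (mdifferentiableAt_symm_of_mem_holoAtlas he.mem hz) h3
  rw [tangentCLM_eq_fderiv (consCLM d), ContinuousLinearMap.fderiv] at h4
  have h5 : tangentCLM d (d + 1) (ι ∘ (sliceChart hι he).symm) z =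
      tangentCLM d (d + 1) (e.symm ∘ consCLM d) z := by
    refine tangentCLM_congr ?_
    filter_upwards [(sliceChart hι he).open_target.mem_nhds hz'] with w hw
      using ι_sliceChart_symm hι he hw
  have h6 : tangentCLM d (d + 1) ι ((sliceChart hι he).symm z) ∘L
      tangentCLM d d (sliceChart hι he).symm z =
      tangentCLM (d + 1) (d + 1) e.symm (consCLM d z) ∘L consCLM d := by
    rw [← h2, h5, h4]
  have h7 : (PForm.pullback ι σ : PForm d p Y).inCoord (sliceChart hι he) z =
    (σ (ι ((sliceChart hι he).symm z))).compContinuousLinearMap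
      (tangentCLM d (d + 1) ι ((sliceChart hι he).symm z) ∘L
      tangentCLM d d (sliceChart hι he).symm z) := rfl
  rw [h7, h6, ι_sliceChart_symm hι he hz]
  rfl

theorem topCoef_comp_consCLM (f : (Cn (d + 1)) [⋀^Fin d]→L[ℂ] ℂ) :
    topCoef (f.compContinuousLinearMap (consCLM d)) = f (coordFace 0) := by
  change f (fun j => consCLM d (Pi.single j 1)) = _
  congr 1
  funext j
  rw [consCLM_single, coordFace, Fin.succAbove_zero]

end SliceChart

end

noncomputable section

/-! ### Existence, uniqueness and coordinate expression of the Poincaré residue. -/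

section Residue

open Filter Set

theorem inCoord_dWedge {n p : ℕ} {X : Type*} [TopologicalSpace X] [ChartedSpace (Cn n) X]
    [IsManifold 𝓘(ℂ, Cn n) ω X] {e : OpenPartialHomeomorph X (Cn n)} (he : e ∈ holoAtlas n X)
    {y : Cn n} (hy : y ∈ e.target) {f : X → ℂ}
    (hf : MDifferentiableAt 𝓘(ℂ, Cn n) 𝓘(ℂ, ℂ) f (e.symm y)) (σ : PForm n p X) :
    (dWedge f σ).inCoord e y = ContinuousAlternatingMap.alternatizeUncurryFin
      ((fderiv ℂ (f ∘ e.symm) y).smulRight (σ.inCoord e y)) := by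
  have h1 := mfderiv_comp y hf (mdifferentiableAt_symm_of_mem_holoAtlas he hy)
  rw [mfderiv_eq_fderiv] at h1
  ext v
  rw [ContinuousAlternatingMap.alternatizeUncurryFin_apply, h1]
  unfold dWedge PForm.inCoord
  rw [ContinuousAlternatingMap.compContinuousLinearMap_apply,
    ContinuousAlternatingMap.alternatizeUncurryFin_apply]
  rfl

variable {d : ℕ}

theorem topCoef_alternatize (L : Cn (d + 1) →L[ℂ] ℂ) (s : (Cn (d + 1)) [⋀^Fin d]→L[ℂ] ℂ) :
    topCoef (ContinuousAlternatingMap.alternatizeUncurryFin (L.smulRight s)) =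
      ∑ i : Fin (d + 1), (-1) ^ (i : ℕ) * (L (Pi.single i 1) * s (coordFace i)) := by
  rw [topCoef, ContinuousAlternatingMap.alternatizeUncurryFin_apply]
  refine Finset.sum_congr rfl fun i _ => ?_
  have : (i.removeNth fun j : Fin (d + 1) => (Pi.single j 1 : Cn (d + 1))) = coordFace i := rfl
  rw [ContinuousLinearMap.smulRight_apply, this]
  simp

theorem topCoef_alternatize_of_proj {L : Cn (d + 1) →L[ℂ] ℂ} {c : ℂ} (hL : ∀ v, L v = v 0 * c)
    (s : (Cn (d + 1)) [⋀^Fin d]→L[ℂ] ℂ) :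
    topCoef (ContinuousAlternatingMap.alternatizeUncurryFin (L.smulRight s)) =
      c * s (coordFace 0) := by
  rw [topCoef_alternatize, Finset.sum_eq_single 0]
  · simp [hL]
  · intro i _ hi
    simp [hL, Pi.single_eq_of_ne hi.symm]
  · simp

variable {X : Type*} [TopologicalSpace X] [ChartedSpace (Cn (d + 1)) X]
  [IsManifold 𝓘(ℂ, Cn (d + 1)) ω X] {D : Set X} {e : OpenPartialHomeomorph X (Cn (d + 1))}

/-- A local equation of `D` in adapted coordinates. -/
theorem IsLocalEquation.exists_coord_mul {U : Set X} {f : X → ℂ}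
    (hf : IsLocalEquation (n := d + 1) D U f) (he : IsAdapted D e) {y : Cn (d + 1)}
    (hy : y ∈ e.target) (hy0 : y 0 = 0) (hyU : e.symm y ∈ U) :
    ContDiffAt ℂ ω (f ∘ e.symm) y ∧
    ∃ (u : Cn (d + 1) → ℂ) (V : Set (Cn (d + 1))), IsOpen V ∧ y ∈ V ∧ ContDiffOn ℝ ∞ u V ∧
      ∀ z ∈ V, u z ≠ 0 ∧ (f ∘ e.symm) z = z 0 * u z := by
  have hfx : ContMDiffAt 𝓘(ℂ, Cn (d + 1)) 𝓘(ℂ, ℂ) ω f (e.symm y) :=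
    hf.holomorphic.contMDiffAt (hf.isOpen.mem_nhds hyU)
  have hF : ContDiffAt ℂ ω (f ∘ e.symm) y := by
    rw [← contMDiffAt_iff_contDiffAt]
    exact ContMDiffAt.comp y hfx (contMDiffAt_symm_of_mem_maximalAtlas he.mem hy)
  have hxe := e.map_target hy
  have hd : fderiv ℂ (f ∘ e.symm) y ≠ 0 := by
    intro h0
    have h1 : MDifferentiableAt 𝓘(ℂ, Cn (d + 1)) 𝓘(ℂ, ℂ) (f ∘ e.symm) (e (e.symm y)) := by
      rw [e.right_inv hy]
      exact (hF.differentiableAt (by simp)).mdifferentiableAt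
    have h2 := mfderiv_comp (e.symm y) h1 (mdifferentiableAt_of_mem_holoAtlas he.mem hxe)
    rw [mfderiv_eq_fderiv, e.right_inv hy, h0] at h2
    have h3 : (f ∘ e.symm) ∘ e =ᶠ[𝓝 (e.symm y)] f := by
      filter_upwards [e.open_source.mem_nhds hxe] with z hz
      simp only [Function.comp_apply, e.left_inv hz]
    rw [h3.mfderiv_eq] at h2
    exact hf.differential_ne_zero _ hyU ((he.symm_mem_iff hy).2 hy0)
      (h2.trans (ContinuousLinearMap.zero_comp _))
  have h0 : ∀ᶠ z in 𝓝 y, z 0 = 0 → (f ∘ e.symm) z = 0 := by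
    filter_upwards [(e.symm.continuousAt hy).eventually (hf.isOpen.mem_nhds hyU),
      e.open_target.mem_nhds hy] with z hzU hz hz0
    exact (hf.mem_iff _ hzU).1 ((he.symm_mem_iff hz).2 hz0)
  exact ⟨hF, exists_eq_coord_mul hF hy0 h0 hd⟩

variable {α : PForm (d + 1) (d + 1) X} {N : Cn (d + 1) → (Cn (d + 1)) [⋀^Fin (d + 1)]→L[ℂ] ℂ}

/-- In adapted coordinates the residue form `σ` restricts to the leading coefficient. -/
theorem coordFace_residue (he : IsAdapted D e) (hN : PoleRep e 1 α N) {U : Set X} {f : X → ℂ}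
    {σ : PForm (d + 1) d X} {τ : PForm (d + 1) (d + 1) X}
    (hf : IsLocalEquation (n := d + 1) D U f) (hσ : σ.SmoothOn U) (hτ : τ.SmoothOn U)
    (h : ∀ z ∈ U \ D, α z = (f z)⁻¹ • dWedge f σ z + τ z) {y : Cn (d + 1)} (hy : y ∈ e.target)
    (hy0 : y 0 = 0) (hyU : e.symm y ∈ U) :
    σ.inCoord e y (coordFace 0) = topCoef (N y) := by
  obtain ⟨hF, u, V, hV, hyV, hu, huV⟩ := hf.exists_coord_mul he hy hy0 hyU
  set F := f ∘ e.symm with hFdef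
  set S := V ∩ (e.target ∩ e.symm ⁻¹' U) with hS
  have hSo : IsOpen S := hV.inter (e.isOpen_inter_preimage_symm hf.isOpen)
  have hfd : ∀ z ∈ S, MDifferentiableAt 𝓘(ℂ, Cn (d + 1)) 𝓘(ℂ, ℂ) f (e.symm z) := fun z hz =>
    (hf.holomorphic.contMDiffAt (hf.isOpen.mem_nhds hz.2.2)).mdifferentiableAt (by simp)
  have hFS : ∀ z ∈ S, ContDiffAt ℂ ω F z := by
    intro z hz
    rw [← contMDiffAt_iff_contDiffAt]
    exact ContMDiffAt.comp z (hf.holomorphic.contMDiffAt (hf.isOpen.mem_nhds hz.2.2))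
      (contMDiffAt_symm_of_mem_maximalAtlas he.mem hz.2.1)
  have hsm : ∀ {p : ℕ} {η : PForm (d + 1) p X}, η.SmoothOn U → ∀ z ∈ S,
      ContDiffAt ℝ ∞ (η.inCoord e) z := by
    intro p η hη z hz
    have := hη.contDiffAt (hf.isOpen.mem_nhds hz.2.2) he.mem (e.map_target hz.2.1)
    rwa [e.right_inv hz.2.1] at this
  -- Multiplying `α = df/f ∧ σ + τ` by `z₀ u = f` clears the pole. Both sides are then continuous
  -- across the hyperplane, so the identity proved off it extends by density.
  have hkey : u y * topCoef (N y) = topCoef (ContinuousAlternatingMap.alternatizeUncurryFin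
      ((fderiv ℂ F y).smulRight (σ.inCoord e y))) + y 0 * u y * topCoef (τ.inCoord e y) := by
    refine eq_of_eq_off hSo (f := fun y => u y * topCoef (N y))
      (g := fun y => topCoef (ContinuousAlternatingMap.alternatizeUncurryFin
      ((fderiv ℂ F y).smulRight (σ.inCoord e y))) + y 0 * u y * topCoef (τ.inCoord e y))
      (fun z hz => ?_) (fun z hz => ?_) (fun z hz hz0 => ?_) ⟨hyV, hy, hyU⟩
    · exact ((hu.contDiffAt (hV.mem_nhds hz.1)).continuousAt.mul
        (hN.1.contDiffAt (e.open_target.mem_nhds hz.2.1)).topCoef.continuousAt).continuousWithinAt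
    · simp_rw [topCoef_alternatize]
      refine ContinuousAt.continuousWithinAt (ContinuousAt.add ?_ ?_)
      · have h1 : ContinuousAt (fun z => ∑ i : Fin (d + 1), (-1) ^ (i : ℕ) *
            (fderiv ℂ F z (Pi.single i 1) * σ.inCoord e z (coordFace i))) z :=
          tendsto_finsetSum _ fun i _ => continuousAt_const.mul
            ((((hFS z hz).fderiv_right (m := ω) le_top).clm_apply
              contDiffAt_const).continuousAt.mul
              ((hsm hσ z hz).alternating_apply _).continuousAt)
        exact h1
      · exact ((continuous_apply 0).continuousAt.mul
          (hu.contDiffAt (hV.mem_nhds hz.1)).continuousAt).mul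
          (hsm hτ z hz).topCoef.continuousAt
    · have hzD : e.symm z ∉ D := fun hD => hz0 ((he.symm_mem_iff hz.2.1).1 hD)
      have h1 := hN.2 z hz.2.1 hz0
      have h2 : α.inCoord e z = (f (e.symm z))⁻¹ • (dWedge f σ).inCoord e z + τ.inCoord e z := by
        change (α (e.symm z)).compContinuousLinearMap _ = _
        rw [h _ ⟨hz.2.2, hzD⟩]
        rfl
      rw [inCoord_dWedge he.mem hz.2.1 (hfd z hz)] at h2
      rw [h2] at h1
      have h3 := congrArg topCoef h1
      have h4 : f (e.symm z) = z 0 * u z := (huV z hz.1).2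
      have h5 := (huV z hz.1).1
      change (f (e.symm z))⁻¹ * topCoef (ContinuousAlternatingMap.alternatizeUncurryFin
        ((fderiv ℂ F z).smulRight (σ.inCoord e z))) + topCoef (τ.inCoord e z) =
        (z 0 ^ 1)⁻¹ * topCoef (N z) at h3
      rw [h4] at h3
      field_simp at h3
      linear_combination -h3
  -- On `z₀ = 0` the differential of `z₀ u` is `u dz₀`, so only the coefficient of `σ` without `dz₀`
  -- survives.
  have hfy : ∀ v, fderiv ℂ F y v = v 0 * u y := by
    intro v
    rw [← fderiv_real_eq (hF.differentiableAt (by simp))]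
    have hev : F =ᶠ[𝓝 y] fun z => z 0 * u z := by
      filter_upwards [hV.mem_nhds hyV] with z hz using (huV z hz).2
    have hp : HasFDerivAt (fun z : Cn (d + 1) => z 0)
        (ContinuousLinearMap.proj (R := ℝ) (φ := fun _ : Fin (d + 1) => ℂ) 0) y :=
      (ContinuousLinearMap.proj (R := ℝ) (φ := fun _ : Fin (d + 1) => ℂ) 0).hasFDerivAt
    have hu1 := ((hu.contDiffAt (hV.mem_nhds hyV)).differentiableAt (by simp)).hasFDerivAt
    have h6 : HasFDerivAt (fun z => z 0 * u z) _ y := hp.mul hu1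
    rw [hev.fderiv_eq, h6.fderiv, hy0]
    simp [mul_comm]
  rw [topCoef_alternatize_of_proj hfy, hy0, zero_mul, zero_mul, add_zero] at hkey
  exact (mul_left_cancel₀ (huV y hyV).1 hkey).symm

variable {Y : Type*} [TopologicalSpace Y] [ChartedSpace (Cn d) Y] [IsManifold 𝓘(ℂ, Cn d) ω Y]
  {ι : Y → X}

/-- The right side does not mention the local equation or `σ`, `τ`; this is the uniqueness of the
residue. -/
theorem topCoef_inCoord_residue [Nonempty Y]
    (hι : IsSubmanifoldStructure (n := d + 1) (k := d) D ι) (he : IsAdapted D e)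
    (hN : PoleRep e 1 α N) {ρ : PForm d d Y} (hρ : IsPoincareResidue D ι α ρ) {z : Cn d}
    (hz : consCLM d z ∈ e.target) :
    topCoef (ρ.inCoord (sliceChart hι he) z) = topCoef (N (consCLM d z)) := by
  have hx : e.symm (consCLM d z) ∈ D := (he.symm_mem_iff hz).2 (consCLM_zero z)
  obtain ⟨U, f, σ, τ, hxU, hf, hσ, hτ, h, hρ⟩ := hρ _ hx
  have h1 := ι_sliceChart_symm hι he hz
  have h2 : ρ.inCoord (sliceChart hι he) z =
      (PForm.pullback ι σ : PForm d d Y).inCoord (sliceChart hι he) z := by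
    rw [PForm.inCoord, PForm.inCoord, hρ _ (by rwa [h1])]
  rw [h2, inCoord_pullback hι he σ hz, topCoef_comp_consCLM,
    coordFace_residue he hN hf hσ hτ h hz (consCLM_zero z) hxU]

/-- The constant form `dz₁ ∧ ⋯ ∧ dz_d` on `ℂᵈ⁺¹`. -/
def faceForm (d : ℕ) : (Cn (d + 1)) [⋀^Fin d]→L[ℂ] ℂ :=
  (detForm d).compContinuousLinearMap (tailCLM d)

theorem faceForm_coordFace_zero : faceForm d (coordFace 0) = 1 := by
  rw [← topCoef_detForm (n := d)]
  change detForm d (fun j => tailCLM d (coordFace 0 j)) = detForm d _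
  congr 1
  funext j
  rw [coordFace, Fin.succAbove_zero, ← consCLM_single, tailCLM_consCLM]

theorem smoothOn_ofCoord {n p : ℕ} {X : Type*} [TopologicalSpace X] [ChartedSpace (Cn n) X]
    [IsManifold 𝓘(ℂ, Cn n) ω X] {e : OpenPartialHomeomorph X (Cn n)} (he : e ∈ holoAtlas n X)
    {η : Cn n → (Cn n) [⋀^Fin p]→L[ℂ] ℂ} (hη : ContDiffOn ℝ ∞ η e.target) :
    (PForm.ofCoord e η).SmoothOn e.source := by
  refine PForm.smoothOn_of_forall fun x hx => ⟨e, he, hx, ?_⟩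
  refine (hη.contDiffAt (e.open_target.mem_nhds (e.map_source hx))).congr_of_eventuallyEq ?_
  filter_upwards [e.open_target.mem_nhds (e.map_source hx)] with y hy
  exact PForm.inCoord_ofCoord he hy

theorem eq_of_inCoord_eq {n p : ℕ} {X : Type*} [TopologicalSpace X] [ChartedSpace (Cn n) X]
    [IsManifold 𝓘(ℂ, Cn n) ω X] {e : OpenPartialHomeomorph X (Cn n)} (he : e ∈ holoAtlas n X)
    {a b : PForm n p X} {x : X} (hx : x ∈ e.source) (h : a.inCoord e (e x) = b.inCoord e (e x)) :
    a x = b x := by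
  rw [← PForm.inCoord_apply_comp (α := a) he hx, h, PForm.inCoord_apply_comp he hx]

theorem eq_of_topCoef_eq {n : ℕ} {f g : (Cn n) [⋀^Fin n]→L[ℂ] ℂ} (h : topCoef f = topCoef g) :
    f = g := by
  rw [eq_topCoef_smul_detForm f, h, ← eq_topCoef_smul_detForm g]

/-- In top degree a simple pole is automatically logarithmic: take for `σ` the numerator times `dz₁
∧ ⋯ ∧ dz_d`, and `τ = 0`. -/
theorem exists_residue_data (he : IsAdapted D e) (hN : PoleRep e 1 α N) :
    ∃ (σ : PForm (d + 1) d X) (τ : PForm (d + 1) (d + 1) X), σ.SmoothOn e.source ∧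
      τ.SmoothOn e.source ∧
      ∀ z ∈ e.source \ D, α z = (e z 0)⁻¹ • dWedge (fun z => e z 0) σ z + τ z := by
  have hs : ContDiffOn ℝ ∞ (fun y => topCoef (N y) • faceForm d) e.target := fun y hy =>
    ((hN.1.contDiffAt (e.open_target.mem_nhds hy)).topCoef.smul
      contDiffAt_const).contDiffWithinAt
  refine ⟨PForm.ofCoord e fun y => topCoef (N y) • faceForm d, fun _ => 0,
    smoothOn_ofCoord he.mem hs, ?_, ?_⟩
  · refine PForm.smoothOn_of_forall fun x hx => ⟨e, he.mem, hx, ?_⟩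
    exact contDiffAt_const (c := (0 : (Cn (d + 1)) [⋀^Fin (d + 1)]→L[ℂ] ℂ))
  · rintro x ⟨hx, hxD⟩
    set σ := PForm.ofCoord e fun y => topCoef (N y) • faceForm d with hσ
    have hy := e.map_source hx
    have hy0 : e x 0 ≠ 0 := fun h => hxD ((he.mem_iff x hx).2 h)
    refine eq_of_inCoord_eq he.mem (b := fun z => (e z 0)⁻¹ • dWedge (fun z => e z 0) σ z + 0)
      hx (eq_of_topCoef_eq ?_)
    have hf : MDifferentiableAt 𝓘(ℂ, Cn (d + 1)) 𝓘(ℂ, ℂ) (fun z => e z 0) (e.symm (e x)) := by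
      rw [e.left_inv hx]
      exact (he.isLocalEquation.holomorphic.contMDiffAt
        (e.open_source.mem_nhds hx)).mdifferentiableAt (by simp)
    have h2 : PForm.inCoord (fun z => (e z 0)⁻¹ • dWedge (fun z => e z 0) σ z + 0) e (e x) =
        (e (e.symm (e x)) 0)⁻¹ • (dWedge (fun z => e z 0) σ).inCoord e (e x) := by
      ext v
      simp [PForm.inCoord]
    have hfd : ∀ v, fderiv ℂ ((fun z => e z 0) ∘ e.symm) (e x) v = v 0 * 1 := by
      intro v
      have hev : (fun z => e z 0) ∘ e.symm =ᶠ[𝓝 (e x)] fun y => y 0 := by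
        filter_upwards [e.open_target.mem_nhds hy] with y hy
        simp only [Function.comp_apply, e.right_inv hy]
      have hp : HasFDerivAt (fun z : Cn (d + 1) => z 0)
          (ContinuousLinearMap.proj (R := ℂ) (φ := fun _ : Fin (d + 1) => ℂ) 0) (e x) :=
        (ContinuousLinearMap.proj (R := ℂ) (φ := fun _ : Fin (d + 1) => ℂ) 0).hasFDerivAt
      rw [hev.fderiv_eq, hp.fderiv, mul_one]
      rfl
    rw [h2, inCoord_dWedge he.mem hy hf, hN.2 _ hy hy0, e.left_inv hx, pow_one]
    change (e x 0)⁻¹ * topCoef (N (e x)) = (e x 0)⁻¹ * topCoef _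
    rw [topCoef_alternatize_of_proj hfd, PForm.inCoord_ofCoord he.mem hy, one_mul]
    congr 1
    change _ = topCoef (N (e x)) * faceForm d (coordFace 0)
    rw [faceForm_coordFace_zero, mul_one]

/-- The residue at `y` is defined from the data chosen at the point `ι y`. That data chosen at other
points yield the same value is `coordFace_residue`, applied twice with the same numerator. -/
theorem exists_isPoincareResidue (hD : IsSmoothHypersurface (n := d + 1) D)
    (hι : IsSubmanifoldStructure (n := d + 1) (k := d) D ι) (hα : α.HasPoleOrderLE D 1) :
    ∃ ρ : PForm d d Y, IsPoincareResidue D ι α ρ := by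
  have h1 : ∀ x, ∃ (e : OpenPartialHomeomorph X (Cn (d + 1)))
      (N : Cn (d + 1) → (Cn (d + 1)) [⋀^Fin (d + 1)]→L[ℂ] ℂ) (σ : PForm (d + 1) d X)
      (τ : PForm (d + 1) (d + 1) X),
      x ∈ e.source ∧ IsAdapted D e ∧ PoleRep e 1 α N ∧ σ.SmoothOn e.source ∧
      τ.SmoothOn e.source ∧
      ∀ z ∈ e.source \ D, α z = (e z 0)⁻¹ • dWedge (fun z => e z 0) σ z + τ z := by
    intro x
    obtain ⟨e, he, hx, N, hN⟩ := hα.poleAt hD x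
    obtain ⟨σ, τ, h⟩ := exists_residue_data he hN
    exact ⟨e, N, σ, τ, hx, he, hN, h⟩
  choose e N σ τ hx he hN hσ hτ h using h1
  refine ⟨fun y => PForm.pullback ι (σ (ι y)) y, fun x _ => ⟨(e x).source, fun z => e x z 0, σ x,
    τ x, hx x, (he x).isLocalEquation, hσ x, hτ x, h x, fun y hy => ?_⟩⟩
  have : Nonempty Y := ⟨y⟩
  refine eq_of_inCoord_eq (sliceChart_mem_holoAtlas hι (he x)) (x := y) hy
    (a := PForm.pullback ι (σ (ι y))) ?_
  have hz : consCLM d (sliceChart hι (he x) y) ∈ (e x).target := by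
    rw [consCLM_sliceChart hι (he x) hy]
    exact (e x).map_source hy
  rw [inCoord_pullback hι (he x) _ hz, inCoord_pullback hι (he x) _ hz]
  have hs : (e x).symm (consCLM d (sliceChart hι (he x) y)) = ι y := by
    rw [consCLM_sliceChart hι (he x) hy, (e x).left_inv hy]
  refine eq_of_topCoef_eq ?_
  rw [topCoef_comp_consCLM, topCoef_comp_consCLM,
    coordFace_residue (he x) (hN x) (he _).isLocalEquation (hσ (ι y)) (hτ (ι y)) (h (ι y)) hz
      (consCLM_zero _) (by rw [hs]; exact hx _),
    coordFace_residue (he x) (hN x) (he _).isLocalEquation (hσ x) (hτ x) (h x) hz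
      (consCLM_zero _) (by rw [hs]; exact hy)]

theorem isPoincareResidue_poincareResidue (hD : IsSmoothHypersurface (n := d + 1) D)
    (hι : IsSubmanifoldStructure (n := d + 1) (k := d) D ι) (hα : α.HasPoleOrderLE D 1) :
    IsPoincareResidue D ι α (poincareResidue (k := d) D ι α) :=
  Classical.epsilon_spec (exists_isPoincareResidue hD hι hα)

/-- The residue in the chart of the hypersurface induced by an adapted chart. -/
theorem topCoef_inCoord_poincareResidue [Nonempty Y] (hD : IsSmoothHypersurface (n := d + 1) D)
    (hι : IsSubmanifoldStructure (n := d + 1) (k := d) D ι) (hα : α.HasPoleOrderLE D 1)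
    (he : IsAdapted D e) (hN : PoleRep e 1 α N) {z : Cn d} (hz : consCLM d z ∈ e.target) :
    topCoef ((poincareResidue (k := d) D ι α).inCoord (sliceChart hι he) z) =
      topCoef (N (consCLM d z)) :=
  topCoef_inCoord_residue hι he hN (isPoincareResidue_poincareResidue hD hι hα) hz

theorem poincareResidue_smoothOn (hD : IsSmoothHypersurface (n := d + 1) D)
    (hι : IsSubmanifoldStructure (n := d + 1) (k := d) D ι) (hα : α.HasPoleOrderLE D 1) :
    (poincareResidue (k := d) D ι α).SmoothOn univ := by
  refine PForm.smoothOn_of_forall fun y _ => ?_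
  have : Nonempty Y := ⟨y⟩
  obtain ⟨e, he, hx, N, hN⟩ := hα.poleAt hD (ι y)
  refine ⟨sliceChart hι he, sliceChart_mem_holoAtlas hι he, hx, ?_⟩
  have hy : sliceChart hι he y ∈ (sliceChart hι he).target := (sliceChart hι he).map_source hx
  have h1 : ContDiffAt ℝ ∞ (fun z => topCoef (N (consCLM d z)) • detForm d)
      (sliceChart hι he y) := by
    have h2 : ContDiffAt ℝ ∞ (fun z => N (consCLM d z)) (sliceChart hι he y) :=
      (hN.1.contDiffAt (e.open_target.mem_nhds hy)).comp _
        ((consCLM d).restrictScalars ℝ).contDiff.contDiffAt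
    exact h2.topCoef.smul contDiffAt_const
  refine h1.congr_of_eventuallyEq ?_
  filter_upwards [(sliceChart hι he).open_target.mem_nhds hy] with z hz
  rw [← topCoef_inCoord_poincareResidue hD hι hα he hN hz]
  exact eq_topCoef_smul_detForm _

theorem poincareResidue_eq_zero (hD : IsSmoothHypersurface (n := d + 1) D)
    (hι : IsSubmanifoldStructure (n := d + 1) (k := d) D ι) (hα : α.HasPoleOrderLE D 1)
    {K : Set X} (hK : IsClosed K) (h0 : ∀ x ∉ D, x ∉ K → α x = 0) {y : Y} (hy : ι y ∉ K) :
    poincareResidue (k := d) D ι α y = 0 := by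
  have : Nonempty Y := ⟨y⟩
  obtain ⟨e, he, hx, N, hN⟩ := hα.poleAt hD (ι y)
  have hψ := sliceChart_mem_holoAtlas hι he
  refine (PForm.inCoord_eq_zero_iff hψ (x := y) hx).1 (eq_of_topCoef_eq ?_)
  have hz : consCLM d (sliceChart hι he y) ∈ e.target := (sliceChart hι he).map_source hx
  rw [topCoef_inCoord_poincareResidue hD hι hα he hN hz, consCLM_sliceChart hι he hx]
  have h1 : N (e (ι y)) = 0 := by
    refine eq_of_eq_off (S := e.target ∩ e.symm ⁻¹' Kᶜ) (g := fun _ => 0)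
      (e.isOpen_inter_preimage_symm hK.isOpen_compl) (hN.1.continuousOn.mono inter_subset_left)
      continuousOn_const ?_ ⟨e.map_source hx, by rwa [mem_preimage, e.left_inv hx]⟩
    rintro z ⟨hz, hzK⟩ hz0
    have h2 := hN.2 z hz hz0
    rw [PForm.inCoord, h0 _ (fun h => hz0 ((he.symm_mem_iff hz).1 h)) hzK] at h2
    ext v
    have h3 := congrArg (fun f => f v) h2
    simpa [hz0] using h3.symm
  rw [h1]
  rfl

end Residue

end

noncomputable section

/-! ### The logarithmic coefficient of simple poles in terms of residues. -/

section ResiduePairing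

open Filter Set MeasureTheory

variable {d : ℕ}

/-- Since `(d+1)d/2 = d(d-1)/2 + d`, the orientation constants of `X` and `D` differ by `(-1)^d
(-2i)`. The prefactor `(-1)^d/(2πi)` cancels the sign and turns the `-2π` of `logCoef_one` into `2`.
-/
theorem pairingConst_mul_eq : pairingConst d * (-2 * Real.pi) = 2 * orientConst d := by
  have h1 : (d + 1) * (d + 1 - 1) / 2 = d * (d - 1) / 2 + d := by
    rcases d with _ | k
    · rfl
    · have : (k + 1 + 1) * (k + 1 + 1 - 1) = (k + 1) * (k + 1 - 1) + (k + 1) * 2 := by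
        simp only [Nat.add_sub_cancel]; ring
      rw [this, Nat.add_mul_div_right _ _ two_pos]
  have h2 : ((-1 : ℂ) ^ d) * (-1) ^ d = 1 := by
    rw [← mul_pow]; simp
  rw [pairingConst, orientConst, orientConst, h1, pow_add, pow_succ (-2 * Complex.I) d]
  have hpi : (Real.pi : ℂ) ≠ 0 := by exact_mod_cast Real.pi_ne_zero
  have hI := Complex.I_ne_zero
  field_simp
  linear_combination h2

variable {X : Type*} [TopologicalSpace X] [T2Space X] [SigmaCompactSpace X]
  [ChartedSpace (Cn (d + 1)) X] [IsManifold 𝓘(ℂ, Cn (d + 1)) ω X]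
  {Y : Type*} [TopologicalSpace Y] [T2Space Y] [SigmaCompactSpace Y]
  [ChartedSpace (Cn d) Y] [IsManifold 𝓘(ℂ, Cn d) ω Y]
  {D K : Set X} {ι : Y → X} {e : OpenPartialHomeomorph X (Cn (d + 1))}
  {a b : PForm (d + 1) (d + 1) X}

theorem IsSubmanifoldStructure.isCompact_preimage (hD : IsClosed D)
    (hι : IsSubmanifoldStructure (n := d + 1) (k := d) D ι) (hK : IsCompact K) :
    IsCompact (ι ⁻¹' K) :=
  Topology.IsClosedEmbedding.isCompact_preimage
    ⟨hι.isEmbedding, by rw [hι.range_eq]; exact hD⟩ hK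

/-- By `logCoef_one` the coefficient is an integral of `G` over the hyperplane, and there `G` is the
product of the numerators, which are the coefficients of the residues in the slice chart. -/
theorem IsLocalized.hasLogCoef_residue (hD : IsSmoothHypersurface (n := d + 1) D)
    (hι : IsSubmanifoldStructure (n := d + 1) (k := d) D ι) (ha : IsLocalized D e K a)
    (hap : a.HasPoleOrderLE D 1) (hae : PoleOn e 1 a) (hbp : b.HasPoleOrderLE D 1)
    (hbe : PoleOn e 1 b) :
    HasLogCoef D a b (2 * integralWedgeConj univ (poincareResidue (k := d) D ι a)
      (poincareResidue (k := d) D ι b)) := by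
  obtain ⟨Na, hNa⟩ := hae
  obtain ⟨Nb, hNb⟩ := hbe
  obtain ⟨G, hG, hG1, hG2, hG3⟩ := ha.exists_isTest_top hNa hNb
  have hmain := ha.hasLogCoef hD hbp.1 hG hG3 hG2
  have he := ha.adapted
  rw [logCoef_one hG, ← mul_assoc, pairingConst_mul_eq] at hmain
  have hoff : ∀ z : Cn d, consCLM d z ∉ e.target → G (consCLM d z) = 0 := fun z hz =>
    hG2 _ fun h => hz (ha.image_subset h)
  have hint : integralWedgeConj univ (poincareResidue (k := d) D ι a)
      (poincareResidue (k := d) D ι b) = orientConst d * ∫ z : Cn d, G (Fin.cons 0 z) := by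
    -- The slice chart inverts `ι` by `Function.invFun` and so needs `Y` nonempty. If `Y` is empty,
    -- then so is `D`, the chart misses the hyperplane, and both sides are zero.
    rcases isEmpty_or_nonempty Y with hY | hY
    · have hz : ∀ z : Cn d, G (Fin.cons 0 z) = 0 := by
        intro z
        rw [← consCLM_apply]
        refine hoff z fun hz => ?_
        have := (he.symm_mem_iff hz).2 (consCLM_zero z)
        rw [← hι.range_eq] at this
        exact hY.elim this.choose
      simp only [hz, integral_zero, mul_zero]
      rw [integralWedgeConj, finsum_of_isEmpty]
    · have hψ := sliceChart_mem_holoAtlas hι he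
      rw [integralWedgeConj_eq_integral_coord hψ isClosed_univ isOpen_univ (subset_univ _)
        (hι.isCompact_preimage hD.isClosed ha.compact) (preimage_mono ha.subset)
        (poincareResidue_smoothOn hD hι hap) (poincareResidue_smoothOn hD hι hbp)
        fun y _ hy => poincareResidue_eq_zero hD hι hap ha.compact.isClosed ha.zero hy,
        preimage_univ, inter_univ, ← integral_const_mul]
      have hset : ∫ z in (sliceChart hι he).target, orientConst d * G (Fin.cons 0 z) =
          ∫ z : Cn d, orientConst d * G (Fin.cons 0 z) := by
        refine setIntegral_eq_integral_of_forall_compl_eq_zero fun z hz => ?_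
        rw [← consCLM_apply, hoff z hz, mul_zero]
      rw [← hset]
      refine setIntegral_congr_fun (sliceChart hι he).open_target.measurableSet fun z hz => ?_
      simp only [wedgeConjDensity_eq]
      rw [topCoef_inCoord_poincareResidue hD hι hap he hNa hz,
        topCoef_inCoord_poincareResidue hD hι hbp he hNb hz, ← hG1 _ hz, consCLM_apply,
        mul_comm]
  rw [hint, ← mul_assoc]
  exact hmain

theorem PForm.HasPoleOrderLE.smul {p m : ℕ} {a : PForm (d + 1) p X}
    (hD : IsSmoothHypersurface (n := d + 1) D)
    (ha : a.HasPoleOrderLE D m) {φ : X → ℝ} (hφ : ContMDiff 𝓘(ℝ, Cn (d + 1)) 𝓘(ℝ, ℝ) ∞ φ) :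
    PForm.HasPoleOrderLE D m fun x => (φ x : ℂ) • a x :=
  hasPoleOrderLE_of_poleAt hD.isClosed fun x => (ha.poleAt hD x).smul hφ

theorem poincareResidue_smul (hD : IsSmoothHypersurface (n := d + 1) D)
    (hι : IsSubmanifoldStructure (n := d + 1) (k := d) D ι) (ha : a.HasPoleOrderLE D 1)
    {φ : X → ℝ} (hφ : ContMDiff 𝓘(ℝ, Cn (d + 1)) 𝓘(ℝ, ℝ) ∞ φ) (y : Y) :
    poincareResidue (k := d) D ι (fun x => (φ x : ℂ) • a x) y =
      (φ (ι y) : ℂ) • poincareResidue (k := d) D ι a y := by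
  have : Nonempty Y := ⟨y⟩
  obtain ⟨e, he, hx, N, hN⟩ := ha.poleAt hD (ι y)
  have hN' : PoleRep e 1 (fun x => (φ x : ℂ) • a x) fun y => (φ (e.symm y) : ℂ) • N y := by
    refine ⟨fun y hy => ?_, fun y hy hy0 => ?_⟩
    · have h1 := contDiffAt_comp_symm he.mem hy hφ.contMDiffAt
      exact ((Complex.ofRealCLM.contDiff.contDiffAt.comp y h1).contDiffWithinAt).smul (hN.1 y hy)
    · rw [PForm.inCoord_smul (fun x => (φ x : ℂ)), hN.2 y hy hy0, smul_comm]
  have hψ := sliceChart_mem_holoAtlas hι he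
  have hz : consCLM d (sliceChart hι he y) ∈ e.target := (sliceChart hι he).map_source hx
  refine eq_of_inCoord_eq hψ (x := y) (b := fun y => (φ (ι y) : ℂ) •
    poincareResidue (k := d) D ι a y) hx (eq_of_topCoef_eq ?_)
  rw [topCoef_inCoord_poincareResidue hD hι (ha.smul hD hφ) he hN' hz,
    PForm.inCoord_smul (fun y => (φ (ι y) : ℂ)), (sliceChart hι he).left_inv hx]
  change (φ _ : ℂ) * topCoef (N _) = (φ _ : ℂ) * topCoef _
  rw [topCoef_inCoord_poincareResidue hD hι ha he hN hz, consCLM_sliceChart hι he hx,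
    e.left_inv hx]

/-- For a form with a simple pole the logarithmic coefficient is the pairing of the residues. -/
theorem hasLogCoef_residue (hD : IsSmoothHypersurface (n := d + 1) D)
    (hι : IsSubmanifoldStructure (n := d + 1) (k := d) D ι) (ha : a.HasPoleOrderLE D 1)
    (hac : a.CompactSupportOff D) (hb : b.HasPoleOrderLE D 1) :
    HasLogCoef D a b (2 * integralWedgeConj univ (poincareResidue (k := d) D ι a)
      (poincareResidue (k := d) D ι b)) := by
  have hch : ∀ x, ∃ e : OpenPartialHomeomorph X (Cn (d + 1)), IsAdapted D e ∧
      x ∈ e.source ∧ PoleOn e 1 a ∧ PoleOn e 1 b := by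
    intro x
    obtain ⟨e, he, hxe, hp⟩ := ha.poleAt hD x
    obtain ⟨W, hW, hxW, hp'⟩ := (hb.poleAt hD x).exists_poleOn hD.isClosed he hxe
    exact ⟨_, he.restrOpen hW, ⟨hxe, hxW⟩, hp.restrOpen hW, hp'⟩
  choose e he hxe hpa hpb using hch
  obtain ⟨F, f, hf, hfe, hsum⟩ := exists_finite_partition (S := a.supportOff D) hac hxe
  have hloc := fun i => IsLocalized.smul_of_tsupport hD.isClosed (he i) ha.1 hac (hf i) (hfe i)
  have hdec : ∀ x ∉ D, a x = ∑ i ∈ F, (f i x : ℂ) • a x := by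
    intro x hx
    by_cases h : x ∈ a.supportOff D
    · rw [alternating_sum_smul, ← Complex.ofReal_sum, hsum x h, Complex.ofReal_one]
      exact (one_smul ℂ _).symm
    · rw [alternating_sum_smul, PForm.eq_zero_of_notMem_supportOff hx h, alternating_smul_zero]
  have hK : IsCompact (⋃ i ∈ F, tsupport (f i) ∩ a.supportOff D) :=
    F.isCompact_biUnion fun i _ => (hloc i).compact
  have hap := fun i => ha.smul hD (hf i)
  have hmain := HasLogCoef.sum (a := a) F (fun lam hl ε hε =>
    regularizedPairing_sum hD F hdec hK (fun i _ => (hloc i).smooth)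
      (fun i hi x hx hxK => (hloc i).zero x hx fun h =>
        hxK (mem_biUnion hi h)) hb.1 hl hε)
    fun i _ => (hloc i).hasLogCoef_residue hD hι (hap i) ((hpa i).smul (he i).mem (hf i)) hb (hpb i)
  have hres : ∀ y : Y, poincareResidue (k := d) D ι a y =
      ∑ i ∈ F, poincareResidue (k := d) D ι (fun x => (f i x : ℂ) • a x) y := by
    intro y
    simp_rw [fun i => poincareResidue_smul hD hι ha (hf i) y]
    by_cases h : ι y ∈ a.supportOff D
    · rw [alternating_sum_smul, ← Complex.ofReal_sum, hsum _ h, Complex.ofReal_one]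
      exact (one_smul ℂ _).symm
    · rw [alternating_sum_smul, poincareResidue_eq_zero hD hι ha (K := a.supportOff D)
        hac.isClosed (fun x hx hxK => PForm.eq_zero_of_notMem_supportOff hx hxK) h,
        alternating_smul_zero]
  have hint : integralWedgeConj univ (poincareResidue (k := d) D ι a)
      (poincareResidue (k := d) D ι b) = ∑ i ∈ F, integralWedgeConj univ
        (poincareResidue (k := d) D ι (fun x => (f i x : ℂ) • a x))
        (poincareResidue (k := d) D ι b) := by
    rw [← integralWedgeConj_sum isClosed_univ isOpen_univ (subset_univ _)
      (hι.isCompact_preimage hD.isClosed hK) F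
      (fun i _ => poincareResidue_smoothOn hD hι (hap i)) (poincareResidue_smoothOn hD hι hb)]
    · congr 1
      funext y
      exact hres y
    · intro i hi y _ hy
      exact poincareResidue_eq_zero hD hι (hap i) (hloc i).compact.isClosed (hloc i).zero
        fun h => hy (mem_biUnion hi h)
  rw [hint, Finset.mul_sum]
  exact hmain

theorem integralWedgeConj_add {n : ℕ} {M : Type*} [TopologicalSpace M] [T2Space M]
    [SigmaCompactSpace M] [ChartedSpace (Cn n) M] [IsManifold 𝓘(ℂ, Cn n) ω M] {L : Set M}
    (hL : IsCompact L) {u v w : PForm n n M} (hu : u.SmoothOn univ) (hv : v.SmoothOn univ)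
    (hw : w.SmoothOn univ) (hu0 : ∀ x ∉ L, u x = 0) (hv0 : ∀ x ∉ L, v x = 0) :
    integralWedgeConj univ (fun x => u x + v x) w =
      integralWedgeConj univ u w + integralWedgeConj univ v w := by
  have := integralWedgeConj_sum (a := fun i : Bool => bif i then u else v) isClosed_univ
    isOpen_univ (subset_univ _) hL Finset.univ
    (fun i _ => by cases i; exacts [hv, hu]) hw
    (fun i _ x _ hx => by cases i; exacts [hv0 x hx, hu0 x hx])
  simpa using this

end ResiduePairing

end

noncomputable section

/-! ### Stokes' theorem for compactly supported `∂`-exact forms. -/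

section Stokes

open Filter Set MeasureTheory

theorem contDiff_indicator_of_compact {E F : Type*} [NormedAddCommGroup E] [NormedSpace ℝ E]
    [NormedAddCommGroup F] [NormedSpace ℝ F] {T L : Set E} {g : E → F} (hT : IsOpen T)
    (hL : IsCompact L) (hLT : L ⊆ T) (hg : ContDiffOn ℝ ∞ g T) (h0 : ∀ y ∈ T, y ∉ L → g y = 0) :
    ContDiff ℝ ∞ (T.indicator g) ∧ HasCompactSupport (T.indicator g) := by
  have hz : ∀ y ∉ L, T.indicator g y = 0 := by
    intro y hy
    by_cases hyT : y ∈ T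
    · rw [indicator_of_mem hyT, h0 y hyT hy]
    · rw [indicator_of_notMem hyT]
  refine ⟨contDiff_iff_contDiffAt.2 fun y => ?_, HasCompactSupport.intro hL fun y hy => hz y hy⟩
  by_cases hy : y ∈ L
  · refine (hg.contDiffAt (hT.mem_nhds (hLT hy))).congr_of_eventuallyEq ?_
    filter_upwards [hT.mem_nhds (hLT hy)] with z hz using indicator_of_mem hz g
  · refine (contDiffAt_const (c := (0 : F))).congr_of_eventuallyEq ?_
    filter_upwards [hL.isClosed.isOpen_compl.mem_nhds hy] with z hz' using hz z hz'

variable {p : ℕ} {M : Type*} [TopologicalSpace M] [T2Space M]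
  [SigmaCompactSpace M] [ChartedSpace (Cn (p + 1)) M] [IsManifold 𝓘(ℂ, Cn (p + 1)) ω M]

/-- As for the pairing on `X`, holomorphy of `b` turns the density into a sum of
`∂/∂z_i`-derivatives, now of compactly supported smooth functions, whose integrals vanish. -/
theorem integralWedgeConj_del_eq_zero_of_coord {δ : PForm (p + 1) p M}
    {b : PForm (p + 1) (p + 1) M} (hδ : δ.SmoothOn univ) (hb : b.HolomorphicOn univ)
    {c : OpenPartialHomeomorph M (Cn (p + 1))} (hc : c ∈ holoAtlas (p + 1) M) {L : Set M}
    (hL : IsCompact L) (hLc : L ⊆ c.source) (h0 : ∀ x ∉ L, δ x = 0) :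
    integralWedgeConj univ δ.del b = 0 := by
  have hdel0 : ∀ x ∉ L, δ.del x = 0 := by
    intro x hx
    have : δ =ᶠ[𝓝 x] fun _ => 0 := by
      filter_upwards [hL.isClosed.isOpen_compl.mem_nhds hx] with z hz using h0 z hz
    rw [PForm.del_congr this, PForm.del_zero]
  rw [integralWedgeConj_eq_integral_coord hc isClosed_univ isOpen_univ (subset_univ _) hL hLc
    (hδ.del isOpen_univ) hb.smoothOn (fun x _ hx => hdel0 x hx), preimage_univ, inter_univ]
  have hLi : IsCompact (c '' L) := hL.image_of_continuousOn (c.continuousOn.mono hLc)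
  have hLt : c '' L ⊆ c.target := by
    rintro _ ⟨x, hx, rfl⟩
    exact c.map_source (hLc hx)
  have hδs : ∀ y ∈ c.target, ContDiffAt ℝ ∞ (δ.inCoord c) y := by
    intro y hy
    have := hδ.contDiffAt univ_mem hc (c.map_target hy)
    rwa [c.right_inv hy] at this
  have hbs : ∀ y ∈ c.target, ContDiffAt ℂ ω (fun y => topCoef (b.inCoord c y)) y := by
    intro y hy
    have := hb.contDiffAt univ_mem hc (c.map_target hy)
    rw [c.right_inv hy] at this
    exact this.topCoef
  have hbr : ∀ y ∈ c.target, ContDiffAt ℝ ∞ (fun y => topCoef (b.inCoord c y)) y := fun y hy =>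
    ((hbs y hy).restrict_scalars ℝ).of_le le_top
  let P : Fin (p + 1) → Cn (p + 1) → ℂ := fun i y =>
    δ.inCoord c y (coordFace i) * (starRingEnd ℂ) (topCoef (b.inCoord c y))
  have hP : ∀ i, ContDiff ℝ ∞ (c.target.indicator (P i)) ∧
      HasCompactSupport (c.target.indicator (P i)) := fun i =>
    contDiff_indicator_of_compact c.open_target hLi hLt
      (fun y hy => (((hδs y hy).alternating_apply _).mul
        (contDiffAt_conj (hbr y hy))).contDiffWithinAt)
      (fun y hy hyL => by
        have : δ.inCoord c y = 0 := by
          rw [PForm.inCoord, h0 _ fun h => hyL ⟨_, h, c.right_inv hy⟩]; rfl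
        simp only [P]
        rw [this]
        exact zero_mul _)
  have hcoord : ∀ y ∈ c.target, wedgeConjDensity (δ.del.inCoord c y) (b.inCoord c y) =
      ∑ i : Fin (p + 1), (-1) ^ (i : ℕ) *
        wirt (-Complex.I) i (c.target.indicator (P i)) y * orientConst (p + 1) := by
    intro y hy
    have hd := PForm.inCoord_del hc (c.map_target hy) (by rw [c.right_inv hy]; exact hδs y hy)
    rw [c.right_inv hy] at hd
    rw [wedgeConjDensity_eq, hd, topCoef_delCoord ((hδs y hy).differentiableAt (by simp)),
      Finset.sum_mul, Finset.sum_mul]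
    refine Finset.sum_congr rfl fun i _ => ?_
    congr 1
    have hev : c.target.indicator (P i) =ᶠ[𝓝 y] P i := by
      filter_upwards [c.open_target.mem_nhds hy] with z hz using indicator_of_mem hz _
    have hbd : DifferentiableAt ℂ (fun y => topCoef (b.inCoord c y)) y :=
      (hbs y hy).differentiableAt (by simp)
    have hbd' := (hbr y hy).differentiableAt (n := ∞) (by simp)
    have hδi : DifferentiableAt ℝ (fun y => δ.inCoord c y (coordFace i)) y :=
      ((hδs y hy).alternating_apply _).differentiableAt (by simp)
    have hconj : DifferentiableAt ℝ (fun y => (starRingEnd ℂ) (topCoef (b.inCoord c y))) y :=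
      (Complex.conjCLE.differentiableAt).comp y hbd'
    rw [wirt_congr hev, wirt_mul hδi hconj, wirt_conj hbd']
    have : (starRingEnd ℂ) (-Complex.I) = Complex.I := by simp
    rw [this, dzbar_of_holomorphic hbd, map_zero, mul_zero, add_zero, mul_assoc]
  rw [setIntegral_congr_fun c.open_target.measurableSet hcoord,
    setIntegral_eq_integral_of_forall_compl_eq_zero]
  · rw [integral_finsetSum]
    · refine Finset.sum_eq_zero fun i _ => ?_
      rw [integral_mul_const, integral_const_mul,
        integral_wirt_eq_zero ((hP i).1.of_le (by simp)) (hP i).2, mul_zero, zero_mul]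
    · intro i _
      exact (((hP i).1.wirt.continuous.integrable_of_hasCompactSupport
        (hP i).2.wirt).const_mul _).mul_const _
  · intro y hy
    refine Finset.sum_eq_zero fun i _ => ?_
    have hev : c.target.indicator (P i) =ᶠ[𝓝 y] fun _ => 0 := by
      filter_upwards [hLi.isClosed.isOpen_compl.mem_nhds fun h => hy (hLt h)] with z hz
      by_cases hzT : z ∈ c.target
      · rw [indicator_of_mem hzT]
        have : δ.inCoord c z = 0 := by
          rw [PForm.inCoord, h0 _ fun h => hz ⟨_, h, c.right_inv hzT⟩]; rfl
        simp only [P]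
        rw [this]
        exact zero_mul _
      · rw [indicator_of_notMem hzT]
    rw [wirt_congr hev, wirt_const, mul_zero, zero_mul]

/-- Stokes' theorem: a compactly supported `∂`-exact form pairs to zero with a holomorphic form. -/
theorem integralWedgeConj_del_eq_zero {δ : PForm (p + 1) p M}
    {b : PForm (p + 1) (p + 1) M} (hδ : δ.SmoothOn univ) (hδc : IsCompact (closure {y | δ y ≠ 0}))
    (hb : b.HolomorphicOn univ) : integralWedgeConj univ δ.del b = 0 := by
  obtain ⟨F, f, hf, hfe, hsum⟩ := exists_finite_partition (n := p + 1) hδc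
    (fun x : M => mem_chart_source (Cn (p + 1)) x)
  set S := closure {y | δ y ≠ 0} with hS
  have hδ0 : ∀ x ∉ S, δ x = 0 := fun x hx => by
    by_contra h
    exact hx (subset_closure h)
  have hsm : ∀ i, PForm.SmoothOn (fun x => (f i x : ℂ) • δ x) univ := fun i =>
    hδ.smul isOpen_univ (hf i)
  have hz : ∀ i, ∀ x ∉ tsupport (f i) ∩ S, (f i x : ℂ) • δ x = 0 := by
    intro i x hx
    by_cases h : x ∈ tsupport (f i)
    · rw [hδ0 x fun h' => hx ⟨h, h'⟩, alternating_smul_zero]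
    · rw [image_eq_zero_of_notMem_tsupport h, Complex.ofReal_zero, alternating_zero_smul]
  have hK : ∀ i, IsCompact (tsupport (f i) ∩ S) := fun i => hδc.inter_left (isClosed_tsupport _)
  have hdec : δ = fun x => ∑ i ∈ F, (f i x : ℂ) • δ x := by
    funext x
    by_cases h : x ∈ S
    · rw [alternating_sum_smul, ← Complex.ofReal_sum, hsum x h, Complex.ofReal_one]
      exact (one_smul ℂ _).symm
    · rw [alternating_sum_smul, hδ0 x h, alternating_smul_zero]
  have hdel : δ.del = fun x => ∑ i ∈ F, PForm.del (fun x => (f i x : ℂ) • δ x) x := by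
    funext x
    rw [← PForm.del_sum F fun i _ => (hsm i).differentiableAt_inChart isOpen_univ (mem_univ x)]
    exact congrFun (congrArg PForm.del hdec) x
  have hdel0 : ∀ i, ∀ x ∉ tsupport (f i) ∩ S, PForm.del (fun x => (f i x : ℂ) • δ x) x = 0 := by
    intro i x hx
    have : (fun x => (f i x : ℂ) • δ x) =ᶠ[𝓝 x] fun _ => 0 := by
      filter_upwards [(hK i).isClosed.isOpen_compl.mem_nhds hx] with z hz' using hz i z hz'
    rw [PForm.del_congr this, PForm.del_zero]
  rw [hdel, integralWedgeConj_sum isClosed_univ isOpen_univ (subset_univ _)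
    (F.isCompact_biUnion fun i _ => hK i) F (fun i _ => (hsm i).del isOpen_univ) hb.smoothOn
    (fun i hi x _ hx => hdel0 i x fun h => hx (mem_biUnion hi h))]
  exact Finset.sum_eq_zero fun i _ => integralWedgeConj_del_eq_zero_of_coord (hsm i) hb
    (chart_mem_holoAtlas i) (hK i) (inter_subset_left.trans (hfe i)) (hz i)

end Stokes

/-! ### Independence of the representative of the residue class. -/

section ResidueClass

open Filter Set

variable {d : ℕ} {X : Type*} [TopologicalSpace X]
  [ChartedSpace (Cn (d + 1)) X] [IsManifold 𝓘(ℂ, Cn (d + 1)) ω X]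
  {Y : Type*} [TopologicalSpace Y]
  [ChartedSpace (Cn d) Y] [IsManifold 𝓘(ℂ, Cn d) ω Y]
  {D : Set X} {ι : Y → X} {a b : PForm (d + 1) (d + 1) X}

/-- The residue of a meromorphic form with a simple pole is holomorphic. -/
theorem poincareResidue_holomorphicOn (hD : IsSmoothHypersurface (n := d + 1) D)
    (hι : IsSubmanifoldStructure (n := d + 1) (k := d) D ι) (hb : b.IsMeromorphic D 1) :
    (poincareResidue (k := d) D ι b).HolomorphicOn univ := by
  refine PForm.contDiffOn_inChart_of_forall fun y _ => ?_
  have : Nonempty Y := ⟨y⟩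
  obtain ⟨U, f, η, hyU, hf, hη, h⟩ := hb.2 (ι y) (hι.mem y)
  -- A chart whose first coordinate is the equation `f` from the definition of a meromorphic form:
  -- its numerator is then `η` in coordinates, hence holomorphic and not merely smooth.
  obtain ⟨e, he, hx, heU, hef⟩ := hf.exists_adapted hyU (hι.mem y)
  have hηs : ∀ z ∈ e.target, ContDiffAt ℂ ω (η.inCoord e) z := by
    intro z hz
    have := hη.contDiffAt (hf.isOpen.mem_nhds (heU (e.map_target hz))) he.mem (e.map_target hz)
    rwa [e.right_inv hz] at this
  have hN : PoleRep e 1 b (η.inCoord e) := by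
    refine ⟨fun z hz => (((hηs z hz).restrict_scalars ℝ).of_le le_top).contDiffWithinAt,
      fun z hz hz0 => ?_⟩
    have hzs := e.map_target hz
    have h1 := h _ ⟨heU hzs, fun h => hz0 ((he.symm_mem_iff hz).1 h)⟩
    rw [← (hef _).2 hzs, e.right_inv hz] at h1
    have h2 : η.inCoord e z = z 0 ^ 1 • b.inCoord e z := by
      rw [PForm.inCoord, ← h1]; rfl
    rw [h2, smul_smul, inv_mul_cancel₀ (pow_ne_zero _ hz0)]
    exact (one_smul ℂ _).symm
  refine ⟨sliceChart hι he, sliceChart_mem_holoAtlas hι he, hx, ?_⟩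
  have hy : sliceChart hι he y ∈ (sliceChart hι he).target := (sliceChart hι he).map_source hx
  have h1 : ContDiffAt ℂ ω (fun z => topCoef (η.inCoord e (consCLM d z)) • detForm d)
      (sliceChart hι he y) := by
    have h2 : ContDiffAt ℂ ω (fun z => η.inCoord e (consCLM d z)) (sliceChart hι he y) :=
      (hηs _ hy).comp _ (consCLM d).contDiff.contDiffAt
    exact h2.topCoef.smul contDiffAt_const
  refine h1.congr_of_eventuallyEq ?_
  filter_upwards [(sliceChart hι he).open_target.mem_nhds hy] with z hz
  rw [← topCoef_inCoord_poincareResidue hD hι hb.hasPoleOrderLE he hN hz]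
  exact eq_topCoef_smul_detForm _

variable [T2Space X] [SigmaCompactSpace X] [T2Space Y] [SigmaCompactSpace Y]

/-- In positive dimension the difference is `∂δ`, which Stokes' theorem removes because `w` is
holomorphic; in dimension zero the two forms are equal. Smoothness of `r` need not be assumed, as it
follows from that of `s` and `δ`. -/
theorem integralWedgeConj_eq_of_isDelExact {n : ℕ} {M : Type*} [TopologicalSpace M] [T2Space M]
    [SigmaCompactSpace M] [ChartedSpace (Cn n) M] [IsManifold 𝓘(ℂ, Cn n) ω M] {r s w : PForm n n M}
    {L : Set M} (hL : IsCompact L) (hs : s.SmoothOn univ) (hs0 : ∀ x ∉ L, s x = 0)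
    (hw : w.HolomorphicOn univ) (h : IsDelExact fun y => r y - s y) :
    integralWedgeConj univ r w = integralWedgeConj univ s w := by
  rcases n with _ | p
  · have h0 : (fun y => r y - s y) = 0 := h
    have : r = s := by
      funext y
      exact sub_eq_zero.1 (congrFun h0 y)
    rw [this]
  · obtain ⟨δ, hδ, hδc, he⟩ := h
    have hr : r = fun y => s y + δ.del y := by
      funext y
      rw [← congrFun he y]; abel
    have hδ0 : ∀ x ∉ closure {y | δ y ≠ 0}, δ.del x = 0 := by
      intro x hx
      have : δ =ᶠ[𝓝 x] fun _ => 0 := by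
        filter_upwards [isClosed_closure.isOpen_compl.mem_nhds hx] with z hz
        by_contra h
        exact hz (subset_closure h)
      rw [PForm.del_congr this, PForm.del_zero]
    rw [hr, integralWedgeConj_add (hL.union hδc) hs (hδ.del isOpen_univ) hw.smoothOn
      (fun x hx => hs0 x fun h => hx (Or.inl h)) (fun x hx => hδ0 x fun h => hx (Or.inr h)),
      integralWedgeConj_del_eq_zero hδ hδc hw, add_zero]

/-- The logarithmic coefficient is computed by any representative of the residue class. -/
theorem hasLogCoef_of_mem_dolbeaultResidue (hD : IsSmoothHypersurface (n := d + 1) D)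
    (hι : IsSubmanifoldStructure (n := d + 1) (k := d) D ι) (hb : b.IsMeromorphic D 1)
    {r : PForm d d Y} (hr : r ∈ dolbeaultResidue D ι a) :
    HasLogCoef D a b (2 * integralWedgeConj univ r (poincareResidue (k := d) D ι b)) := by
  obtain ⟨c, γ, hc, hcc, hγ, hγc, hdec, hex⟩ := hr
  have hK : IsCompact (c.supportOff D ∪ γ.supportOff D) := IsCompact.union hcc hγc
  have hγ0 : ∀ x ∉ D, x ∉ γ.supportOff D → γ.del x = 0 := by
    intro x hx hxK
    have : γ =ᶠ[𝓝 x] fun _ => 0 := by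
      filter_upwards [hD.isClosed.isOpen_compl.mem_nhds hx,
        isClosed_closure.isOpen_compl.mem_nhds hxK] with z hz hzK
      exact PForm.eq_zero_of_notMem_supportOff hz hzK
    rw [PForm.del_congr this, PForm.del_zero]
  rw [integralWedgeConj_eq_of_isDelExact (hι.isCompact_preimage hD.isClosed hcc)
    (poincareResidue_smoothOn hD hι hc) (fun y hy => poincareResidue_eq_zero hD hι hc hcc.isClosed
      (fun x hx hxK => PForm.eq_zero_of_notMem_supportOff hx hxK) hy)
    (poincareResidue_holomorphicOn hD hι hb) hex]
  have h1 := hasLogCoef_residue hD hι hc hcc hb.hasPoleOrderLE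
  have h2 := hasLogCoef_del hD hγ hγc hb
  -- The pairing splits along `a = c + ∂γ`: the simple pole contributes the residues and the exact
  -- part nothing.
  have := HasLogCoef.sum (a := a) (b := b) (c := fun i : Bool => bif i then c else γ.del)
    (A := fun i => bif i then 2 * integralWedgeConj univ (poincareResidue (k := d) D ι c)
      (poincareResidue (k := d) D ι b) else 0) Finset.univ
    (fun lam hl ε hε => regularizedPairing_sum hD Finset.univ
      (fun x hx => by rw [hdec x hx]; simp) hK
      (fun i _ => by cases i; exacts [hγ.1.del hD.isClosed.isOpen_compl, hc.1])
      (fun i _ x hx hxK => by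
        cases i
        · exact hγ0 x hx fun h => hxK (Or.inr h)
        · exact PForm.eq_zero_of_notMem_supportOff hx fun h => hxK (Or.inl h))
      hb.1.smoothOn hl hε)
    (fun i _ => by cases i; exacts [h2, h1])
  simpa using this

end ResidueClass

end

noncomputable section

/-! ### Reduction of poles to simple ones modulo the image of `∂`. -/

section PoleReduction

open Filter Set

variable {d p : ℕ} {X : Type*} [TopologicalSpace X] [T2Space X]
  [ChartedSpace (Cn (d + 1)) X] [IsManifold 𝓘(ℂ, Cn (d + 1)) ω X]
  {D K : Set X} {e : OpenPartialHomeomorph X (Cn (d + 1))} {x : X}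

/-- The form `z₀^{-k} g η` in the coordinates of the chart `e`, for a constant form `η`. -/
def poleForm (e : OpenPartialHomeomorph X (Cn (d + 1))) (k : ℕ) (g : Cn (d + 1) → ℂ)
    (η : (Cn (d + 1)) [⋀^Fin p]→L[ℂ] ℂ) : PForm (d + 1) p X :=
  PForm.ofCoord e fun y => ((y 0) ^ k)⁻¹ • g y • η

theorem poleRep_poleForm (he : e ∈ holoAtlas (d + 1) X) {g : Cn (d + 1) → ℂ} (hg : ContDiff ℝ ∞ g)
    (k : ℕ) (η : (Cn (d + 1)) [⋀^Fin p]→L[ℂ] ℂ) :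
    PoleRep e k (poleForm e k g η) fun y => g y • η :=
  ⟨(hg.smul contDiff_const).contDiffOn, fun _ hy _ => PForm.inCoord_ofCoord he hy⟩

theorem poleForm_eq_zero (he : e ∈ holoAtlas (d + 1) X) {g : Cn (d + 1) → ℂ}
    (hg0 : ∀ y, y ∉ e '' K → g y = 0) (k : ℕ) (η : (Cn (d + 1)) [⋀^Fin p]→L[ℂ] ℂ) (hKe : K ⊆ e.source)
    (hx : x ∉ K) : poleForm e k g η x = 0 := by
  by_cases hxe : x ∈ e.source
  · refine (PForm.inCoord_eq_zero_iff he hxe).1 ?_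
    rw [poleForm, PForm.inCoord_ofCoord he (e.map_source hxe), hg0, alternating_zero_smul,
      alternating_smul_zero]
    rintro ⟨z, hz, hze⟩
    rw [e.injOn (hKe hz) hxe hze] at hz
    exact hx hz
  · exact PForm.ofCoord_of_notMem hxe

theorem poleAt_poleForm (hD : IsSmoothHypersurface (n := d + 1) D) (he : IsAdapted D e)
    (hK : IsCompact K) (hKe : K ⊆ e.source) {g : Cn (d + 1) → ℂ} (hg : ContDiff ℝ ∞ g)
    (hg0 : ∀ y, y ∉ e '' K → g y = 0) (k : ℕ) (η : (Cn (d + 1)) [⋀^Fin p]→L[ℂ] ℂ) (x : X) :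
    PoleAt D k (poleForm e k g η) x := by
  by_cases hxe : x ∈ e.source
  · exact ⟨e, he, hxe, _, poleRep_poleForm he.mem hg k η⟩
  · refine poleAt_of_eventually_zero hD ?_
    filter_upwards [hK.isClosed.isOpen_compl.mem_nhds fun h => hxe (hKe h)] with z hz
    exact poleForm_eq_zero he.mem hg0 k η hKe hz

theorem PoleRep.mono {α : PForm (d + 1) p X} {N : Cn (d + 1) → (Cn (d + 1)) [⋀^Fin p]→L[ℂ] ℂ}
    {k : ℕ} (h : PoleRep e k α N) : PoleRep e (k + 1) α fun y => y 0 • N y := by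
  refine ⟨(contDiff_apply ℝ ℂ (0 : Fin (d + 1))).contDiffOn.smul h.1, fun y hy hy0 => ?_⟩
  rw [h.2 y hy hy0, smul_smul, pow_succ, mul_inv, mul_assoc, inv_mul_cancel₀ hy0, mul_one]

theorem PoleAt.mono {α : PForm (d + 1) p X} {k : ℕ} (h : PoleAt D k α x) :
    PoleAt D (k + 1) α x := by
  obtain ⟨e, he, hx, N, hN⟩ := h
  exact ⟨e, he, hx, _, hN.mono⟩

theorem PForm.del_eq_zero_of_support {γ : PForm (d + 1) p X} (hK : IsClosed K)
    (h : ∀ x ∉ K, γ x = 0) (hx : x ∉ K) : γ.del x = 0 := by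
  have : γ =ᶠ[𝓝 x] fun _ => 0 := by
    filter_upwards [hK.isOpen_compl.mem_nhds hx] with z hz using h z hz
  rw [PForm.del_congr this, PForm.del_zero]

theorem faceForm_coordFace {i : Fin (d + 1)} (hi : i ≠ 0) : faceForm d (coordFace i) = 0 := by
  obtain ⟨k, rfl⟩ : ∃ k, d = k + 1 := Nat.exists_eq_succ_of_ne_zero (by
    rintro rfl
    exact hi (Fin.fin_one_eq_zero i))
  refine (detForm (k + 1)).map_coord_zero (m := fun j => tailCLM (k + 1) (coordFace i j)) 0 ?_
  rw [coordFace, Fin.succAbove_ne_zero_zero hi]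
  ext j
  change (Pi.single 0 1 : Cn (k + 1 + 1)) j.succ = 0
  rw [Pi.single_eq_of_ne (Fin.succ_ne_zero j)]

/-- Integration by parts: a pole of order `k + 2` is reduced to one of order `k + 1` modulo the
image of `∂`. -/
theorem poleForm_succ (hD : IsSmoothHypersurface (n := d + 1) D) (he : IsAdapted D e)
    (hK : IsCompact K) (hKe : K ⊆ e.source) {g : Cn (d + 1) → ℂ} (hg : IsTest g)
    (hg0 : ∀ y, y ∉ e '' K → g y = 0) (k : ℕ) (hx : x ∉ D) :
    poleForm e (k + 2) g (detForm (d + 1)) x =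
      poleForm e (k + 1) (fun y => ((k : ℂ) + 1)⁻¹ * wirt (-Complex.I) 0 g y) (detForm (d + 1)) x +
        (poleForm e (k + 1) (fun y => -((k : ℂ) + 1)⁻¹ * g y) (faceForm d)).del x := by
  set q : Cn (d + 1) → ℂ := fun y => -((k : ℂ) + 1)⁻¹ * g y with hqd
  have hq : IsTest q := hg.const_mul _
  have hq0 : ∀ y, y ∉ e '' K → q y = 0 := fun y hy => by simp only [hqd, hg0 y hy, mul_zero]
  have hB0 : ∀ x ∉ K, poleForm e (k + 1) q (faceForm d) x = 0 := fun x hx =>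
    poleForm_eq_zero he.mem hq0 _ _ hKe hx
  by_cases hxe : x ∈ e.source
  · set A := poleForm e (k + 1) (fun y => ((k : ℂ) + 1)⁻¹ * wirt (-Complex.I) 0 g y)
      (detForm (d + 1)) with hA
    set B := poleForm e (k + 1) q (faceForm d) with hB
    have hy := e.map_source hxe
    have hy0 : e x 0 ≠ 0 := fun h => hx ((he.mem_iff x hxe).2 h)
    have hBs : B.SmoothOn Dᶜ := (hasPoleOrderLE_of_poleAt hD.isClosed
      (poleAt_poleForm hD he hK hKe hq.smooth hq0 (k + 1) (faceForm d))).1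
    have hBx := hBs.contDiffAt (hD.isClosed.isOpen_compl.mem_nhds hx) he.mem hxe
    have hBc : ∀ i : Fin (d + 1), (fun z => B.inCoord e z (coordFace i)) =ᶠ[𝓝 (e x)] fun z =>
        faceForm d (coordFace i) * (q z * mono (-((k : ℤ) + 1)) 0 z) := by
      intro i
      filter_upwards [e.open_target.mem_nhds hy] with z hz
      rw [hB, poleForm, PForm.inCoord_ofCoord he.mem hz]
      change (z 0 ^ (k + 1))⁻¹ * (q z * faceForm d (coordFace i)) = _
      rw [mono, zpow_zero, zpow_neg, mul_one]
      norm_cast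
      ring
    have hmd : DifferentiableAt ℝ (fun z => q z * mono (-((k : ℤ) + 1)) 0 z) (e x) :=
      (hq.diff _).mul ((contDiffAt_mono _ _ hy0).differentiableAt (by simp))
    refine eq_of_inCoord_eq he.mem (b := fun x => A x + B.del x) hxe (eq_of_topCoef_eq ?_)
    rw [PForm.inCoord_add, PForm.inCoord_del he.mem hxe hBx]
    change _ = topCoef (A.inCoord e (e x)) + topCoef (delCoord (B.inCoord e) (e x))
    -- `faceForm` has no other coefficient on the standard faces than the one omitting `dz₀`, so
    -- `∂B` reduces to a single derivative in `z₀`.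
    rw [topCoef_delCoord (hBx.differentiableAt (by simp)), Finset.sum_eq_single 0]
    · rw [wirt_congr (hBc 0), faceForm_coordFace_zero, wirt_const_mul _ hmd,
        dz_test_mul_mono hq _ _ hy0, if_pos rfl, hA, poleForm, poleForm,
        PForm.inCoord_ofCoord he.mem hy, PForm.inCoord_ofCoord he.mem hy, hqd,
        wirt_const_mul _ (hg.diff _)]
      change (e x 0 ^ (k + 2))⁻¹ * (g (e x) * topCoef (detForm (d + 1))) = (e x 0 ^ (k + 1))⁻¹ *
        (((k : ℂ) + 1)⁻¹ * wirt (-Complex.I) 0 g (e x) * topCoef (detForm (d + 1))) + _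
      have h1 : (e x 0) ^ (-((k : ℤ) + 1)) = (e x 0 ^ (k + 1))⁻¹ := by
        rw [zpow_neg]; norm_cast
      have h2 : (e x 0) ^ (-((k : ℤ) + 1) - 1) = (e x 0 ^ (k + 2))⁻¹ := by
        rw [show -((k : ℤ) + 1) - 1 = -((k + 2 : ℕ) : ℤ) by push_cast; ring, zpow_neg, zpow_natCast]
      have hk : (k : ℂ) + 1 ≠ 0 := by exact_mod_cast Nat.succ_ne_zero k
      rw [topCoef_detForm, mono, mono, h1, h2]
      push_cast
      simp only [zpow_zero, mul_one, Fin.val_zero, pow_zero, one_mul]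
      field_simp
      ring
    · intro i _ hi
      rw [wirt_congr (hBc i), wirt_const_mul _ hmd, faceForm_coordFace hi, zero_mul, mul_zero]
    · simp
  · have hxK : x ∉ K := fun h => hxe (hKe h)
    have hw0 : poleForm e (k + 1) (fun y => ((k : ℂ) + 1)⁻¹ * wirt (-Complex.I) 0 g y)
        (detForm (d + 1)) x = 0 := PForm.ofCoord_of_notMem hxe
    have hl0 : poleForm e (k + 2) g (detForm (d + 1)) x = 0 := PForm.ofCoord_of_notMem hxe
    rw [hl0, hw0, PForm.del_eq_zero_of_support hK.isClosed hB0 hxK, add_zero]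

/-- Iterating `poleForm_succ` on the order `k + 1`: each step moves one exact form into `γ` and
differentiates the numerator, which stays supported in the image of `K`, until the pole is simple.
-/
theorem exists_reduction_poleForm (hD : IsSmoothHypersurface (n := d + 1) D) (he : IsAdapted D e)
    (hK : IsCompact K) (hKe : K ⊆ e.source) (k : ℕ) : ∀ {g : Cn (d + 1) → ℂ}, IsTest g →
    (∀ y, y ∉ e '' K → g y = 0) → ∃ (c : PForm (d + 1) (d + 1) X) (γ : PForm (d + 1) d X),
      (∀ x, PoleAt D 1 c x) ∧ (∀ x ∉ K, c x = 0) ∧ (∀ x, PoleAt D k γ x) ∧ (∀ x ∉ K, γ x = 0) ∧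
      ∀ x ∉ D, poleForm e (k + 1) g (detForm (d + 1)) x = c x + γ.del x := by
  induction k with
  | zero =>
    intro g hg hg0
    refine ⟨poleForm e 1 g (detForm (d + 1)), fun _ => 0,
      poleAt_poleForm hD he hK hKe hg.smooth hg0 1 _,
      fun x hx => poleForm_eq_zero he.mem hg0 1 _ hKe hx,
      fun x => poleAt_of_eventually_zero hD (Eventually.of_forall fun _ => rfl), fun _ _ => rfl,
      fun x _ => ?_⟩
    rw [PForm.del_zero, add_zero]
  | succ k ih =>
    intro g hg hg0
    have hLi : IsCompact (e '' K) := hK.image_of_continuousOn (e.continuousOn.mono hKe)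
    have hw0 : ∀ y, y ∉ e '' K → ((k : ℂ) + 1)⁻¹ * wirt (-Complex.I) 0 g y = 0 := by
      intro y hy
      have hev : g =ᶠ[𝓝 y] fun _ => 0 := by
        filter_upwards [hLi.isClosed.isOpen_compl.mem_nhds hy] with z hz using hg0 z hz
      rw [wirt_congr hev, wirt_const, mul_zero]
    obtain ⟨c, γ, hc, hc0, hγ, hγ0, h⟩ := ih (hg.wirt.const_mul _) hw0
    have hq0 : ∀ y, y ∉ e '' K → -((k : ℂ) + 1)⁻¹ * g y = 0 := fun y hy => by
      rw [hg0 y hy, mul_zero]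
    have hB := poleAt_poleForm hD he hK hKe (hg.const_mul (-((k : ℂ) + 1)⁻¹)).smooth hq0 (k + 1)
      (faceForm d)
    refine ⟨c, fun x => γ x + poleForm e (k + 1) (fun y => -((k : ℂ) + 1)⁻¹ * g y) (faceForm d) x,
      hc, hc0, fun x => (hγ x).mono.add hD (hB x), fun x hx => ?_, fun x hx => ?_⟩
    · change γ x + _ = 0
      rw [hγ0 x hx, poleForm_eq_zero he.mem hq0 _ _ hKe hx, add_zero]
    · have hs1 := (hasPoleOrderLE_of_poleAt hD.isClosed hγ).1.differentiableAt_inChart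
        hD.isClosed.isOpen_compl hx
      have hs2 := (hasPoleOrderLE_of_poleAt hD.isClosed hB).1.differentiableAt_inChart
        hD.isClosed.isOpen_compl hx
      rw [poleForm_succ hD he hK hKe hg hg0 k hx, h x hx, PForm.del_add hs1 hs2, add_assoc]

/-- A localized top form is the sum of a form with a simple pole and a `∂`-exact form. -/
theorem IsLocalized.exists_reduction (hD : IsSmoothHypersurface (n := d + 1) D)
    {a : PForm (d + 1) (d + 1) X} (ha : IsLocalized D e K a) {k : ℕ} (hp : PoleOn e k a) :
    ∃ (c : PForm (d + 1) (d + 1) X) (γ : PForm (d + 1) d X),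
      (∀ x, PoleAt D 1 c x) ∧ (∀ x ∉ K, c x = 0) ∧ (∀ x, PoleAt D k γ x) ∧ (∀ x ∉ K, γ x = 0) ∧
      ∀ x ∉ D, a x = c x + γ.del x := by
  obtain ⟨N₀, hN₀⟩ := hp
  -- The order is raised from `k` to `k + 1`, so that forms without a pole are covered by the
  -- reduction of poles of order at least one.
  have hN := hN₀.mono
  set N := fun y : Cn (d + 1) => y 0 • N₀ y
  have he := ha.adapted
  have hG := contDiff_indicator_of_compact e.open_target ha.isCompact_image ha.image_subset
    (g := fun y => topCoef (N y))
    (fun y hy => (hN.1.contDiffAt (e.open_target.mem_nhds hy)).topCoef.contDiffWithinAt)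
    (fun y hy hyK => by rw [ha.rep_eq_zero hN hy hyK]; rfl)
  set g := e.target.indicator fun y => topCoef (N y) with hgd
  have hg0 : ∀ y, y ∉ e '' K → g y = 0 := by
    intro y hy
    by_cases hyT : y ∈ e.target
    · rw [hgd, indicator_of_mem hyT, ha.rep_eq_zero hN hyT hy]; rfl
    · rw [hgd, indicator_of_notMem hyT]
  obtain ⟨c, γ, hc, hc0, hγ, hγ0, h⟩ := exists_reduction_poleForm hD he ha.compact ha.subset k
    ⟨hG.1, hG.2⟩ hg0
  refine ⟨c, γ, hc, hc0, hγ, hγ0, fun x hx => ?_⟩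
  rw [← h x hx]
  by_cases hxe : x ∈ e.source
  · have hy := e.map_source hxe
    have hy0 : e x 0 ≠ 0 := fun h => hx ((he.mem_iff x hxe).2 h)
    refine eq_of_inCoord_eq he.mem hxe (eq_of_topCoef_eq ?_)
    rw [hN.2 _ hy hy0, poleForm, PForm.inCoord_ofCoord he.mem hy, hgd, indicator_of_mem hy]
    change _ * topCoef (N (e x)) = _ * (topCoef (N (e x)) * topCoef (detForm (d + 1)))
    rw [topCoef_detForm, mul_one]
  · rw [ha.zero x hx fun h => hxe (ha.subset h)]
    exact (PForm.ofCoord_of_notMem hxe).symm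

theorem PForm.compactSupportOff_of_eq_zero {a : PForm (d + 1) p X} (hK : IsCompact K)
    (h : ∀ x ∉ K, a x = 0) : a.CompactSupportOff D := by
  refine hK.of_isClosed_subset isClosed_closure (closure_minimal ?_ hK.isClosed)
  rintro x ⟨-, hx⟩
  by_contra hxK
  exact hx (h x hxK)

theorem isDelExact_zero {k : ℕ} {Y : Type*} [TopologicalSpace Y] [ChartedSpace (Cn k) Y]
    [IsManifold 𝓘(ℂ, Cn k) ω Y] {q : ℕ} : IsDelExact (fun _ => 0 : PForm k q Y) := by
  rcases q with _ | q
  · rfl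
  · refine ⟨fun _ => 0, ?_, ?_, ?_⟩
    · exact PForm.smoothOn_of_forall fun y _ => ⟨_, chart_mem_holoAtlas y, mem_chart_source _ y,
        contDiffAt_const (c := (0 : (Cn k) [⋀^Fin q]→L[ℂ] ℂ))⟩
    · simp
    · funext y
      exact (PForm.del_zero y).symm

/-- Each piece `f_i a` of a finite partition is reduced in its own chart; the simple-pole parts and
the primitives are then summed, and the representative is the residue of the former sum. -/
theorem dolbeaultResidue_nonempty [SigmaCompactSpace X] {Y : Type*} [TopologicalSpace Y]
    [ChartedSpace (Cn d) Y] [IsManifold 𝓘(ℂ, Cn d) ω Y] {ι : Y → X}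
    (hD : IsSmoothHypersurface (n := d + 1) D) {m : ℕ} {a : PForm (d + 1) (d + 1) X}
    (ha : a.HasPoleOrderLE D m) (hac : a.CompactSupportOff D) :
    (dolbeaultResidue D ι a : Set (PForm d d Y)).Nonempty := by
  choose e he hxe hpa using ha.poleAt hD
  obtain ⟨F, f, hf, hfe, hsum⟩ := exists_finite_partition (S := a.supportOff D) hac hxe
  have hloc := fun i => IsLocalized.smul_of_tsupport hD.isClosed (he i) ha.1 hac (hf i) (hfe i)
  have hdec : ∀ x ∉ D, a x = ∑ i ∈ F, (f i x : ℂ) • a x := by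
    intro x hx
    by_cases h : x ∈ a.supportOff D
    · rw [alternating_sum_smul, ← Complex.ofReal_sum, hsum x h, Complex.ofReal_one]
      exact (one_smul ℂ _).symm
    · rw [alternating_sum_smul, PForm.eq_zero_of_notMem_supportOff hx h, alternating_smul_zero]
  have hK : IsCompact (⋃ i ∈ F, tsupport (f i) ∩ a.supportOff D) :=
    F.isCompact_biUnion fun i _ => (hloc i).compact
  choose c γ hc hc0 hγ hγ0 h using fun i =>
    (hloc i).exists_reduction hD ((hpa i).smul (he i).mem (hf i))
  have hcs := hasPoleOrderLE_of_poleAt (α := fun x => ∑ i ∈ F, c i x) hD.isClosed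
    fun x => PoleAt.sum hD F fun i _ => hc i x
  have hγs := hasPoleOrderLE_of_poleAt (α := fun x => ∑ i ∈ F, γ i x) hD.isClosed
    fun x => PoleAt.sum hD F fun i _ => hγ i x
  refine ⟨poincareResidue (k := d) D ι fun x => ∑ i ∈ F, c i x, fun x => ∑ i ∈ F, c i x,
    fun x => ∑ i ∈ F, γ i x, hcs, ?_, hγs.hasPoles, ?_, fun x hx => ?_, ?_⟩
  · exact PForm.compactSupportOff_of_eq_zero hK fun x hx => Finset.sum_eq_zero fun i hi =>
      hc0 i x fun h => hx (mem_biUnion hi h)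
  · exact PForm.compactSupportOff_of_eq_zero hK fun x hx => Finset.sum_eq_zero fun i hi =>
      hγ0 i x fun h => hx (mem_biUnion hi h)
  · rw [PForm.del_sum F fun i _ => (hasPoleOrderLE_of_poleAt hD.isClosed
      (hγ i)).1.differentiableAt_inChart hD.isClosed.isOpen_compl hx, hdec x hx,
      ← Finset.sum_add_distrib]
    exact Finset.sum_congr rfl fun i _ => h i x hx
  · simp only [sub_self]
    exact isDelExact_zero

end PoleReduction

end

noncomputable section

/-! ### The constant term as a function of the cut-off function. -/

section ConstantTerm

variable {d : ℕ} {X : Type*} [TopologicalSpace X] [T2Space X] [SigmaCompactSpace X]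
  [ChartedSpace (Cn (d + 1)) X] [IsManifold 𝓘(ℂ, Cn (d + 1)) ω X]

open Classical in
/-- The constant term in the expansion of the regularized pairing. -/
def constantTerm (a b : PForm (d + 1) (d + 1) X) (lam : X → ℝ) : ℂ :=
  if h : ∃ I A, HasLogExp (fun ε => regularizedPairing lam ε a b) A I then h.choose else 0

/-- By uniqueness the chosen constant is the right one; the default value `0` only concerns
functions for which no expansion exists. -/
theorem HasLogExp.constantTerm {a b : PForm (d + 1) (d + 1) X} {lam : X → ℝ} {A I : ℂ}
    (h : HasLogExp (fun ε => regularizedPairing lam ε a b) A I) :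
    HasLogExp (fun ε => regularizedPairing lam ε a b) A (constantTerm a b lam) := by
  have hex : ∃ I A, HasLogExp (fun ε => regularizedPairing lam ε a b) A I := ⟨I, A, h⟩
  obtain ⟨A', h'⟩ := hex.choose_spec
  rw [_root_.constantTerm, dif_pos hex]
  rwa [(h.unique h').1]

end ConstantTerm

end

theorem theorem3p3 {d : ℕ} {X : Type*} [TopologicalSpace X] [T2Space X] [SigmaCompactSpace X]
    [ChartedSpace (Cn (d + 1)) X] [IsManifold 𝓘(ℂ, Cn (d + 1)) ω X]
    {Y : Type*} [TopologicalSpace Y] [T2Space Y] [SigmaCompactSpace Y]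
    [ChartedSpace (Cn d) Y] [IsManifold 𝓘(ℂ, Cn d) ω Y]
    (D : Set X) (hD : IsSmoothHypersurface (n := d + 1) D)
    (ι : Y → X) (hι : IsSubmanifoldStructure (n := d + 1) (k := d) D ι)
    (m : ℕ) (α β : PForm (d + 1) (d + 1) X)
    (hα : α.HasPoleOrderLE D m) (hαc : α.CompactSupportOff D)
    (hβ : β.IsMeromorphic D 1) :
    (dolbeaultResidue D ι α).Nonempty ∧
    ∃ I₁ : (X → ℝ) → ℂ,
      (∀ lam : X → ℝ, IsCutoff (d + 1) D lam → ∀ r ∈ dolbeaultResidue D ι α,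
        (fun ε : ℝ => regularizedPairing lam ε α β -
            (2 * (Real.log ε : ℂ) *
              integralWedgeConj Set.univ r (poincareResidue (k := d) D ι β) + I₁ lam))
          =O[𝓝[>] 0] (fun ε : ℝ => ε)) ∧
      (∀ lam : X → ℝ, IsCutoff (d + 1) D lam →
        ∀ φ : X → ℝ, ContMDiff 𝓘(ℝ, Cn (d + 1)) 𝓘(ℝ, ℝ) ∞ φ →
        ∀ r ∈ dolbeaultResidue D ι (fun x => (φ x : ℂ) • α x),
          I₁ (fun x => Real.exp (φ x) * lam x) =
            I₁ lam - 2 * integralWedgeConj Set.univ r (poincareResidue (k := d) D ι β)) := by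
  refine ⟨dolbeaultResidue_nonempty hD hα hαc, constantTerm α β, ?_, ?_⟩
  · intro lam hl r hr
    obtain ⟨I, hI⟩ := hasLogCoef_of_mem_dolbeaultResidue hD hι hβ hr lam hl
    have h := hI.constantTerm
    rw [HasLogExp] at h
    refine h.congr_left fun ε => ?_
    ring
  · intro lam hl φ hφ r hr
    obtain ⟨⟨B, hB⟩, hshift⟩ := exists_hasLogCoef hD hα.hasPoles hαc hβ.hasPoleOrderLE
    obtain ⟨A, hA, hs⟩ := hshift φ hφ
    obtain ⟨I₁, h₁⟩ := hA lam hl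
    obtain ⟨I₂, h₂⟩ := hasLogCoef_of_mem_dolbeaultResidue hD hι hβ hr lam hl
    obtain ⟨I, hI⟩ := hB lam hl
    obtain ⟨I', hI'⟩ := hB _ (hl.exp_mul hφ)
    rw [← (h₁.unique h₂).1]
    -- The shift equals the logarithmic coefficient `A` of `φα`, and comparing two expansions of the
    -- pairing of `φα` with `β` has just identified `A` with the residue integral of the given
    -- representative.
    exact hs lam hl _ _ _ _ hI.constantTerm hI'.constantTerm
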